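/- **Model.** In the binary-forking model, threads share a memory of words and run asynchronously; a computation starts with one thread and ends when a special "finish" instruction is executed. Each instruction of a thread is an arithmetic operation or test on words, a read, a write, a test-and-set (TAS: atomically, if the cell is $0$ set it to $1$ and return $0$, otherwise return $1$), the allocation of a block of memory, a comparison of two input elements, the drawing of a uniformly random element of $\{0,\dots,m-1\}$, a procedure call, a fork (creating one child thread), the end of the thread, or the finish. The instructions of all threads are executed in a total order that is chosen by an adversarial scheduler, which may use the whole past of the execution, including the random words drawn so far. Joins are implemented by a TAS on a synchronization cell: of the two threads that meet, the later one continues and the other ends. The *work* is the number of executed instructions, i.e. the size of the tree in which every instruction has as children the next instruction of its thread and, for a fork, the first instruction of the child; the *span* is the depth of this tree. **Algorithm.** The randomized sample sort with constants $c_1,c_2,r,n_0$ sorts an array of $n$ elements as follows (element comparisons are made strict by breaking ties by the index of the element in the original input). 1. If $n\le n_0$, sort sequentially by insertion sort and return. Otherwise let $q=\lfloor n^{1/3}\rfloor$, $l=\lfloor\log_2 n\rfloor$. 2. Draw $q\,l$ samples from the array independently and uniformly at random, sort them by making all pairwise comparisons, and take every $l$-th one as a pivot ($q$ pivots). 3.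 Allocate $q+1$ buckets, each with $m=2c_1r(q+1)^2$ positions. In parallel, every element finds its bucket by binary search among the pivots and then repeatedly chooses a random position of the bucket and tries to reserve it by a TAS, at most $c_2 l$ times. If some element fails, restart from step 2. 4. Pack the buckets into a contiguous array by parallel prefix sums, and sort all buckets recursively in parallel. **Theorem.** For all integers $c_1,c_2\ge 2$ there are constants $r,n_0,d\in\mathbb N$ and $C>0$ such that for every $n$, every sequence of $n$ (not necessarily distinct) elements of a linearly ordered set and every scheduler, the following holds for the computation of the sample sort in the binary-forking model. * It finishes almost surely, and whenever it finishes, the array contains the $n$ input elements in nondecreasing order. At any time, all words that have been used are at most $(n+2)^d\,(w+1)$, where $w$ is the work done so far (so words have $O(\log n+\log w)$ bits). * If $n\ge 2$, the expected work is at most $C\,n\log n$, and for every real $k\ge 1$ the span is at most $C\,k\log n$ with probability at least $1-n^{-k}$ (that is, the span is $O(\log n)$ with high probability). -/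

import Mathlib

open scoped ENNReal

namespace BF

/-! ## The binary-forking model

Threads share a memory of words and run asynchronously.  A thread is a sequential random-access
program; besides arithmetic, reads and writes it may draw a random word, compare two input
elements, allocate memory, perform a test-and-set, fork a child thread, end itself, or finish the
whole computation.  Each of these is one instruction, and so is a procedure call. -/

/-- A machine word.  The input elements are referred to by their indices, which are words. -/
abbrev Word := ℕ

/-- Arithmetic and test instructions on words; tests return `1` for true and `0` for false. -/
inductive AluOp
  | add | sub | mul | div | mod | lt | le | eq

def AluOp.eval : AluOp → Word → Word → Word
  | add, x, y => x + y
  | sub, x, y => x - y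
  | mul, x, y => x * y
  | div, x, y => x / y
  | mod, x, y => x % y
  | lt, x, y => if x < y then 1 else 0
  | le, x, y => if x ≤ y then 1 else 0
  | eq, x, y => if x = y then 1 else 0

/-- The instructions of a thread that return a word and let the thread go on. -/
inductive Instr
  /-- arithmetic on two words -/
  | alu (o : AluOp) (x y : Word)
  /-- a uniformly random element of `{0, …, m - 1}`, drawn when the instruction is executed -/
  | rand (m : Word)
  /-- is the input element with index `i` strictly smaller than the one with index `j`? -/
  | cmp (i j : Word)
  /-- allocate a fresh contiguous block of `k` memory cells and return its address -/
  | alloc (k : Word)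
  | read (a : Word)
  | write (a v : Word)
  /-- atomically: if cell `a` is `0`, set it to `1` and return `0`; otherwise return `1` -/
  | tas (a : Word)
  /-- fork a child thread; the instruction returns `0` in the parent and `1` in the child -/
  | fork

/-- The code of a thread that may call (possibly recursive) procedures with names in `P`. -/
inductive Prog (P : Type) (α : Type)
  /-- return from the current procedure -/
  | ret (a : α)
  /-- end the thread -/
  | endThread
  /-- finish the whole computation -/
  | finish
  | instr (i : Instr) (k : Word → Prog P α)
  | call (p : P) (k : Word → Prog P α)

namespace Prog

variable {P α β : Type}

def bind : Prog P α → (α → Prog P β) → Prog P β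
  | ret a, f => f a
  | endThread, _ => endThread
  | finish, _ => finish
  | instr i k, f => instr i (fun w => (k w).bind f)
  | call p k, f => call p (fun w => (k w).bind f)

instance : Monad (Prog P) where
  pure := Prog.ret
  bind := Prog.bind

end Prog

/-- A thread: the number of instructions on its path from the root of the computation tree, and
the code that it still has to execute. -/
structure Thread (P : Type) where
  depth : ℕ
  code : Prog P Word

/-- A global state, together with the costs so far. -/
structure Config (P : Type) where
  mem : Word → Word
  /-- cells from here on are unallocated -/
  next : Word
  threads : List (Thread P)
  finished : Bool
  /-- number of instructions executed by all threads: the size of the computation tree -/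
  work : ℕ
  /-- longest path of executed instructions in the computation tree: its depth -/
  span : ℕ
  /-- largest word that has been returned by an instruction -/
  maxWord : Word

section Semantics

variable {P : Type} (proc : P → Prog P Word) (lt : Word → Word → Bool)

/-- The uniform distribution on `{0, …, m - 1}` (and the constant `0` if `m = 0`). -/
noncomputable def uniformBelow (m : ℕ) : PMF Word :=
  if h : 0 < m then PMF.uniformOfFinset (Finset.range m) ⟨0, Finset.mem_range.mpr h⟩
  else PMF.pure 0

/-- Account for one instruction that ends a tree path of length `depth`. -/
def Config.charge (c : Config P) (depth : ℕ) : Config P :=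
  { c with work := c.work + 1, span := max c.span depth }

/-- The thread in position `i` continues with `code` after an instruction returned `w`. -/
def Config.resume (c : Config P) (i depth : ℕ) (w : Word) (code : Prog P Word) : Config P :=
  { c with
    threads := c.threads.set i ⟨depth, code⟩
    maxWord := max c.maxWord w }

/-- Execute one instruction of the thread `θ`, which is in position `i` of the list of threads. -/
noncomputable def Config.exec (c₀ : Config P) (i : ℕ) (θ : Thread P) : PMF (Config P) :=
  let d := θ.depth + 1
  let c := c₀.charge d
  match θ.code with
  | .ret _ => PMF.pure { c with threads := c.threads.eraseIdx i }
  | .endThread => PMF.pure { c with threads := c.threads.eraseIdx i }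
  | .finish => PMF.pure { c with finished := true }
  | .call p k => PMF.pure { c with threads := c.threads.set i ⟨d, (proc p).bind k⟩ }
  | .instr (.alu o x y) k => PMF.pure (c.resume i d (o.eval x y) (k (o.eval x y)))
  | .instr (.rand m) k => (uniformBelow m).map fun w => c.resume i d w (k w)
  | .instr (.cmp x y) k =>
      let w := if lt x y then 1 else 0
      PMF.pure (c.resume i d w (k w))
  | .instr (.alloc m) k =>
      PMF.pure { c.resume i d c.next (k c.next) with next := c.next + m }
  | .instr (.read a) k => PMF.pure (c.resume i d (c.mem a) (k (c.mem a)))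
  | .instr (.write a v) k =>
      PMF.pure { c.resume i d 0 (k 0) with mem := Function.update c.mem a v }
  | .instr (.tas a) k =>
      if c.mem a = 0 then
        PMF.pure { c.resume i d 0 (k 0) with mem := Function.update c.mem a 1 }
      else PMF.pure (c.resume i d 1 (k 1))
  | .instr .fork k =>
      PMF.pure { c with threads := c.threads.set i ⟨d, k 0⟩ ++ [⟨d, k 1⟩] }

/-- One step of the machine: the thread selected by the number `s` executes an instruction.
Nothing happens after the computation has finished. -/
noncomputable def Config.step (c : Config P) (s : ℕ) : PMF (Config P) :=
  if c.finished then PMF.pure c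
  else
    match c.threads[s % c.threads.length]? with
    | none => PMF.pure c
    | some θ => c.exec proc lt (s % c.threads.length) θ

/-- A scheduler determines the total order of the instructions: on the basis of the whole
execution so far (the past states, latest first, and the present one) it selects the thread that
executes the next instruction.  Thus it may depend on all random words drawn so far. -/
abbrev Scheduler (P : Type) := List (Config P) → Config P → ℕ

/-- The distribution of the state after `t` further steps. -/
noncomputable def run (σ : Scheduler P) : ℕ → List (Config P) → Config P → PMF (Config P)
  | 0, _, c => PMF.pure c
  | t + 1, past, c => (c.step proc lt (σ past c)).bind fun c' => run σ t (c :: past) c'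

/-- The probability that the computation from `c` finishes (a limit of increasing events). -/
noncomputable def probFinish (σ : Scheduler P) (c : Config P) : ℝ≥0∞ :=
  ⨆ t : ℕ, (run proc lt σ t [] c).toOuterMeasure {c' | c'.finished = true}

/-- The expected work of the complete computation from `c` (by monotone convergence). -/
noncomputable def expectedWork (σ : Scheduler P) (c : Config P) : ℝ≥0∞ :=
  ⨆ t : ℕ, ∑' c' : Config P, run proc lt σ t [] c c' * (c'.work : ℝ≥0∞)

/-- The probability that the span of the complete computation from `c` is at most `s` (a limit of
decreasing events). -/
noncomputable def probSpanLE (σ : Scheduler P) (c : Config P) (s : ℝ) : ℝ≥0∞ :=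
  ⨅ t : ℕ, (run proc lt σ t [] c).toOuterMeasure {c' | (c'.span : ℝ) ≤ s}

end Semantics

/-! ## Instructions as monadic operations, and the binary join -/

section Operations

variable {P : Type}

def alu (o : AluOp) (x y : Word) : Prog P Word := .instr (.alu o x y) .ret
def rand (m : Word) : Prog P Word := .instr (.rand m) .ret
def cmp (i j : Word) : Prog P Word := .instr (.cmp i j) .ret
def alloc (k : Word) : Prog P Word := .instr (.alloc k) .ret
def read (a : Word) : Prog P Word := .instr (.read a) .ret
def write (a v : Word) : Prog P Word := .instr (.write a v) .ret
def tas (a : Word) : Prog P Word := .instr (.tas a) .ret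
def fork : Prog P Word := .instr .fork .ret
def call (p : P) : Prog P Word := .call p .ret

/-- Read, write and test-and-set at address `a + i`. -/
def readAt (a i : Word) : Prog P Word := do
  let t ← alu .add a i
  read t

def writeAt (a i v : Word) : Prog P Word := do
  let t ← alu .add a i
  write t v

def tasAt (a i : Word) : Prog P Word := do
  let t ← alu .add a i
  tas t

/-- Run `p` and `q` in parallel and join: the parent runs `p`, the child runs `q`, each stores its
result, and a test-and-set on a synchronization cell decides which of the two arrives last; that
one executes the continuation, the other one ends. -/
def par (p q : Prog P Word) : Prog P (Word × Word) := do
  let s ← alloc 3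
  let _ ← write s 0
  let c ← fork
  let _ ← (if c = 0 then (do let v ← p; writeAt s 1 v) else (do let v ← q; writeAt s 2 v))
  let b ← tas s
  if b = 0 then .endThread
  else do
    let v ← readAt s 1
    let w ← readAt s 2
    pure (v, w)

/-- Comparison of input elements, with ties broken by index. -/
def less (i j : Word) : Prog P Word := do
  let a ← cmp i j
  if a = 1 then pure 1
  else do
    let b ← cmp j i
    if b = 1 then pure 0 else alu .lt i j

end Operations

/-! ## The sample sort -/

/-- The constants of the algorithm: subproblems of size at most `n₀` are base cases, a bucket of
a subproblem of size `n` gets an array of size `2 * c₁ * r * n ^ (2/3)`, and an element tries at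
most `c₂ * log₂ n` positions in it. -/
structure Params where
  c₁ : ℕ
  c₂ : ℕ
  r : ℕ
  n₀ : ℕ

/-- The bodies of the parallel loops (with the registers that they use). -/
inductive Task
  /-- write a random element of the array `b` of length `n` to position `i` of `S` -/
  | sample (b n S : Word)
  /-- does entry `i` of `S` precede its entry `x` at position `j`? -/
  | precedes (S x j : Word)
  /-- count the entries of `S` preceding entry `i`, and write entry `i` to that position of `R` -/
  | place (S s R : Word)
  /-- pivot `i` is the sorted sample number `(i + 1) * l`, counted from `1` -/
  | pivot (R l Q : Word)
  /-- set entry `i` of `F` to `0` -/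
  | clear (F : Word)
  /-- put element `i` of the array `b` into its bucket; return `1` on failure -/
  | distribute (b Q q F V m tries : Word)
  /-- sort bucket `i`, whose limits in the array `b` are entries `i` and `i + 1` of `B` -/
  | recurse (b B : Word)

/-- The procedures. -/
inductive Proc
  /-- `log₂ x + acc`, rounded down -/
  | log (x acc : Word)
  /-- the cube root of `x`, rounded down -/
  | cbrt (x : Word)
  /-- perform the task for all `lo ≤ i < hi` in parallel, and return the sum of the results -/
  | parFor (T : Task) (lo hi : Word)
  /-- move entry `i` of the array `b` down into the sorted entries `0, …, i - 1` -/
  | insert (b i : Word)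
  /-- insertion sort of the array `b` of length `n` whose first `i` entries are sorted -/
  | insertionSort (b n i : Word)
  /-- the first position in `lo, …, hi` of the sorted pivots `Q` whose pivot is not below `e` -/
  | search (Q e lo hi : Word)
  /-- try at most `k` random positions among the `m` positions starting at `base` -/
  | attempt (e F V base m k : Word)
  /-- sum of the flags `F` between `lo` and `hi`; partial sums are kept in `T` -/
  | sumFlags (F T lo hi : Word)
  /-- move the flagged entries of `V` between `lo` and `hi` to `out`, starting at position `acc`;
  write the positions at which the buckets (of `m` entries each) start to `B` -/
  | pack (F V T m B out lo hi acc : Word)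
  /-- sort the array `b` of length `n` -/
  | sort (b n : Word)
  /-- the part of `sort` from the random sampling on -/
  | sampleSort (b n : Word)

open BF.Proc BF.Task BF.AluOp

def Task.code : Task → Word → Prog Proc Word
  | sample b n S, i => do
      let j ← rand n
      let e ← readAt b j
      let _ ← writeAt S i e
      pure 0
  | precedes S x j, i => do
      let y ← readAt S i
      let a ← less y x
      if a = 1 then pure 1
      else do
        let same ← alu .eq y x
        if same = 0 then pure 0 else alu .lt i j
  | Task.place S s R, i => do
      let x ← readAt S i
      let rank ← call (parFor (precedes S x i) 0 s)
      let _ ← writeAt R rank x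
      pure 0
  | pivot R l Q, i => do
      let i' ← alu .add i 1
      let t ← alu .mul i' l
      let t' ← alu .sub t 1
      let x ← readAt R t'
      let _ ← writeAt Q i x
      pure 0
  | clear F, i => do
      let _ ← writeAt F i 0
      pure 0
  | distribute b Q q F V m tries, i => do
      let e ← readAt b i
      let j ← call (search Q e 0 q)
      let base ← alu .mul j m
      call (attempt e F V base m tries)
  | recurse b B, i => do
      let lo ← readAt B i
      let i' ← alu .add i 1
      let hi ← readAt B i'
      let b' ← alu .add b lo
      let n ← alu .sub hi lo
      call (sort b' n)

def Proc.code (κ : Params) : Proc → Prog Proc Word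
  | log x acc => do
      let small ← alu .lt x 2
      if small = 1 then pure acc
      else do
        let x' ← alu .div x 2
        let acc' ← alu .add acc 1
        call (log x' acc')
  | cbrt x => do
      let isZero ← alu .eq x 0
      if isZero = 1 then pure 0
      else do
        let x' ← alu .div x 8
        let y ← call (cbrt x')
        let s ← alu .mul y 2
        let s' ← alu .add s 1
        let s2 ← alu .mul s' s'
        let s3 ← alu .mul s2 s'
        let ok ← alu .le s3 x
        if ok = 1 then pure s' else pure s
  | parFor T lo hi => do
      let d ← alu .sub hi lo
      let empty ← alu .eq d 0
      if empty = 1 then pure 0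
      else do
        let single ← alu .eq d 1
        if single = 1 then T.code lo
        else do
          let t ← alu .add lo hi
          let mid ← alu .div t 2
          let vw ← par (call (parFor T lo mid)) (call (parFor T mid hi))
          alu .add vw.1 vw.2
  | Proc.insert b i => do
      let isZero ← alu .eq i 0
      if isZero = 1 then pure 0
      else do
        let i' ← alu .sub i 1
        let x ← readAt b i'
        let y ← readAt b i
        let a ← less y x
        if a = 0 then pure 0
        else do
          let _ ← writeAt b i' y
          let _ ← writeAt b i x
          call (Proc.insert b i')
  | insertionSort b n i => do
      let more ← alu .lt i n
      if more = 0 then pure 0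
      else do
        let _ ← call (Proc.insert b i)
        let i' ← alu .add i 1
        call (insertionSort b n i')
  | search Q e lo hi => do
      let more ← alu .lt lo hi
      if more = 0 then pure lo
      else do
        let t ← alu .add lo hi
        let mid ← alu .div t 2
        let x ← readAt Q mid
        let a ← less x e
        if a = 1 then do
          let mid' ← alu .add mid 1
          call (search Q e mid' hi)
        else call (search Q e lo mid)
  | attempt e F V base m k => do
      let none ← alu .eq k 0
      if none = 1 then pure 1
      else do
        let s ← rand m
        let a ← alu .add base s
        let taken ← tasAt F a
        if taken = 0 then do
          let _ ← writeAt V a e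
          pure 0
        else do
          let k' ← alu .sub k 1
          call (attempt e F V base m k')
  | sumFlags F T lo hi => do
      let d ← alu .sub hi lo
      let single ← alu .eq d 1
      if single = 1 then readAt F lo
      else do
        let t ← alu .add lo hi
        let mid ← alu .div t 2
        let vw ← par (call (sumFlags F T lo mid)) (call (sumFlags F T mid hi))
        let _ ← writeAt T mid vw.1
        alu .add vw.1 vw.2
  | pack F V T m B out lo hi acc => do
      let d ← alu .sub hi lo
      let single ← alu .eq d 1
      if single = 1 then do
        let j ← alu .div lo m
        let p ← alu .mod lo m
        let first ← alu .eq p 0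
        let _ ← (if first = 1 then writeAt B j acc else pure 0)
        let f ← readAt F lo
        if f = 0 then pure 0
        else do
          let e ← readAt V lo
          writeAt out acc e
      else do
        let t ← alu .add lo hi
        let mid ← alu .div t 2
        let v ← readAt T mid
        let acc' ← alu .add acc v
        let _ ← par (call (pack F V T m B out lo mid acc)) (call (pack F V T m B out mid hi acc'))
        pure 0
  | sort b n => do
      let small ← alu .le n κ.n₀
      if small = 1 then call (insertionSort b n 0) else call (sampleSort b n)
  | sampleSort b n => do
      -- `s = q * l` random samples, where `q` and `l` are `n ^ (1/3)` and `log₂ n` rounded down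
      let l ← call (log n 0)
      let q ← call (cbrt n)
      let s ← alu .mul q l
      let S ← alloc s
      let _ ← call (parFor (sample b n S) 0 s)
      -- sort the samples into `R` by all pairwise comparisons
      let R ← alloc s
      let _ ← call (parFor (Task.place S s R) 0 s)
      -- the `q` pivots `Q`: every `l`-th sample
      let Q ← alloc q
      let _ ← call (parFor (pivot R l Q) 0 q)
      -- `q + 1` buckets with `m` places each: flags `F` and contents `V`
      let q' ← alu .add q 1
      let q2 ← alu .mul q' q'
      let m ← alu .mul (2 * κ.c₁ * κ.r) q2
      let M ← alu .mul q' m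
      let F ← alloc M
      let V ← alloc M
      let _ ← call (parFor (clear F) 0 M)
      -- distribute the elements
      let tries ← alu .mul κ.c₂ l
      let failures ← call (parFor (distribute b Q q F V m tries) 0 n)
      let ok ← alu .eq failures 0
      if ok = 0 then call (sampleSort b n)
      else do
        -- pack the buckets into the array `b`; their limits in it are written to `B`
        let T ← alloc M
        let k ← alu .add q' 1
        let B ← alloc k
        let _ ← call (sumFlags F T 0 M)
        let _ ← call (pack F V T m B b 0 M 0)
        let _ ← writeAt B q' n
        -- sort the buckets in parallel
        call (parFor (recurse b B) 0 q')

/-- The code of the initial thread: sort the `n` entries of the input array at address `0`, then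
finish. -/
def mainCode (n : ℕ) : Prog Proc Word := do
  let _ ← call (sort 0 n)
  .finish

/-- The initial state: the input array at addresses `0, …, n - 1` holds the input elements,
represented by their indices. -/
def startConfig (n : ℕ) : Config Proc where
  mem a := if a < n then a else 0
  next := n
  threads := [⟨0, mainCode n⟩]
  finished := false
  work := 0
  span := 0
  maxWord := n

/-- The comparison instruction for the input `x`. -/
def keyLt {n : ℕ} {α : Type*} [LinearOrder α] (x : Fin n → α) (i j : Word) : Bool :=
  if h : i < n ∧ j < n then decide (x ⟨i, h.1⟩ < x ⟨j, h.2⟩) else false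

/-- The array at address `0` holds the elements of `x`, each one once, in nondecreasing order. -/
def IsSortedOutput {n : ℕ} {α : Type*} [LinearOrder α] (x : Fin n → α) (mem : Word → Word) : Prop :=
  ∃ π : Equiv.Perm (Fin n), (∀ i : Fin n, mem i = π i) ∧ Monotone fun i => x (π i)

end BF

/-! The scheduler is adversarial and the threads interact only through test-and-set, so correctness,
termination, work and span are proved together, in a step-indexed concurrent separation logic with
credits. A thread owns fractional permissions for cells (and for ghost cells that exist only in the
proof). What is shared lies in invariants that a thread may open for one instruction. `safe` says
that a thread can run `t` more steps paying for every instruction out of its credits and those of an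
opened invariant. Credits are preserved only in expectation, so a random draw may distribute them
unevenly among its outcomes.

An instruction in depth `d` costs `th ^ d`, with a base `th ≥ 1`. The sum `z` of all prices paid so
far satisfies `work ≤ z` and `th ^ span ≤ z + 1`, and its expectation never exceeds the credits `Φ`
at the start (`Good.step`, `Good.run`). With `th = 1` this bounds the expected work. With `th`
slightly above `1` it bounds an exponential moment of the span, and Markov's inequality gives the
tail (`le_probSpanLE`). The logic also counts threads: there is one more than the debt recorded in
the invariants, so some thread can always run. Hence an unfinished computation has executed `t`
instructions after `t` steps, and finite expected work forces termination almost surely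
(`probFinish_eq_one`).

At a join the first thread leaves its result, permissions and credits in an invariant, and the last
one takes them out. The continuation may run in a depth that is random and not known beforehand. So
sorting is specified with a parameter `κ`: from credit `κ * X n * th ^ d` it must leave `κ * th ^
d'`, where `d'` is the depth in which it ends (`SortSpec`). Two such remainders with parameter `κ *
β` pay for a join and leave a remainder with parameter `κ` (`tri_recurse`).

The probabilistic part consists of pessimistic estimators, used as credits inside invariants. If the
estimator does not increase on average with a draw and is at least the cost of a restart whenever
the round goes wrong, then its initial value pays for all restarts of that round. For the sampling,
the estimator bounds the probability that a block of `h = 16 * (q + 1) ^ 2` consecutive ranks gets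
fewer than `l` samples. If no block does, no bucket has more than `2 * h` elements
(`bucket_card_le`). For the distribution, the scheduler can delay a test-and-set after its place has
been drawn. A collision is therefore charged when the second of two elements draws the same place,
and to both of them (`bump`). An element that fails has at least `T` collisions (`DistOk`), and
`hitPot` estimates that event. Together a round fails with probability at most `4 * 4 ^ (-l)`
(`LargeSize.fail_le`).

It remains to solve the recurrence in `RoundOk`: a round pays for its own instructions, for a
restart with the above probability, and for its buckets, whose logarithms are at most `3 / 4` of
that of `n`. A function of order `n log n` solves it for `th = 1` (`sortOk_work`). For the span `2 ^
(28 * log n)` up to a constant does, because `28 * 3 / 4 = 21` leaves room for the number of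
buckets, the forks and the depth of the round (`sortOk_span`). -/

open scoped ENNReal NNReal

namespace BF

/-! ## A concurrent program logic with expected costs -/

/-- States of the logic: `s (0, a)` is the content of memory cell `a`, the other entries are ghost
cells that belong to it. -/
abbrev St := ℕ × ℕ → ℕ

/-- Fractional permissions. -/
abbrev Share := ℕ × ℕ → ℝ≥0

/-- Any positive share of a cell prevents the other threads from changing it. So this relation
describes what the environment may do to the state as seen by the owner of `p`. -/
def Agree (p : Share) (s s' : St) : Prop := ∀ a, p a ≠ 0 → s a = s' a

theorem Agree.refl (p : Share) (s : St) : Agree p s s := fun _ _ => rfl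

theorem Agree.trans {p : Share} {s s' s'' : St} (h : Agree p s s') (h' : Agree p s' s'') :
    Agree p s s'' := fun a ha => (h a ha).trans (h' a ha)

theorem Agree.mono {p q : Share} {s s' : St} (h : Agree q s s') (hpq : p ≤ q) : Agree p s s' :=
  fun a ha => h a fun h0 => ha (le_antisymm (h0 ▸ hpq a) zero_le)

/-- Invariants: predicates on the state, permissions, credits, and a debt of threads. -/
abbrev Inv := St → Share → ℝ≥0∞ → ℕ → Prop

/-- The invariants allocated so far, and a lower bound for the allocation pointer. -/
structure World where
  invs : List Inv
  nx : ℕ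

/-- Worlds only grow. An invariant that has served its purpose is not removed but passes to a state
from which nothing more is needed. -/
instance : Preorder World where
  le W W' := W.invs ⊆ W'.invs ∧ W.nx ≤ W'.nx
  le_refl W := ⟨List.Subset.refl _, le_rfl⟩
  le_trans _ _ _ h h' := ⟨List.Subset.trans h.1 h'.1, h.2.trans h'.2⟩

/-- The invariant holds in a state that agrees with `s` on the cells that it owns. -/
def Inv.At (I : Inv) : Inv := fun s p e δ => ∃ s₀, Agree p s₀ s ∧ I s₀ p e δ

theorem Inv.At.agree {I : Inv} {s s' : St} {p : Share} {e : ℝ≥0∞} {δ : ℕ} (h : I.At s p e δ)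
    (ha : Agree p s s') : I.At s' p e δ :=
  let ⟨s₀, h0, hI⟩ := h
  ⟨s₀, h0.trans ha, hI⟩

/-- This is the separating conjunction of the invariants. The empty list accepts any permissions and
credits, so these may be thrown away, but its debt must be zero: threads are counted exactly. -/
def Holds : List Inv → St → Share → ℝ≥0∞ → ℕ → Prop
  | [], _, _, _, δ => δ = 0
  | I :: l, s, p, e, δ => ∃ p₁ p₂ e₁ e₂ δ₁ δ₂, p₁ + p₂ = p ∧ e₁ + e₂ = e ∧ δ₁ + δ₂ = δ ∧
      I.At s p₁ e₁ δ₁ ∧ Holds l s p₂ e₂ δ₂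

theorem Holds.agree {l : List Inv} {s s' : St} {p : Share} {e : ℝ≥0∞} {δ : ℕ}
    (h : Holds l s p e δ) (ha : Agree p s s') : Holds l s' p e δ := by
  induction l generalizing p e δ with
  | nil => exact h
  | cons I l ih =>
    obtain ⟨p₁, p₂, e₁, e₂, δ₁, δ₂, rfl, rfl, rfl, hI, h⟩ := h
    exact ⟨p₁, p₂, e₁, e₂, δ₁, δ₂, rfl, rfl, rfl, hI.agree (ha.mono le_self_add), ih h (ha.mono le_add_self)⟩

/-- In every extension of the world `W`, the resource described by `J` can be taken out. -/
def Opens (W : World) (J : Inv) : Prop := ∀ W', W ≤ W' → ∀ s p e δ, Holds W'.invs s p e δ →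
  ∃ p₁ p₂ e₁ e₂ δ₁ δ₂, p₁ + p₂ = p ∧ e₁ + e₂ = e ∧ δ₁ + δ₂ = δ ∧ J.At s p₁ e₁ δ₁ ∧
    ∀ s' p₁' e₁' δ₁', Agree p₂ s s' → J.At s' p₁' e₁' δ₁' →
      Holds W'.invs s' (p₁' + p₂) (e₁' + e₂) (δ₁' + δ₂)

theorem Opens.mono {W W' : World} {J : Inv} (h : Opens W J) (hW : W ≤ W') : Opens W' J :=
  fun W'' hW' => h W'' (hW.trans hW')

theorem holds_open {l : List Inv} {I : Inv} (hI : I ∈ l) {s p e δ} (h : Holds l s p e δ) :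
    ∃ p₁ p₂ e₁ e₂ δ₁ δ₂, p₁ + p₂ = p ∧ e₁ + e₂ = e ∧ δ₁ + δ₂ = δ ∧ I.At s p₁ e₁ δ₁ ∧
    ∀ s' p₁' e₁' δ₁', Agree p₂ s s' → I.At s' p₁' e₁' δ₁' →
      Holds l s' (p₁' + p₂) (e₁' + e₂) (δ₁' + δ₂) := by
  induction l generalizing p e δ with
  | nil => simp at hI
  | cons I' l ih =>
    obtain ⟨p₁, p₂, e₁, e₂, δ₁, δ₂, rfl, rfl, rfl, hI', h⟩ := h
    rcases List.mem_cons.1 hI with rfl | hI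
    · exact ⟨p₁, p₂, e₁, e₂, δ₁, δ₂, rfl, rfl, rfl, hI', fun s' p₁' e₁' δ₁' ha hJ =>
        ⟨p₁', p₂, e₁', e₂, δ₁', δ₂, rfl, rfl, rfl, hJ, h.agree ha⟩⟩
    · obtain ⟨q₁, q₂, f₁, f₂, ε₁, ε₂, rfl, rfl, rfl, gI, g⟩ := ih hI h
      refine ⟨q₁, p₁ + q₂, f₁, e₁ + f₂, ε₁, δ₁ + ε₂, by abel, by abel, by abel, gI,
        fun s' p₁' e₁' δ₁' ha hJ => ?_⟩
      exact ⟨p₁, p₁' + q₂, e₁, e₁' + f₂, δ₁, δ₁' + ε₂, by abel, by abel, by abel,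
        hI'.agree (ha.mono le_self_add), g _ _ _ _ (ha.mono le_add_self) hJ⟩

theorem Opens.of_mem {W : World} {I : Inv} (hI : I ∈ W.invs) : Opens W I :=
  fun _ hW _ _ _ _ h => holds_open (hW.1 hI) h

/-- The trivial resource. -/
def Inv.none : Inv := fun _ p e δ => p = 0 ∧ e = 0 ∧ δ = 0

/-- With the trivial resource, instructions that need no invariant are instances of the rule for
instructions that open one. -/
theorem Opens.none (W : World) : Opens W Inv.none := fun W' _ s p e δ h =>
  ⟨0, p, 0, e, 0, δ, by simp, by simp, by simp, ⟨s, .refl _ _, rfl, rfl, rfl⟩,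
    fun s' p' e' δ' ha ⟨_, _, h1, h2, h3⟩ => by subst h1 h2 h3; simpa using h.agree ha⟩

/-- The parameters of the logic: the program, the comparison, the base of the exponential price
of an instruction, a bound for words, and the postcondition of the computation. -/
structure Env where
  par : Params
  lt : Word → Word → Bool
  th : ℝ≥0∞
  bd : ℕ
  fin : (Word → Word) → Prop
  one_le_th : 1 ≤ th
  th_ne_top : th ≠ ⊤

/-- The outcome of one instruction of a thread: the new memory and allocation pointer, the threads
that replace it, and the word that was returned. -/
structure Out where
  mem : ℕ → ℕ
  next : ℕ
  ths : List (Thread Proc)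
  word : ℕ
  fin : Bool

-- This is an instruction seen by its own thread only, without the list of threads and the counters.
-- The logic is local to threads; `exec_eq_lstep` connects it with the machine.
open Classical in
noncomputable def lstep (E : Env) (θ : Thread Proc) (mem : Word → Word) (next : Word) : PMF Out :=
  let d := θ.depth + 1
  match θ.code with
  | .ret _ => PMF.pure ⟨mem, next, [], 0, false⟩
  | .endThread => PMF.pure ⟨mem, next, [], 0, false⟩
  | .finish => PMF.pure ⟨mem, next, [θ], 0, true⟩
  | .call p k => PMF.pure ⟨mem, next, [⟨d, (Proc.code E.par p).bind k⟩], 0, false⟩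
  | .instr (.alu o x y) k => PMF.pure ⟨mem, next, [⟨d, k (o.eval x y)⟩], o.eval x y, false⟩
  | .instr (.rand m) k => (uniformBelow m).map fun w => ⟨mem, next, [⟨d, k w⟩], w, false⟩
  | .instr (.cmp x y) k =>
      PMF.pure ⟨mem, next, [⟨d, k (if E.lt x y then 1 else 0)⟩], if E.lt x y then 1 else 0, false⟩
  | .instr (.alloc m) k => PMF.pure ⟨mem, next + m, [⟨d, k next⟩], next, false⟩
  | .instr (.read a) k => PMF.pure ⟨mem, next, [⟨d, k (mem a)⟩], mem a, false⟩
  | .instr (.write a v) k =>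
      PMF.pure ⟨Function.update mem a v, next, [⟨d, k 0⟩], 0, false⟩
  | .instr (.tas a) k =>
      if mem a = 0 then PMF.pure ⟨Function.update mem a 1, next, [⟨d, k 0⟩], 0, false⟩
      else PMF.pure ⟨mem, next, [⟨d, k 1⟩], 1, false⟩
  | .instr .fork k => PMF.pure ⟨mem, next, [⟨d, k 0⟩, ⟨d, k 1⟩], 0, false⟩

/-- The new state of the machine after an instruction of the thread in position `i`. -/
def Out.toConfig (o : Out) (c : Config Proc) (i : ℕ) (depth : ℕ) : Config Proc where
  mem := o.mem
  next := o.next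
  -- The first resulting thread takes the old position, and a forked child goes to the end of the
  -- list.
  threads := c.threads.take i ++ o.ths.take 1 ++ c.threads.drop (i + 1) ++ o.ths.drop 1
  finished := o.fin
  work := c.work + 1
  span := max c.span depth
  maxWord := max c.maxWord o.word

theorem exec_eq_lstep (E : Env) (c : Config Proc) (i : ℕ) (θ : Thread Proc)
    (hi : c.threads[i]? = some θ) (hc : c.finished = false) :
    c.exec (Proc.code E.par) E.lt i θ =
      (lstep E θ c.mem c.next).map fun o => o.toConfig c i (θ.depth + 1) := by
  have hlt : i < c.threads.length := (List.getElem?_eq_some_iff.1 hi).1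
  have hset : ∀ x : Thread Proc,
      c.threads.take i ++ (x :: c.threads.drop (i + 1)) = c.threads.set i x := fun x => by
    rw [List.set_eq_take_append_cons_drop, if_pos hlt]
  have hself : c.threads.set i θ = c.threads := by
    obtain ⟨h, rfl⟩ := List.getElem?_eq_some_iff.1 hi
    simp
  obtain ⟨dp, code⟩ := θ
  unfold Config.exec lstep
  rcases code with a | _ | _ | ⟨i, k⟩ | ⟨p, k⟩
  · simp [Out.toConfig, Config.charge, hc, List.eraseIdx_eq_take_drop_succ, PMF.pure_map]
  · simp [Out.toConfig, Config.charge, hc, List.eraseIdx_eq_take_drop_succ, PMF.pure_map]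
  · simp [Out.toConfig, Config.charge, PMF.pure_map, hset, hself]
  · rcases i with _ | _ | _ | _ | _ | _ | a | _
    case tas =>
      by_cases h : c.mem a = 0 <;>
      simp [Out.toConfig, Config.charge, Config.resume, hc, PMF.pure_map, hset, h]
    all_goals
      simp [Out.toConfig, Config.charge, Config.resume, hc, PMF.pure_map, PMF.map_comp, ← hset,
        Function.comp_def]
  · simp [Out.toConfig, Config.charge, hc, PMF.pure_map, hset]

/-- The world `W` holds in state `s`, where threads have permissions `q`, and invariants have
permissions `pW` and credits `eW`. -/
structure World.Ok (E : Env) (W : World) (s : St) (q pW : Share) (eW : ℝ≥0∞) (δ : ℕ) : Prop where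
  holds : Holds W.invs s pW eW δ
  le_one : q + pW ≤ 1
  fresh : ∀ j a, W.nx ≤ a → (q + pW) (j, a) = 0
  bound : ∀ a, s (0, a) ≤ E.bd + W.nx

/-- With permissions `p` and credits `e`, the thread can execute `t` more steps safely. -/
def safe (E : Env) : ℕ → World → Thread Proc → St → Share → ℝ≥0∞ → Prop
  | 0, _, _, _, _, _ => True
  -- Before the step, the environment may have extended the world and changed all cells without a
  -- share in `p`. The share `pF` belongs to the other threads.
  | t + 1, W, θ, s, p, e => ∀ W' s' pF pW eW δ, W ≤ W' → Agree p s s' →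
      World.Ok E W' s' (p + pF) pW eW δ →
      -- Here `f o` is the credit that remains after outcome `o`. Only its expectation is bounded,
      -- and it may include credit taken from the invariants.
      ∃ f : Out → ℝ≥0∞, E.th ^ (θ.depth + 1) +
          ∑' o, lstep E θ (fun a => s' (0, a)) W'.nx o * f o ≤ e + eW ∧
        ∀ o ∈ (lstep E θ (fun a => s' (0, a)) W'.nx).support,
          (o.word ≤ E.bd + o.next ∧ W'.nx ≤ o.next ∧ o.next ≤ W'.nx + E.bd) ∧
          (o.fin = true → E.fin o.mem) ∧
          (o.fin = false → ∃ W'' s'' pW'' eW'' δ'', ∃ rs : List (Thread Proc × Share × ℝ≥0∞),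
            W' ≤ W'' ∧ W''.nx = o.next ∧ (∀ a, s'' (0, a) = o.mem a) ∧ Agree pF s' s'' ∧
            World.Ok E W'' s'' ((rs.map fun x => x.2.1).sum + pF) pW'' eW'' δ'' ∧
            rs.map (fun x => x.1) = o.ths ∧
            (∀ x ∈ rs, safe E t W'' x.1 s'' x.2.1 x.2.2) ∧
            -- The last equation keeps the number of threads minus the debt constant. A fork creates
            -- a debt, which is cleared when the superfluous thread ends.
            (rs.map fun x => x.2.2).sum + eW'' ≤ f o ∧ δ'' + 1 = δ + rs.length)

variable {E : Env}

theorem safe.mono {t : ℕ} {W W' : World} {θ : Thread Proc} {s s' : St} {p : Share} {e : ℝ≥0∞}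
    (h : safe E t W θ s p e) (hW : W ≤ W') (hs : Agree p s s') : safe E t W' θ s' p e := by
  cases t with
  | zero => trivial
  | succ t =>
    exact fun W'' s'' pF pW eW δ hW' hs' hok =>
      h W'' s'' pF pW eW δ (hW.trans hW') (hs.trans hs') hok

theorem safe.of_succ {t : ℕ} {W : World} {θ : Thread Proc} {s : St} {p : Share} {e : ℝ≥0∞}
    (h : safe E (t + 1) W θ s p e) : safe E t W θ s p e := by
  induction t generalizing W θ s p e with
  | zero => trivial
  | succ t ih =>
    intro W' s' pF pW eW δ hW hs hok
    obtain ⟨f, hf, H⟩ := h W' s' pF pW eW δ hW hs hok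
    refine ⟨f, hf, fun o ho => ⟨(H o ho).1, (H o ho).2.1, fun hfin => ?_⟩⟩
    obtain ⟨W'', s'', pW'', eW'', δ'', rs, h1, h2, h3, h4, h5, h6, h7, h8⟩ := (H o ho).2.2 hfin
    exact ⟨W'', s'', pW'', eW'', δ'', rs, h1, h2, h3, h4, h5, h6, fun x hx => ih (h7 x hx), h8⟩

theorem safe.of_le {t t' : ℕ} {W : World} {θ : Thread Proc} {s : St} {p : Share} {e : ℝ≥0∞}
    (h : safe E t' W θ s p e) (htt : t ≤ t') : safe E t W θ s p e := by
  induction htt with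
  | refl => exact h
  | step _ ih => exact ih h.of_succ

theorem safe.weaken {t : ℕ} {W : World} {θ : Thread Proc} {s : St} {p p' : Share} {e e' : ℝ≥0∞}
    (h : safe E t W θ s p e) (hp : p ≤ p') (he : e ≤ e') : safe E t W θ s p' e' := by
  cases t with
  | zero => trivial
  | succ t =>
    intro W' s' pF pW eW δ hW hs hok
    obtain ⟨r, rfl⟩ : ∃ r, p' = p + r := ⟨p' - p, (add_tsub_cancel_of_le hp).symm⟩
    obtain ⟨f, hf, H⟩ := h W' s' (r + pF) pW eW δ hW (hs.mono le_self_add)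
      (by rwa [← add_assoc])
    refine ⟨f, hf.trans (by gcongr), fun o ho => ⟨(H o ho).1, (H o ho).2.1, fun hfin => ?_⟩⟩
    obtain ⟨W'', s'', pW'', eW'', δ'', rs, h1, h2, h3, h4, h5, h6⟩ := (H o ho).2.2 hfin
    refine ⟨W'', s'', pW'', eW'', δ'', rs, h1, h2, h3, h4.mono le_add_self,
      ⟨h5.holds, (add_le_add (add_le_add le_rfl le_add_self) le_rfl).trans h5.le_one,
       fun j a ha => ?_, h5.bound⟩, h6⟩
    have := h5.fresh j a ha
    simp only [Pi.add_apply, add_eq_zero] at this ⊢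
    tauto

/-- The allocation of an invariant. -/
theorem safe.new_inv {t : ℕ} {W : World} {θ : Thread Proc} {s : St} {p q : Share} {e g : ℝ≥0∞}
    (I : Inv) (hI : I s q g 0)
    (h : safe E t ⟨I :: W.invs, W.nx⟩ θ s p e) : safe E t W θ s (p + q) (e + g) := by
  cases t with
  | zero => trivial
  | succ t =>
    intro W' s' pF pW eW δ hW hs hok
    obtain ⟨f, hf, H⟩ := h ⟨I :: W'.invs, W'.nx⟩ s' pF (q + pW) (g + eW) δ
      ⟨List.cons_subset_cons _ hW.1, hW.2⟩ (hs.mono le_self_add)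
      ⟨⟨q, pW, g, eW, 0, δ, rfl, rfl, by simp, ⟨s, hs.mono le_add_self, hI⟩, hok.holds⟩,
        by have := hok.le_one; rwa [show p + pF + (q + pW) = p + q + pF + pW by abel],
        by have := hok.fresh; rwa [show p + pF + (q + pW) = p + q + pF + pW by abel], hok.bound⟩
    refine ⟨f, by rw [add_assoc]; exact hf, fun o ho => ⟨(H o ho).1, (H o ho).2.1, fun hfin => ?_⟩⟩
    obtain ⟨W'', s'', pW'', eW'', δ'', rs, h1, h2⟩ := (H o ho).2.2 hfin
    exact ⟨W'', s'', pW'', eW'', δ'', rs, ⟨fun x hx => h1.1 (by simp [hx]), h1.2⟩, h2⟩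

/-- A cell may change only if the thread and the opened resource own it completely together. Since
shares add up to at most one, nobody else then has a share of it. -/
theorem agree_of_split {p q r : Share} (h : p + q + r ≤ 1) {s s' : St}
    (hs : ∀ a, p a + q a < 1 → s a = s' a) : Agree r s s' := fun a ha => by
  apply hs
  have := h a
  simp only [Pi.add_apply, Pi.one_apply] at this
  exact lt_of_lt_of_le (lt_add_of_pos_right _ (pos_iff_ne_zero.2 ha)) this

/-- Updating ghost cells with the help of an invariant. -/
theorem safe.view_shift {t : ℕ} {W : World} {θ : Thread Proc} {s : St} {p : Share} {e : ℝ≥0∞}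
    {J : Inv} (hJ : Opens W J)
    (h : ∀ W' s' p₁ e₁ δ₁, W ≤ W' → Agree p s s' → J.At s' p₁ e₁ δ₁ →
      p + p₁ ≤ 1 → ∃ s'' p' e' p₁' e₁', (∀ a, s'' (0, a) = s' (0, a)) ∧
        (∀ a, p a + p₁ a < 1 → s' a = s'' a) ∧ J.At s'' p₁' e₁' δ₁ ∧ p' + p₁' ≤ p + p₁ ∧
        e' + e₁' ≤ e + e₁ ∧ safe E t W' θ s'' p' e') : safe E t W θ s p e := by
  cases t with
  | zero => trivial
  | succ t =>
    intro W' s' pF pW eW δ hW hs hok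
    obtain ⟨p₁, p₂, e₁, e₂, δ₁, δ₂, rfl, rfl, rfl, g1, g2⟩ := hJ W' hW _ _ _ _ hok.holds
    have hle := hok.le_one
    obtain ⟨s'', p', e', p₁', e₁', k1, k2, k3, k4, k5, k6⟩ := h W' s' p₁ e₁ δ₁ hW hs g1
      (le_trans (fun a => by
        simp only [Pi.add_apply]; gcongr <;> exact le_self_add) hle)
    have hag : Agree (p₂ + pF) s' s'' := agree_of_split (p := p) (q := p₁) (by
      rwa [show p + p₁ + (p₂ + pF) = p + pF + (p₁ + p₂) by abel]) k2
    have hle2 : p' + pF + (p₁' + p₂) ≤ p + pF + (p₁ + p₂) := by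
      calc p' + pF + (p₁' + p₂) = (p' + p₁') + (pF + p₂) := by abel
        _ ≤ (p + p₁) + (pF + p₂) := by gcongr
        _ = _ := by abel
    obtain ⟨f, hf, H⟩ := k6 W' s'' pF (p₁' + p₂) (e₁' + e₂) (δ₁ + δ₂) le_rfl (.refl _ _)
      ⟨g2 _ _ _ _ (hag.mono le_self_add) k3, hle2.trans hle, fun j a ha => by
        have := hle2 (j, a)
        rw [hok.fresh j a ha] at this
        exact le_antisymm this zero_le, fun a => by rw [k1]; exact hok.bound a⟩
    simp only [k1] at hf H
    refine ⟨f, hf.trans ?_, fun o ho => ⟨(H o ho).1, (H o ho).2.1, fun hfin => ?_⟩⟩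
    · rw [← add_assoc, ← add_assoc]; exact add_le_add k5 le_rfl
    obtain ⟨W'', s3, pW'', eW'', δ'', rs, h1, h2, h3, h4, h5⟩ := (H o ho).2.2 hfin
    exact ⟨W'', s3, pW'', eW'', δ'', rs, h1, h2, h3, (hag.mono le_add_self).trans h4, h5⟩

/-- One step of a thread that does not allocate memory, with the help of an invariant. -/
theorem safe.step {t : ℕ} {W : World} {θ : Thread Proc} {s : St} {p : Share} {e : ℝ≥0∞}
    {J : Inv} (hJ : Opens W J)
    (h : ∀ W' s' p₁ e₁ δ₁, W ≤ W' → Agree p s s' → J.At s' p₁ e₁ δ₁ →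
      p + p₁ ≤ 1 → (∀ a, s' (0, a) ≤ E.bd + W'.nx) →
      ∃ f : Out → ℝ≥0∞, E.th ^ (θ.depth + 1) +
          ∑' o, lstep E θ (fun a => s' (0, a)) W'.nx o * f o ≤ e + e₁ ∧
        ∀ o ∈ (lstep E θ (fun a => s' (0, a)) W'.nx).support,
          o.word ≤ E.bd + W'.nx ∧ o.next = W'.nx ∧ (∀ a, o.mem a ≤ E.bd + W'.nx) ∧
          (o.fin = true → E.fin o.mem) ∧
          (o.fin = false → ∃ s'' p₁' e₁' δ₁', ∃ rs : List (Thread Proc × Share × ℝ≥0∞),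
            (∀ a, s'' (0, a) = o.mem a) ∧ (∀ a, p a + p₁ a < 1 → s' a = s'' a) ∧
            J.At s'' p₁' e₁' δ₁' ∧ (rs.map fun x => x.2.1).sum + p₁' ≤ p + p₁ ∧
            rs.map (fun x => x.1) = o.ths ∧
            (∀ x ∈ rs, safe E t W' x.1 s'' x.2.1 x.2.2) ∧
            (rs.map fun x => x.2.2).sum + e₁' ≤ f o ∧ δ₁' + 1 = δ₁ + rs.length)) :
    safe E (t + 1) W θ s p e := by
  intro W' s' pF pW eW δ hW hs hok
  obtain ⟨p₁, p₂, e₁, e₂, δ₁, δ₂, rfl, rfl, rfl, g1, g2⟩ := hJ W' hW _ _ _ _ hok.holds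
  have hle := hok.le_one
  obtain ⟨f, hf, H⟩ := h W' s' p₁ e₁ δ₁ hW hs g1
    (le_trans (fun a => by simp only [Pi.add_apply]; gcongr <;> exact le_self_add) hle) hok.bound
  refine ⟨fun o => f o + e₂, ?_, fun o ho => ?_⟩
  · simp only [mul_add, ENNReal.tsum_add, ENNReal.tsum_mul_right, PMF.tsum_coe, one_mul]
    rw [← add_assoc, ← add_assoc]
    exact add_le_add hf le_rfl
  obtain ⟨H1, H2, H3, H4, H5⟩ := H o ho
  refine ⟨⟨H2 ▸ H1, by omega, by omega⟩, H4, fun hfin => ?_⟩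
  obtain ⟨s'', p₁', e₁', δ₁', rs, k1, k2, k3, k4, k5, k6, k7, k8⟩ := H5 hfin
  have hag : Agree (p₂ + pF) s' s'' := agree_of_split (p := p) (q := p₁) (by
      rwa [show p + p₁ + (p₂ + pF) = p + pF + (p₁ + p₂) by abel]) k2
  have hle2 : (rs.map fun x => x.2.1).sum + pF + (p₁' + p₂) ≤ p + pF + (p₁ + p₂) := by
      calc _ = ((rs.map fun x => x.2.1).sum + p₁') + (pF + p₂) := by abel
        _ ≤ (p + p₁) + (pF + p₂) := by gcongr
        _ = _ := by abel
  refine ⟨W', s'', p₁' + p₂, e₁' + e₂, δ₁' + δ₂, rs, le_rfl, H2.symm, k1, hag.mono le_add_self,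
    ⟨g2 _ _ _ _ (hag.mono le_self_add) k3, hle2.trans hle, fun j a ha => ?_, fun a => ?_⟩,
    k5, k6, ?_, by omega⟩
  · have := hle2 (j, a)
    rw [hok.fresh j a ha] at this
    exact le_antisymm this zero_le
  · rw [k1]; exact H3 a
  · rw [← add_assoc]; exact add_le_add k7 le_rfl

end BF

namespace BF
variable {E : Env}

/-! ## Soundness -/

/-- The state of the machine is safe for `t` more steps, with potential `Φ`. -/
structure Good (E : Env) (B t : ℕ) (c : Config Proc) (Φ : ℝ≥0∞) : Prop where
  word : c.maxWord ≤ E.bd + c.next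
  next : c.next ≤ B + E.bd * c.work
  fin : c.finished = true → E.fin c.mem
  -- The number `z` is the total price paid so far. Every price is at least one, which gives the
  -- bound for the work, and the price of the deepest instruction gives the bound for the span. The
  -- summand `1` covers the start, when the span is `0`.
  cost : ∃ z : ℝ≥0∞, (c.work : ℝ≥0∞) ≤ z ∧ E.th ^ c.span ≤ z + 1 ∧ z ≤ Φ ∧
    (c.finished = false → ∃ W s pW eW δ, ∃ rs : List (Thread Proc × Share × ℝ≥0∞),
      W.nx = c.next ∧ (∀ a, s (0, a) = c.mem a) ∧
      World.Ok E W s (rs.map fun x => x.2.1).sum pW eW δ ∧ rs.map (fun x => x.1) = c.threads ∧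
      (∀ x ∈ rs, safe E t W x.1 s x.2.1 x.2.2) ∧
      z + (rs.map fun x => x.2.2).sum + eW ≤ Φ ∧ rs.length = δ + 1)

theorem Good.of_succ {B t : ℕ} {c : Config Proc} {Φ : ℝ≥0∞} (h : Good E B (t + 1) c Φ) :
    Good E B t c Φ := by
  obtain ⟨z, h1, h2, h3, h4⟩ := h.cost
  refine ⟨h.word, h.next, h.fin, z, h1, h2, h3, fun hf => ?_⟩
  obtain ⟨W, s, pW, eW, δ, rs, g1, g2, g3, g4, g5, g6⟩ := h4 hf
  exact ⟨W, s, pW, eW, δ, rs, g1, g2, g3, g4, fun x hx => (g5 x hx).of_succ, g6⟩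

/-- The price of the instruction moves from the credits of the scheduled thread to `z`. The credits
of the other threads do not change, and those of the thread and the invariants become `f o`. So the
potential is a supermartingale, whatever thread is selected. -/
theorem Good.step {B t : ℕ} {c : Config Proc} {Φ : ℝ≥0∞}
    (h : Good E B (t + 1) c Φ) (hc : c.finished = false) (σ : ℕ) :
    ∃ θ i, c.step (Proc.code E.par) E.lt σ =
      (lstep E θ c.mem c.next).map (fun o => o.toConfig c i (θ.depth + 1)) ∧
    ∃ f : Out → ℝ≥0∞, ∑' o, lstep E θ c.mem c.next o * f o ≤ Φ ∧
      ∀ o ∈ (lstep E θ c.mem c.next).support,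
        Good E B t (o.toConfig c i (θ.depth + 1)) (f o) := by
  obtain ⟨z, hz1, hz2, hz3, h4⟩ := h.cost
  obtain ⟨W, s, pW, eW, δ, rs, g1, g2, g3, g4, g5, g6, g7⟩ := h4 hc
  have hlen : c.threads.length = δ + 1 := by rw [← g4, List.length_map, g7]
  set i := σ % c.threads.length with hi
  -- There are `δ + 1` threads, hence at least one: the computation cannot get stuck before it
  -- finishes.
  have hlt : i < rs.length := by
    rw [g7, ← hlen]; exact Nat.mod_lt _ (by omega)
  rcases hr : rs[i] with ⟨θ, p, e⟩
  have hrs : rs = rs.take i ++ (θ, p, e) :: rs.drop (i + 1) := by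
    rw [← hr, List.getElem_cons_drop, List.take_append_drop]
  set A := rs.take i
  set D := rs.drop (i + 1)
  have hθ : c.threads[i]? = some θ := by
    rw [← g4, List.getElem?_map, List.getElem?_eq_getElem hlt, hr]; rfl
  refine ⟨θ, i, ?_, ?_⟩
  · rw [Config.step, if_neg (by simp [hc]), ← hi, hθ]
    exact exec_eq_lstep E c i θ hθ hc
  have hsum : ∀ {M : Type} [AddCommMonoid M] (g : Thread Proc × Share × ℝ≥0∞ → M),
      (rs.map g).sum = g (θ, p, e) + ((A.map g).sum + (D.map g).sum) := fun g => by
    conv_lhs => rw [hrs]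
    simp only [List.map_append, List.map_cons, List.sum_append, List.sum_cons]
    abel
  have hmem : (fun a => s (0, a)) = c.mem := funext g2
  obtain ⟨f, hf, H⟩ := g5 (θ, p, e) (by rw [hrs]; simp) W s
    ((A.map fun x => x.2.1).sum + (D.map fun x => x.2.1).sum) pW eW δ le_rfl (.refl _ _)
    (by rw [hsum] at g3; exact g3)
  rw [hmem, g1] at hf H
  set R := (A.map fun x => x.2.2).sum + (D.map fun x => x.2.2).sum with hR
  refine ⟨fun o => z + E.th ^ (θ.depth + 1) + R + f o, ?_, fun o ho => ?_⟩
  · simp only [mul_add, ENNReal.tsum_add, ENNReal.tsum_mul_right, PMF.tsum_coe, one_mul]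
    rw [hsum] at g6
    calc _ = z + R + (E.th ^ (θ.depth + 1) + ∑' o, lstep E θ c.mem c.next o * f o) := by ring
      _ ≤ z + R + (e + eW) := by gcongr
      _ = z + (e + R) + eW := by ring
      _ ≤ Φ := g6
  obtain ⟨⟨H1, H2, H2'⟩, H3, H4⟩ := H o ho
  refine ⟨?_, ?_, H3, z + E.th ^ (θ.depth + 1), ?_, ?_, ?_, fun hfin => ?_⟩
  · simp only [Out.toConfig, sup_le_iff]
    exact ⟨h.word.trans (Nat.add_le_add_left H2 _), H1⟩
  · simp only [Out.toConfig, mul_add, mul_one, ← add_assoc]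
    exact H2'.trans (Nat.add_le_add_right h.next _)
  · simp only [Out.toConfig]
    push_cast
    exact add_le_add hz1 (one_le_pow₀ E.one_le_th)
  · simp only [Out.toConfig]
    rcases max_choice c.span (θ.depth + 1) with h' | h' <;> rw [h']
    · refine hz2.trans ?_
      gcongr
      exact le_self_add
    · rw [add_assoc]
      exact le_add_left le_self_add
  · exact le_trans le_self_add le_self_add
  · obtain ⟨W'', s'', pW'', eW'', δ'', rs', k1, k2, k3, k4, k5, k6, k7, k8, k9⟩ := H4 hfin
    have hperm : ∀ {M : Type} [AddCommMonoid M] (g : Thread Proc × Share × ℝ≥0∞ → M),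
        ((A ++ rs'.take 1 ++ D ++ rs'.drop 1).map g).sum =
          (rs'.map g).sum + ((A.map g).sum + (D.map g).sum) := fun g => by
      conv_rhs => rw [← List.take_append_drop 1 rs']
      simp only [List.map_append, List.sum_append]
      abel
    refine ⟨W'', s'', pW'', eW'', δ'', A ++ rs'.take 1 ++ D ++ rs'.drop 1, k2, k3, ?_, ?_, ?_, ?_,
      ?_⟩
    · rw [hperm]; exact k5
    · simp only [Out.toConfig, ← k6, ← g4, List.map_append, List.map_take, List.map_drop, A, D]
    · intro x hx
      have hx' : x ∈ rs' ∨ x ∈ A ∨ x ∈ D := by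
        simp only [List.mem_append] at hx
        rcases hx with ((hx | hx) | hx) | hx
        · exact .inr (.inl hx)
        · exact .inl (List.mem_of_mem_take hx)
        · exact .inr (.inr hx)
        · exact .inl (List.mem_of_mem_drop hx)
      rcases hx' with hx' | hx'
      · exact k7 x hx'
      · refine (g5 x ?_).of_succ.mono k1 (k4.mono ?_)
        · rw [hrs]; simp; tauto
        · rcases hx' with hx' | hx'
          · exact le_add_right (List.single_le_sum (by simp) _ (List.mem_map_of_mem hx'))
          · exact le_add_left (List.single_le_sum (by simp) _ (List.mem_map_of_mem hx'))
    · rw [hperm]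
      calc _ = z + E.th ^ (θ.depth + 1) + R + ((rs'.map fun x => x.2.2).sum + eW'') := by
            rw [hR]; ring
        _ ≤ _ := add_le_add le_rfl k8
    · have : A.length + D.length + 1 = rs.length := by
        conv_rhs => rw [hrs]
        simp; omega
      have h' : (rs'.take 1).length + (rs'.drop 1).length = rs'.length := by
        rw [← List.length_append, List.take_append_drop]
      simp only [List.length_append]
      omega

/-- Optional stopping in its simplest form: a quantity dominated by the potential of every good
state has expectation at most the initial potential. The second part holds because every step of an
unfinished computation executes exactly one instruction. -/
theorem Good.run {B : ℕ} (σ : Scheduler Proc) (pay : Config Proc → ℝ≥0∞)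
    (hpay : ∀ c Φ, Good E B 0 c Φ → pay c ≤ Φ) (t : ℕ) (past : List (Config Proc))
    (c : Config Proc) (Φ : ℝ≥0∞) (h : Good E B t c Φ) :
    ∑' c', run (Proc.code E.par) E.lt σ t past c c' * pay c' ≤ Φ ∧
    ∀ c' ∈ (run (Proc.code E.par) E.lt σ t past c).support,
      (∃ Φ', Good E B 0 c' Φ') ∧ (c'.finished = true ∨ c'.work = c.work + t) := by
  induction t generalizing past c Φ with
  | zero =>
    simp only [BF.run, PMF.support_pure, Set.mem_singleton_iff, forall_eq, add_zero, or_true,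
      and_true]
    refine ⟨?_, Φ, h⟩
    rw [tsum_eq_single c (by intro b hb; simp [PMF.pure_apply, hb])]
    simpa using hpay c Φ h
  | succ t ih =>
    rw [BF.run]
    by_cases hc : c.finished = true
    · rw [Config.step, if_pos hc, PMF.pure_bind]
      refine ⟨(ih _ c Φ h.of_succ).1, fun c' hc' => ?_⟩
      have := (ih _ c Φ h.of_succ).2 c' hc'
      refine ⟨this.1, .inl ?_⟩
      clear ih this
      have key : ∀ t past, BF.run (Proc.code E.par) E.lt σ t past c = PMF.pure c := by
        intro t
        induction t with
        | zero => intro past; rfl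
        | succ t ih' =>
          intro past
          rw [BF.run, Config.step, if_pos hc, PMF.pure_bind]
          exact ih' _
      rw [key] at hc'
      simp at hc'
      rw [hc', hc]
    · obtain ⟨θ, i, hstep, f, hf, H⟩ := h.step (by simpa using hc) (σ past c)
      rw [hstep, PMF.bind_map]
      constructor
      · refine le_trans ?_ hf
        simp only [PMF.bind_apply, ← ENNReal.tsum_mul_right]
        rw [ENNReal.tsum_comm]
        refine ENNReal.tsum_le_tsum fun o => ?_
        by_cases ho : o ∈ (lstep E θ c.mem c.next).support
        · simp only [mul_assoc, ENNReal.tsum_mul_left, Function.comp_apply]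
          gcongr
          exact (ih _ _ _ (H o ho)).1
        · rw [PMF.mem_support_iff, not_not] at ho
          simp [ho]
      · intro c' hc'
        rw [PMF.mem_support_bind_iff] at hc'
        obtain ⟨o, ho, hc'⟩ := hc'
        obtain ⟨h1, h2⟩ := (ih _ _ _ (H o ho)).2 c' hc'
        refine ⟨h1, h2.imp_right fun h => ?_⟩
        rw [h]
        simp only [Out.toConfig]
        omega

end BF

namespace BF
variable {E : Env}

/-! ## Rules for single instructions -/

theorem Prog.bind_def {P α β : Type} (p : Prog P α) (f : α → Prog P β) : (p >>= f) = p.bind f := rfl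

theorem Prog.pure_def {P α : Type} (a : α) : (pure a : Prog P α) = .ret a := rfl

theorem Prog.bind_ite {P α β : Type} (c : Prop) [Decidable c] (p q : Prog P α)
    (f : α → Prog P β) : (if c then p else q).bind f = if c then p.bind f else q.bind f := by
  split_ifs <;> rfl

theorem Prog.bind_assoc {P α β γ : Type} (p : Prog P α) (f : α → Prog P β) (g : β → Prog P γ) :
    (p.bind f).bind g = p.bind fun a => (f a).bind g := by
  induction p with
  | ret a => rfl
  | endThread => rfl
  | finish => rfl
  | instr i k ih => simp only [Prog.bind, ih]
  | call p k ih => simp only [Prog.bind, ih]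

theorem tsum_pure_mul (o : Out) (f : Out → ℝ≥0∞) : ∑' o', PMF.pure o o' * f o' = f o := by
  rw [tsum_eq_single o (by intro b hb; simp [PMF.pure_apply, hb])]
  simp

/-- One deterministic step on cells that the thread owns. -/
theorem safe.det {t : ℕ} {W : World} {d : ℕ} {code code' : Prog Proc Word} {s : St} {p : Share}
    {e e' : ℝ≥0∞} (he : E.th ^ (d + 1) + e ≤ e')
    (h : ∀ W' s', W ≤ W' → Agree p s s' → (∀ a, s' (0, a) ≤ E.bd + W'.nx) → ∃ mem w s'',
      lstep E ⟨d, code⟩ (fun a => s' (0, a)) W'.nx =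
        PMF.pure ⟨mem, W'.nx, [⟨d + 1, code'⟩], w, false⟩ ∧ w ≤ E.bd + W'.nx ∧
      (∀ a, s'' (0, a) = mem a) ∧ (∀ a, mem a ≤ E.bd + W'.nx) ∧
      (∀ a, p a < 1 → s' a = s'' a) ∧ safe E t W' ⟨d + 1, code'⟩ s'' p e) :
    safe E (t + 1) W ⟨d, code⟩ s p e' := by
  refine safe.step (Opens.none W) fun W' s' p₁ e₁ δ₁ hW hs ⟨_, _, hp, he1, hδ⟩ _ hb => ?_
  subst hp he1 hδ
  obtain ⟨mem, w, s'', h1, h2, h3, h4, h5, h6⟩ := h W' s' hW hs hb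
  rw [h1]
  refine ⟨fun _ => e, ?_, fun o ho => ?_⟩
  · rw [tsum_pure_mul]; simpa using he
  rw [PMF.support_pure, Set.mem_singleton_iff] at ho
  subst ho
  refine ⟨h2, rfl, h4, by simp, fun _ => ⟨s'', 0, 0, 0, [(⟨d + 1, code'⟩, p, e)], h3,
    fun a ha => h5 a (by simpa using ha), ⟨s'', .refl _ _, rfl, rfl, rfl⟩, by simp, rfl, ?_, by simp, by simp⟩⟩
  simpa using h6

variable {t : ℕ} {W : World} {d : ℕ} {s : St} {p : Share} {e e' : ℝ≥0∞}

theorem safe.alu {o : AluOp} {x y : ℕ} {k : ℕ → Prog Proc Word} (he : E.th ^ (d + 1) + e ≤ e')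
    (hb : @LE.le ℕ _ (o.eval x y) (E.bd + W.nx)) (h : safe E t W ⟨d + 1, k (o.eval x y)⟩ s p e) :
    safe E (t + 1) W ⟨d, .instr (.alu o x y) k⟩ s p e' :=
  safe.det he fun _ s' hW hs hb' => ⟨_, _, s', rfl, hb.trans (Nat.add_le_add_left hW.2 _),
    fun _ => rfl, hb', fun _ _ => rfl, h.mono hW hs⟩

theorem safe.cmp {x y : ℕ} {k : ℕ → Prog Proc Word} (he : E.th ^ (d + 1) + e ≤ e')
    (hb : 1 ≤ E.bd) (h : safe E t W ⟨d + 1, k (if E.lt x y then 1 else 0)⟩ s p e) :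
    safe E (t + 1) W ⟨d, .instr (.cmp x y) k⟩ s p e' :=
  safe.det he fun _ s' hW hs hb' => ⟨_, _, s', rfl, by split_ifs <;> omega,
    fun _ => rfl, hb', fun _ _ => rfl, h.mono hW hs⟩

theorem safe.call {q : Proc} {k : ℕ → Prog Proc Word} (he : E.th ^ (d + 1) + e ≤ e')
    (h : safe E t W ⟨d + 1, (Proc.code E.par q).bind k⟩ s p e) :
    safe E (t + 1) W ⟨d, .call q k⟩ s p e' :=
  safe.det he fun _ s' hW hs hb' => ⟨_, _, s', rfl, by omega,
    fun _ => rfl, hb', fun _ _ => rfl, h.mono hW hs⟩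

theorem safe.read {a : ℕ} {k : ℕ → Prog Proc Word} (he : E.th ^ (d + 1) + e ≤ e')
    (ha : p (0, a) ≠ 0) (h : safe E t W ⟨d + 1, k (s (0, a))⟩ s p e) :
    safe E (t + 1) W ⟨d, .instr (.read a) k⟩ s p e' :=
  safe.det he fun _ s' hW hs hb' => ⟨_, _, s', by rw [hs _ ha]; rfl, hb' a,
    fun _ => rfl, hb', fun _ _ => rfl, h.mono hW hs⟩

theorem real_update (s : St) (a v : ℕ) :
    (fun b => Function.update s (0, a) v (0, b)) = Function.update (fun b => s (0, b)) a v := by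
  ext b
  by_cases h : b = a
  · subst h; simp
  · simp [Function.update_of_ne, h]

theorem Agree.update {s s' : St} (h : Agree p s s') (a : ℕ × ℕ) (v : ℕ) :
    Agree p (Function.update s a v) (Function.update s' a v) := fun b hb => by
  by_cases hba : b = a
  · subst hba; simp
  · simp [Function.update_of_ne, hba, h b hb]

theorem safe.write {a v : ℕ} {k : ℕ → Prog Proc Word} (he : E.th ^ (d + 1) + e ≤ e')
    (ha : 1 ≤ p (0, a)) (hv : v ≤ E.bd + W.nx)
    (h : safe E t W ⟨d + 1, k 0⟩ (Function.update s (0, a) v) p e) :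
    safe E (t + 1) W ⟨d, .instr (.write a v) k⟩ s p e' := by
  refine safe.det he fun W' s' hW hs hb' => ⟨_, _, Function.update s' (0, a) v, rfl, by omega,
    fun b => congrFun (real_update s' a v) b, fun b => ?_, fun b hb => ?_,
    h.mono hW (hs.update _ _)⟩
  · have h1 := hv.trans (Nat.add_le_add_left hW.2 _)
    by_cases hb : b = a
    · subst hb; simpa using h1
    · simpa [Function.update_of_ne, hb] using hb' b
  · have : b ≠ (0, a) := by rintro rfl; exact absurd ha (not_le.2 hb)
    simp [Function.update_of_ne, this]

/-- Full permission for all cells in `a, …, a + k - 1`. -/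
def blk (a k : ℕ) : Share := fun x => if a ≤ x.2 ∧ x.2 < a + k then 1 else 0

/-- Nobody has a share beyond the allocation pointer, so the thread can receive full shares of the
new cells and of all ghost cells at their addresses. The fact that `p` vanishes from `a` on is
passed to the continuation; it separates the new block from the arrays already owned. -/
theorem safe.alloc {m : ℕ} {k : ℕ → Prog Proc Word} (he : E.th ^ (d + 1) + e ≤ e')
    (hm : m ≤ E.bd)
    (h : ∀ W' a s', W ≤ W' → W.nx ≤ a → a + m ≤ W'.nx → Agree p s s' →
      (∀ j b, a ≤ b → p (j, b) = 0) → safe E t W' ⟨d + 1, k a⟩ s' (p + blk a m) e) :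
    safe E (t + 1) W ⟨d, .instr (.alloc m) k⟩ s p e' := by
  intro W' s' pF pW eW δ hW hs hok
  refine ⟨fun _ => e + eW, ?_, fun o ho => ?_⟩
  · simp only [lstep]
    rw [tsum_pure_mul, ← add_assoc]
    gcongr
  simp only [lstep, PMF.support_pure, Set.mem_singleton_iff] at ho
  subst ho
  have hfr := hok.fresh
  simp only [Pi.add_apply, add_eq_zero] at hfr
  refine ⟨⟨by show W'.nx ≤ E.bd + (W'.nx + m); omega, by simp, by simpa using hm⟩, by simp, fun _ => ?_⟩
  refine ⟨⟨W'.invs, W'.nx + m⟩, s', pW, eW, δ, [(⟨d + 1, k W'.nx⟩, p + blk W'.nx m, e)],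
    ⟨List.Subset.refl _, by simp⟩, rfl, fun _ => rfl, .refl _ _, ⟨hok.holds, fun x => ?_, ?_, ?_⟩,
    rfl, ?_, by simp, by simp⟩
  · have h1 := hok.le_one x
    obtain ⟨j, a⟩ := x
    simp only [List.map_cons, List.map_nil, List.sum_cons, List.sum_nil, add_zero, Pi.add_apply,
      Pi.one_apply, blk] at h1 ⊢
    split_ifs with h
    · obtain ⟨⟨h2, h3⟩, h4⟩ := hfr j a h.1
      simp [h2, h3, h4]
    · simpa using h1
  · intro j a ha
    obtain ⟨⟨h2, h3⟩, h4⟩ := hfr j a (le_trans (by simp) ha)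
    simp only at ha
    simp [h2, h3, h4, blk, ha]
  · intro a
    exact (hok.bound a).trans (by simp)
  · simp only [List.mem_singleton, forall_eq]
    exact h _ _ _ ⟨hW.1, hW.2.trans (by simp)⟩ hW.2 le_rfl hs (fun j b hb => (hfr j b hb).1.1)

theorem safe.finish (he : E.th ^ (d + 1) ≤ e)
    (h : ∀ s', Agree p s s' → E.fin fun a => s' (0, a)) :
    safe E t W ⟨d, .finish⟩ s p e := by
  cases t with
  | zero => trivial
  | succ t =>
    intro W' s' pF pW eW δ hW hs hok
    refine ⟨fun _ => 0, by simpa using he.trans le_self_add, fun o ho => ?_⟩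
    simp only [lstep, PMF.support_pure, Set.mem_singleton_iff] at ho
    subst ho
    exact ⟨by simp, fun _ => h _ hs, by simp⟩

/-! ## The rule for the binary join -/

/-- A Hoare triple with frames: from state `s` with permissions `p` and credits `e`, the program
returns a word, and then has the same permissions, and a depth and credits satisfying `Q`. -/
def Tri (E : Env) (t : ℕ) (W : World) (d : ℕ) (c : Prog Proc Word) (s : St) (p : Share) (e : ℝ≥0∞)
    (Q : Word → ℕ → St → ℝ≥0∞ → Prop) : Prop :=
  ∀ t' ≤ t, ∀ W', W ≤ W' → ∀ (k : Word → Prog Proc Word) s₀ px ex, Agree p s s₀ →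
    (∀ t'' ≤ t', ∀ W'', W' ≤ W'' → ∀ v d' s' e', Q v d' s' e' → Agree px s₀ s' →
      safe E t'' W'' ⟨d', k v⟩ s' (p + px) (e' + ex)) →
    safe E t' W' ⟨d, c.bind k⟩ s₀ (p + px) (e + ex)

theorem Tri.mono {c : Prog Proc Word} {Q : Word → ℕ → St → ℝ≥0∞ → Prop}
    (h : Tri E t W d c s p e Q) {t' : ℕ} (ht : t' ≤ t) {W' : World} (hW : W ≤ W') {s' : St}
    (hs : Agree p s s') : Tri E t' W' d c s' p e Q :=
  fun t'' ht' W'' hW' k s₀ px ex hs' => h t'' (ht'.trans ht) W'' (hW.trans hW') k s₀ px ex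
    (hs.trans hs')

theorem Tri.conseq {c : Prog Proc Word} {Q Q' : Word → ℕ → St → ℝ≥0∞ → Prop}
    (h : Tri E t W d c s p e Q) (hQ : ∀ v d' s' e', Q v d' s' e' → Q' v d' s' e') :
    Tri E t W d c s p e Q' :=
  fun t' ht' W' hW k s₀ px ex hs hk => h t' ht' W' hW k s₀ px ex hs
    fun t'' ht'' W'' hW'' v d' s' e' hq => hk t'' ht'' W'' hW'' v d' s' e' (hQ _ _ _ _ hq)

theorem Tri.frame {c : Prog Proc Word} {Q : Word → ℕ → St → ℝ≥0∞ → Prop}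
    (h : Tri E t W d c s p e Q) (px : Share) (ex : ℝ≥0∞) :
    Tri E t W d c s (p + px) (e + ex)
      (fun v d' s' e' => ∃ e₀, e' = e₀ + ex ∧ Q v d' s' e₀ ∧ Agree px s s') :=
  fun t' ht' W' hW k s₀ py ey hs hk => by
    rw [add_assoc, add_assoc]
    refine h t' ht' W' hW k s₀ (px + py) (ex + ey) (hs.mono le_self_add)
      fun t'' ht'' W'' hW'' v d' s' e' hq hag => ?_
    rw [← add_assoc, ← add_assoc]
    exact hk t'' ht'' W'' hW'' v d' s' _ ⟨e', rfl, hq,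
      (hs.mono le_add_self).trans (hag.mono le_self_add)⟩ (hag.mono le_add_self)

theorem Tri.weaken {c : Prog Proc Word} {Q : Word → ℕ → St → ℝ≥0∞ → Prop} {e' : ℝ≥0∞}
    (h : Tri E t W d c s p e Q) (he : e ≤ e') : Tri E t W d c s p e' Q :=
  fun t' ht' W' hW k s₀ px ex hs hk =>
    (h t' ht' W' hW k s₀ px ex hs hk).weaken le_rfl (by gcongr)

/-- The code that a side of `par` executes when it has computed its result. -/
def joinCode (a i : ℕ) (k : Word × Word → Prog Proc Word) (v : Word) : Prog Proc Word :=
  .instr (.alu .add a i) fun x => .instr (.write x v) fun _ => .instr (.tas a) fun b =>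
    if b = 0 then .endThread
    else .instr (.alu .add a 1) fun x => .instr (.read x) fun v =>
      .instr (.alu .add a 2) fun y => .instr (.read y) fun w => k (v, w)

theorem par_bind (q₁ q₂ : Prog Proc Word) (k : Word × Word → Prog Proc Word) :
    (par q₁ q₂).bind k = .instr (.alloc 3) fun a => .instr (.write a 0) fun _ =>
      .instr .fork fun c => if c = 0 then q₁.bind (joinCode a 1 k) else q₂.bind (joinCode a 2 k) := by
  simp only [par, Prog.bind_def, Prog.pure_def, alloc, write, fork, tas, readAt, writeAt, read, alu,
    Prog.bind, Prog.bind_assoc, Prog.bind_ite]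
  rfl

end BF

namespace BF
variable {E : Env} {t : ℕ} {W : World} {d : ℕ} {s : St} {p : Share} {e e' : ℝ≥0∞}

/-- Permission `c` for the cell `a`. -/
def pt (a : ℕ × ℕ) (c : ℝ≥0) : Share := Pi.single a c

theorem pt_self (a : ℕ × ℕ) (c : ℝ≥0) : pt a c a = c := by simp [pt]

/-- The offset of the cell for the result of a side of a join. -/
def side (i : Bool) : ℕ := if i then 2 else 1

/-- The invariant of the join at `a` between threads that own `P i` and guarantee `Q i`. -/
def JoinInv (E : Env) (a : ℕ) (P : Bool → Share) (Q : Bool → Word → ℕ → St → ℝ≥0∞ → Prop) : Inv :=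
  fun s p e δ =>
    -- Before the fork: the parent owns the synchronization cell. The invariant keeps the two result
    -- cells and the ghost cell `(1, a)`, the token of the first thread to arrive.
    (p = pt (1, a) 1 + pt (0, a + 1) 1 + pt (0, a + 2) 1 ∧ e = 0 ∧ δ = 0) ∨
    -- After the fork, before any arrival: each side has its result cell, and the debt is one
    -- because one of the two threads is going to end.
    (p = pt (0, a) 1 + pt (1, a) 1 ∧ s (0, a) = 0 ∧ e = 0 ∧ δ = 1) ∨
    -- After the first arrival: its thread has the token and the debt is still one, or it has ended,
    -- has returned the token and has cleared the debt.
    (s (0, a) ≠ 0 ∧ ∃ pz, ((δ = 1 ∧ pz = 0) ∨ (δ = 0 ∧ pz = pt (1, a) 1)) ∧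
      -- Side `i` has deposited its result, permissions and credits, except for the price of its
      -- last four instructions, the end of the thread included.
      ((∃ i v d' e' s', p = pz + pt (0, a) 1 + pt (0, a + side i) 1 + P i ∧
          s (0, a + side i) = v ∧ Agree (P i) s' s ∧ Q i v d' s' e' ∧
          e' = e + 4 * E.th ^ (d' + 7)) ∨
        -- The last thread has taken everything out. The halves of the result cells that stay behind
        -- exclude this state for a thread that still owns its result cell completely, and the other
        -- halves suffice for reading.
        (p = pz + pt (0, a) 1 + pt (0, a + 1) 2⁻¹ + pt (0, a + 2) 2⁻¹ ∧ e = 0)))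

theorem lt_of_pt {p q : Share} {a : ℕ × ℕ} (h : p + q ≤ 1) (hp : 1 ≤ p a) : q a = 0 := by
  have := h a
  simp only [Pi.add_apply, Pi.one_apply] at this
  have h2 : 1 + q a ≤ 1 := (add_le_add hp le_rfl).trans this
  simpa using h2

theorem th_pow_le (E : Env) {a b : ℕ} (h : a ≤ b) : E.th ^ a ≤ E.th ^ b :=
  pow_le_pow_right₀ E.one_le_th h

/-- Ownership of the token excludes the states in which the invariant holds it. In the remaining
states the debt is one, and the disappearance of this thread clears it. -/
theorem safe.endThread {a : ℕ} {P : Bool → Share} {Q : Bool → Word → ℕ → St → ℝ≥0∞ → Prop}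
    (hJ : JoinInv E a P Q ∈ W.invs) (hp : p = pt (1, a) 1) (he : E.th ^ (d + 1) ≤ e) :
    safe E t W ⟨d, .endThread⟩ s p e := by
  cases t with
  | zero => trivial
  | succ t =>
    refine safe.step (Opens.of_mem hJ) fun W' s' p₁ e₁ δ₁ hW hs ⟨s₀, hs₀, hI⟩ hle hb => ?_
    have h1 : p₁ (1, a) = 0 := lt_of_pt hle (by rw [hp, pt_self])
    refine ⟨fun _ => e₁, ?_, fun o ho => ?_⟩
    · simp only [lstep, tsum_pure_mul]; gcongr
    simp only [lstep, PMF.support_pure, Set.mem_singleton_iff] at ho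
    subst ho
    refine ⟨by simp, rfl, hb, by simp, fun _ => ?_⟩
    rcases hI with ⟨rfl, -, -⟩ | ⟨rfl, -, -⟩ | ⟨h0, pz, hpz, hI⟩
    · simp [pt_self] at h1
    · simp [pt_self] at h1
    have hpz' : δ₁ = 1 ∧ pz = 0 := by
      rcases hpz with h | ⟨-, rfl⟩
      · exact h
      · rcases hI with ⟨i, v, d', e', s₂, rfl, -⟩ | ⟨rfl, -⟩ <;> simp [pt_self] at h1
    obtain ⟨rfl, rfl⟩ := hpz'
    refine ⟨s', pt (1, a) 1 + p₁, e₁, 0, [], fun b => rfl, fun _ _ => rfl, ⟨s', .refl _ _, ?_⟩,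
      by simp [hp], rfl, by simp, by simp, by simp⟩
    refine .inr (.inr ?_)
    rcases hI with ⟨i, v, d', e', s₂, rfl, h2, h3, h4, h5⟩ | ⟨rfl, h2⟩
    · rw [← hs₀ (0, a) (by simp [pt_self])]
      refine ⟨h0, _, .inr ⟨rfl, rfl⟩, .inl ⟨i, v, d', e', s₂, by abel, ?_,
        h3.trans (hs₀.mono ?_), h4, h5⟩⟩
      · rw [← hs₀ (0, a + side i) (by simp [pt_self]), h2]
      · exact le_add_self
    · rw [← hs₀ (0, a) (by simp [pt_self])]
      exact ⟨h0, _, .inr ⟨rfl, rfl⟩, .inr ⟨by abel, h2⟩⟩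

theorem safe.alu_add {x y : ℕ} {k : ℕ → Prog Proc Word} (he : E.th ^ (d + 1) + e ≤ e')
    (hb : x + y ≤ E.bd + W.nx) (h : safe E t W ⟨d + 1, k (x + y)⟩ s p e) :
    safe E (t + 1) W ⟨d, .instr (.alu .add x y) k⟩ s p e' := safe.alu he hb h

/-- The arrival of a thread at a join. -/
theorem safe.arrive {a : ℕ} {P : Bool → Share} {Q : Bool → Word → ℕ → St → ℝ≥0∞ → Prop}
    (hJ : JoinInv E a P Q ∈ W.invs) (ha : a + 3 ≤ W.nx)
    (hQ : ∀ j v d s e, Q j v d s e → v ≤ E.bd ∧ 11 * E.th ^ (d + 7) ≤ e)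
    (k : Word × Word → Prog Proc Word)
    (hk : ∀ t' ≤ t, ∀ W', W ≤ W' → ∀ (v : Bool → Word) (d : Bool → ℕ) (e' : Bool → ℝ≥0∞)
      (s₁ : Bool → St) s' i ef, (∀ j, Q j (v j) (d j) (s₁ j) (e' j)) →
      (∀ j, Agree (P j) (s₁ j) s') →
      e' false + e' true ≤ ef + 11 * E.th ^ (max (d false) (d true) + 7) →
      safe E t' W' ⟨d i + 7, k (v false, v true)⟩ s' (P false + P true) ef)
    (i : Bool) {v : Word} (hq : Q i v d s e) :
    safe E t W ⟨d, joinCode a (side i) k v⟩ s (P i + pt (0, a + side i) 1) e := by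
  obtain ⟨hv, hle⟩ := hQ _ _ _ _ _ hq
  -- A side executes at most seven instructions at the join. The eleven prices demanded by `hQ` are
  -- four for the first thread to arrive and seven for the last one.
  set c := E.th ^ (d + 7) with hc
  obtain ⟨er, rfl⟩ : ∃ er, e = 11 * c + er := ⟨e - 11 * c, (add_tsub_cancel_of_le hle).symm⟩
  have hside : side i ≤ 2 := by unfold side; split_ifs <;> simp
  have hprice : ∀ n ≤ 7, E.th ^ (d + n) ≤ c := fun n hn => th_pow_le E (by omega)
  have hpay : ∀ n m : ℕ, n ≤ 7 → m < 11 →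
      E.th ^ (d + n) + ((m : ℝ≥0∞) * c + er) ≤ ((m + 1 : ℕ) : ℝ≥0∞) * c + er := by
    intro n m hn hm
    calc _ ≤ c + (m * c + er) := add_le_add (hprice n hn) le_rfl
      _ = _ := by push_cast; ring
  unfold joinCode
  rcases t with _ | t
  · trivial
  refine safe.alu_add (hpay 1 10 (by omega) (by omega)) (by omega) ?_
  rcases t with _ | t
  · trivial
  refine safe.write (hpay 2 9 (by omega) (by omega)) (by simp [pt_self])
    (le_trans (b := E.bd) hv (by simp)) ?_
  rcases t with _ | t
  · trivial
  set s₂ := Function.update s (0, a + side i) v with hs₂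
  refine safe.step (Opens.of_mem hJ) fun W' s' p₁ e₁ δ₁ hW hs ⟨s₀, hs₀, hI⟩ hle hb => ?_
  have hbd : a + 3 ≤ W'.nx := ha.trans hW.2
  have hown : p₁ (0, a + side i) = 0 := lt_of_pt hle (by simp [pt_self])
  have hne : ∀ {b : ℕ} {i : Bool}, (0, b + side i) ≠ ((0, b) : ℕ × ℕ) := fun {b i} => by
    simp only [ne_eq, Prod.mk.injEq, true_and]; unfold side; split_ifs <;> omega
  have hPz : P i (0, a + side i) = 0 := by
    have := lt_of_pt (p := pt (0, a + side i) 1) (q := P i + p₁) (a := (0, a + side i))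
      (by rwa [← add_assoc, add_comm (pt _ _)]) (by simp [pt_self])
    simp only [Pi.add_apply, add_eq_zero] at this
    exact this.1
  have hPi : Agree (P i) s s' := Agree.trans (s' := s₂) (fun b hb => by
    rw [hs₂, Function.update_of_ne]; rintro rfl; exact hb hPz) (hs.mono le_self_add)
  have hsv : s' (0, a + side i) = v := by
    rw [← hs _ (by simp [pt_self]), hs₂]; simp
  rcases hI with ⟨rfl, -, -⟩ | ⟨rfl, h0, rfl, rfl⟩ | ⟨h0, pz, hpz, hI⟩
  · exfalso; revert hown
    unfold side; split_ifs <;> simp [pt_self]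
  · -- the first thread
    have h0' : s' (0, a) = 0 := by rw [← hs₀ (0, a) (by simp [pt_self]), h0]
    refine ⟨fun _ => (8 : ℕ) * c + er, ?_, fun o ho => ?_⟩
    · simp only [lstep, if_pos h0', tsum_pure_mul, add_zero]
      exact hpay 3 8 (by omega) (by omega)
    simp only [lstep, if_pos h0', PMF.support_pure, Set.mem_singleton_iff] at ho
    subst ho
    refine ⟨by simp, rfl, fun b => ?_, by simp, fun _ => ?_⟩
    · by_cases hb' : b = a
      · subst hb'; simp; omega
      · simpa [Function.update_of_ne, hb'] using hb b
    refine ⟨Function.update s' (0, a) 1, pt (0, a) 1 + pt (0, a + side i) 1 + P i, 7 * c + er, 1,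
      [(⟨d + 3, .endThread⟩, pt (1, a) 1, c)], fun b => congrFun (real_update s' a 1) b,
      fun b hb' => ?_, ⟨_, .refl _ _, ?_⟩, ?_, rfl, ?_, ?_, rfl⟩
    · rw [Function.update_of_ne]
      rintro rfl
      simp only [Pi.add_apply, pt_self] at hb'
      exact not_le.2 hb' (le_add_left (le_add_right le_rfl))
    · refine .inr (.inr ⟨by simp, 0, .inl ⟨rfl, rfl⟩, .inl ⟨i, v, d, _, s, by simp, ?_, ?_, hq, ?_⟩⟩)
      · rw [Function.update_of_ne hne, hsv]
      · refine hPi.trans fun b hb' => ?_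
        rw [Function.update_of_ne]
        rintro rfl
        have := lt_of_pt (p := pt (0, a) 1) (q := P i) (a := (0, a))
          (le_trans (fun b => by
            simp only [Pi.add_apply]
            calc _ = P i b + pt (0, a) 1 b := add_comm _ _
              _ ≤ _ := add_le_add le_self_add le_self_add) hle) (by simp [pt_self])
        exact hb' this
      · ring
    · simp only [List.map_cons, List.map_nil, List.sum_cons, List.sum_nil]
      apply le_of_eq; abel
    · simp only [List.mem_singleton, forall_eq]
      exact safe.endThread (hW.1 hJ) rfl (hprice 4 (by omega))
    · simp only [List.map_cons, List.map_nil, List.sum_cons, List.sum_nil]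
      apply le_of_eq; push_cast; ring
  · -- the second thread
    have hI' : ∃ d' e' s₁, p₁ = pz + pt (0, a) 1 + pt (0, a + side (!i)) 1 + P (!i) ∧
        Agree (P (!i)) s₁ s₀ ∧ Q (!i) (s₀ (0, a + side (!i))) d' s₁ e' ∧
        e' = e₁ + 4 * E.th ^ (d' + 7) := by
      rcases hI with ⟨j, v', d', e', s₁, rfl, rfl, h1, h2, h3⟩ | ⟨rfl, -⟩
      · obtain rfl : j = !i := by
          rcases Bool.eq_or_eq_not j i with rfl | h
          · simp [pt_self] at hown
          · exact h
        exact ⟨d', e', s₁, rfl, h1, h2, h3⟩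
      · exfalso; revert hown
        unfold side; split_ifs <;> simp [pt_self]
    obtain ⟨d', e', s₁, rfl, h1, h2, h3⟩ := hI'
    have h0' : s' (0, a) ≠ 0 := by rwa [← hs₀ (0, a) (by simp [pt_self])]
    refine ⟨fun _ => (8 : ℕ) * c + er + e₁, ?_, fun o ho => ?_⟩
    · simp only [lstep, if_neg h0', tsum_pure_mul]
      rw [← add_assoc]
      exact add_le_add (hpay 3 8 (by omega) (by omega)) le_rfl
    simp only [lstep, if_neg h0', PMF.support_pure, Set.mem_singleton_iff] at ho
    subst ho
    set pc : Share := P i + P (!i) + pt (0, a + 1) 2⁻¹ + pt (0, a + 2) 2⁻¹ with hpc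
    refine ⟨(by omega : 1 ≤ E.bd + W'.nx), rfl, hb, by simp, fun _ => ⟨s',
      pz + pt (0, a) 1 + pt (0, a + 1) 2⁻¹ + pt (0, a + 2) 2⁻¹, 0, δ₁, [(⟨d + 3, _⟩, pc,
        (8 : ℕ) * c + er + e₁)], fun b => rfl, fun b hb' => rfl, ⟨s', .refl _ _, ?_⟩, ?_, rfl, ?_,
      by simp, by simp⟩⟩
    · exact .inr (.inr ⟨h0', pz, hpz, .inr ⟨rfl, rfl⟩⟩)
    · have h12 : pt (0, a + side i) 1 + pt (0, a + side (!i)) 1 =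
          pt (0, a + 1) 1 + pt (0, a + 2) 1 := by
        cases i
        · rfl
        · exact add_comm _ _
      have hh : ∀ b, pt b 1 = pt b 2⁻¹ + pt b 2⁻¹ := fun b => by
        unfold pt
        rw [← Pi.single_add]
        congr 1
        rw [← two_mul, mul_inv_cancel₀ two_ne_zero]
      simp only [List.map_cons, List.map_nil, List.sum_cons, List.sum_nil, add_zero]
      apply le_of_eq
      calc _ = P i + P (!i) + pz + pt (0, a) 1 + ((pt (0, a + 1) 2⁻¹ + pt (0, a + 1) 2⁻¹) +
            (pt (0, a + 2) 2⁻¹ + pt (0, a + 2) 2⁻¹)) := by rw [hpc]; abel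
        _ = P i + P (!i) + pz + pt (0, a) 1 +
            (pt (0, a + side i) 1 + pt (0, a + side (!i)) 1) := by rw [← hh, ← hh, h12]
        _ = _ := by abel
    simp only [List.mem_singleton, forall_eq, one_ne_zero, if_false]
    have hpay' : ∀ n m : ℕ, n ≤ 7 → m < 11 → E.th ^ (d + n) + ((m : ℝ≥0∞) * c + er + e₁) ≤
        ((m + 1 : ℕ) : ℝ≥0∞) * c + er + e₁ := fun n m hn hm => by
      rw [← add_assoc]; exact add_le_add (hpay n m hn hm) le_rfl
    rcases t with _ | t
    · trivial
    refine safe.alu_add (hpay' 4 7 (by omega) (by omega)) (by omega) ?_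
    rcases t with _ | t
    · trivial
    refine safe.read (hpay' 5 6 (by omega) (by omega)) (by simp [hpc, pt_self]) ?_
    rcases t with _ | t
    · trivial
    refine safe.alu_add (hpay' 6 5 (by omega) (by omega)) (by omega) ?_
    rcases t with _ | t
    · trivial
    refine safe.read (hpay' 7 4 (by omega) (by omega)) (by simp [hpc, pt_self]) ?_
    have hsn : s₀ (0, a + side (!i)) = s' (0, a + side (!i)) := hs₀ _ (by simp [pt_self])
    have hPn : Agree (P (!i)) s₁ s' := h1.trans (hs₀.mono le_add_self)
    rw [hsn] at h2
    -- The remaining credits of both sides are pooled. The scheduler decides who arrives last, so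
    -- the prices of both sides are estimated by the maximum of the two depths.
    have hfin : (11 * c + er) + e' ≤ (((4 : ℕ) : ℝ≥0∞) * c + er + e₁) +
        11 * E.th ^ (max d d' + 7) := by
      rw [h3]
      calc _ = 4 * c + er + e₁ + (7 * c + 4 * E.th ^ (d' + 7)) := by ring
        _ ≤ 4 * c + er + e₁ + (7 * E.th ^ (max d d' + 7) + 4 * E.th ^ (max d d' + 7)) :=
          add_le_add le_rfl (add_le_add (mul_le_mul' le_rfl (th_pow_le E (by omega)))
            (mul_le_mul' le_rfl (th_pow_le E (by omega))))
        _ = _ := by push_cast; ring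
    have hk' := hk t (by omega) W' hW
      (fun j => s' (0, a + side j)) (fun j => if j = i then d else d')
      (fun j => if j = i then 11 * c + er else e') (fun j => if j = i then s else s₁) s' i
      (((4 : ℕ) : ℝ≥0∞) * c + er + e₁) (fun j => ?_) (fun j => ?_) ?_
    · simp only [if_true] at hk'
      refine hk'.weaken ?_ le_rfl
      have : P false + P true = P i + P (!i) := by
        cases i
        · rfl
        · exact add_comm _ _
      rw [this, hpc, add_assoc _ (pt _ _)]
      exact le_self_add
    · rcases Bool.eq_or_eq_not j i with rfl | rfl
      · simpa [hsv] using hq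
      · simpa using h2
    · rcases Bool.eq_or_eq_not j i with rfl | rfl
      · simpa using hPi
      · simpa using hPn
    · cases i
      · simpa using hfin
      · simpa [add_comm, max_comm] using hfin

end BF

namespace BF
variable {E : Env} {t : ℕ} {W : World} {d : ℕ} {s : St} {p : Share} {e e' : ℝ≥0∞}

theorem blk_three (a : ℕ) : pt (0, a) 1 + (pt (1, a) 1 + pt (0, a + 1) 1 + pt (0, a + 2) 1) ≤
    blk a 3 := by
  rintro ⟨i, b⟩
  simp only [Pi.add_apply, blk, pt, Pi.single_apply, Prod.mk.injEq]
  by_cases h : a ≤ b ∧ b < a + 3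
  · rw [if_pos h]
    rcases (by omega : b = a ∨ b = a + 1 ∨ b = a + 2) with rfl | rfl | rfl <;>
      by_cases h0 : i = 0 <;> by_cases h1 : i = 1 <;> simp_all
  · rw [if_neg h, if_neg (by omega), if_neg (by omega), if_neg (by omega), if_neg (by omega)]
    simp

/-- Two threads run in parallel and join. -/
theorem safe.par {q : Bool → Prog Proc Word} {P : Bool → Share} {eP : Bool → ℝ≥0∞}
    {Q : Bool → Word → ℕ → St → ℝ≥0∞ → Prop} {k : Word × Word → Prog Proc Word}
    (hq : ∀ j, Tri E t W (d + 3) (q j) s (P j) (eP j) (Q j))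
    (hQ : ∀ j v d s e, Q j v d s e → v ≤ E.bd ∧ 11 * E.th ^ (d + 7) ≤ e)
    (hp : P false + P true = p) (he : 3 * E.th ^ (d + 3) + (eP false + eP true) ≤ e)
    (hbd : 3 ≤ E.bd)
    (hk : ∀ t' ≤ t, ∀ W', W ≤ W' → ∀ (v : Bool → Word) (d : Bool → ℕ) (e' : Bool → ℝ≥0∞)
      (s₁ : Bool → St) s' i ef, (∀ j, Q j (v j) (d j) (s₁ j) (e' j)) →
      (∀ j, Agree (P j) (s₁ j) s') →
      e' false + e' true ≤ ef + 11 * E.th ^ (max (d false) (d true) + 7) →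
      safe E t' W' ⟨d i + 7, k (v false, v true)⟩ s' (P false + P true) ef) :
    safe E t W ⟨d, (par (q false) (q true)).bind k⟩ s p e := by
  refine safe.weaken (p := p) ?_ le_rfl he
  rw [par_bind]
  subst hp
  set c := E.th ^ (d + 3) with hc
  have hpay : ∀ n m : ℕ, n ≤ 3 →
      E.th ^ (d + n) + ((m : ℝ≥0∞) * c + (eP false + eP true)) ≤
        ((m + 1 : ℕ) : ℝ≥0∞) * c + (eP false + eP true) := by
    intro n m hn
    calc _ ≤ c + (m * c + (eP false + eP true)) := add_le_add (th_pow_le E (by omega)) le_rfl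
      _ = _ := by push_cast; ring
  rcases t with _ | t
  · trivial
  refine safe.alloc (hpay 1 2 (by omega)) hbd fun W₁ a s₁ hW₁ ha1 ha2 hs₁ hfree => ?_
  rcases t with _ | t
  · trivial
  refine safe.write (hpay 2 1 (by omega)) (by simp [blk]) (by simp) ?_
  set s₂ := Function.update s₁ (0, a) 0 with hs₂
  have hs2 : Agree (P false + P true) s s₂ := hs₁.trans fun b hb => by
    rw [hs₂, Function.update_of_ne]; rintro rfl; exact hb (hfree 0 a le_rfl)
  refine safe.weaken (p := P false + P true + pt (0, a) 1 +
    (pt (1, a) 1 + pt (0, a + 1) 1 + pt (0, a + 2) 1))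
    (e := ((1 : ℕ) : ℝ≥0∞) * c + (eP false + eP true) + 0) ?_ ?_ (by simp)
  · refine safe.new_inv (JoinInv E a P Q) (.inl ⟨rfl, rfl, rfl⟩) ?_
    set W₂ : World := ⟨JoinInv E a P Q :: W₁.invs, W₁.nx⟩ with hW₂
    have hW12 : W₁ ≤ W₂ := ⟨List.subset_cons_of_subset _ (List.Subset.refl _), le_rfl⟩
    have hmem : JoinInv E a P Q ∈ W₂.invs := by simp [hW₂]
    rcases t with _ | t
    · trivial
    refine safe.step (Opens.of_mem hmem) fun W' s' p₁ e₁ δ₁ hW hs ⟨s₀, hs₀, hI⟩ hle hb => ?_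
    have hown : p₁ (0, a) = 0 := lt_of_pt hle (by simp [pt_self])
    -- The parent still owns the synchronization cell completely, so the join can only be in its
    -- state before the fork.
    rcases hI with ⟨rfl, rfl, rfl⟩ | ⟨rfl, -⟩ | ⟨-, pz, -, hI⟩
    · refine ⟨fun _ => eP false + eP true, ?_, fun o ho => ?_⟩
      · simp only [lstep, tsum_pure_mul]
        simpa using hpay 3 0 (by omega)
      simp only [lstep, PMF.support_pure, Set.mem_singleton_iff] at ho
      subst ho
      have hs' : Agree (P false + P true) s s' := hs2.trans (hs.mono le_self_add)
      have hchild : ∀ j, safe E t W' ⟨d + 1 + 1 + 1, (q j).bind (joinCode a (side j) k)⟩ s'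
          (P j + pt (0, a + side j) 1) (eP j) := by
        intro j
        rw [← add_zero (eP j)]
        refine hq j t (by omega) W' (hW₁.trans (hW12.trans hW)) _ s' _ 0
          (hs'.mono ?_) fun t'' ht'' W'' hW'' v d' s'' e' hQ' _ => ?_
        · cases j
          · exact le_self_add
          · exact le_add_self
        rw [add_zero]
        exact safe.arrive (hW''.1 (hW.1 hmem)) (ha2.trans (hW.2.trans hW''.2)) hQ k
          (fun t₃ ht₃ W₃ hW₃ => hk t₃ (by omega) W₃
            (hW₁.trans (hW12.trans (hW.trans (hW''.trans hW₃))))) j hQ'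
      refine ⟨by simp, rfl, hb, by simp, fun _ => ⟨s', pt (0, a) 1 + pt (1, a) 1, 0, 1,
        [(⟨d + 1 + 1 + 1, (q false).bind (joinCode a 1 k)⟩, P false + pt (0, a + 1) 1, eP false),
         (⟨d + 1 + 1 + 1, (q true).bind (joinCode a 2 k)⟩, P true + pt (0, a + 2) 1, eP true)],
        fun b => rfl, fun b hb' => rfl, ⟨s', .refl _ _, .inr (.inl ⟨rfl, ?_, rfl, rfl⟩)⟩, ?_, ?_, ?_,
        by simp, by simp⟩⟩
      · rw [← hs _ (by simp [pt_self]), hs₂]; simp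
      · simp only [List.map_cons, List.map_nil, List.sum_cons, List.sum_nil]
        apply le_of_eq; abel
      · simp
      · simp only [List.mem_cons, List.not_mem_nil, or_false, forall_eq_or_imp, forall_eq]
        exact ⟨hchild false, hchild true⟩
    · simp [pt_self] at hown
    · exfalso
      rcases hI with ⟨i, v, d', e', s₁, rfl, -⟩ | ⟨rfl, -⟩ <;> simp [pt_self] at hown
  · rw [add_assoc]
    exact add_le_add le_rfl (blk_three a)

/-! ## Parallel loops -/

theorem code_parFor_bind (κ : Params) (T : Task) (lo hi : ℕ) (k : Word → Prog Proc Word) :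
    (Proc.code κ (.parFor T lo hi)).bind k =
      .instr (.alu .sub hi lo) fun d => .instr (.alu .eq d 0) fun e => if e = 1 then k 0 else
      .instr (.alu .eq d 1) fun e => if e = 1 then (T.code lo).bind k else
      .instr (.alu .add lo hi) fun t => .instr (.alu .div t 2) fun mid =>
        (par (.call (.parFor T lo mid) .ret) (.call (.parFor T mid hi) .ret)).bind fun vw =>
          .instr (.alu .add vw.1 vw.2) k := by
  simp only [Proc.code, Prog.bind_def, Prog.pure_def, BF.call, BF.alu, Prog.bind, Prog.bind_assoc,
    Prog.bind_ite]

theorem ite_one_zero {c : Prop} [Decidable c] :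
    (@Eq ℕ (if c then 1 else 0) 1) ↔ c := by split_ifs <;> simp_all

theorem ite_le_bd {c : Prop} [Decidable c] {b n : ℕ} (hb : 1 ≤ b) :
    (if c then 1 else 0) ≤ b + n := by split_ifs <;> omega

theorem safe.alu_eq {x y : ℕ} {k : ℕ → Prog Proc Word} (he : E.th ^ (d + 1) + e ≤ e')
    (hb : 1 ≤ E.bd) (h : safe E t W ⟨d + 1, k (if x = y then 1 else 0)⟩ s p e) :
    safe E (t + 1) W ⟨d, .instr (.alu .eq x y) k⟩ s p e' := safe.alu he (ite_le_bd hb) h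

theorem safe.alu_sub {x y : ℕ} {k : ℕ → Prog Proc Word} (he : E.th ^ (d + 1) + e ≤ e')
    (hb : x ≤ E.bd + W.nx) (h : safe E t W ⟨d + 1, k (x - y)⟩ s p e) :
    safe E (t + 1) W ⟨d, .instr (.alu .sub x y) k⟩ s p e' :=
  safe.alu he ((Nat.sub_le x y).trans hb) h

theorem safe.alu_div {x y : ℕ} {k : ℕ → Prog Proc Word} (he : E.th ^ (d + 1) + e ≤ e')
    (hb : x ≤ E.bd + W.nx) (h : safe E t W ⟨d + 1, k (x / y)⟩ s p e) :
    safe E (t + 1) W ⟨d, .instr (.alu .div x y) k⟩ s p e' :=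
  safe.alu he ((Nat.div_le_self x y).trans hb) h

/-- The postcondition of a parallel loop. -/
def ForPost (F : ℕ → Word → St → Prop) (R : ℕ → ℝ≥0∞ → Prop) (lo hi : ℕ) :
    Word → ℕ → St → ℝ≥0∞ → Prop := fun v d s e => ∃ vs : ℕ → ℕ, v = ∑ i ∈ Finset.Ico lo hi, vs i ∧
      (∀ i, lo ≤ i → i < hi → F i (vs i) s) ∧ R d e

theorem tri_parFor_one {T : Task} {ρ : ℕ → Share} {ε : ℕ → ℝ≥0∞} {L : ℕ}
    {F : ℕ → Word → St → Prop} {R R' : ℕ → ℝ≥0∞ → Prop} (hR : ∀ d e, R d e → R' d e)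
    {lo : ℕ} (hb : 1 ≤ E.bd) (hlo : lo < E.bd) (hd : d + 4 ≤ L)
    (htask : ∀ d' ≤ L, Tri E t W d' (T.code lo) s (ρ lo) (ε lo)
      (fun v d'' s' e' => F lo v s' ∧ R d'' e')) :
    Tri E t W d (.call (.parFor T lo (lo + 1)) .ret) s (∑ i ∈ Finset.Ico lo (lo + 1), ρ i)
      (∑ i ∈ Finset.Ico lo (lo + 1), ε i + ((13 * (lo + 1 - lo) - 9 : ℕ) : ℝ≥0∞) * E.th ^ L)
      (ForPost F R' lo (lo + 1)) := by
  intro t' ht' W' hW k s₀ px ex hs hk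
  simp only [ForPost, Nat.Ico_succ_singleton, Finset.sum_singleton, Nat.add_sub_cancel_left]
    at hs hk ⊢
  have hpay : ∀ n m : ℕ, n ≤ 4 → E.th ^ (d + n) + (ε lo + (m : ℝ≥0∞) * E.th ^ L + ex) ≤
      ε lo + ((m + 1 : ℕ) : ℝ≥0∞) * E.th ^ L + ex := fun n m hn => by
    calc _ ≤ E.th ^ L + (ε lo + (m : ℝ≥0∞) * E.th ^ L + ex) :=
          add_le_add (th_pow_le E (by omega)) le_rfl
      _ = _ := by push_cast; ring
  change safe E t' W' ⟨d, .call (.parFor T lo (lo + 1)) k⟩ s₀ _ _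
  rcases t' with _ | t'
  · trivial
  refine safe.call (hpay 1 3 (by omega)) ?_
  rw [code_parFor_bind]
  rcases t' with _ | t'
  · trivial
  refine safe.alu_sub (hpay 2 2 (by omega)) (by omega) ?_
  rcases t' with _ | t'
  · trivial
  refine safe.alu_eq (hpay 3 1 (by omega)) hb ?_
  rw [if_neg (by rw [ite_one_zero]; omega)]
  rcases t' with _ | t'
  · trivial
  refine safe.alu_eq (hpay 4 0 (by omega)) hb ?_
  rw [if_pos (by rw [ite_one_zero]; omega)]
  simp only [Nat.cast_zero, zero_mul, add_zero]
  refine htask (d + 4) (by omega) t' (by omega) W' hW k s₀ px ex hs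
    fun t'' ht'' W'' hW'' v d' s' e' hq hag => ?_
  exact hk t'' (by omega) W'' hW'' v d' s' e' ⟨fun _ => v, rfl, fun i h1 h2 => by
    obtain rfl : i = lo := by omega
    exact hq.1, hR _ _ hq.2⟩ hag

/-- For `m` tasks the tree of calls has `m` leaves with four instructions each and `m - 1` inner
nodes with nine instructions up to the fork, together `13 * m - 9`. These happen before the tasks,
in depth at most `L`. The eleven instructions of a join and the addition after it come later, in a
depth that depends on the tasks. They are paid out of the credits that the tasks leave, described by
`R j` after `j` levels of joins. -/
theorem tri_parFor {T : Task} {ρ : ℕ → Share} {ε : ℕ → ℝ≥0∞} {L : ℕ} {F : ℕ → Word → St → Prop}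
    {R : ℕ → ℕ → ℝ≥0∞ → Prop} (hbd : 3 ≤ E.bd)
    {lo hi j : ℕ} (hR1 : ∀ j' < j, ∀ d e, R j' d e → 12 * E.th ^ (d + 8) ≤ e)
    (hRs : ∀ j d e, R j d e → R (j + 1) d e)
    (hRj : ∀ j' < j, ∀ d₁ d₂ e₁ e₂ d e, R j' d₁ e₁ → R j' d₂ e₂ → d ≤ max d₁ d₂ →
      e₁ + e₂ ≤ e + 12 * E.th ^ (max d₁ d₂ + 8) → R (j' + 1) (d + 8) e)
    (hlt : lo < hi) (hj : hi - lo ≤ 2 ^ j) (hhi : 2 * hi ≤ E.bd)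
    (hF : ∀ i, lo ≤ i → i < hi → ∀ v s s', Agree (ρ i) s s' → F i v s → F i v s')
    (hF1 : ∀ i, lo ≤ i → i < hi → ∀ v s, F i v s → v ≤ 1)
    (htask : ∀ i, lo ≤ i → i < hi → ∀ d', d' ≤ L → Tri E t W d' (T.code i) s (ρ i) (ε i)
      (fun v d'' s' e' => F i v s' ∧ R 0 d'' e'))
    (hd : d + 9 * j + 4 ≤ L) :
    Tri E t W d (.call (.parFor T lo hi) .ret) s (∑ i ∈ Finset.Ico lo hi, ρ i)
      (∑ i ∈ Finset.Ico lo hi, ε i + ((13 * (hi - lo) - 9 : ℕ) : ℝ≥0∞) * E.th ^ L)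
      (ForPost F (R j) lo hi) := by
  have hR0 : ∀ j d e, R 0 d e → R j d e := fun j d e h => by
    induction j with
    | zero => exact h
    | succ j ih => exact hRs _ _ _ ih
  induction j generalizing lo hi d t W s with
  | zero =>
    obtain rfl : hi = lo + 1 := by omega
    exact tri_parFor_one (hR0 0) (by omega) (by omega) (by omega) (htask lo le_rfl (by omega))
  | succ j ih =>
    rcases (by omega : hi = lo + 1 ∨ lo + 2 ≤ hi) with rfl | h2
    · exact tri_parFor_one (hR0 (j + 1)) (by omega) (by omega) (by omega)
        (htask lo le_rfl (by omega))
    intro t' ht' W' hW k s₀ px ex hs hk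
    rw [pow_succ] at hj
    set mid := (lo + hi) / 2 with hmid
    have hm1 : lo < mid := by omega
    have hm2 : mid < hi := by omega
    have hsplit : ∀ {M : Type} [AddCommMonoid M] (g : ℕ → M),
        ∑ i ∈ Finset.Ico lo hi, g i =
          ∑ i ∈ Finset.Ico lo mid, g i + ∑ i ∈ Finset.Ico mid hi, g i := fun g =>
      (Finset.sum_Ico_consecutive g hm1.le hm2.le).symm
    set c := E.th ^ L with hc
    set e₁ := ∑ i ∈ Finset.Ico lo mid, ε i + ((13 * (mid - lo) - 9 : ℕ) : ℝ≥0∞) * c with he₁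
    set e₂ := ∑ i ∈ Finset.Ico mid hi, ε i + ((13 * (hi - mid) - 9 : ℕ) : ℝ≥0∞) * c with he₂
    have he : ∑ i ∈ Finset.Ico lo hi, ε i + ((13 * (hi - lo) - 9 : ℕ) : ℝ≥0∞) * c + ex =
        ((9 : ℕ) : ℝ≥0∞) * c + (e₁ + ex + e₂) := by
      rw [hsplit, show 13 * (hi - lo) - 9 = 9 + (13 * (mid - lo) - 9) + (13 * (hi - mid) - 9) by
        omega, he₁, he₂]
      generalize 13 * (mid - lo) - 9 = n₁
      generalize 13 * (hi - mid) - 9 = n₂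
      push_cast
      ring
    have hpay : ∀ n m : ℕ, n ≤ 6 → E.th ^ (d + n) + ((m : ℝ≥0∞) * c + (e₁ + ex + e₂)) ≤
        ((m + 1 : ℕ) : ℝ≥0∞) * c + (e₁ + ex + e₂) := fun n m hn => by
      calc _ ≤ c + ((m : ℝ≥0∞) * c + (e₁ + ex + e₂)) :=
            add_le_add (th_pow_le E (by omega)) le_rfl
        _ = _ := by push_cast; ring
    rw [he]
    change safe E t' W' ⟨d, .call (.parFor T lo hi) k⟩ s₀ _ _
    rcases t' with _ | t'
    · trivial
    refine safe.call (hpay 1 8 (by omega)) ?_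
    rw [code_parFor_bind]
    rcases t' with _ | t'
    · trivial
    refine safe.alu_sub (hpay 2 7 (by omega)) (by omega) ?_
    rcases t' with _ | t'
    · trivial
    refine safe.alu_eq (hpay 3 6 (by omega)) (by omega) ?_
    rw [if_neg (by rw [ite_one_zero]; omega)]
    rcases t' with _ | t'
    · trivial
    refine safe.alu_eq (hpay 4 5 (by omega)) (by omega) ?_
    rw [if_neg (by rw [ite_one_zero]; omega)]
    rcases t' with _ | t'
    · trivial
    refine safe.alu_add (hpay 5 4 (by omega)) (by omega) ?_
    rcases t' with _ | t'
    · trivial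
    refine safe.alu_div (hpay 6 3 (by omega)) (by omega) ?_
    change safe E t' W' ⟨d + 6, (par (.call (.parFor T lo mid) .ret)
      (.call (.parFor T mid hi) .ret)).bind _⟩ s₀ _ _
    have hag1 : Agree (∑ i ∈ Finset.Ico lo mid, ρ i) s s₀ := hs.mono (by
      rw [hsplit]; exact le_self_add)
    have hag2 : Agree (∑ i ∈ Finset.Ico mid hi, ρ i) s s₀ := hs.mono (by
      rw [hsplit]; exact le_add_self)
    have t1 := ((ih (lo := lo) (hi := mid) (d := d + 6 + 3) (t := t) (W := W) (s := s)
      (fun j' h => hR1 j' (by omega)) (fun j' h => hRj j' (by omega)) hm1 (by omega)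
      (by omega) (fun i h h' => hF i h (by omega)) (fun i h h' => hF1 i h (by omega))
      (fun i h h' => htask i h (by omega)) (by omega)).mono (t' := t') (by omega) hW hag1).frame px ex
    have t2 := (ih (lo := mid) (hi := hi) (d := d + 6 + 3) (t := t) (W := W) (s := s)
      (fun j' h => hR1 j' (by omega)) (fun j' h => hRj j' (by omega)) hm2 (by omega)
      (by omega) (fun i h h' => hF i (by omega) h') (fun i h h' => hF1 i (by omega) h')
      (fun i h h' => htask i (by omega) h') (by omega)).mono (t' := t') (by omega) hW hag2
    have hv : ∀ lo' hi' v d s e, lo ≤ lo' → hi' ≤ hi → ForPost F (R j) lo' hi' v d s e →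
        v ≤ hi' - lo' := by
      rintro lo' hi' v d s e h1 h2 ⟨vs, rfl, hvs, -⟩
      calc ∑ i ∈ Finset.Ico lo' hi', vs i ≤ ∑ i ∈ Finset.Ico lo' hi', 1 :=
            Finset.sum_le_sum fun i hi => by
              rw [Finset.mem_Ico] at hi
              exact hF1 i (by omega) (by omega) _ _ (hvs i hi.1 hi.2)
        _ = hi' - lo' := by simp
    have h12 : ∀ {d e}, 12 * E.th ^ (d + 8) ≤ e → 11 * E.th ^ (d + 7) ≤ e := fun {d e} h =>
      le_trans (mul_le_mul' (by norm_num) (th_pow_le E (by omega))) h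
    refine safe.par
      (q := fun i => if i then .call (.parFor T mid hi) .ret else .call (.parFor T lo mid) .ret)
      -- The frame travels with the left side and comes back through the join, since the
      -- continuation may be executed by either thread.
      (P := fun i => if i then ∑ i ∈ Finset.Ico mid hi, ρ i else ∑ i ∈ Finset.Ico lo mid, ρ i + px)
      (eP := fun i => if i then e₂ else e₁ + ex)
      (Q := fun i => if i then ForPost F (R j) mid hi else fun v d' s' e' =>
        ∃ e₀, e' = e₀ + ex ∧ ForPost F (R j) lo mid v d' s' e₀ ∧ Agree px s₀ s')
      (fun i => ?_) (fun i => ?_) ?_ ?_ hbd ?_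
    · cases i
      · exact t1
      · exact t2
    · cases i
      · rintro v d s _ ⟨e, rfl, h, -⟩
        exact ⟨(hv _ _ _ _ _ _ le_rfl hm2.le h).trans (by omega : mid - lo ≤ E.bd), (h12 (hR1 j (by omega) _ _ h.choose_spec.2.2)).trans le_self_add⟩
      · rintro v d s e h
        exact ⟨(hv _ _ _ _ _ _ hm1.le le_rfl h).trans (by omega : hi - mid ≤ E.bd), h12 (hR1 j (by omega) _ _ h.choose_spec.2.2)⟩
    · simp only [if_true, Bool.false_eq_true, if_false]
      rw [hsplit]; abel
    · simp only [if_true, Bool.false_eq_true, if_false]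
      push_cast
      exact add_le_add (mul_le_mul' le_rfl (th_pow_le E (by omega))) le_rfl
    intro t₃ ht₃ W₃ hW₃ v dd e' s₁ s' i ef hQ hag hle
    obtain ⟨el, hel, ⟨vs₁, hvs₁, hF₁, hr₁⟩, hpx⟩ : ∃ e₀, e' false = e₀ + ex ∧
      ForPost F (R j) lo mid (v false) (dd false) (s₁ false) e₀ ∧ Agree px s₀ (s₁ false) := by
      simpa using hQ false
    obtain ⟨vs₂, hvs₂, hF₂, hr₂⟩ : ForPost F (R j) mid hi (v true) (dd true) (s₁ true) (e' true) := by
      simpa using hQ true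
    have hagf : Agree (∑ i ∈ Finset.Ico lo mid, ρ i + px) (s₁ false) s' := by simpa using hag false
    have hagt : Agree (∑ i ∈ Finset.Ico mid hi, ρ i) (s₁ true) s' := by simpa using hag true
    simp only [if_true, Bool.false_eq_true, if_false]
    set D := max (dd false) (dd true) with hD
    have hdi : dd i ≤ D := by cases i <;> simp [hD]
    have hX : (11 * E.th ^ (D + 7) : ℝ≥0∞) ≠ ⊤ :=
      ENNReal.mul_ne_top (by norm_num) (ENNReal.pow_ne_top E.th_ne_top)
    have hle2 : (el + e' true) + ex ≤ ef + 11 * E.th ^ (D + 7) := by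
      rw [hel] at hle; convert hle using 1; ring
    have hmax : 12 * E.th ^ (D + 8) ≤ el + e' true := by
      rcases max_choice (dd false) (dd true) with h | h <;> rw [hD, h]
      · exact (hR1 j (by omega) _ _ hr₁).trans le_self_add
      · exact (hR1 j (by omega) _ _ hr₂).trans le_add_self
    have hY : ex + E.th ^ (D + 8) ≤ ef := by
      have : 11 * E.th ^ (D + 7) + (ex + E.th ^ (D + 8)) ≤ 11 * E.th ^ (D + 7) + ef := by
        calc _ ≤ 11 * E.th ^ (D + 8) + (ex + E.th ^ (D + 8)) :=
              add_le_add (mul_le_mul' le_rfl (th_pow_le E (by omega))) le_rfl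
          _ = 12 * E.th ^ (D + 8) + ex := by ring
          _ ≤ (el + e' true) + ex := add_le_add hmax le_rfl
          _ ≤ _ := hle2
          _ = _ := add_comm _ _
      exact (ENNReal.add_le_add_iff_left hX).1 this
    obtain ⟨er, her1, her2⟩ : ∃ er, E.th ^ (D + 8) + (er + ex) ≤ ef ∧
        el + e' true ≤ er + 12 * E.th ^ (D + 8) := by
      -- The frame credit can be cancelled only if it is finite. If it is infinite, so is `ef`, and
      -- nothing has to be shown.
      by_cases hex : ex = ⊤
      · refine ⟨el + e' true, ?_, le_self_add⟩
        have : ef = ⊤ := top_le_iff.1 (by rw [← hex]; exact le_trans le_self_add hY)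
        rw [this]; exact le_top
      · obtain ⟨er, rfl⟩ : ∃ er, ef = ex + E.th ^ (D + 8) + er :=
          ⟨_, (add_tsub_cancel_of_le hY).symm⟩
        refine ⟨er, le_of_eq (by ring), (ENNReal.add_le_add_iff_right hex).1 (hle2.trans ?_)⟩
        calc _ = 11 * E.th ^ (D + 7) + E.th ^ (D + 8) + er + ex := by ring
          _ ≤ 11 * E.th ^ (D + 8) + E.th ^ (D + 8) + er + ex := by
            gcongr
            · exact E.one_le_th
            · norm_num
          _ = _ := by ring
    rcases t₃ with _ | t₃
    · trivial
    have hb1 := hv lo mid _ _ _ _ le_rfl hm2.le ⟨vs₁, hvs₁, hF₁, hr₁⟩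
    have hb2 := hv mid hi _ _ _ _ hm1.le le_rfl ⟨vs₂, hvs₂, hF₂, hr₂⟩
    have hsum : (v false : ℕ) + v true = ∑ i ∈ Finset.Ico lo hi, (if i < mid then vs₁ i else vs₂ i) := by
      rw [hvs₁, hvs₂, hsplit]
      congr 1
      · refine Finset.sum_congr rfl fun i hi => ?_
        rw [Finset.mem_Ico] at hi; rw [if_pos hi.2]
      · refine Finset.sum_congr rfl fun i hi => ?_
        rw [Finset.mem_Ico] at hi; rw [if_neg (by omega)]
    have hpost : ForPost F (R (j + 1)) lo hi (v false + v true) (dd i + 8) s' er := by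
      refine ⟨_, hsum, fun i h1 h2 => ?_, ?_⟩
      · by_cases him : i < mid
        · rw [if_pos him]
          exact hF i h1 h2 _ _ _ (hagf.mono (le_add_right (Finset.single_le_sum
            (f := ρ) (fun _ _ => zero_le) (Finset.mem_Ico.2 ⟨h1, him⟩)))) (hF₁ i h1 him)
        · rw [if_neg him]
          exact hF i h1 h2 _ _ _ (hagt.mono (Finset.single_le_sum
            (f := ρ) (fun _ _ => zero_le) (Finset.mem_Ico.2 ⟨by omega, h2⟩)))
            (hF₂ i (by omega) h2)
      · exact hRj j (by omega) _ _ _ _ _ _ hr₁ hr₂ hdi her2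
    refine safe.alu_add (e := er + ex)
      (le_trans (add_le_add (th_pow_le E (by omega)) le_rfl) her1) ?_ ?_
    · have h1 : @LE.le ℕ _ (v false) (mid - lo) := hb1
      have h2 : @LE.le ℕ _ (v true) (hi - mid) := hb2
      generalize v false = x at *
      generalize v true = y at *
      change @LE.le ℕ _ (@HAdd.hAdd ℕ ℕ ℕ _ x y) _
      exact (add_le_add h1 h2).trans (by omega)
    · have := hk t₃ (by omega) W₃ hW₃ _ _ s' er hpost (hpx.trans (hagf.mono le_add_self))
      refine this.weaken ?_ le_rfl
      rw [hsplit]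
      apply le_of_eq; abel

end BF

namespace BF
variable {E : Env} {t : ℕ} {W : World} {L : ℕ} {f : ℝ≥0∞} {d w : ℕ} {s : St} {p : Share}

/-! ## Rules with a budget of instructions -/

/-- Safety with a budget of `w` instructions up to depth `L`, and further credits `f`. -/
def FS (E : Env) (t : ℕ) (W : World) (L : ℕ) (f : ℝ≥0∞) (d w : ℕ) (c : Prog Proc Word) (s : St)
    (p : Share) : Prop := safe E t W ⟨d, c⟩ s p ((w : ℝ≥0∞) * E.th ^ L + f)

theorem FS.mono {c : Prog Proc Word} (h : FS E t W L f d w c s p) {t' w' : ℕ} {W' : World} {s' : St}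
    (ht : t' ≤ t) (hW : W ≤ W') (hs : Agree p s s') (hw : w ≤ w') :
    FS E t' W' L f d w' c s' p :=
  ((safe.of_le h ht).mono hW hs).weaken le_rfl (by gcongr)

theorem price_le (hd : d < L) (hw : 0 < w) :
    E.th ^ (d + 1) + (((w - 1 : ℕ) : ℝ≥0∞) * E.th ^ L + f) ≤ (w : ℝ≥0∞) * E.th ^ L + f := by
  obtain ⟨w, rfl⟩ : ∃ w', w = w' + 1 := ⟨w - 1, by omega⟩
  calc _ ≤ E.th ^ L + ((w : ℝ≥0∞) * E.th ^ L + f) := add_le_add (th_pow_le E hd) le_rfl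
    _ = _ := by push_cast; ring

section
variable {k : ℕ → Prog Proc Word} {x y : ℕ}

theorem FS.alu {o : AluOp} (hd : d < L) (hw : 0 < w)
    (hb : @LE.le ℕ _ (o.eval x y) (E.bd + W.nx))
    (h : FS E t W L f (d + 1) (w - 1) (k (o.eval x y)) s p) :
    FS E t W L f d w (.instr (.alu o x y) k) s p := by
  cases t with
  | zero => trivial
  | succ t => exact safe.alu (price_le hd hw) hb h.of_succ

theorem FS.add (hd : d < L) (hw : 0 < w) (hb : x + y ≤ E.bd + W.nx)
    (h : FS E t W L f (d + 1) (w - 1) (k (x + y)) s p) :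
    FS E t W L f d w (.instr (.alu .add x y) k) s p := FS.alu hd hw hb h

theorem FS.mul (hd : d < L) (hw : 0 < w) (hb : x * y ≤ E.bd)
    (h : FS E t W L f (d + 1) (w - 1) (k (x * y)) s p) :
    FS E t W L f d w (.instr (.alu .mul x y) k) s p :=
  FS.alu hd hw (hb.trans (Nat.le_add_right _ _)) h

theorem FS.sub (hd : d < L) (hw : 0 < w) (hb : x ≤ E.bd)
    (h : FS E t W L f (d + 1) (w - 1) (k (x - y)) s p) :
    FS E t W L f d w (.instr (.alu .sub x y) k) s p :=
  FS.alu hd hw (((Nat.sub_le x y).trans hb).trans (Nat.le_add_right _ _)) h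

theorem FS.div (hd : d < L) (hw : 0 < w) (hb : x ≤ E.bd)
    (h : FS E t W L f (d + 1) (w - 1) (k (x / y)) s p) :
    FS E t W L f d w (.instr (.alu .div x y) k) s p :=
  FS.alu hd hw (((Nat.div_le_self x y).trans hb).trans (Nat.le_add_right _ _)) h

theorem FS.mod (hd : d < L) (hw : 0 < w) (hb : x ≤ E.bd)
    (h : FS E t W L f (d + 1) (w - 1) (k (x % y)) s p) :
    FS E t W L f d w (.instr (.alu .mod x y) k) s p :=
  FS.alu hd hw (((Nat.mod_le x y).trans hb).trans (Nat.le_add_right _ _)) h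

theorem FS.eq (hd : d < L) (hw : 0 < w) (hb : 1 ≤ E.bd)
    (h : FS E t W L f (d + 1) (w - 1) (k (if x = y then 1 else 0)) s p) :
    FS E t W L f d w (.instr (.alu .eq x y) k) s p := FS.alu hd hw (ite_le_bd hb) h

theorem FS.lt (hd : d < L) (hw : 0 < w) (hb : 1 ≤ E.bd)
    (h : FS E t W L f (d + 1) (w - 1) (k (if x < y then 1 else 0)) s p) :
    FS E t W L f d w (.instr (.alu .lt x y) k) s p := FS.alu hd hw (ite_le_bd hb) h

theorem FS.le (hd : d < L) (hw : 0 < w) (hb : 1 ≤ E.bd)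
    (h : FS E t W L f (d + 1) (w - 1) (k (if x ≤ y then 1 else 0)) s p) :
    FS E t W L f d w (.instr (.alu .le x y) k) s p := FS.alu hd hw (ite_le_bd hb) h

theorem FS.cmp (hd : d < L) (hw : 0 < w) (hb : 1 ≤ E.bd)
    (h : FS E t W L f (d + 1) (w - 1) (k (if E.lt x y then 1 else 0)) s p) :
    FS E t W L f d w (.instr (.cmp x y) k) s p := by
  cases t with
  | zero => trivial
  | succ t => exact safe.cmp (price_le hd hw) hb h.of_succ

theorem FS.call {q : Proc} (hd : d < L) (hw : 0 < w)
    (h : FS E t W L f (d + 1) (w - 1) ((Proc.code E.par q).bind k) s p) :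
    FS E t W L f d w (.call q k) s p := by
  cases t with
  | zero => trivial
  | succ t => exact safe.call (price_le hd hw) h.of_succ

theorem FS.read (hd : d < L) (hw : 0 < w) (ha : p (0, x) ≠ 0)
    (h : FS E t W L f (d + 1) (w - 1) (k (s (0, x))) s p) :
    FS E t W L f d w (.instr (.read x) k) s p := by
  cases t with
  | zero => trivial
  | succ t => exact safe.read (price_le hd hw) ha h.of_succ

theorem FS.write (hd : d < L) (hw : 0 < w) (ha : 1 ≤ p (0, x)) (hv : y ≤ E.bd + W.nx)
    (h : FS E t W L f (d + 1) (w - 1) (k 0) (Function.update s (0, x) y) p) :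
    FS E t W L f d w (.instr (.write x y) k) s p := by
  cases t with
  | zero => trivial
  | succ t => exact safe.write (price_le hd hw) ha hv h.of_succ

theorem FS.alloc (hd : d < L) (hw : 0 < w) (hm : x ≤ E.bd)
    (h : ∀ W' a s', W ≤ W' → W.nx ≤ a → a + x ≤ W'.nx → Agree p s s' →
      (∀ j b, a ≤ b → p (j, b) = 0) → FS E t W' L f (d + 1) (w - 1) (k a) s' (p + blk a x)) :
    FS E t W L f d w (.instr (.alloc x) k) s p := by
  cases t with
  | zero => trivial
  | succ t =>
    exact safe.alloc (price_le hd hw) hm fun W' a s' h1 h2 h3 h4 h5 => (h W' a s' h1 h2 h3 h4 h5).of_succ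

theorem FS.readAt (hd : d + 1 < L) (hw : 1 < w) (hb : x + y ≤ E.bd + W.nx) (ha : p (0, x + y) ≠ 0)
    (h : FS E t W L f (d + 2) (w - 2) (k (s (0, x + y))) s p) :
    FS E t W L f d w ((readAt x y).bind k) s p :=
  FS.add (by omega) (by omega) hb (FS.read (by omega) (by omega) ha h)

theorem FS.writeAt {v : ℕ} (hd : d + 1 < L) (hw : 1 < w) (hb : x + y ≤ E.bd + W.nx)
    (ha : 1 ≤ p (0, x + y)) (hv : v ≤ E.bd + W.nx)
    (h : FS E t W L f (d + 2) (w - 2) (k 0) (Function.update s (0, x + y) v) p) :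
    FS E t W L f d w ((writeAt x y v).bind k) s p :=
  FS.add (by omega) (by omega) hb (FS.write (by omega) (by omega) ha hv h)

end

/-- The words below `N` are ordered by `rk`, and `less` compares them. -/
structure Ranked (E : Env) (N : ℕ) (rk : ℕ → ℕ) : Prop where
  inj : ∀ i < N, ∀ j < N, rk i = rk j → i = j
  less : ∀ i < N, ∀ j < N, (E.lt i j = true ∨ E.lt j i = false ∧ i < j) ↔ rk i < rk j

variable {N : ℕ} {rk : ℕ → ℕ}

theorem FS.less (hr : Ranked E N rk) {i j : ℕ} {k : ℕ → Prog Proc Word} (hi : i < N) (hj : j < N)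
    (hd : d + 3 ≤ L) (hw : 3 ≤ w) (hb : 1 ≤ E.bd)
    (hk : ∀ d' w', d' ≤ d + 3 → w ≤ w' + 3 →
      FS E t W L f d' w' (k (if rk i < rk j then 1 else 0)) s p) :
    FS E t W L f d w ((BF.less i j).bind k) s p := by
  have h := hr.less i hi j hj
  simp only [BF.less, Prog.bind_def, Prog.pure_def, BF.alu, BF.cmp, Prog.bind, Prog.bind_ite]
  refine FS.cmp (by omega) (by omega) hb ?_
  by_cases h1 : E.lt i j = true
  · have := hk (d + 1) (w - 1) (by omega) (by omega)
    rw [if_pos (h.1 (.inl h1))] at this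
    simpa [h1] using this
  simp only [h1, if_false, Bool.false_eq_true, zero_ne_one]
  refine FS.cmp (by omega) (by omega) hb ?_
  by_cases h2 : E.lt j i = true
  · have := hk (d + 1 + 1) (w - 1 - 1) (by omega) (by omega)
    rw [if_neg (by rw [← h]; simp [h1, h2])] at this
    simpa [h2] using this
  simp only [h2, if_false, Bool.false_eq_true, zero_ne_one]
  refine FS.lt (by omega) (by omega) hb ?_
  have := hk (d + 1 + 1 + 1) (w - 1 - 1 - 1) (by omega) (by omega)
  simp only [← h, h1, h2] at this
  simpa using this

/-! ## Sequential procedures -/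

theorem FS.log {x acc : ℕ} {k : ℕ → Prog Proc Word} {c : ℕ} (hc : c = 4 * (Nat.log 2 x + 1))
    (hd : d + c ≤ L) (hw : c ≤ w) (hx : 2 ≤ E.bd) (hx' : x ≤ E.bd) (hacc : acc + Nat.log 2 x ≤ E.bd)
    (hk : ∀ d' w', d' ≤ d + c → w ≤ w' + c → FS E t W L f d' w' (k (Nat.log 2 x + acc)) s p) :
    FS E t W L f d w (.call (.log x acc) k) s p := by
  induction x using Nat.strong_induction_on generalizing acc c d w with
  | _ x ih =>
  have hcode : (Proc.code E.par (.log x acc)).bind k = .instr (.alu .lt x 2) fun v =>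
      if v = 1 then k acc else .instr (.alu .div x 2) fun x' => .instr (.alu .add acc 1) fun acc' =>
        .call (.log x' acc') k := by
    simp only [Proc.code, Prog.bind_def, Prog.pure_def, BF.call, BF.alu, Prog.bind, Prog.bind_ite]
  refine FS.call (by omega) (by omega) ?_
  rw [hcode]
  refine FS.lt (by omega) (by omega) (by omega) ?_
  by_cases h : x < 2
  · rw [if_pos (by simp [h])]
    have := hk (d + 2) (w - 2) (by omega) (by omega)
    rwa [Nat.log_of_lt h, zero_add] at this
  rw [if_neg (by simp [h])]
  have hl : Nat.log 2 x = Nat.log 2 (x / 2) + 1 := by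
    rw [Nat.log_div_base]
    have := Nat.log_pos (b := 2) (by norm_num) (by omega : 2 ≤ x)
    omega
  refine FS.div (by omega) (by omega) (by omega) ?_
  refine FS.add (by omega) (by omega) (by omega) ?_
  refine ih (x / 2) (by omega) (c := c - 4) (by omega) (by omega) (by omega) (by omega) (by omega)
    fun d' w' h1 h2 => ?_
  have := hk d' w' (by omega) (by omega)
  rwa [hl, add_assoc, add_comm 1] at this

/-- If `y` is the root of `x / 8`, then the root of `x` is `2 * y` or `2 * y + 1`, because `8 * y ^
3 ≤ x < 8 * (y + 1) ^ 3`. -/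
theorem FS.cbrt {x : ℕ} {k : ℕ → Prog Proc Word} {c : ℕ} (hc : c = 10 * Nat.log 2 (2 * x) + 2)
    (hd : d + c ≤ L) (hw : c ≤ w) (hx : 4 * x + 1 ≤ E.bd)
    (hk : ∀ d' w' q, d' ≤ d + c → w ≤ w' + c → q ^ 3 ≤ x → x < (q + 1) ^ 3 →
      FS E t W L f d' w' (k q) s p) :
    FS E t W L f d w (.call (.cbrt x) k) s p := by
  induction x using Nat.strong_induction_on generalizing c d w k with
  | _ x ih =>
  have hcode : (Proc.code E.par (.cbrt x)).bind k = .instr (.alu .eq x 0) fun v =>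
      if v = 1 then k 0 else .instr (.alu .div x 8) fun x' => .call (.cbrt x') fun y =>
        .instr (.alu .mul y 2) fun s => .instr (.alu .add s 1) fun s' =>
        .instr (.alu .mul s' s') fun s2 => .instr (.alu .mul s2 s') fun s3 =>
        .instr (.alu .le s3 x) fun ok => if ok = 1 then k s' else k s := by
    simp only [Proc.code, Prog.bind_def, Prog.pure_def, BF.call, BF.alu, Prog.bind, Prog.bind_ite]
  refine FS.call (by omega) (by omega) ?_
  rw [hcode]
  refine FS.eq (by omega) (by omega) (by omega) ?_
  by_cases h : x = 0
  · rw [if_pos (by simp [h])]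
    subst h
    exact hk (d + 1 + 1) (w - 1 - 1) 0 (by omega) (by omega) (by simp) (by simp)
  rw [if_neg (by simp [h])]
  have hl : Nat.log 2 (2 * (x / 8)) + 1 ≤ Nat.log 2 (2 * x) := by
    have e1 : Nat.log 2 (2 * x) = Nat.log 2 x + 1 := by
      rw [mul_comm, Nat.log_mul_base (by norm_num) h]
    rw [e1]
    exact Nat.add_le_add_right (Nat.log_mono_right (by omega)) 1
  refine FS.div (by omega) (by omega) (by omega) ?_
  refine ih (x / 8) (by omega) (c := 10 * Nat.log 2 (2 * (x / 8)) + 2) rfl (by omega) (by omega)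
    (by omega) fun d' w' y h1 h2 h3 h4 => ?_
  have hy : y ≤ y ^ 3 := Nat.le_self_pow (by norm_num) y
  have hy2 : y ^ 2 ≤ y ^ 3 := by
    rcases Nat.eq_zero_or_pos y with rfl | hy
    · simp
    · exact Nat.pow_le_pow_right hy (by norm_num)
  have e3 : (y * 2 + 1) * (y * 2 + 1) * (y * 2 + 1) = 8 * y ^ 3 + 12 * y ^ 2 + 6 * y + 1 := by ring
  have e2 : (y * 2 + 1) * (y * 2 + 1) = 4 * y ^ 2 + 4 * y + 1 := by ring
  have b3 : 8 * y ^ 3 ≤ x := by omega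
  refine FS.mul (by omega) (by omega) (by omega) ?_
  refine FS.add (by omega) (by omega) (by omega) ?_
  refine FS.mul (by omega) (by omega) (by omega) ?_
  refine FS.mul (by omega) (by omega) (by omega) ?_
  refine FS.le (by omega) (by omega) (by omega) ?_
  by_cases hle : (y * 2 + 1) * (y * 2 + 1) * (y * 2 + 1) ≤ x
  · rw [if_pos (by simp [hle])]
    refine hk _ _ _ (by omega) (by omega) ((by ring_nf; ring_nf at hle; exact hle)) ?_
    have : (y * 2 + 1 + 1) ^ 3 = 8 * (y + 1) ^ 3 := by ring
    omega
  · rw [if_neg (by simp [hle])]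
    refine hk _ _ _ (by omega) (by omega) (by rw [show (y * 2) ^ 3 = 8 * y ^ 3 by ring]; exact b3) ?_
    rw [show (y * 2 + 1) ^ 3 = (y * 2 + 1) * (y * 2 + 1) * (y * 2 + 1) by ring]
    omega

/-- Insertion into a sorted initial segment. -/
theorem FS.insert (hr : Ranked E N rk) {b i : ℕ} {k : ℕ → Prog Proc Word} {c : ℕ}
    (hc : c = 14 * (i + 1)) (hd : d + c ≤ L) (hw : c ≤ w) (hb : 1 ≤ E.bd) (hN : N ≤ E.bd)
    (hi : i ≤ E.bd) (hbi : b + i ≤ E.bd + W.nx)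
    (hp : ∀ j ≤ i, 1 ≤ p (0, b + j)) (hlt : ∀ j ≤ i, s (0, b + j) < N)
    (hsort : ∀ j j', j < j' → j' < i → rk (s (0, b + j)) < rk (s (0, b + j')))
    (hdist : ∀ j < i, s (0, b + j) ≠ s (0, b + i))
    (hk : ∀ d' w' s', d' ≤ d + c → w ≤ w' + c →
      (∀ x, (∀ j ≤ i, x ≠ (0, b + j)) → s' x = s x) →
      (∀ j ≤ i, ∃ j' ≤ i, s' (0, b + j) = s (0, b + j')) →
      (∀ j j', j < j' → j' ≤ i → rk (s' (0, b + j)) < rk (s' (0, b + j'))) →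
      FS E t W L f d' w' (k 0) s' p) :
    FS E t W L f d w (.call (.insert b i) k) s p := by
  induction i generalizing c d w s with
  | zero =>
    have hcode : (Proc.code E.par (.insert b 0)).bind k = .instr (.alu .eq 0 0) fun v =>
        if v = 1 then k 0 else .instr (.alu .sub 0 1) fun i' => (BF.readAt b i').bind fun x =>
          (BF.readAt b 0).bind fun y => (BF.less y x).bind fun a => if a = 0 then k 0 else
          (BF.writeAt b i' y).bind fun _ => (BF.writeAt b 0 x).bind fun _ =>
          .call (.insert b i') k := by
      simp only [Proc.code, Prog.bind_def, Prog.pure_def, BF.call, BF.alu, Prog.bind, Prog.bind_ite,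
        Prog.bind_assoc]
    refine FS.call (by omega) (by omega) ?_
    rw [hcode]
    refine FS.eq (by omega) (by omega) (by omega) ?_
    rw [if_pos (by simp)]
    exact hk (d + 1 + 1) (w - 1 - 1) s (by omega) (by omega) (fun _ _ => rfl)
      (fun j hj => ⟨j, hj, rfl⟩) (fun j j' h1 h2 => by omega)
  | succ i ih =>
    have hcode : (Proc.code E.par (.insert b (i + 1))).bind k = .instr (.alu .eq (i + 1) 0) fun v =>
        if v = 1 then k 0 else .instr (.alu .sub (i + 1) 1) fun i' => (BF.readAt b i').bind fun x =>
          (BF.readAt b (i + 1)).bind fun y => (BF.less y x).bind fun a => if a = 0 then k 0 else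
          (BF.writeAt b i' y).bind fun _ => (BF.writeAt b (i + 1) x).bind fun _ =>
          .call (.insert b i') k := by
      simp only [Proc.code, Prog.bind_def, Prog.pure_def, BF.call, BF.alu, Prog.bind, Prog.bind_ite,
        Prog.bind_assoc]
    refine FS.call (by omega) (by omega) ?_
    rw [hcode]
    refine FS.eq (by omega) (by omega) (by omega) ?_
    rw [if_neg (by simp)]
    refine FS.sub (by omega) (by omega) (by omega) ?_
    rw [Nat.add_sub_cancel]
    refine FS.readAt (by omega) (by omega) (by omega)
      (fun h => by simpa [h] using hp i (by omega)) ?_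
    refine FS.readAt (by omega) (by omega) (by omega)
      (fun h => by simpa [h] using hp (i + 1) (by omega)) ?_
    refine FS.less hr (hlt _ le_rfl) (hlt i (by omega)) (by omega) (by omega) hb
      fun d₁ w₁ h1 h2 => ?_
    have hx := hlt i (by omega)
    have hy := hlt (i + 1) le_rfl
    generalize ex : s (0, b + i) = x at hx
    generalize ey : s (0, b + (i + 1)) = y at hy
    have hbi' : b + i ≤ E.bd + W.nx := by omega
    by_cases hxy : rk y < rk x
    · simp only [if_pos hxy, one_ne_zero, if_false]
      refine FS.writeAt (by omega) (by omega) hbi' (hp i (by omega)) (by omega) ?_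
      refine FS.writeAt (by omega) (by omega) hbi (hp _ le_rfl) (by omega) ?_
      set s₁ : St := Function.update (Function.update s (0, b + i) y) (0, b + (i + 1)) x with hs₁
      have e1 : ∀ j < i, s₁ (0, b + j) = s (0, b + j) := fun j hj => by
        rw [hs₁, Function.update_of_ne (by simp; omega), Function.update_of_ne (by simp; omega)]
      have e2 : s₁ (0, b + i) = y := by
        rw [hs₁, Function.update_of_ne (by simp), Function.update_self]
      have e3 : s₁ (0, b + (i + 1)) = x := by rw [hs₁, Function.update_self]
      refine ih (c := 14 * (i + 1)) rfl (by omega) (by omega) (by omega) hbi'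
        (fun j hj => hp j (by omega)) (fun j hj => ?_) (fun j j' h3 h4 => ?_) (fun j hj => ?_)
        fun d' w' s' h3 h4 h5 h6 h7 => ?_
      · rcases hj.eq_or_lt with rfl | hj
        · rw [e2]; exact hy
        · rw [e1 j hj]; exact hlt j (by omega)
      · rw [e1 j (by omega), e1 j' h4]; exact hsort j j' h3 (by omega)
      · rw [e1 j hj, e2, ← ey]; exact hdist j (by omega)
      · have e4 : s' (0, b + (i + 1)) = x := by
          rw [h5 _ (fun j hj h => by simp at h; omega), e3]
        refine hk d' w' s' (by omega) (by omega) (fun z hz => ?_) (fun j hj => ?_)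
          (fun j j' h8 h9 => ?_)
        · rw [h5 z fun j hj => hz j (by omega), hs₁, Function.update_of_ne (hz _ le_rfl),
            Function.update_of_ne (hz i (by omega))]
        · rcases hj.eq_or_lt with rfl | hj
          · exact ⟨i, by omega, by rw [e4, ex]⟩
          · obtain ⟨j', h8, h9⟩ := h6 j (by omega)
            rcases h8.eq_or_lt with rfl | h8
            · exact ⟨j' + 1, le_rfl, by rw [h9, e2, ey]⟩
            · exact ⟨j', by omega, by rw [h9, e1 j' h8]⟩
        · rcases h9.eq_or_lt with rfl | h9
          · obtain ⟨j', h10, h11⟩ := h6 j (by omega)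
            rw [e4, h11]
            rcases h10.eq_or_lt with rfl | h10
            · rwa [e2]
            · rw [e1 j' h10, ← ex]; exact hsort j' i h10 (by omega)
          · exact h7 j j' h8 (by omega)
    · simp only [if_neg hxy, if_true]
      refine hk d₁ w₁ s (by omega) (by omega) (fun _ _ => rfl) (fun j hj => ⟨j, hj, rfl⟩)
        (fun j j' h3 h4 => ?_)
      have hxy' : rk x < rk y := lt_of_le_of_ne (not_lt.1 hxy) fun h =>
        hdist i (by omega) (by rw [ex, ey]; exact hr.inj x hx y hy h)
      rcases h4.eq_or_lt with rfl | h4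
      · rw [ey]
        rcases (by omega : j = i ∨ j < i) with rfl | hj
        · rwa [ex]
        · refine (hsort j i hj (by omega)).trans ?_
          rwa [ex]
      · exact hsort j j' h3 h4

theorem FS.insertionSort (hr : Ranked E N rk) {b n i : ℕ} {k : ℕ → Prog Proc Word} {c : ℕ}
    (hc : c = (n + 1 - i) * (14 * n + 20)) (hd : d + c ≤ L) (hw : c ≤ w) (hb : 1 ≤ E.bd)
    (hN : N ≤ E.bd) (hi : i ≤ n) (hn : n ≤ E.bd) (hbn : b + n ≤ E.bd + W.nx)
    (hp : ∀ j < n, 1 ≤ p (0, b + j)) (hlt : ∀ j < n, s (0, b + j) < N)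
    (hsort : ∀ j j', j < j' → j' < i → rk (s (0, b + j)) < rk (s (0, b + j')))
    (hdist : ∀ j j', j < j' → j' < n → s (0, b + j) ≠ s (0, b + j'))
    (hk : ∀ d' w' s', d' ≤ d + c → w ≤ w' + c →
      (∀ x, (∀ j < n, x ≠ (0, b + j)) → s' x = s x) →
      (∀ j < n, ∃ j' < n, s' (0, b + j) = s (0, b + j')) →
      (∀ j j', j < j' → j' < n → rk (s' (0, b + j)) < rk (s' (0, b + j'))) →
      FS E t W L f d' w' (k 0) s' p) :
    FS E t W L f d w (.call (.insertionSort b n i) k) s p := by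
  obtain ⟨j, hj⟩ : ∃ j, j = n - i := ⟨_, rfl⟩
  induction j generalizing i c d w s with
  | zero =>
    have hcode : (Proc.code E.par (.insertionSort b n i)).bind k = .instr (.alu .lt i n) fun v =>
        if v = 0 then k 0 else .call (.insert b i) fun _ => .instr (.alu .add i 1) fun i' =>
          .call (.insertionSort b n i') k := by
      simp only [Proc.code, Prog.bind_def, Prog.pure_def, BF.call, BF.alu, Prog.bind, Prog.bind_ite]
    obtain rfl : i = n := by omega
    rw [Nat.add_sub_cancel_left, one_mul] at hc
    refine FS.call (by omega) (by omega) ?_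
    rw [hcode]
    refine FS.lt (by omega) (by omega) (by omega) ?_
    rw [if_pos (by simp)]
    exact hk _ _ s (by omega) (by omega) (fun _ _ => rfl) (fun j hj => ⟨j, hj, rfl⟩) hsort
  | succ j ih =>
    have hcode : (Proc.code E.par (.insertionSort b n i)).bind k = .instr (.alu .lt i n) fun v =>
        if v = 0 then k 0 else .call (.insert b i) fun _ => .instr (.alu .add i 1) fun i' =>
          .call (.insertionSort b n i') k := by
      simp only [Proc.code, Prog.bind_def, Prog.pure_def, BF.call, BF.alu, Prog.bind, Prog.bind_ite]
    have hc' : c = (n + 1 - (i + 1)) * (14 * n + 20) + (14 * n + 20) := by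
      rw [hc, show n + 1 - i = (n + 1 - (i + 1)) + 1 by omega]; ring
    generalize hC : (n + 1 - (i + 1)) * (14 * n + 20) = C at hc'
    refine FS.call (by omega) (by omega) ?_
    rw [hcode]
    refine FS.lt (by omega) (by omega) (by omega) ?_
    rw [if_neg (by simp; omega)]
    refine FS.insert hr rfl (by omega) (by omega) hb hN (by omega) (by omega)
      (fun j hj => hp j (by omega)) (fun j hj => hlt j (by omega)) hsort
      (fun j hj => hdist j i hj (by omega)) fun d₁ w₁ s₁ h1 h2 h3 h4 h5 => ?_
    refine FS.add (by omega) (by omega) (by omega) ?_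
    have e1 : ∀ j, i < j → s₁ (0, b + j) = s (0, b + j) := fun j hj =>
      h3 _ fun j' hj' h => by simp at h; omega
    have e2 : ∀ j < n, ∃ j' < n, s₁ (0, b + j) = s (0, b + j') := fun j hj => by
      by_cases hji : i < j
      · exact ⟨j, hj, e1 j hji⟩
      · obtain ⟨j', h6, h7⟩ := h4 j (by omega)
        exact ⟨j', by omega, h7⟩
    refine ih (c := C) hC.symm (by omega) (by omega) (by omega) (fun j hj => ?_)
      (fun j j' h6 h7 => h5 j j' h6 (by omega)) (fun j j' h6 h7 => ?_)
      (fun d' w' s' h6 h7 h8 h9 h10 => ?_) (by omega)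
    · obtain ⟨j', h6, h7⟩ := e2 j hj
      rw [h7]; exact hlt j' h6
    · by_cases hj' : j' ≤ i
      · exact fun h => by have := h5 j j' h6 hj'; rw [h] at this; exact lt_irrefl _ this
      · rw [e1 j' (by omega)]
        by_cases hj : j ≤ i
        · obtain ⟨j₁, h8, h9⟩ := h4 j hj
          rw [h9]; exact hdist j₁ j' (by omega) h7
        · rw [e1 j (by omega)]; exact hdist j j' h6 h7
    · refine hk d' w' s' (by omega) (by omega) (fun x hx => ?_) (fun j hj => ?_) h10
      · rw [h8 x hx, h3 x fun j hj => hx j (by omega)]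
      · obtain ⟨j₁, h11, h12⟩ := h9 j hj
        obtain ⟨j₂, h13, h14⟩ := e2 j₁ h11
        exact ⟨j₂, h13, by rw [h12, h14]⟩

/-- There are `hi - lo + 1` possible answers, and every call at least halves their number. Equal
pivots do no harm, because only weak monotonicity is used. -/
theorem FS.search (hr : Ranked E N rk) {Q e lo hi q j : ℕ} {P : ℕ → ℕ} {k : ℕ → Prog Proc Word}
    {c : ℕ} (hc : c = 10 * j + 2) (hd : d + c ≤ L) (hw : c ≤ w) (hb : 1 ≤ E.bd) (he : e < N)
    (hj : hi - lo + 1 ≤ 2 ^ j) (hlo : lo ≤ hi) (hhi : hi ≤ q) (hq : 2 * q ≤ E.bd)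
    (hQ : Q + q ≤ E.bd + W.nx) (hp : ∀ i < q, p (0, Q + i) ≠ 0)
    (hP : ∀ i < q, s (0, Q + i) = P i) (hPN : ∀ i < q, P i < N)
    (hmono : ∀ i i', i ≤ i' → i' < q → rk (P i) ≤ rk (P i'))
    (h_lo : ∀ i < lo, rk (P i) < rk e) (h_hi : ∀ i, hi ≤ i → i < q → rk e ≤ rk (P i))
    (hk : ∀ d' w' r, d' ≤ d + c → w ≤ w' + c → r ≤ q → (∀ i < r, rk (P i) < rk e) →
      (∀ i, r ≤ i → i < q → rk e ≤ rk (P i)) → FS E t W L f d' w' (k r) s p) :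
    FS E t W L f d w (.call (.search Q e lo hi) k) s p := by
  induction j generalizing lo hi c d w with
  | zero =>
    have hcode : (Proc.code E.par (.search Q e lo hi)).bind k = .instr (.alu .lt lo hi) fun v =>
        if v = 0 then k lo else .instr (.alu .add lo hi) fun t => .instr (.alu .div t 2) fun mid =>
          (BF.readAt Q mid).bind fun x => (BF.less x e).bind fun a => if a = 1 then
          .instr (.alu .add mid 1) fun mid' => .call (.search Q e mid' hi) k
          else .call (.search Q e lo mid) k := by
      simp only [Proc.code, Prog.bind_def, Prog.pure_def, BF.call, BF.alu, Prog.bind, Prog.bind_ite,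
        Prog.bind_assoc]
    obtain rfl : lo = hi := by simp at hj; omega
    refine FS.call (by omega) (by omega) ?_
    rw [hcode]
    refine FS.lt (by omega) (by omega) (by omega) ?_
    rw [if_pos (by simp)]
    exact hk _ _ lo (by omega) (by omega) hhi h_lo h_hi
  | succ j ih =>
    have hcode : (Proc.code E.par (.search Q e lo hi)).bind k = .instr (.alu .lt lo hi) fun v =>
        if v = 0 then k lo else .instr (.alu .add lo hi) fun t => .instr (.alu .div t 2) fun mid =>
          (BF.readAt Q mid).bind fun x => (BF.less x e).bind fun a => if a = 1 then
          .instr (.alu .add mid 1) fun mid' => .call (.search Q e mid' hi) k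
          else .call (.search Q e lo mid) k := by
      simp only [Proc.code, Prog.bind_def, Prog.pure_def, BF.call, BF.alu, Prog.bind, Prog.bind_ite,
        Prog.bind_assoc]
    refine FS.call (by omega) (by omega) ?_
    rw [hcode]
    refine FS.lt (by omega) (by omega) (by omega) ?_
    by_cases hlt : lo < hi
    swap
    · rw [if_pos (by simp; omega)]
      exact hk _ _ lo (by omega) (by omega) (by omega) h_lo fun i hi => h_hi i (by omega)
    rw [if_neg (by simp; omega)]
    refine FS.add (by omega) (by omega) (by omega) ?_
    refine FS.div (by omega) (by omega) (by omega) ?_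
    have h2 : 2 ^ (j + 1) = 2 * 2 ^ j := by ring
    obtain ⟨mid, hmid⟩ : ∃ mid, mid = (lo + hi) / 2 := ⟨_, rfl⟩
    rw [← hmid]
    refine FS.readAt (by omega) (by omega) (by omega) (hp mid (by omega)) ?_
    rw [hP mid (by omega)]
    refine FS.less hr (hPN mid (by omega)) he (by omega) (by omega) hb fun d₁ w₁ h3 h4 => ?_
    by_cases hx : rk (P mid) < rk e
    · simp only [if_pos hx, if_true]
      refine FS.add (by omega) (by omega) (by omega) ?_
      refine ih (c := 10 * j + 2) rfl (by omega) (by omega) (by omega) (by omega) hhi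
        (fun i hi => (hmono i mid (by omega) (by omega)).trans_lt hx) h_hi
        fun d' w' r h5 h6 => hk d' w' r (by omega) (by omega)
    · simp only [if_neg hx, zero_ne_one, if_false]
      refine ih (c := 10 * j + 2) rfl (by omega) (by omega) (by omega) (by omega) (by omega)
        h_lo (fun i h5 h6 => (not_lt.1 hx).trans (hmono mid i h5 h6))
        fun d' w' r h5 h6 => hk d' w' r (by omega) (by omega)

end BF

namespace BF
variable {E : Env} {t : ℕ} {W : World} {L : ℕ} {f : ℝ≥0∞} {d w : ℕ} {s : St} {p : Share}

/-! ## Triples with costs, and parallel loops -/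

/-- A triple for a program that needs at most `cw` instructions, of depth at most `cd`. -/
def Fn (E : Env) (t : ℕ) (W : World) (L cd cw : ℕ) (c : Prog Proc Word) (s : St) (p : Share)
    (F : ℕ → St → Prop) : Prop :=
  ∀ t' ≤ t, ∀ W', W ≤ W' → ∀ (k : ℕ → Prog Proc Word) s₀ px f d w, Agree p s s₀ → d + cd ≤ L →
    cw ≤ w → (∀ t'' ≤ t', ∀ W'', W' ≤ W'' → ∀ (v : ℕ) d' w' s', d' ≤ d + cd → w ≤ w' + cw → F v s' →
      Agree px s₀ s' → FS E t'' W'' L f d' w' (k v) s' (p + px)) →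
    FS E t' W' L f d w (c.bind k) s₀ (p + px)

theorem Fn.tri {cd cw a : ℕ} {c : Prog Proc Word} {F : ℕ → St → Prop}
    (h : Fn E t W L cd cw c s p F) (hd : d + cd ≤ L) :
    Tri E t W d c s p (((cw + a : ℕ) : ℝ≥0∞) * E.th ^ L)
      (fun v d' s' e' => F v s' ∧ d' ≤ d + cd ∧ (a : ℝ≥0∞) * E.th ^ L ≤ e') := by
  intro t' ht' W' hW k s₀ px ex hs hk
  refine h t' ht' W' hW k s₀ px ex d (cw + a) hs hd (by omega)
    fun t'' ht'' W'' hW'' v d' w' s' h1 h2 h3 h4 => ?_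
  refine hk t'' ht'' W'' hW'' v d' s' _ ⟨h3, h1, ?_⟩ h4
  have : a ≤ w' := by omega
  gcongr

open Classical in
/-- The permissions of task `i` of `n` tasks, where cells are owned by tasks or shared. -/
noncomputable def Share.split (n : ℕ) (own : ℕ × ℕ → Option ℕ) (p : Share) (i : ℕ) : Share :=
  fun a => if own a = none then p a / n else if own a = some i then p a else 0

section
variable {n : ℕ} {own : ℕ × ℕ → Option ℕ}

theorem sum_split (hn : n ≠ 0) (hown : ∀ a i, own a = some i → i < n) (p : Share) :
    ∑ i ∈ Finset.Ico 0 n, Share.split n own p i = p := by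
  ext a
  rw [Finset.sum_apply]
  simp only [Share.split]
  rcases h : own a with _ | i
  · simp only [if_true, Finset.sum_const, Nat.card_Ico, Nat.sub_zero, nsmul_eq_mul]
    rw [mul_div_cancel₀ _ (by exact_mod_cast hn)]
  · simp [hown a i h]

theorem split_shared {a : ℕ × ℕ} {i : ℕ} (h : own a = none) (hi : i < n) (hp : p a ≠ 0) :
    Share.split n own p i a ≠ 0 := by
  have : n ≠ 0 := by omega
  simp [Share.split, h, hp, this]

theorem split_own {a : ℕ × ℕ} {i : ℕ} (h : own a = some i) : Share.split n own p i a = p a := by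
  simp [Share.split, h]

/-- For tasks of bounded depth, each leaves twelve prices at the fixed depth `L`. Two of these
remainders meet at a join, one pays for it and the other goes on. With the `13` instructions per
task of the tree this gives `cw + 25` per task. The depth grows by at most nine per level on the way
down and by eight on the way up. -/
theorem FS.parFor {T : Task} {k : ℕ → Prog Proc Word} {F : ℕ → ℕ → St → Prop} {cd cw j c c' : ℕ}
    (own : ℕ × ℕ → Option ℕ) (hown : ∀ a i, own a = some i → i < n)
    (hc : c = cd + 17 * j + 4) (hc' : c' = n * (cw + 25) + 3)
    (hd : d + c ≤ L) (hw : c' ≤ w) (hj : n ≤ 2 ^ j)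
    (hbd : 3 ≤ E.bd) (hn : 2 * n ≤ E.bd)
    (hF : ∀ i < n, ∀ v s s', Agree (Share.split n own p i) s s' → F i v s → F i v s')
    (hF1 : ∀ i < n, ∀ v s, F i v s → v ≤ 1)
    (htask : ∀ i < n, Fn E t W L cd cw (T.code i) s (Share.split n own p i)
      (fun v s' => F i v s' ∧ ∀ a, own a = none → p a ≠ 0 → s a = s' a))
    (hk : ∀ t' ≤ t, ∀ W', W ≤ W' → ∀ d' w' s' (vs : ℕ → ℕ), d' ≤ d + c → w ≤ w' + c' →
      (∀ i < n, F i (vs i) s') → (∀ a, own a = none → p a ≠ 0 → s a = s' a) →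
      FS E t' W' L f d' w' (k (∑ i ∈ Finset.range n, vs i)) s' p) :
    FS E t W L f d w (.call (.parFor T 0 n) k) s p := by
  rcases Nat.eq_zero_or_pos n with rfl | hn0
  · refine FS.call (by omega) (by omega) ?_
    rw [code_parFor_bind]
    refine FS.sub (by omega) (by omega) (by omega) (FS.eq (by omega) (by omega) (by omega) ?_)
    rw [if_pos (by simp)]
    have := hk t le_rfl W le_rfl (d + 1 + 1 + 1) (w - 1 - 1 - 1) s (fun _ => 0) (by omega) (by omega)
      (by simp) (fun _ _ _ => rfl)
    simpa using this
  set L' := d + 9 * j + 4 with hL'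
  have key := tri_parFor (E := E) (t := t) (W := W) (T := T) (ρ := Share.split n own p)
    (ε := fun _ => ((cw + 12 : ℕ) : ℝ≥0∞) * E.th ^ L) (L := L') (d := d) (s := s)
    (F := fun i v s' => F i v s' ∧ ∀ a, own a = none → p a ≠ 0 → s a = s' a)
    (R := fun j d e => d ≤ L' + cd + 8 * j ∧ ((12 : ℕ) : ℝ≥0∞) * E.th ^ L ≤ e) (lo := 0) (hi := n)
    (j := j) hbd ?_ ?_ ?_ hn0 (by omega) hn ?_ ?_ ?_ le_rfl
  · rw [sum_split (by omega) hown] at key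
    have h2 := key t le_rfl W le_rfl k s 0 (((w - c' : ℕ) : ℝ≥0∞) * E.th ^ L + f) (.refl _ _) ?_
    · refine h2.weaken (by simp) ?_
      have e1 : c' = n * (cw + 12) + (13 * n - 9) + 12 := by rw [hc']; ring_nf; omega
      have hw' : w = n * (cw + 12) + (13 * n - 9) + 12 + (w - c') := by omega
      rw [hw', Finset.sum_const, Nat.card_Ico, Nat.sub_zero, nsmul_eq_mul]
      rw [show n * (cw + 12) + (13 * n - 9) + 12 + (w - c') - c' = w - c' by omega]
      calc _ ≤ (n : ℝ≥0∞) * (((cw + 12 : ℕ) : ℝ≥0∞) * E.th ^ L) +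
            ((13 * n - 9 : ℕ) : ℝ≥0∞) * E.th ^ L + (((w - c' : ℕ) : ℝ≥0∞) * E.th ^ L + f) := by
            have := th_pow_le E (by omega : L' ≤ L)
            exact add_le_add (add_le_add le_rfl (mul_le_mul' le_rfl this)) le_rfl
        _ ≤ _ := by
          generalize 13 * n - 9 = y
          push_cast
          calc _ ≤ _ := le_self_add (b := 12 * E.th ^ L)
            _ = _ := by ring
    · rintro t' ht' W' hW' v d' s' e' ⟨vs, rfl, hvs, hd', he'⟩ -
      have h3 := hk t' ht' W' hW' d' (w - c') s' vs (by omega) (by omega)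
        (fun i hi => (hvs i (Nat.zero_le _) hi).1) (hvs 0 le_rfl hn0).2
      rw [Finset.range_eq_Ico] at h3
      refine safe.weaken (p := p) h3 (by simp) ?_
      exact le_add_self
  · rintro j' hj' d' e ⟨h1, h2⟩
    refine le_trans ?_ h2
    push_cast
    exact mul_le_mul' le_rfl (th_pow_le E (by omega))
  · rintro j d e ⟨h1, h2⟩
    exact ⟨by omega, h2⟩
  · rintro j' hj' d₁ d₂ e₁ e₂ d' e ⟨h1, h2⟩ ⟨h3, h4⟩ h5 h6
    refine ⟨by omega, ?_⟩
    have hX : (12 * E.th ^ (max d₁ d₂ + 8) : ℝ≥0∞) ≠ ⊤ :=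
      ENNReal.mul_ne_top (by norm_num) (ENNReal.pow_ne_top E.th_ne_top)
    refine (ENNReal.add_le_add_iff_right hX).1 (le_trans ?_ h6)
    refine add_le_add h2 (le_trans ?_ h4)
    push_cast
    exact mul_le_mul' le_rfl (th_pow_le E (by omega))
  · rintro i - hi v s₁ s₂ hag ⟨h1, h2⟩
    exact ⟨hF i hi v _ _ hag h1, fun a ha hp => (h2 a ha hp).trans (hag a (split_shared ha hi hp))⟩
  · rintro i - hi v s₁ ⟨h1, -⟩
    exact hF1 i hi v _ h1
  · rintro i - hi d' hd'
    refine ((htask i hi).tri (a := 12) (by omega)).conseq fun v d'' s' e' h => ?_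
    exact ⟨h.1, by omega, h.2.2⟩

end

end BF

/-! ### Loops whose tasks own disjoint cells -/

namespace BF
variable {E : Env} {t : ℕ} {W : World} {L : ℕ} {f : ℝ≥0∞} {d w : ℕ} {s : St} {p : Share}

/-- Safety only has to be shown in states where all shares together are at most one, so the same may
be assumed of `p`. -/
theorem safe.of_le_one {θ : Thread Proc} {e : ℝ≥0∞} (h : p ≤ 1 → safe E t W θ s p e) :
    safe E t W θ s p e := by
  cases t with
  | zero => trivial
  | succ t =>
    intro W' s' pF pW eW δ hW hs hok
    refine h (le_trans ?_ hok.le_one) W' s' pF pW eW δ hW hs hok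
    rw [add_assoc]
    exact le_self_add

/-- The frame is absorbed into one share `P`. Because of `P ≤ 1`, the frame has a part of a cell
only where `p` is below one, so the cells that `p` owns completely are free to change. -/
theorem Fn.intro {cd cw : ℕ} {c : Prog Proc Word} {F : ℕ → St → Prop}
    (h : ∀ t' ≤ t, ∀ W', W ≤ W' → ∀ (k : ℕ → Prog Proc Word) s₀ P f d w, p ≤ P →
      P ≤ 1 → Agree p s s₀ → d + cd ≤ L → cw ≤ w →
      (∀ t'' ≤ t', ∀ W'', W' ≤ W'' → ∀ (v : ℕ) d' w' s', d' ≤ d + cd → w ≤ w' + cw → F v s' →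
        (∀ x, p x < 1 → P x ≠ 0 → s₀ x = s' x) → FS E t'' W'' L f d' w' (k v) s' P) →
      FS E t' W' L f d w (c.bind k) s₀ P) : Fn E t W L cd cw c s p F := by
  intro t' ht' W' hW' k s₀ px f d w hag hd hw hk
  refine safe.of_le_one fun hle => ?_
  refine h t' ht' W' hW' k s₀ (p + px) f d w le_self_add hle hag hd hw
    fun t'' ht'' W'' hW'' v d' w' s' h1 h2 h3 h4 => hk t'' ht'' W'' hW'' v d' w' s' h1 h2 h3 ?_
  intro x hx
  refine h4 x ?_ (by simp [hx])
  have := hle x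
  simp only [Pi.add_apply, Pi.one_apply] at this
  exact lt_of_lt_of_le (lt_add_of_pos_right _ (pos_iff_ne_zero.2 hx)) this

open Classical in
/-- A parallel loop in which task `i` owns the cells `A i`. -/
theorem FS.parFor_owned {n : ℕ} {T : Task} {k : ℕ → Prog Proc Word} {F : ℕ → ℕ → St → Prop}
    {cd cw j c c' : ℕ} (A : ℕ → ℕ × ℕ → Prop)
    (hA : ∀ i < n, ∀ i' < n, ∀ a, A i a → A i' a → i = i')
    (hc : c = cd + 17 * j + 4) (hc' : c' = n * (cw + 25) + 3)
    (hd : d + c ≤ L) (hw : c' ≤ w) (hj : n ≤ 2 ^ j)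
    (hbd : 3 ≤ E.bd) (hn : 2 * n ≤ E.bd)
    (hF : ∀ i < n, ∀ v s s', (∀ a, A i a → p a ≠ 0 → s a = s' a) → F i v s → F i v s')
    (hF1 : ∀ i < n, ∀ v s, F i v s → v ≤ 1)
    (htask : ∀ i < n, ∀ q : Share, (∀ a, A i a → q a = p a) →
      (∀ a, (∀ i' < n, ¬ A i' a) → p a ≠ 0 → q a ≠ 0) →
      Fn E t W L cd cw (T.code i) s q
      (fun v s' => F i v s' ∧ ∀ a, q a ≠ 0 → ¬ A i a → s a = s' a))
    (hk : ∀ t' ≤ t, ∀ W', W ≤ W' → ∀ d' w' s' (vs : ℕ → ℕ), d' ≤ d + c → w ≤ w' + c' →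
      (∀ i < n, F i (vs i) s') → (∀ a, (∀ i < n, ¬ A i a) → p a ≠ 0 → s a = s' a) →
      FS E t' W' L f d' w' (k (∑ i ∈ Finset.range n, vs i)) s' p) :
    FS E t W L f d w (.call (.parFor T 0 n) k) s p := by
  set own : ℕ × ℕ → Option ℕ := fun a =>
    if h : ∃ i < n, A i a then some h.choose else none with hown
  have h1 : ∀ i < n, ∀ a, A i a → own a = some i := fun i hi a ha => by
    have h : ∃ i < n, A i a := ⟨i, hi, ha⟩
    rw [hown]
    simp only [dif_pos h]
    rw [hA _ h.choose_spec.1 i hi a h.choose_spec.2 ha]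
  have h2 : ∀ a, own a = none ↔ ∀ i < n, ¬ A i a := fun a => by
    rw [hown]
    by_cases h : ∃ i < n, A i a
    · simp only [dif_pos h]; simpa using h
    · simp only [dif_neg h]; simpa using h
  refine FS.parFor own (F := F) (fun a i ha => ?_) hc hc' hd hw hj hbd hn
    (fun i hi v s s' hag => hF i hi v s s' fun a ha hp => hag a ?_) hF1 (fun i hi => ?_)
    (fun t' ht' W' hW' d' w' s' vs g1 g2 g3 g4 => hk t' ht' W' hW' d' w' s' vs g1 g2 g3
      fun a ha => g4 a ((h2 a).2 ha))
  · rw [hown] at ha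
    by_cases h : ∃ i < n, A i a
    · simp only [dif_pos h, Option.some.injEq] at ha
      rw [← ha]; exact h.choose_spec.1
    · simp [dif_neg h] at ha
  · rwa [split_own (h1 i hi a ha)]
  · have := htask i hi (Share.split n own p i) (fun a ha => split_own (h1 i hi a ha))
      (fun a ha hp => split_shared ((h2 a).2 ha) hi hp)
    intro t' ht' W' hW' k s₀ px f d w hag hd hw hk
    refine this t' ht' W' hW' k s₀ px f d w hag hd hw
      fun t'' ht'' W'' hW'' v d' w' s' g1 g2 g3 g4 => hk t'' ht'' W'' hW'' v d' w' s' g1 g2 ?_ g4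
    exact ⟨g3.1, fun a ha hp => g3.2 a (split_shared ha hi hp) ((h2 a).1 ha i hi)⟩

variable {N : ℕ} {rk : ℕ → ℕ}

theorem one_le_of_le {q P : Share} (h : q ≤ P) {a : ℕ × ℕ} (ha : 1 ≤ q a) : 1 ≤ P a := ha.trans (h a)

theorem ne_zero_of_le {q P : Share} (h : q ≤ P) {a : ℕ × ℕ} (ha : q a ≠ 0) : P a ≠ 0 :=
  fun h0 => ha (le_antisymm (h0 ▸ h a) zero_le)

theorem update_agree {q P : Share} {a : ℕ × ℕ} {v : ℕ} {s : St} (ha : 1 ≤ q a) (x : ℕ × ℕ)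
    (hx : q x < 1) (_ : P x ≠ 0) : s x = Function.update s a v x := by
  rw [Function.update_of_ne]
  rintro rfl
  exact absurd ha (not_le.2 hx)

/-- Clearing an array. -/
theorem FS.clear {n F j : ℕ} {k : ℕ → Prog Proc Word} {c c' : ℕ}
    (hc : c = 17 * j + 6) (hc' : c' = n * 27 + 3)
    (hd : d + c ≤ L) (hw : c' ≤ w) (hj : n ≤ 2 ^ j)
    (hbd : 3 ≤ E.bd) (hn : 2 * n ≤ E.bd) (hFn : F + n ≤ E.bd + W.nx)
    (hp : ∀ i < n, 1 ≤ p (0, F + i))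
    (hk : ∀ t' ≤ t, ∀ W', W ≤ W' → ∀ d' w' s' v, d' ≤ d + c → w ≤ w' + c' →
      (∀ i < n, s' (0, F + i) = 0) → (∀ a, (∀ i < n, a ≠ (0, F + i)) → p a ≠ 0 → s a = s' a) →
      FS E t' W' L f d' w' (k v) s' p) :
    FS E t W L f d w (.call (.parFor (.clear F) 0 n) k) s p := by
  refine FS.parFor_owned (F := fun i v s' => v = 0 ∧ s' (0, F + i) = 0) (cd := 2) (cw := 2)
    (fun i a => a = (0, F + i)) (fun i _ i' _ a h1 h2 => ?_) (hc.trans (by ring)) hc' hd hw hj hbd hn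
    (fun i hi v s s' h1 h2 => ?_) (fun i hi v s h => by omega) (fun i hi q h1 h2 => ?_)
    (fun t' ht' W' hW' d' w' s' vs g1 g2 g3 g4 => hk t' ht' W' hW' d' w' s' _ g1 g2
      (fun i hi => (g3 i hi).2) g4)
  · rw [h1] at h2; simpa using h2
  · rwa [← h1 _ rfl (fun h => by simpa [h] using hp i hi)]
  · refine Fn.intro fun t' ht' W' hW' k s₀ P f d w hqP hP1 hag hd hw hk => ?_
    have hq : 1 ≤ q (0, F + i) := by rw [h1 _ rfl]; exact hp i hi
    have hnx := hW'.2
    simp only [Task.code, Prog.bind_def, Prog.pure_def, Prog.bind_assoc, Prog.bind]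
    refine FS.writeAt (by omega) (by omega) (by omega) (one_le_of_le hqP hq) (Nat.zero_le _) ?_
    refine hk t' le_rfl W' le_rfl 0 _ _ _ (by omega) (by omega) ⟨⟨rfl, by simp⟩, fun a ha hA => ?_⟩
      (update_agree hq)
    rw [Function.update_of_ne hA]
    exact hag a ha

/-- Choosing the pivots. -/
theorem FS.pivot {R l Q q j : ℕ} {k : ℕ → Prog Proc Word} {c c' : ℕ}
    (hc : c = 17 * j + 11) (hc' : c' = q * 32 + 3)
    (hd : d + c ≤ L) (hw : c' ≤ w) (hj : q ≤ 2 ^ j)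
    (hbd : 3 ≤ E.bd) (hn : 2 * q ≤ E.bd) (hl : 1 ≤ l) (hql : q * l ≤ E.bd)
    (hR : R + q * l ≤ E.bd + W.nx) (hQ : Q + q ≤ E.bd + W.nx)
    (hRQ : ∀ i < q * l, ∀ i' < q, R + i ≠ Q + i')
    (hpR : ∀ i < q * l, p (0, R + i) ≠ 0) (hpQ : ∀ i < q, 1 ≤ p (0, Q + i))
    (hRv : ∀ i < q * l, s (0, R + i) ≤ E.bd)
    (hk : ∀ t' ≤ t, ∀ W', W ≤ W' → ∀ d' w' s' v, d' ≤ d + c → w ≤ w' + c' →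
      (∀ i < q, s' (0, Q + i) = s (0, R + ((i + 1) * l - 1))) →
      (∀ a, (∀ i < q, a ≠ (0, Q + i)) → p a ≠ 0 → s a = s' a) →
      FS E t' W' L f d' w' (k v) s' p) :
    FS E t W L f d w (.call (.parFor (.pivot R l Q) 0 q) k) s p := by
  refine FS.parFor_owned (F := fun i v s' => v = 0 ∧ s' (0, Q + i) = s (0, R + ((i + 1) * l - 1)))
    (cd := 7) (cw := 7)
    (fun i a => a = (0, Q + i)) (fun i _ i' _ a h1 h2 => ?_) (hc.trans (by ring)) hc' hd hw hj hbd hn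
    (fun i hi v s s' h1 h2 => ?_) (fun i hi v s h => by omega) (fun i hi q' h1 h2 => ?_)
    (fun t' ht' W' hW' d' w' s' vs g1 g2 g3 g4 => hk t' ht' W' hW' d' w' s' _ g1 g2
      (fun i hi => (g3 i hi).2) g4)
  · rw [h1] at h2; simpa using h2
  · rwa [← h1 _ rfl (fun h => by simpa [h] using hpQ i hi)]
  · refine Fn.intro fun t' ht' W' hW' k s₀ P f d w hqP hP1 hag hd hw hk => ?_
    have hq : 1 ≤ q' (0, Q + i) := by rw [h1 _ rfl]; exact hpQ i hi
    have hnx := hW'.2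
    have hil : (i + 1) * l ≤ q * l := Nat.mul_le_mul_right _ hi
    have hil' : 1 * l ≤ (i + 1) * l := Nat.mul_le_mul_right _ (by omega)
    have hlt : (i + 1) * l - 1 < q * l := by omega
    have hq0 : q' (0, R + ((i + 1) * l - 1)) ≠ 0 := h2 _ (fun i' hi' h => by
      simp only [Prod.mk.injEq, true_and] at h
      exact hRQ _ hlt i' hi' h) (hpR _ hlt)
    simp only [Task.code, Prog.bind_def, Prog.pure_def, Prog.bind_assoc, Prog.bind, BF.alu]
    refine FS.add (by omega) (by omega) (by omega) ?_
    refine FS.mul (by omega) (by omega) (by omega) ?_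
    refine FS.sub (by omega) (by omega) (by omega) ?_
    refine FS.readAt (by omega) (by omega) (by omega) (ne_zero_of_le hqP hq0) ?_
    rw [← hag _ hq0]
    have := hRv _ hlt
    refine FS.writeAt (by omega) (by omega) (by omega) (one_le_of_le hqP hq) (by omega) ?_
    refine hk t' le_rfl W' le_rfl 0 _ _ _ (by omega) (by omega)
      ⟨⟨rfl, by simp⟩, fun a ha hA => ?_⟩ (update_agree hq)
    rw [Function.update_of_ne hA]
    exact hag a ha

/-! ## Sorting the samples -/

/-- The number of keys below the key of `i`. -/
def keyPos (key : ℕ → ℕ) (m i : ℕ) : ℕ := ((Finset.range m).filter fun j => key j < key i).card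

theorem keyPos_lt {key : ℕ → ℕ} {m i : ℕ} (hi : i < m) : keyPos key m i < m := by
  refine lt_of_lt_of_eq (Finset.card_lt_card (t := Finset.range m) ?_) (Finset.card_range m)
  refine Finset.filter_ssubset.2 ⟨i, Finset.mem_range.2 hi, lt_irrefl _⟩

theorem keyPos_mono {key : ℕ → ℕ} {m i j : ℕ} (hi : i < m) (h : key i < key j) :
    keyPos key m i < keyPos key m j := by
  refine Finset.card_lt_card (Finset.ssubset_iff_of_subset (fun x hx => ?_) |>.2 ⟨i, ?_, ?_⟩)
  · rw [Finset.mem_filter] at hx ⊢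
    exact ⟨hx.1, hx.2.trans h⟩
  · rw [Finset.mem_filter, Finset.mem_range]; exact ⟨hi, h⟩
  · simp

theorem keyPos_inj {key : ℕ → ℕ} {m i j : ℕ} (hi : i < m) (hj : j < m)
    (h : keyPos key m i = keyPos key m j) : key i = key j := by
  rcases lt_trichotomy (key i) (key j) with h1 | h1 | h1
  · exact absurd h (keyPos_mono hi h1).ne
  · exact h1
  · exact absurd h.symm (keyPos_mono hj h1).ne

/-- The key of entry `i` of an array of length `m`, with ties broken by position. -/
def tieKey (rk Y : ℕ → ℕ) (m i : ℕ) : ℕ := rk (Y i) * m + i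

theorem tieKey_lt_iff {rk Y : ℕ → ℕ} {m i j : ℕ} (hi : i < m) (hj : j < m) :
    tieKey rk Y m i < tieKey rk Y m j ↔ rk (Y i) < rk (Y j) ∨ rk (Y i) = rk (Y j) ∧ i < j := by
  unfold tieKey
  rcases lt_trichotomy (rk (Y i)) (rk (Y j)) with h | h | h
  · have : (rk (Y i) + 1) * m ≤ rk (Y j) * m := Nat.mul_le_mul_right _ h
    rw [add_mul] at this
    simp only [h, true_or, iff_true]
    omega
  · simp [h]
  · have : (rk (Y j) + 1) * m ≤ rk (Y i) * m := Nat.mul_le_mul_right _ h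
    rw [add_mul] at this
    have h2 : ¬ rk (Y i) < rk (Y j) := by omega
    have h3 : ¬ rk (Y i) = rk (Y j) := by omega
    simp only [h2, h3, false_and, or_false, iff_false]
    omega

theorem FS.precedes (hr : Ranked E N rk) {S m x i j : ℕ} {Y : ℕ → ℕ} {k : ℕ → Prog Proc Word} {c c' : ℕ}
    (hc : c = 17 * j + 11) (hc' : c' = m * 32 + 3)
    (hd : d + c ≤ L) (hw : c' ≤ w) (hj : m ≤ 2 ^ j)
    (hbd : 3 ≤ E.bd) (hn : 2 * m ≤ E.bd) (hS : S + m ≤ E.bd + W.nx)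
    (hp : ∀ i < m, p (0, S + i) ≠ 0) (hY : ∀ i < m, s (0, S + i) = Y i) (hYN : ∀ i < m, Y i < N)
    (hi : i < m) (hx : x = Y i)
    (hk : ∀ t' ≤ t, ∀ W', W ≤ W' → ∀ d' w' s', d' ≤ d + c → w ≤ w' + c' →
      Agree p s s' → FS E t' W' L f d' w' (k (keyPos (tieKey rk Y m) m i)) s' p) :
    FS E t W L f d w (.call (.parFor (.precedes S x i) 0 m) k) s p := by
  refine FS.parFor_owned
    (F := fun j v s' => v = if tieKey rk Y m j < tieKey rk Y m i then 1 else 0) (cd := 7) (cw := 7)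
    (fun i a => False) (fun i _ i' _ a h1 h2 => h1.elim) (hc.trans (by ring)) hc' hd hw hj hbd hn
    (fun i hi v s s' h1 h2 => h2) (fun i hi v s h => by rw [h]; split_ifs <;> omega)
    (fun i' hi' q h1 h2 => ?_)
    (fun t' ht' W' hW' d' w' s' vs g1 g2 g3 g4 => ?_)
  · refine Fn.intro fun t' ht' W' hW' k s₀ P f d w hqP hP1 hag hd hw hk => ?_
    have hnx := hW'.2
    have hq := h2 (0, S + i') (by simp) (hp i' hi')
    simp only [Task.code, Prog.bind_def, Prog.pure_def, Prog.bind_assoc, Prog.bind, BF.alu,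
      Prog.bind_ite]
    refine FS.readAt (by omega) (by omega) (by omega) (ne_zero_of_le hqP hq) ?_
    rw [← hag _ hq, hY i' hi', hx]
    refine FS.less hr (hYN i' hi') (hYN i hi) (by omega) (by omega) (by omega)
      fun d₁ w₁ h3 h4 => ?_
    have key := tieKey_lt_iff (rk := rk) (Y := Y) hi' hi
    have hfin : ∀ v d' w', d' ≤ d + 7 → w ≤ w' + 7 →
        v = (if tieKey rk Y m i' < tieKey rk Y m i then 1 else 0) →
        FS E t' W' L f d' w' (k v) s₀ P := fun v d' w' h5 h6 h7 =>
      hk t' le_rfl W' le_rfl v d' w' s₀ h5 h6 ⟨h7, fun a ha _ => hag a ha⟩ (fun _ _ _ => rfl)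
    by_cases h5 : rk (Y i') < rk (Y i)
    · simp only [if_pos h5, if_true]
      exact hfin _ _ _ (by omega) (by omega) (by rw [if_pos (key.2 (.inl h5))])
    simp only [if_neg h5, zero_ne_one, if_false]
    refine FS.eq (by omega) (by omega) (by omega) ?_
    by_cases h6 : Y i' = Y i
    · simp only [if_pos h6, one_ne_zero, if_false]
      refine FS.lt (by omega) (by omega) (by omega) ?_
      refine hfin _ _ _ (by omega) (by omega) ?_
      simp only [key, h6, lt_irrefl, false_or, true_and]
    · simp only [if_neg h6, if_true]
      refine hfin _ _ _ (by omega) (by omega) ?_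
      rw [if_neg]
      rw [key]
      rintro (h7 | ⟨h7, -⟩)
      · exact h5 h7
      · exact h6 (hr.inj _ (hYN i' hi') _ (hYN i hi) h7)
  · have := hk t' ht' W' hW' d' w' s' g1 g2 (fun a ha => g4 a (by simp) ha)
    rw [Finset.sum_congr rfl (fun i hi => g3 i (Finset.mem_range.1 hi)), Finset.sum_boole]
    exact this

/-- Samples are drawn with replacement and may coincide. Breaking ties by position makes the ranks
distinct, so that the parallel tasks write to different cells. -/
theorem tiePos_inj {rk Y : ℕ → ℕ} {m i i' : ℕ} (hi : i < m) (hi' : i' < m)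
    (h : keyPos (tieKey rk Y m) m i = keyPos (tieKey rk Y m) m i') : i = i' := by
  have h1 := keyPos_inj hi hi' h
  have h2 := tieKey_lt_iff (rk := rk) (Y := Y) hi hi'
  have h3 := tieKey_lt_iff (rk := rk) (Y := Y) hi' hi
  rw [h1] at h2 h3
  simp only [lt_irrefl, false_iff, not_or, not_and] at h2 h3
  omega

theorem tiePos_surj {rk Y : ℕ → ℕ} {m a : ℕ} (ha : a < m) :
    ∃ i < m, keyPos (tieKey rk Y m) m i = a := by
  obtain ⟨i, hi, h⟩ := Finset.surj_on_of_inj_on_of_card_le (s := Finset.range m)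
    (t := Finset.range m) (fun i _ => keyPos (tieKey rk Y m) m i)
    (fun i hi => Finset.mem_range.2 (keyPos_lt (Finset.mem_range.1 hi)))
    (fun i i' hi hi' h => tiePos_inj (Finset.mem_range.1 hi) (Finset.mem_range.1 hi') h) le_rfl
    a (Finset.mem_range.2 ha)
  exact ⟨i, Finset.mem_range.1 hi, h.symm⟩

/-- Task `i` owns the cell that it will write, although the program finds the address only by
counting. The samples do not change during the loop, so permissions may depend on their values. -/
theorem FS.place (hr : Ranked E N rk) {S m R j : ℕ} {Y : ℕ → ℕ} {k : ℕ → Prog Proc Word} {c c' : ℕ}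
    (hc : c = 34 * j + 19) (hc' : c' = m * (m * 32 + 32) + 3)
    (hd : d + c ≤ L) (hw : c' ≤ w) (hj : m ≤ 2 ^ j)
    (hbd : 3 ≤ E.bd) (hN : N ≤ E.bd) (hn : 2 * m ≤ E.bd) (hS : S + m ≤ E.bd + W.nx)
    (hR : R + m ≤ E.bd + W.nx)
    (hSR : ∀ i < m, ∀ i' < m, S + i ≠ R + i')
    (hp : ∀ i < m, p (0, S + i) ≠ 0) (hpR : ∀ i < m, 1 ≤ p (0, R + i))
    (hY : ∀ i < m, s (0, S + i) = Y i) (hYN : ∀ i < m, Y i < N)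
    (hk : ∀ t' ≤ t, ∀ W', W ≤ W' → ∀ d' w' s' v, d' ≤ d + c → w ≤ w' + c' →
      (∀ i < m, s' (0, R + keyPos (tieKey rk Y m) m i) = Y i) →
      (∀ a, (∀ i < m, a ≠ (0, R + i)) → p a ≠ 0 → s a = s' a) →
      FS E t' W' L f d' w' (k v) s' p) :
    FS E t W L f d w (.call (.parFor (.place S m R) 0 m) k) s p := by
  set pos := keyPos (tieKey rk Y m) m with hpos
  have pos_lt : ∀ i < m, pos i < m := fun i hi => keyPos_lt hi
  have pos_inj : ∀ i < m, ∀ i' < m, pos i = pos i' → i = i' := fun i hi i' hi' h => tiePos_inj hi hi' h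
  refine FS.parFor_owned (F := fun i v s' => v = 0 ∧ s' (0, R + pos i) = Y i)
    (cd := 17 * j + 15) (cw := m * 32 + 7)
    (fun i a => a = (0, R + pos i)) (fun i hi i' hi' a h1 h2 => ?_) (hc.trans (by ring))
    hc' hd hw hj hbd hn
    (fun i hi v s s' h1 h2 => ?_) (fun i hi v s h => by omega) (fun i hi q h1 h2 => ?_)
    (fun t' ht' W' hW' d' w' s' vs g1 g2 g3 g4 => hk t' ht' W' hW' d' w' s' _ g1 g2
      (fun i hi => (g3 i hi).2) fun a ha hp => g4 a (fun i hi => ha _ (pos_lt i hi)) hp)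
  · rw [h1] at h2
    simp only [Prod.mk.injEq, true_and] at h2
    exact pos_inj i hi i' hi' (by omega)
  · rwa [← h1 _ rfl (fun h => by simpa [h] using hpR _ (pos_lt i hi))]
  · refine Fn.intro fun t' ht' W' hW' k s₀ P f d w hqP hP1 hag hd hw hk => ?_
    have hq : 1 ≤ q (0, R + pos i) := by rw [h1 _ rfl]; exact hpR _ (pos_lt i hi)
    have hnx := hW'.2
    have hq0 : ∀ i < m, q (0, S + i) ≠ 0 := fun i hi => h2 _ (fun i' hi' h => by
      simp only [Prod.mk.injEq, true_and] at h
      exact hSR _ hi _ (pos_lt i' hi') h) (hp i hi)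
    simp only [Task.code, Prog.bind_def, Prog.pure_def, Prog.bind_assoc, Prog.bind, BF.call]
    refine FS.readAt (by omega) (by omega) (by omega) (ne_zero_of_le hqP (hq0 i hi)) ?_
    rw [← hag _ (hq0 i hi), hY i hi]
    refine FS.precedes hr (Y := Y) (i := i) rfl rfl (by omega) (by omega) hj hbd hn (by omega)
      (fun i hi => ne_zero_of_le hqP (hq0 i hi))
      (fun i hi => by rw [← hag _ (hq0 i hi)]; exact hY i hi) hYN hi rfl
      fun t'' ht'' W'' hW'' d' w' s' h5 h6 h7 => ?_
    have hnx' := hW''.2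
    have h8 := hYN i hi
    have h9 : keyPos (tieKey rk Y m) m i < m := pos_lt i hi
    refine FS.writeAt (by omega) (by omega) (by omega) (one_le_of_le hqP hq)
      (h8.le.trans (by omega)) ?_
    refine hk t'' ht'' W'' hW'' 0 _ _ _ (by omega) (by omega)
      ⟨⟨rfl, by simp [hpos]⟩, fun a ha hA => ?_⟩ fun x hx hx' => ?_
    · rw [Function.update_of_ne hA, ← h7 a (ne_zero_of_le hqP ha)]
      exact hag a ha
    · rw [h7 x hx']
      exact update_agree hq x hx hx'

end BF

namespace BF
variable {E : Env} {t : ℕ} {W : World} {L : ℕ} {f : ℝ≥0∞} {d w : ℕ} {s : St} {p : Share}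

/-! ## Binary forking with costs -/

open Classical in
/-- Two programs run in parallel, where side `j` owns the cells `A j`. -/
theorem FS.par {c : Bool → Prog Proc Word} {k : ℕ × ℕ → Prog Proc Word} {F : Bool → ℕ → St → Prop}
    {cd : ℕ} {cw : Bool → ℕ} (A : Bool → ℕ × ℕ → Prop) (hA : ∀ a, A false a → A true a → False)
    (hd : d + cd + 10 ≤ L) (hw : cw false + cw true + 25 ≤ w) (hbd : 3 ≤ E.bd)
    (hF : ∀ j v s s', (∀ a, A j a → p a ≠ 0 → s a = s' a) → F j v s → F j v s')
    (hF1 : ∀ j v s, F j v s → v ≤ E.bd)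
    (htask : ∀ j, ∀ q : Share, (∀ a, A j a → q a = p a) →
      (∀ a, (∀ j', ¬ A j' a) → p a ≠ 0 → q a ≠ 0) →
      Fn E t W L cd (cw j) (c j) s q
        (fun v s' => F j v s' ∧ ∀ a, q a ≠ 0 → ¬ A j a → s a = s' a))
    (hk : ∀ t' ≤ t, ∀ W', W ≤ W' → ∀ d' w' s' (v : Bool → ℕ), d' ≤ d + cd + 10 →
      w ≤ w' + (cw false + cw true + 25) → (∀ j, F j (v j) s') →
      (∀ a, (∀ j, ¬ A j a) → p a ≠ 0 → s a = s' a) →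
      FS E t' W' L f d' w' (k (v false, v true)) s' p) :
    FS E t W L f d w ((par (c false) (c true)).bind k) s p := by
  set P : Bool → Share := fun j a => if A j a then p a else if A (!j) a then 0 else p a / 2 with hP
  have hsum : P false + P true = p := by
    ext a
    simp only [hP, Pi.add_apply, Bool.not_false, Bool.not_true]
    by_cases h0 : A false a <;> by_cases h1 : A true a
    · exact (hA a h0 h1).elim
    · simp [h0, h1]
    · simp [h0, h1]
    · simp [h0, h1]
  have hP1 : ∀ j a, A j a → P j a = p a := fun j a ha => by simp [hP, ha]
  have hP2 : ∀ j a, (∀ j', ¬ A j' a) → p a ≠ 0 → P j a ≠ 0 := fun j a ha hp => by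
    simp [hP, ha j, ha (!j), hp]
  have tri := fun j => (htask j (P j) (hP1 j) (hP2 j)).tri (d := d + 3) (a := 11) (by omega)
  set X : ℝ≥0∞ := ((w - (cw false + cw true + 25) : ℕ) : ℝ≥0∞) * E.th ^ L + f with hX
  refine safe.par (q := c)
    (P := P) (eP := fun j => ((cw j + 11 : ℕ) : ℝ≥0∞) * E.th ^ L + if j then 0 else X)
    (Q := fun j v d' s' e' => ∃ e₀, e' = e₀ + (if j then 0 else X) ∧
      ((F j v s' ∧ ∀ a, P j a ≠ 0 → ¬ A j a → s a = s' a) ∧ d' ≤ d + 3 + cd ∧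
        ((11 : ℕ) : ℝ≥0∞) * E.th ^ L ≤ e₀)) (fun j => ?_) ?_ hsum ?_ hbd ?_
  · have := (tri j).frame 0 (if j then 0 else X)
    rw [add_zero] at this
    exact this.conseq fun v d' s' e' ⟨e₀, h1, h2, _⟩ => ⟨e₀, h1, h2⟩
  · rintro j v d' s' e' ⟨e₀, rfl, h1, h2, h3⟩
    refine ⟨hF1 j v _ h1.1, le_trans (le_trans ?_ h3) le_self_add⟩
    push_cast
    exact mul_le_mul' le_rfl (th_pow_le E (by omega))
  · simp only [Bool.false_eq_true, if_false, if_true, add_zero]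
    have hw' : w = (w - (cw false + cw true + 25)) + cw false + cw true + 25 := by omega
    rw [hw', hX]
    generalize w - (cw false + cw true + 25) = y
    calc _ ≤ 3 * E.th ^ L + _ :=
          add_le_add (mul_le_mul' le_rfl (th_pow_le E (by omega : d + 3 ≤ L))) le_rfl
      _ = _ := by push_cast; ring
  · intro t' ht' W' hW' v d' e' s₁ s' i ef hQ hag hle
    choose e₀ he₀ hq hd' h11 using hQ
    have hX' : (11 * E.th ^ (max (d' false) (d' true) + 7) : ℝ≥0∞) ≠ ⊤ :=
      ENNReal.mul_ne_top (by norm_num) (ENNReal.pow_ne_top E.th_ne_top)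
    have h5 : max (d' false) (d' true) ≤ d + 3 + cd := max_le (hd' _) (hd' _)
    have hef : X + 11 * E.th ^ L ≤ ef := by
      refine (ENNReal.add_le_add_iff_right hX').1 (le_trans ?_ hle)
      have h6 := h11 false
      have h7 := h11 true
      rw [he₀ false, he₀ true]
      simp only [Bool.false_eq_true, if_false, if_true, add_zero]
      push_cast at h6 h7
      have h8 : (11 * E.th ^ (max (d' false) (d' true) + 7) : ℝ≥0∞) ≤ 11 * E.th ^ L :=
        mul_le_mul' le_rfl (th_pow_le E (by omega))
      calc _ ≤ X + e₀ true + e₀ false := add_le_add (add_le_add le_rfl h7) (h8.trans h6)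
        _ = _ := by ring
    rw [hsum]
    have := hk t' ht' W' hW' (d' i + 7) (w - (cw false + cw true + 25)) s' v
      (by have := hd' i; omega) (by omega)
      (fun j => hF j _ _ _ (fun a ha hp => hag j a (by rwa [hP1 j a ha])) (hq j).1)
      (fun a ha hp => ((hq false).2 a (hP2 _ a ha hp) (ha _)).trans (hag false a (hP2 _ a ha hp)))
    exact safe.weaken (p := p) this le_rfl (le_trans le_self_add hef)

/-! ## Counting the flags -/

/-- The array `T` holds the sums of the left halves of a binary tree over `lo, …, hi - 1`. -/
inductive TreeSum (φ T : ℕ → ℕ) : ℕ → ℕ → Prop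
  | leaf (lo : ℕ) : TreeSum φ T lo (lo + 1)
  | node (lo hi mid : ℕ) (hmid : mid = (lo + hi) / 2) (h2 : lo + 2 ≤ hi)
      (hT : T mid = ∑ i ∈ Finset.Ico lo mid, φ i) (hl : TreeSum φ T lo mid)
      (hr : TreeSum φ T mid hi) : TreeSum φ T lo hi

theorem TreeSum.congr {φ T T' : ℕ → ℕ} {lo hi : ℕ} (h : TreeSum φ T lo hi)
    (hT : ∀ i, lo < i → i < hi → T i = T' i) : TreeSum φ T' lo hi := by
  induction h with
  | leaf lo => exact .leaf lo
  | node lo hi mid hmid h2 hTm _ _ ihl ihr =>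
    exact .node lo hi mid hmid h2 (by rw [← hT mid (by omega) (by omega)]; exact hTm)
      (ihl fun i h h' => hT i h (by omega)) (ihr fun i h h' => hT i (by omega) h')

/-- Every number strictly between `lo` and `hi` is the midpoint of exactly one inner node of the
recursion, so the partial sums need one cell each and the two halves write to disjoint ranges. An
inner node costs `33` instructions and a leaf five. -/
theorem Fn.sumFlags {F T lo hi j : ℕ} {φ : ℕ → ℕ} (hj : hi - lo ≤ 2 ^ j) (hlo : lo < hi)
    (hbd : 3 ≤ E.bd) (hhi : 2 * hi ≤ E.bd) (hFb : F + hi ≤ E.bd + W.nx) (hTb : T + hi ≤ E.bd + W.nx)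
    (hφ : ∀ i, lo ≤ i → i < hi → s (0, F + i) = φ i) (hφ1 : ∀ i, φ i ≤ 1)
    (hpF : ∀ i, lo ≤ i → i < hi → p (0, F + i) ≠ 0)
    (hpT : ∀ i, lo < i → i < hi → 1 ≤ p (0, T + i))
    (hFT : ∀ i, lo ≤ i → i < hi → ∀ i', lo < i' → i' < hi → F + i ≠ T + i') :
    Fn E t W L (18 * j + 5) (38 * (hi - lo) - 33) (.call (.sumFlags F T lo hi) .ret) s p
      (fun v s' => (v = ∑ i ∈ Finset.Ico lo hi, φ i ∧ TreeSum φ (fun i => s' (0, T + i)) lo hi) ∧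
        ∀ a, p a ≠ 0 → (∀ i, lo < i → i < hi → a ≠ (0, T + i)) → s a = s' a) := by
  induction j generalizing lo hi s p t W with
  | zero =>
    obtain rfl : hi = lo + 1 := by omega
    refine Fn.intro fun t' ht' W' hW' k s₀ P f d w hpP hP1 hag hd hw hk => ?_
    have hnx := hW'.2
    change FS E t' W' L f d w (.call (.sumFlags F T lo (lo + 1)) k) s₀ P
    refine FS.call (by omega) (by omega) ?_
    simp only [Proc.code, Prog.bind_def, BF.call, BF.alu, Prog.bind, Prog.bind_ite,
      Prog.bind_assoc]
    refine FS.sub (by omega) (by omega) (by omega) ?_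
    refine FS.eq (by omega) (by omega) (by omega) ?_
    rw [if_pos (by rw [ite_one_zero]; omega)]
    have h0 := hpF lo le_rfl (by omega)
    refine FS.readAt (by omega) (by omega) (by omega) (ne_zero_of_le hpP h0) ?_
    refine hk t' le_rfl W' le_rfl _ _ _ s₀ (by omega) (by omega)
      ⟨⟨?_, .leaf lo⟩, fun a ha _ => hag a ha⟩ (fun _ _ _ => rfl)
    rw [← hag _ h0, hφ lo le_rfl (by omega)]
    simp
  | succ j ih =>
    rcases (by omega : hi = lo + 1 ∨ lo + 2 ≤ hi) with rfl | h2
    · have := ih (s := s) (p := p) (t := t) (W := W) (lo := lo) (hi := lo + 1)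
        (by rw [Nat.add_sub_cancel_left]; exact Nat.one_le_two_pow) hlo hhi hFb hTb hφ hpF hpT hFT
      intro t' ht' W' hW' k s₀ px f d w hag hd hw hk
      exact this t' ht' W' hW' k s₀ px f d w hag (by omega) hw
        fun t'' ht'' W'' hW'' v d' w' s' h1 => hk t'' ht'' W'' hW'' v d' w' s' (by omega)
    refine Fn.intro fun t' ht' W' hW' k s₀ P f d w hpP hP1 hag hd hw hk => ?_
    have hnx := hW'.2
    have h2j : 2 ^ (j + 1) = 2 * 2 ^ j := by ring
    change FS E t' W' L f d w (.call (.sumFlags F T lo hi) k) s₀ P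
    refine FS.call (by omega) (by omega) ?_
    simp only [Proc.code, Prog.bind_def, BF.alu, Prog.bind, Prog.bind_ite,
      Prog.bind_assoc]
    refine FS.sub (by omega) (by omega) (by omega) ?_
    refine FS.eq (by omega) (by omega) (by omega) ?_
    rw [if_neg (by rw [ite_one_zero]; omega)]
    refine FS.add (by omega) (by omega) (by omega) ?_
    refine FS.div (by omega) (by omega) (by omega) ?_
    obtain ⟨mid, hmid⟩ : ∃ mid, mid = (lo + hi) / 2 := ⟨_, rfl⟩
    rw [← hmid]
    have hsum : ∑ i ∈ Finset.Ico lo hi, φ i =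
        ∑ i ∈ Finset.Ico lo mid, φ i + ∑ i ∈ Finset.Ico mid hi, φ i :=
      (Finset.sum_Ico_consecutive φ (by omega) (by omega)).symm
    have hle : ∀ a b, ∑ i ∈ Finset.Ico a b, φ i ≤ b - a := fun a b => by
      calc _ ≤ ∑ i ∈ Finset.Ico a b, 1 := Finset.sum_le_sum fun i _ => hφ1 i
        _ = b - a := by simp
    have hl := hle lo mid
    have hr := hle mid hi
    have hpm : 1 ≤ p (0, T + mid) := hpT mid (by omega) (by omega)
    let lo' : Bool → ℕ := fun b => if b then mid else lo
    let hi' : Bool → ℕ := fun b => if b then hi else mid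
    have hlo' : ∀ b, lo ≤ lo' b ∧ lo' b < hi' b ∧ hi' b ≤ hi ∧ hi' b - lo' b ≤ 2 ^ j := by
      intro b; cases b <;> simp [lo', hi'] <;> omega
    refine FS.par (c := fun b => .call (.sumFlags F T (lo' b) (hi' b)) .ret)
      (cd := 18 * j + 5) (cw := fun b => 38 * (hi' b - lo' b) - 33)
      (F := fun b v s' => v = ∑ i ∈ Finset.Ico (lo' b) (hi' b), φ i ∧
        TreeSum φ (fun i => s' (0, T + i)) (lo' b) (hi' b))
      (fun b a => ∃ i, lo' b < i ∧ i < hi' b ∧ a = (0, T + i)) ?_ (by omega) ?_ hbd ?_ ?_ ?_ ?_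
    · rintro a ⟨i, h3, h4, h5⟩ ⟨i', h6, h7, h8⟩
      rw [h5] at h8
      simp [lo', hi'] at h3 h4 h6 h7 h8
      omega
    · simp [lo', hi']; omega
    · rintro b v s₁ s₂ h3 ⟨h4, h5⟩
      refine ⟨h4, h5.congr fun i h6 h7 => h3 _ ⟨i, h6, h7, rfl⟩ fun h => ?_⟩
      obtain ⟨h8, h9, h10, -⟩ := hlo' b
      have := one_le_of_le hpP (hpT i (by omega) (by omega))
      simp [h] at this
    · rintro b v s₁ ⟨h3, -⟩
      obtain ⟨h8, h9, h10, -⟩ := hlo' b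
      have := hle (lo' b) (hi' b)
      omega
    · intro b q h3 h4
      obtain ⟨h8, h9, h10, h11⟩ := hlo' b
      have hq0 : ∀ i, lo ≤ i → i < hi → q (0, F + i) ≠ 0 := fun i h5 h6 =>
        h4 _ (by
          rintro b' ⟨i', h7, h12, h13⟩
          simp only [Prod.mk.injEq, true_and] at h13
          obtain ⟨g8, g9, g10, -⟩ := hlo' b'
          exact hFT i h5 h6 i' (by omega) (by omega) h13) (ne_zero_of_le hpP (hpF i h5 h6))
      have := ih (s := s₀) (p := q) (t := t') (W := W') h11 h9 (by omega) (by omega) (by omega)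
        (fun i h5 h6 => by rw [← hag _ (hpF i (by omega) (by omega))]; exact hφ i (by omega) (by omega))
        (fun i h5 h6 => hq0 i (by omega) (by omega))
        (fun i h5 h6 => by
          rw [h3 _ ⟨i, h5, h6, rfl⟩]; exact one_le_of_le hpP (hpT i (by omega) (by omega)))
        (fun i h5 h6 i' h7 h12 => hFT i (by omega) (by omega) i' (by omega) (by omega))
      intro t₁ ht₁ W₁ hW₁ k s₁ px f d w hag hd hw hk
      refine this t₁ ht₁ W₁ hW₁ k s₁ px f d w hag hd hw
        fun t'' ht'' W'' hW'' v d' w' s' h1 h2 h3 => hk t'' ht'' W'' hW'' v d' w' s' h1 h2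
          ⟨h3.1, fun a ha hA => h3.2 a ha fun i h5 h6 h7 => hA ⟨i, h5, h6, h7⟩⟩
    · intro t₁ ht₁ W₁ hW₁ d₁ w₁ s₁ v h3 h4 h5 h6
      obtain ⟨h7, h8⟩ : v false = ∑ i ∈ Finset.Ico lo mid, φ i ∧
        TreeSum φ (fun i => s₁ (0, T + i)) lo mid := by simpa [lo', hi'] using h5 false
      obtain ⟨h9, h10⟩ : v true = ∑ i ∈ Finset.Ico mid hi, φ i ∧
        TreeSum φ (fun i => s₁ (0, T + i)) mid hi := by simpa [lo', hi'] using h5 true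
      have hnx1 := hW₁.2
      simp [lo', hi'] at h4
      refine FS.writeAt (by omega) (by omega) (by omega) (one_le_of_le hpP hpm) (by omega) ?_
      refine FS.add (by omega) (by omega) (by omega) ?_
      refine hk t₁ ht₁ W₁ hW₁ _ _ _ _ (by omega) (by omega) ⟨⟨by omega, ?_⟩, fun a ha hA => ?_⟩
        fun x hx hx' => ?_
      · refine .node lo hi mid hmid h2 (by simp [h7]) (h8.congr fun i h h' => ?_)
          (h10.congr fun i h h' => ?_)
        · rw [Function.update_of_ne (by simp; omega)]
        · rw [Function.update_of_ne (by simp; omega)]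
      · rw [Function.update_of_ne (hA mid (by omega) (by omega)), ← h6 a ?_ (ne_zero_of_le hpP ha)]
        · exact hag a ha
        · rintro b ⟨i, h11, h12, h13⟩
          obtain ⟨g8, g9, g10, -⟩ := hlo' b
          exact hA i (by omega) (by omega) h13
      · rw [← update_agree hpm x hx hx', ← h6 x ?_ hx']
        rintro b ⟨i, h11, h12, rfl⟩
        obtain ⟨g8, g9, g10, -⟩ := hlo' b
        exact absurd (hpT i (by omega) (by omega)) (not_le.2 hx)

/-! ## Packing -/

/-- The cells that are written by `pack`. -/
def PackOwn (B out m : ℕ) (φ pc : ℕ → ℕ) (lo hi : ℕ) (a : ℕ × ℕ) : Prop :=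
  ∃ i, lo ≤ i ∧ i < hi ∧ (i % m = 0 ∧ a = (0, B + i / m) ∨ φ i = 1 ∧ a = (0, out + pc i))

theorem PackOwn.mono {B out m : ℕ} {φ pc : ℕ → ℕ} {lo hi lo' hi' : ℕ} {a : ℕ × ℕ}
    (h : PackOwn B out m φ pc lo' hi' a) (h1 : lo ≤ lo') (h2 : hi' ≤ hi) :
    PackOwn B out m φ pc lo hi a :=
  let ⟨i, h3, h4, h5⟩ := h
  ⟨i, h1.trans h3, h4.trans_le h2, h5⟩

theorem PackOwn.of_le {B out m : ℕ} {φ pc : ℕ → ℕ} {lo hi i : ℕ} (h1 : lo ≤ i) (h2 : i < hi) :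
    (i % m = 0 → PackOwn B out m φ pc lo hi (0, B + i / m)) ∧
    (φ i = 1 → PackOwn B out m φ pc lo hi (0, out + pc i)) :=
  ⟨fun h => ⟨i, h1, h2, .inl ⟨h, rfl⟩⟩, fun h => ⟨i, h1, h2, .inr ⟨h, rfl⟩⟩⟩

/-- The flagged entries of `V` have been moved to their places, and the limits been written. -/
def Packed (B out m : ℕ) (φ pc V : ℕ → ℕ) (lo hi : ℕ) (s : St) : Prop :=
  ∀ i, lo ≤ i → i < hi → (i % m = 0 → s (0, B + i / m) = pc i) ∧ (φ i = 1 → s (0, out + pc i) = V i)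

theorem Packed.congr {B out m : ℕ} {φ pc V : ℕ → ℕ} {lo hi : ℕ} {s s' : St}
    (h : Packed B out m φ pc V lo hi s)
    (hs : ∀ a, PackOwn B out m φ pc lo hi a → s a = s' a) : Packed B out m φ pc V lo hi s' :=
  fun i h1 h2 =>
    ⟨fun h3 => by rw [← hs _ ((PackOwn.of_le h1 h2).1 h3)]; exact (h i h1 h2).1 h3,
     fun h3 => by rw [← hs _ ((PackOwn.of_le h1 h2).2 h3)]; exact (h i h1 h2).2 h3⟩

/-- The number `pc i` counts the flags before place `i` and is the position of its element in the
packed array. It increases after every flagged place, so different tasks write to different cells.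
The stored left sums let every call compute `pc` of its lower limit. -/
theorem Fn.pack {F V T m B out lo hi acc j : ℕ} {φ pc Vv : ℕ → ℕ} (hj : hi - lo ≤ 2 ^ j)
    (hlo : lo < hi) (hbd : 3 ≤ E.bd) (hhi : 2 * hi ≤ E.bd) (hFb : F + hi ≤ E.bd + W.nx)
    (hTb : T + hi ≤ E.bd + W.nx) (hVb : V + hi ≤ E.bd + W.nx) (hBb : B + hi ≤ E.bd + W.nx)
    (hob : out + pc hi ≤ E.bd + W.nx) (hpch : pc hi ≤ E.bd)
    (hpc : ∀ i, pc (i + 1) = pc i + φ i) (hacc : acc = pc lo)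
    (hφ : ∀ i, lo ≤ i → i < hi → s (0, F + i) = φ i) (hφ1 : ∀ i, φ i ≤ 1)
    (hV : ∀ i, lo ≤ i → i < hi → φ i = 1 → s (0, V + i) = Vv i ∧ Vv i ≤ E.bd)
    (hT : TreeSum φ (fun i => s (0, T + i)) lo hi)
    (hpF : ∀ i, lo ≤ i → i < hi → p (0, F + i) ≠ 0)
    (hpV : ∀ i, lo ≤ i → i < hi → p (0, V + i) ≠ 0)
    (hpT : ∀ i, lo ≤ i → i < hi → p (0, T + i) ≠ 0)
    (hpA : ∀ a, PackOwn B out m φ pc lo hi a → 1 ≤ p a)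
    (hdis : ∀ i, lo ≤ i → i < hi → ∀ a, PackOwn B out m φ pc lo hi a →
      a ≠ (0, F + i) ∧ a ≠ (0, V + i) ∧ a ≠ (0, T + i))
    (hBo : ∀ i i', lo ≤ i → i < hi → lo ≤ i' → i' < hi → i % m = 0 → φ i' = 1 →
      B + i / m ≠ out + pc i') :
    Fn E t W L (18 * j + 14) (47 * (hi - lo) - 33) (.call (.pack F V T m B out lo hi acc) .ret) s p
      (fun v s' => (v = 0 ∧ Packed B out m φ pc Vv lo hi s') ∧
        ∀ a, p a ≠ 0 → ¬ PackOwn B out m φ pc lo hi a → s a = s' a) := by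
  have pc_mono : Monotone pc := monotone_nat_of_le_succ fun i => by rw [hpc]; omega
  induction j generalizing lo hi s p t W acc with
  | zero =>
    obtain rfl : hi = lo + 1 := by omega
    refine Fn.intro fun t' ht' W' hW' k s₀ P f d w hpP hP1 hag hd hw hk => ?_
    have hnx := hW'.2
    have hm := pc_mono (by omega : lo ≤ lo + 1)
    change FS E t' W' L f d w (.call (.pack F V T m B out lo (lo + 1) acc) k) s₀ P
    refine FS.call (by omega) (by omega) ?_
    simp only [Proc.code, Prog.bind_def, Prog.pure_def, BF.call, BF.alu, Prog.bind, Prog.bind_ite,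
      Prog.bind_assoc]
    refine FS.sub (by omega) (by omega) (by omega) ?_
    refine FS.eq (by omega) (by omega) (by omega) ?_
    rw [if_pos (by rw [ite_one_zero]; omega)]
    refine FS.div (by omega) (by omega) (by omega) ?_
    refine FS.mod (by omega) (by omega) (by omega) ?_
    refine FS.eq (by omega) (by omega) (by omega) ?_
    have hdiv : lo / m ≤ lo := Nat.div_le_self lo m
    have hpF0 := hpF lo le_rfl (by omega)
    have hpV0 := hpV lo le_rfl (by omega)
    have hself := PackOwn.of_le (B := B) (out := out) (m := m) (φ := φ) (pc := pc) (le_refl lo)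
      (by omega : lo < lo + 1)
    have hd0 := hdis lo le_rfl (by omega)
    have part2 : ∀ d₁ w₁ s₁, d₁ ≤ d + 8 → w ≤ w₁ + 8 →
        (lo % m = 0 → s₁ (0, B + lo / m) = pc lo) →
        (∀ a, ¬ (lo % m = 0 ∧ a = (0, B + lo / m)) → s₀ a = s₁ a) →
        FS E t' W' L f d₁ w₁ ((BF.readAt F lo).bind fun f => if f = 0 then k 0 else
          (BF.readAt V lo).bind fun e => (BF.writeAt out acc e).bind k) s₁ P := by
      intro d₁ w₁ s₁ h1 h2 h3 h4
      have h4' : ∀ a, a ≠ (0, B + lo / m) → s₀ a = s₁ a := fun a ha => h4 a fun h => ha h.2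
      have h4F : s₀ (0, F + lo) = s₁ (0, F + lo) := h4 _ fun h => (hd0 _ (hself.1 h.1)).1 h.2.symm
      have h4V : s₀ (0, V + lo) = s₁ (0, V + lo) := h4 _ fun h => (hd0 _ (hself.1 h.1)).2.1 h.2.symm
      refine FS.readAt (by omega) (by omega) (by omega) (ne_zero_of_le hpP hpF0) ?_
      rw [← h4F, ← hag _ hpF0, hφ lo le_rfl (by omega)]
      by_cases hf : φ lo = 0
      · simp only [if_pos hf]
        refine hk t' le_rfl W' le_rfl 0 _ _ s₁ (by omega) (by omega)
          ⟨⟨rfl, fun i h5 h6 => ?_⟩, fun a ha hA => ?_⟩ fun x hx hx' => ?_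
        · obtain rfl : i = lo := by omega
          exact ⟨h3, fun h => by omega⟩
        · rw [hag a ha, h4 a fun h => hA (h.2 ▸ hself.1 h.1)]
        · exact h4 x fun h => absurd (hpA _ (h.2 ▸ hself.1 h.1)) (not_le.2 hx)
      · have hf1 : φ lo = 1 := by have := hφ1 lo; omega
        simp only [if_neg hf]
        obtain ⟨g1, g2⟩ := hV lo le_rfl (by omega) hf1
        refine FS.readAt (by omega) (by omega) (by omega) (ne_zero_of_le hpP hpV0) ?_
        rw [← h4V, ← hag _ hpV0, g1, hacc]
        have g3 := hpA _ (hself.2 hf1)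
        refine FS.writeAt (by omega) (by omega) (by omega) (one_le_of_le hpP g3) (by omega) ?_
        refine hk t' le_rfl W' le_rfl 0 _ _ _ (by omega) (by omega)
          ⟨⟨rfl, fun i h5 h6 => ?_⟩, fun a ha hA => ?_⟩ fun x hx hx' => ?_
        · obtain rfl : i = lo := by omega
          refine ⟨fun h => ?_, fun h => by simp⟩
          rw [Function.update_of_ne (by simpa using hBo i i le_rfl (by omega) le_rfl (by omega) h hf1)]
          exact h3 h
        · rw [Function.update_of_ne (by rintro rfl; exact hA (hself.2 hf1)), hag a ha,
            h4 a fun h => hA (h.2 ▸ hself.1 h.1)]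
        · rw [← update_agree g3 x hx hx']
          exact h4 x fun h => absurd (hpA _ (h.2 ▸ hself.1 h.1)) (not_le.2 hx)
    by_cases h0 : lo % m = 0
    · simp only [if_pos h0, if_true]
      have g3 := hpA _ (hself.1 h0)
      refine FS.writeAt (by omega) (by omega) (by omega) (one_le_of_le hpP g3) (by omega) ?_
      refine part2 _ _ _ (by omega) (by omega) (fun _ => by simp [hacc]) fun a ha => ?_
      rw [Function.update_of_ne fun h => ha ⟨h0, h⟩]
    · simp only [if_neg h0, zero_ne_one, if_false]
      exact part2 _ _ _ (by omega) (by omega) (fun h => (h0 h).elim) fun a ha => rfl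
  | succ j ih =>
    rcases (by omega : hi = lo + 1 ∨ lo + 2 ≤ hi) with rfl | h2
    · have := ih (s := s) (p := p) (t := t) (W := W) (lo := lo) (hi := lo + 1)
        (by rw [Nat.add_sub_cancel_left]; exact Nat.one_le_two_pow) hlo hhi hFb hTb hVb hBb hob hpch
        hacc hφ hV hT hpF hpV hpT hpA hdis hBo
      intro t' ht' W' hW' k s₀ px f d w hag hd hw hk
      exact this t' ht' W' hW' k s₀ px f d w hag (by omega) hw
        fun t'' ht'' W'' hW'' v d' w' s' h1 => hk t'' ht'' W'' hW'' v d' w' s' (by omega)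
    refine Fn.intro fun t' ht' W' hW' k s₀ P f d w hpP hP1 hag hd hw hk => ?_
    have hnx := hW'.2
    have h2j : 2 ^ (j + 1) = 2 * 2 ^ j := by ring
    change FS E t' W' L f d w (.call (.pack F V T m B out lo hi acc) k) s₀ P
    refine FS.call (by omega) (by omega) ?_
    simp only [Proc.code, Prog.bind_def, Prog.pure_def, BF.alu, Prog.bind, Prog.bind_ite,
      Prog.bind_assoc]
    refine FS.sub (by omega) (by omega) (by omega) ?_
    refine FS.eq (by omega) (by omega) (by omega) ?_
    rw [if_neg (by rw [ite_one_zero]; omega)]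
    refine FS.add (by omega) (by omega) (by omega) ?_
    refine FS.div (by omega) (by omega) (by omega) ?_
    obtain ⟨mid, hmid⟩ : ∃ mid, mid = (lo + hi) / 2 := ⟨_, rfl⟩
    rw [← hmid]
    have hsum : ∀ b, lo ≤ b → ∑ i ∈ Finset.Ico lo b, φ i + pc lo = pc b := by
      intro b hb
      induction b, hb using Nat.le_induction with
      | base => simp
      | succ b hb ih => rw [Finset.sum_Ico_succ_top hb, hpc, ← ih]; ring
    have hpm := hpT mid (by omega) (by omega)
    have hmm := pc_mono (by omega : mid ≤ hi)
    have hlm := pc_mono (by omega : lo ≤ mid)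
    have hacc' : acc + s₀ (0, T + mid) = pc mid := by
      rw [← hag _ hpm, hacc, ← hsum mid (by omega)]
      cases hT with
      | leaf => omega
      | node _ _ mid' hmid' _ hT _ _ =>
        rw [← hmid] at hmid'
        subst hmid'
        rw [hT, add_comm]
    obtain ⟨hTl, hTr⟩ : TreeSum φ (fun i => s (0, T + i)) lo mid ∧
        TreeSum φ (fun i => s (0, T + i)) mid hi := by
      cases hT with
      | leaf => omega
      | node _ _ mid' hmid' _ _ hl hr =>
        rw [← hmid] at hmid'
        subst hmid'
        exact ⟨hl, hr⟩
    refine FS.readAt (by omega) (by omega) (by omega) (ne_zero_of_le hpP hpm) ?_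
    refine FS.add (by omega) (by omega) (by omega) ?_
    rw [hacc']
    let lo' : Bool → ℕ := fun b => if b then mid else lo
    let hi' : Bool → ℕ := fun b => if b then hi else mid
    let acc' : Bool → ℕ := fun b => if b then pc mid else acc
    have hlo' : ∀ b, lo ≤ lo' b ∧ lo' b < hi' b ∧ hi' b ≤ hi ∧ hi' b - lo' b ≤ 2 ^ j := by
      intro b; cases b <;> simp [lo', hi'] <;> omega
    have hacc'' : ∀ b, acc' b = pc (lo' b) := by
      intro b; cases b <;> simp [lo', acc', hacc]
    have hT' : ∀ b, TreeSum φ (fun i => s (0, T + i)) (lo' b) (hi' b) := by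
      intro b; cases b <;> simpa [lo', hi']
    refine FS.par (c := fun b => .call (.pack F V T m B out (lo' b) (hi' b) (acc' b)) .ret)
      (cd := 18 * j + 14) (cw := fun b => 47 * (hi' b - lo' b) - 33)
      (F := fun b v s' => v = 0 ∧ Packed B out m φ pc Vv (lo' b) (hi' b) s')
      (fun b a => PackOwn B out m φ pc (lo' b) (hi' b) a) ?_ (by omega) ?_ hbd ?_ ?_ ?_ ?_
    · rintro a ⟨i, h3, h4, h5⟩ ⟨i', h6, h7, h8⟩
      simp [lo', hi'] at h3 h4 h6 h7
      rcases h5 with ⟨h5, rfl⟩ | ⟨h5, rfl⟩ <;> rcases h8 with ⟨h8, h9⟩ | ⟨h8, h9⟩ <;>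
        simp only [Prod.mk.injEq, true_and] at h9
      · have e1 := Nat.div_add_mod i m
        have e2 := Nat.div_add_mod i' m
        rw [h5, show i / m = i' / m by omega] at e1
        omega
      · exact hBo i i' h3 (by omega) (by omega) h7 h5 h8 h9
      · exact hBo i' i (by omega) h7 h3 (by omega) h8 h5 h9.symm
      · have := pc_mono (by omega : i + 1 ≤ i')
        rw [hpc] at this
        omega
    · simp [lo', hi']; omega
    · rintro b v s₁ s₂ h3 ⟨h4, h5⟩
      refine ⟨h4, h5.congr fun a ha => h3 a ha fun h => ?_⟩
      obtain ⟨h8, h9, h10, -⟩ := hlo' b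
      have := one_le_of_le hpP (hpA a (ha.mono h8 h10))
      simp [h] at this
    · rintro b v s₁ ⟨h3, -⟩
      omega
    · intro b q h3 h4
      obtain ⟨h8, h9, h10, h11⟩ := hlo' b
      have hq0 : ∀ a, (∀ b', PackOwn B out m φ pc lo hi b' → b' ≠ a) → p a ≠ 0 → q a ≠ 0 :=
        fun a h5 h6 => h4 _ (by
          intro b' h7
          obtain ⟨g8, g9, g10, -⟩ := hlo' b'
          exact h5 a (h7.mono g8 g10) rfl) (ne_zero_of_le hpP h6)
      have hmh := pc_mono h10
      have := ih (s := s₀) (p := q) (t := t') (W := W') (lo := lo' b) (hi := hi' b) (acc := acc' b)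
        h11 h9 (by omega) (by omega) (by omega) (by omega) (by omega) (by omega) (by omega) (hacc'' b)
        (fun i h5 h6 => by rw [← hag _ (hpF i (by omega) (by omega))]; exact hφ i (by omega) (by omega))
        (fun i h5 h6 => by rw [← hag _ (hpV i (by omega) (by omega))]; exact hV i (by omega) (by omega))
        ((hT' b).congr fun i h5 h6 => hag _ (hpT i (by omega) (by omega)))
        (fun i h5 h6 => hq0 _ (fun a ha => (hdis i (by omega) (by omega) a ha).1)
          (hpF i (by omega) (by omega)))
        (fun i h5 h6 => hq0 _ (fun a ha => (hdis i (by omega) (by omega) a ha).2.1)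
          (hpV i (by omega) (by omega)))
        (fun i h5 h6 => hq0 _ (fun a ha => (hdis i (by omega) (by omega) a ha).2.2)
          (hpT i (by omega) (by omega)))
        (fun a ha => by rw [h3 a ha]; exact one_le_of_le hpP (hpA a (ha.mono h8 h10)))
        (fun i h5 h6 a ha => hdis i (by omega) (by omega) a (ha.mono h8 h10))
        (fun i i' h5 h6 h7 h12 => hBo i i' (by omega) (by omega) (by omega) (by omega))
      intro t₁ ht₁ W₁ hW₁ k s₁ px f d w hag hd hw hk
      refine this t₁ ht₁ W₁ hW₁ k s₁ px f d w hag hd hw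
        fun t'' ht'' W'' hW'' v d' w' s' h1 h2 h3 => hk t'' ht'' W'' hW'' v d' w' s' h1 h2 h3
    · intro t₁ ht₁ W₁ hW₁ d₁ w₁ s₁ v h3 h4 h5 h6
      obtain ⟨-, h8⟩ := h5 false
      obtain ⟨-, h10⟩ := h5 true
      simp [lo', hi'] at h4 h8 h10
      have hne : ∀ a, ¬ PackOwn B out m φ pc lo hi a → ∀ b, ¬ PackOwn B out m φ pc (lo' b) (hi' b) a :=
        fun a ha b h => ha (h.mono (hlo' b).1 (hlo' b).2.2.1)
      refine hk t₁ ht₁ W₁ hW₁ 0 _ _ _ (by omega) (by omega) ⟨⟨rfl, fun i h1 h2 => ?_⟩, fun a ha hA => ?_⟩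
        fun x hx hx' => ?_
      · by_cases him : i < mid
        · exact h8 i h1 him
        · exact h10 i (by omega) h2
      · rw [← h6 a (hne a hA) (ne_zero_of_le hpP ha)]
        exact hag a ha
      · exact h6 x (hne x fun h => absurd (hpA x h) (not_le.2 hx)) hx'

end BF

namespace BF
variable {E : Env} {t : ℕ} {W : World} {L : ℕ} {f : ℝ≥0∞} {d w : ℕ} {s : St} {p : Share}

/-! ## Instructions that use invariants -/

theorem uniformBelow_eq {m : ℕ} (hm : 0 < m) : uniformBelow m =
    PMF.uniformOfFinset (Finset.range m) (Finset.nonempty_range_iff.2 hm.ne') := dif_pos hm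

theorem tsum_uniformBelow {m : ℕ} (hm : 0 < m) (f : ℕ → ℝ≥0∞) :
    ∑' v, uniformBelow m v * f v = (m : ℝ≥0∞)⁻¹ * ∑ v ∈ Finset.range m, f v := by
  rw [uniformBelow_eq hm, tsum_eq_sum (s := Finset.range m), Finset.mul_sum]
  · refine Finset.sum_congr rfl fun v hv => ?_
    rw [PMF.uniformOfFinset_apply_of_mem _ hv, Finset.card_range]
  · intro v hv
    rw [PMF.uniformOfFinset_apply_of_notMem _ hv, zero_mul]

/-- The usual way to exclude that an invariant is already dead: a dead invariant owns a ghost cell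
completely, which is impossible while somebody keeps half of it. -/
theorem half_add_one : ¬ (1 / 2 : ℝ≥0) + 1 ≤ 1 :=
  not_le.2 (lt_add_of_pos_left _ (by positivity))

theorem tsum_map_mul {α β : Type*} (μ : PMF α) (g : α → β) (f : β → ℝ≥0∞) :
    ∑' b, μ.map g b * f b = ∑' a, μ a * f (g a) := by
  classical
  simp only [PMF.map_apply, ← ENNReal.tsum_mul_right]
  rw [ENNReal.tsum_comm]
  refine tsum_congr fun a => ?_
  rw [tsum_eq_single (g a)]
  · simp
  · intro b hb
    simp [hb]

/-- Here `g v` is the credit of the invariant after the draw of `v`. Only the average has to be at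
most the present credit; this is where the pessimistic estimators enter the logic. -/
theorem FS.rand {m : ℕ} {k : ℕ → Prog Proc Word} {J : Inv} (hd : d < L) (hw : 0 < w) (hm : 0 < m)
    (hmb : m ≤ E.bd) (hJ : Opens W J)
    (h : ∀ W' s' p₁ e₁ δ₁, W ≤ W' → Agree p s s' → J.At s' p₁ e₁ δ₁ → p + p₁ ≤ 1 →
      ∃ g : ℕ → ℝ≥0∞, ∑ v ∈ Finset.range m, g v ≤ m * e₁ ∧ ∀ v < m, ∃ s'' p' p₁',
        (∀ a, s'' (0, a) = s' (0, a)) ∧ (∀ x, p x + p₁ x < 1 → s' x = s'' x) ∧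
        J.At s'' p₁' (g v) δ₁ ∧ p' + p₁' ≤ p + p₁ ∧ FS E t W' L f (d + 1) (w - 1) (k v) s'' p') :
    FS E t W L f d w (.instr (.rand m) k) s p := by
  cases t with
  | zero => trivial
  | succ t =>
    refine safe.step hJ fun W' s' p₁ e₁ δ₁ hW hs hI hle hb => ?_
    obtain ⟨g, hg, H⟩ := h W' s' p₁ e₁ δ₁ hW hs hI hle
    refine ⟨fun o => ((w - 1 : ℕ) : ℝ≥0∞) * E.th ^ L + f + g o.word, ?_, fun o ho => ?_⟩
    · simp only [mul_add, ENNReal.tsum_add, ENNReal.tsum_mul_right, PMF.tsum_coe, one_mul]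
      have h1 : ∑' o, lstep E ⟨d, .instr (.rand m) k⟩ (fun a => s' (0, a)) W'.nx o * g o.word ≤ e₁ := by
        simp only [lstep, tsum_map_mul]
        rw [tsum_uniformBelow hm]
        calc _ ≤ (m : ℝ≥0∞)⁻¹ * (m * e₁) := mul_le_mul' le_rfl hg
          _ = e₁ := by
            rw [← mul_assoc, ENNReal.inv_mul_cancel (by simpa using hm.ne') (by simp), one_mul]
      rw [← add_assoc]
      exact add_le_add (price_le hd hw) h1
    · simp only [lstep] at ho
      rw [PMF.support_map] at ho
      obtain ⟨v, hv, rfl⟩ := ho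
      have hvm : v < m := by
        rw [uniformBelow_eq hm, PMF.mem_support_uniformOfFinset_iff] at hv
        simpa using hv
      obtain ⟨s'', p', p₁', k1, k2, k3, k4, k5⟩ := H v hvm
      refine ⟨(hvm.le.trans (hmb.trans (Nat.le_add_right _ _)) : v ≤ E.bd + W'.nx), rfl, hb, by simp, fun _ => ⟨s'', p₁', g v, δ₁,
        [(⟨d + 1, k v⟩, p', ((w - 1 : ℕ) : ℝ≥0∞) * E.th ^ L + f)], k1, k2, k3, by simpa using k4, rfl, ?_, by simp, by simp⟩⟩
      intro x hx
      rw [List.mem_singleton] at hx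
      subst hx
      exact FS.mono k5 (Nat.le_succ t) le_rfl (.refl _ _) le_rfl

theorem FS.tas {a : ℕ} {k : ℕ → Prog Proc Word} {J : Inv} (hd : d < L) (hw : 0 < w)
    (hb1 : 1 ≤ E.bd) (hJ : Opens W J)
    (h : ∀ W' s' p₁ e₁ δ₁, W ≤ W' → Agree p s s' → J.At s' p₁ e₁ δ₁ → p + p₁ ≤ 1 →
      ∃ s'' p' p₁', (∀ b, s'' (0, b) = if s' (0, a) = 0 ∧ b = a then 1 else s' (0, b)) ∧
        (∀ x, p x + p₁ x < 1 → s' x = s'' x) ∧ J.At s'' p₁' e₁ δ₁ ∧ p' + p₁' ≤ p + p₁ ∧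
        FS E t W' L f (d + 1) (w - 1) (k (if s' (0, a) = 0 then 0 else 1)) s'' p') :
    FS E t W L f d w (.instr (.tas a) k) s p := by
  cases t with
  | zero => trivial
  | succ t =>
    refine safe.step hJ fun W' s' p₁ e₁ δ₁ hW hs hI hle hb => ?_
    obtain ⟨s'', p', p₁', k1, k2, k3, k4, k5⟩ := h W' s' p₁ e₁ δ₁ hW hs hI hle
    have k5' := FS.mono k5 (Nat.le_succ t) le_rfl (.refl _ _) le_rfl
    refine ⟨fun o => ((w - 1 : ℕ) : ℝ≥0∞) * E.th ^ L + f + e₁, ?_, fun o ho => ?_⟩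
    · simp only [ENNReal.tsum_mul_right, PMF.tsum_coe, one_mul]
      rw [← add_assoc]
      exact add_le_add (price_le hd hw) le_rfl
    · simp only [lstep] at ho
      by_cases h0 : s' (0, a) = 0
      · rw [if_pos h0, PMF.support_pure, Set.mem_singleton_iff] at ho
        subst ho
        rw [if_pos h0] at k5'
        refine ⟨by simp, rfl, fun b => ?_, by simp, fun _ => ⟨s'', p₁', e₁, δ₁,
          [(⟨d + 1, k 0⟩, p', ((w - 1 : ℕ) : ℝ≥0∞) * E.th ^ L + f)], fun b => ?_, k2, k3,
          by simpa using k4, rfl, ?_, by simp, by simp⟩⟩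
        · simp only [Function.update_apply]
          split_ifs
          · omega
          · exact hb b
        · rw [k1]; simp [Function.update_apply, h0]
        · intro x hx
          rw [List.mem_singleton] at hx
          subst hx
          exact k5'
      · rw [if_neg h0, PMF.support_pure, Set.mem_singleton_iff] at ho
        subst ho
        rw [if_neg h0] at k5'
        refine ⟨hb1.trans (Nat.le_add_right _ _), rfl, hb, by simp, fun _ => ⟨s'', p₁', e₁, δ₁,
          [(⟨d + 1, k 1⟩, p', ((w - 1 : ℕ) : ℝ≥0∞) * E.th ^ L + f)], fun b => ?_, k2, k3,
          by simpa using k4, rfl, ?_, by simp, by simp⟩⟩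
        · rw [k1]; simp [h0]
        · intro x hx
          rw [List.mem_singleton] at hx
          subst hx
          exact k5'

theorem FS.write_inv {a v : ℕ} {k : ℕ → Prog Proc Word} {J : Inv} (hd : d < L) (hw : 0 < w)
    (hv : v ≤ E.bd + W.nx) (hJ : Opens W J)
    (h : ∀ W' s' p₁ e₁ δ₁, W ≤ W' → Agree p s s' → J.At s' p₁ e₁ δ₁ → p + p₁ ≤ 1 →
      ∃ s'' p' p₁', (∀ b, s'' (0, b) = if b = a then v else s' (0, b)) ∧
        (∀ x, p x + p₁ x < 1 → s' x = s'' x) ∧ J.At s'' p₁' e₁ δ₁ ∧ p' + p₁' ≤ p + p₁ ∧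
        FS E t W' L f (d + 1) (w - 1) (k 0) s'' p') :
    FS E t W L f d w (.instr (.write a v) k) s p := by
  cases t with
  | zero => trivial
  | succ t =>
    refine safe.step hJ fun W' s' p₁ e₁ δ₁ hW hs hI hle hb => ?_
    obtain ⟨s'', p', p₁', k1, k2, k3, k4, k5⟩ := h W' s' p₁ e₁ δ₁ hW hs hI hle
    have k5' := FS.mono k5 (Nat.le_succ t) le_rfl (.refl _ _) le_rfl
    refine ⟨fun o => ((w - 1 : ℕ) : ℝ≥0∞) * E.th ^ L + f + e₁, ?_, fun o ho => ?_⟩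
    · simp only [ENNReal.tsum_mul_right, PMF.tsum_coe, one_mul]
      rw [← add_assoc]
      exact add_le_add (price_le hd hw) le_rfl
    · simp only [lstep, PMF.support_pure, Set.mem_singleton_iff] at ho
      subst ho
      refine ⟨by simp, rfl, fun b => ?_, by simp, fun _ => ⟨s'', p₁', e₁, δ₁,
        [(⟨d + 1, k 0⟩, p', ((w - 1 : ℕ) : ℝ≥0∞) * E.th ^ L + f)], fun b => ?_, k2, k3,
        by simpa using k4, rfl, ?_, by simp, by simp⟩⟩
      · simp only [Function.update_apply]
        split_ifs
        · exact hv.trans (Nat.add_le_add_left hW.2 _)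
        · exact hb b
      · rw [k1]; simp [Function.update_apply]
      · intro x hx
        rw [List.mem_singleton] at hx
        subst hx
        exact k5'

/-- Credit `g` may move from the invariant to the thread. The price of a restart reaches the program
in this way. -/
theorem FS.view_shift {c : Prog Proc Word} {J : Inv} (hJ : Opens W J)
    (h : ∀ W' s' p₁ e₁ δ₁, W ≤ W' → Agree p s s' → J.At s' p₁ e₁ δ₁ → p + p₁ ≤ 1 →
      ∃ s'' p' p₁' g e₁', (∀ a, s'' (0, a) = s' (0, a)) ∧ (∀ x, p x + p₁ x < 1 → s' x = s'' x) ∧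
        J.At s'' p₁' e₁' δ₁ ∧ p' + p₁' ≤ p + p₁ ∧ g + e₁' ≤ e₁ ∧
        FS E t W' L (f + g) d w c s'' p') :
    FS E t W L f d w c s p := by
  refine safe.view_shift hJ fun W' s' p₁ e₁ δ₁ hW hs hI hle => ?_
  obtain ⟨s'', p', p₁', g, e₁', k1, k2, k3, k4, k5, k6⟩ := h W' s' p₁ e₁ δ₁ hW hs hI hle
  refine ⟨s'', p', (w : ℝ≥0∞) * E.th ^ L + (f + g), p₁', e₁', k1, k2, k3, k4, ?_, k6⟩
  calc _ = (w : ℝ≥0∞) * E.th ^ L + f + (g + e₁') := by ring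
    _ ≤ _ := add_le_add le_rfl k5

theorem FS.new_inv {c : Prog Proc Word} {q P : Share} {g : ℝ≥0∞} (I : Inv) (hI : I s q g 0)
    (hP : p + q ≤ P) (h : FS E t ⟨I :: W.invs, W.nx⟩ L f d w c s p) :
    FS E t W L (f + g) d w c s P := by
  refine safe.weaken (safe.new_inv I hI h) hP ?_
  rw [add_assoc]

theorem World.le_new (W : World) (I : Inv) : W ≤ ⟨I :: W.invs, W.nx⟩ :=
  ⟨List.subset_cons_self _ _, le_rfl⟩

/-! ## Ghost cells -/

/-- The ghost cells that belong to the memory cells `S, …, S + m - 1`. -/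
def Gh (S m : ℕ) (x : ℕ × ℕ) : Prop := x.1 ≠ 0 ∧ S ≤ x.2 ∧ x.2 < S + m

open Classical in
/-- The permissions `p`, with permission `c` for the ghost cells. -/
noncomputable def Share.gh (S m : ℕ) (c : ℝ≥0) (p : Share) : Share := fun x => if Gh S m x then c else p x

theorem gh_of {S m : ℕ} {c : ℝ≥0} {x : ℕ × ℕ} (h : Gh S m x) : Share.gh S m c p x = c := if_pos h

theorem gh_of_not {S m : ℕ} {c : ℝ≥0} {x : ℕ × ℕ} (h : ¬ Gh S m x) : Share.gh S m c p x = p x :=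
  if_neg h

theorem gh_zero {S m : ℕ} {c : ℝ≥0} (a : ℕ) : Share.gh S m c p (0, a) = p (0, a) :=
  gh_of_not fun h => h.1 rfl

theorem gh_mk {S m i j : ℕ} (hj : j ≠ 0) (hi : i < m) : Gh S m (j, S + i) :=
  ⟨hj, Nat.le_add_right _ _, by simp only; omega⟩

/-- Initialize ghost cells. -/
theorem FS.init_ghost {c : Prog Proc Word} {S m : ℕ} (γ : St) (hp : ∀ x, Gh S m x → 1 ≤ p x)
    (h : ∀ W' s', W ≤ W' → (∀ x, ¬ Gh S m x → p x ≠ 0 → s x = s' x) → (∀ x, Gh S m x → s' x = γ x) →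
      FS E t W' L f d w c s' p) : FS E t W L f d w c s p := by
  classical
  refine FS.view_shift (Opens.none W) fun W' s' p₁ e₁ δ₁ hW hs ⟨_, _, hp₁, he, hδ⟩ _ => ?_
  subst hp₁ he hδ
  refine ⟨fun x => if Gh S m x then γ x else s' x, p, 0, 0, 0, fun a => if_neg fun h => h.1 rfl,
    fun x hx => ?_, ⟨_, .refl _ _, rfl, rfl, rfl⟩, le_rfl, by simp, ?_⟩
  · refine (if_neg fun hg => ?_).symm
    have := hp x hg
    simp only [Pi.zero_apply, add_zero] at hx
    exact absurd this (not_le.2 hx)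
  · rw [add_zero]
    exact h W' _ hW (fun x hx hp => by rw [if_neg hx]; exact hs x hp) fun x hx => if_pos hx

/-! ## Sampling -/

/-- The invariant of the sampling loop: `Ψ` of the samples drawn so far can be paid. -/
def SampleInv (S m : ℕ) (Ψ : (ℕ → ℕ) → ℝ≥0∞) : Inv := fun s p e δ => δ = 0 ∧
  -- The first alternative is the dead state after the loop, when the credit has been taken out. In
  -- the second one the invariant has half of all ghost cells, so that it sees the samples drawn so
  -- far.
  ((∀ i < m, 1 ≤ p (1, S + i)) ∨ p = Share.gh S m (1 / 2) 0 ∧ Ψ (fun i => s (1, S + i)) ≤ e)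

/-- The ghost cell `(1, S + i)` is `0` before sample `i` is drawn, and afterwards one more than the
drawn position. Task and invariant have half of it each, so it can change only at the draw, together
with the credit. After the loop all halves are together again and the value of the estimator is
returned as credit. -/
theorem FS.sample {b n S m j : ℕ} {k : ℕ → Prog Proc Word} {c c' : ℕ} {Ψ : (ℕ → ℕ) → ℝ≥0∞}
    (hc : c = 17 * j + 9) (hc' : c' = m * 30 + 3)
    (hd : d + c ≤ L) (hw : c' ≤ w) (hj : m ≤ 2 ^ j) (hm0 : 0 < m) (hn0 : 0 < n)
    (hbd : 3 ≤ E.bd) (hm : 2 * m ≤ E.bd) (hn : n ≤ E.bd) (hbn : b + n ≤ E.bd + W.nx)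
    (hS : S + m ≤ E.bd + W.nx)
    (hSb : ∀ i < m, ∀ i' < n, S + i ≠ b + i')
    (hp : ∀ i < m, 1 ≤ p (0, S + i)) (hpg : ∀ x, Gh S m x → 1 ≤ p x)
    (hpb : ∀ i < n, p (0, b + i) ≠ 0) (hb : ∀ i < n, s (0, b + i) ≤ E.bd)
    (hΨ : ∀ g i, i < m → g i = 0 →
      ∑ v ∈ Finset.range n, Ψ (Function.update g i (v + 1)) ≤ n * Ψ g)
    (hΨc : ∀ g g', (∀ i < m, g i = g' i) → Ψ g = Ψ g')
    (hk : ∀ t' ≤ t, ∀ W', W ≤ W' → ∀ d' w' s' v (y : ℕ → ℕ), d' ≤ d + c → w ≤ w' + c' →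
      (∀ i < m, y i < n ∧ s' (0, S + i) = s (0, b + y i)) →
      (∀ x, (x.2 < S ∨ S + m ≤ x.2) → p x ≠ 0 → s x = s' x) →
      FS E t' W' L (f + Ψ fun i => y i + 1) d' w' (k v) s' (Share.gh S m 0 p)) :
    FS E t W L (f + Ψ fun _ => 0) d w (.call (.parFor (.sample b n S) 0 m) k) s p := by
  refine FS.init_ghost (fun _ => 0) hpg fun W₁ s₁ hW₁ hs₁ hs₁0 => ?_
  have hnx1 := hW₁.2
  refine FS.new_inv (SampleInv S m Ψ) (p := Share.gh S m (1 / 2) p) (q := Share.gh S m (1 / 2) 0)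
    ⟨rfl, .inr ⟨rfl, (hΨc _ _ fun i hi => hs₁0 _ (gh_mk one_ne_zero hi)).le⟩⟩ (fun x => ?_) ?_
  · simp only [Pi.add_apply]
    by_cases hx : Gh S m x
    · rw [gh_of hx, gh_of hx, add_halves]; exact hpg x hx
    · rw [gh_of_not hx, gh_of_not hx]; simp
  set W₂ : World := ⟨SampleInv S m Ψ :: W₁.invs, W₁.nx⟩ with hW₂
  have hW12 : W₁ ≤ W₂ := World.le_new _ _
  have hJ : Opens W₂ (SampleInv S m Ψ) := Opens.of_mem (by simp [hW₂])
  have hbv : ∀ i < n, s (0, b + i) = s₁ (0, b + i) := fun i hi => hs₁ _ (fun h => h.1 rfl) (hpb i hi)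
  refine FS.parFor_owned (A := fun i a => a.2 = S + i) (cd := 5) (cw := 5)
    (F := fun i v s' => v = 0 ∧ ∃ y < n, s' (1, S + i) = y + 1 ∧ s' (0, S + i) = s (0, b + y))
    (fun i _ i' _ a h1 h2 => by omega) (hc.trans (by ring)) hc' hd hw hj hbd hm
    (fun i hi v s s' h1 h2 => ?_) (fun i hi v s h => by omega) (fun i hi q h1 h2 => ?_)
    (fun t' ht' W' hW' d' w' s' vs g1 g2 g3 g4 => ?_)
  · obtain ⟨h2, y, h3, h4, h5⟩ := h2
    refine ⟨h2, y, h3, ?_, ?_⟩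
    · rw [← h1 (1, S + i) rfl, h4]
      rw [gh_of (gh_mk one_ne_zero hi)]; norm_num
    · rw [← h1 (0, S + i) rfl, h5]
      rw [gh_zero]; intro h; simpa [h] using hp i hi
  · intro t' ht' W' hW' k s₀ px f d w hag hd hw hk
    refine safe.of_le_one fun hle1 => ?_
    have hnx2 := (hW12.trans hW').2
    have hq0 : 1 ≤ q (0, S + i) := by rw [h1 _ rfl, gh_zero]; exact hp i hi
    have hq1 : q (1, S + i) = 1 / 2 := by rw [h1 _ rfl, gh_of (gh_mk one_ne_zero hi)]
    have hqb : ∀ i' < n, q (0, b + i') ≠ 0 := fun i' hi' =>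
      h2 _ (fun i'' hi'' h => hSb i'' hi'' i' hi' h.symm) (by rw [gh_zero]; exact hpb i' hi')
    simp only [Task.code, Prog.bind_def, Prog.pure_def, Prog.bind_assoc, Prog.bind, BF.rand]
    refine FS.rand (by omega) (by omega) hn0 hn (hJ.mono hW') fun W₃ s₃ p₁ e₁ δ₁ hW₃ hs₃ hI hle => ?_
    obtain ⟨s₄, hs₄, hδ, hdead | ⟨hp₁, he₁⟩⟩ := hI
    · exfalso
      have h3 := hdead i hi
      have h4 := hle (1, S + i)
      simp only [Pi.add_apply, Pi.one_apply, hq1] at h4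
      exact half_add_one (le_trans (add_le_add le_self_add h3) h4)
    have hpx : px (1, S + i) = 0 := by
      have h4 := hle (1, S + i)
      rw [hp₁] at h4
      simp only [Pi.add_apply, Pi.one_apply, hq1, gh_of (gh_mk one_ne_zero hi)] at h4
      have h5 : (1 : ℝ≥0) + px (1, S + i) ≤ 1 := by
        calc _ = 1 / 2 + px (1, S + i) + 1 / 2 := by
              rw [add_right_comm, add_halves]
          _ ≤ 1 := h4
      simpa using h5
    have hge : ∀ i < m, s₄ (1, S + i) = s₃ (1, S + i) := fun i hi =>
      hs₄ _ (by rw [hp₁, gh_of (gh_mk one_ne_zero hi)]; norm_num)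
    have hg0 : s₄ (1, S + i) = 0 := by
      rw [hge i hi, ← hs₃ _ (by simp [hq1]), ← hag _ (by rw [hq1]; norm_num)]
      exact hs₁0 _ (gh_mk one_ne_zero hi)
    refine ⟨fun v => Ψ (Function.update (fun i => s₄ (1, S + i)) i (v + 1)),
      (hΨ _ i hi hg0).trans (mul_le_mul' le_rfl he₁), fun v hv =>
      ⟨Function.update s₃ (1, S + i) (v + 1), q + px, p₁, fun a => ?_, fun x hx => ?_,
        ⟨Function.update s₄ (1, S + i) (v + 1), hs₄.update _ _, hδ, .inr ⟨hp₁, ?_⟩⟩, le_rfl, ?_⟩⟩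
    · rw [Function.update_of_ne (by simp)]
    · rw [Function.update_of_ne]
      rintro rfl
      rw [hp₁] at hx
      simp only [Pi.add_apply, hq1, gh_of (gh_mk one_ne_zero hi), hpx, add_zero, add_halves,
        lt_irrefl] at hx
    · refine (hΨc _ _ fun i' hi' => ?_).le
      by_cases h : i' = i
      · subst h; simp
      · rw [Function.update_of_ne (by simpa using h), Function.update_of_ne h]
    have hnx3 := hW₃.2
    have hqb' : ∀ i' < n, (q + px) (0, b + i') ≠ 0 := fun i' hi' => ne_zero_of_le le_self_add (hqb i' hi')
    have hval : Function.update s₃ (1, S + i) (v + 1) (0, b + v) = s (0, b + v) := by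
      rw [Function.update_of_ne (by simp), ← hs₃ _ (hqb' v hv), ← hag _ (hqb v hv), hbv v hv]
    have hvb := hb v hv
    have hW1 : W₁.nx = W₂.nx := rfl
    refine FS.readAt (by omega) (by omega) (by omega) (hqb' v hv) ?_
    rw [hval]
    refine FS.writeAt (by omega) (by omega) (by omega) (one_le_of_le le_self_add hq0) (by omega) ?_
    have hpx0 : px (0, S + i) = 0 := by
      have h4 := hle1 (0, S + i)
      simp only [Pi.add_apply, Pi.one_apply] at h4
      have h5 : (1 : ℝ≥0) + px (0, S + i) ≤ 1 := (add_le_add hq0 le_rfl).trans h4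
      simpa using h5
    refine hk t' le_rfl W₃ hW₃ 0 _ _ _ (by omega) (by omega) ⟨⟨rfl, v, hv, ?_, ?_⟩, fun a ha hA => ?_⟩
      fun a ha => ?_
    · rw [Function.update_of_ne (by simp), Function.update_self]
    · rw [Function.update_self]
    · rw [Function.update_of_ne (by rintro rfl; exact hA rfl),
        Function.update_of_ne (by rintro rfl; exact hA rfl),
        ← hs₃ a (ne_zero_of_le le_self_add ha)]
      exact hag a ha
    · rw [Function.update_of_ne (by rintro rfl; exact ha hpx0),
        Function.update_of_ne (by rintro rfl; exact ha hpx)]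
      exact hs₃ a (ne_zero_of_le le_add_self ha)
  · refine FS.view_shift (hJ.mono hW') fun W₃ s₃ p₁ e₁ δ₁ hW₃ hs₃ hI hle => ?_
    obtain ⟨s₄, hs₄, hδ, hdead | ⟨hp₁, he₁⟩⟩ := hI
    · exfalso
      have h3 := hdead 0 hm0
      have h4 := hle (1, S + 0)
      simp only [Pi.add_apply, Pi.one_apply] at h4
      rw [gh_of (gh_mk one_ne_zero hm0)] at h4
      exact half_add_one (le_trans (add_le_add le_rfl h3) h4)
    choose! hv y hy hy1 hy2 using g3
    have hge : ∀ i < m, s₄ (1, S + i) = s₃ (1, S + i) := fun i hi =>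
      hs₄ _ (by rw [hp₁, gh_of (gh_mk one_ne_zero hi)]; norm_num)
    refine ⟨s₃, Share.gh S m 0 p, Share.gh S m 1 0, Ψ fun i => y i + 1, 0, fun a => rfl,
      fun _ _ => rfl, ⟨s₃, .refl _ _, hδ, .inl fun i hi => (gh_of (gh_mk one_ne_zero hi)).ge⟩,
      fun x => ?_, ?_, ?_⟩
    · rw [hp₁]
      simp only [Pi.add_apply]
      by_cases hx : Gh S m x
      · rw [gh_of hx, gh_of hx, gh_of hx, gh_of hx, add_halves, zero_add]
      · rw [gh_of_not hx, gh_of_not hx, gh_of_not hx, gh_of_not hx]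
    · rw [add_zero, ← hΨc (fun i => s₄ (1, S + i)) _ fun i hi => ?_]
      · exact he₁
      · rw [hge i hi, ← hs₃ _ (by rw [gh_of (gh_mk one_ne_zero hi)]; norm_num)]
        exact hy1 i hi
    · refine hk t' ht' W₃ (((hW₁.trans hW12).trans hW').trans hW₃) d' w' s₃ _ y g1 g2
        (fun i hi => ⟨hy i hi, ?_⟩) fun x hx hpx => ?_
      · rw [← hs₃ _ (by rw [gh_zero]; intro h; simpa [h] using hp i hi)]
        exact hy2 i hi
      · have hng : ¬ Gh S m x := fun h => by have := h.2; omega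
        have hpx' : Share.gh S m (1 / 2) p x ≠ 0 := by rwa [gh_of_not hng]
        rw [hs₁ x hng hpx, g4 x (fun i hi h => by omega) hpx', hs₃ x hpx']

end BF

namespace BF
variable {E : Env} {t : ℕ} {W : World} {L : ℕ} {f : ℝ≥0∞} {d w : ℕ} {s : St} {p : Share}

/-! ## Distribution of the elements to the buckets -/

/-- The states of the distribution of `n` elements, where element `i` goes to bucket `β i` of `m`
places: it has `R i` attempts left; `lc i` is `0` or `1 +` the place that it has drawn, and `kd i`
is `0` if that place has not been reserved yet, `1` when it is reserved, and `2` when `i` has been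
written to it.  The number `h i` counts collisions. -/
structure DistOk (n m M T : ℕ) (β a₀ R lc kd Fv Vv h : ℕ → ℕ) : Prop where
  place : ∀ i < n, ∀ a, lc i = a + 1 → a < M ∧ a / m = β i
  kind : ∀ i < n, kd i ≠ 0 → lc i ≠ 0
  flag : ∀ a < M, (Fv a = 0 ∧ ∀ i < n, lc i = a + 1 → kd i = 0) ∨
    (Fv a = 1 ∧ ∃ i < n, lc i = a + 1 ∧ kd i ≠ 0)
  inj : ∀ i < n, ∀ i' < n, lc i = lc i' → kd i ≠ 0 → kd i' ≠ 0 → i = i'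
  value : ∀ i < n, ∀ a, lc i = a + 1 → kd i = 2 → Vv a = a₀ i
  idle : ∀ i < n, lc i = 0 → T ≤ h i + R i
  pending : ∀ i < n, lc i ≠ 0 → kd i = 0 → T ≤ h i + R i + 1
  hit : ∀ i < n, lc i ≠ 0 → kd i = 0 → (∃ i' < n, i' ≠ i ∧ lc i' = lc i) → T ≤ h i + R i

section
variable {n m M T : ℕ} {β a₀ R lc kd Fv Vv h : ℕ → ℕ}

theorem DistOk.congr (H : DistOk n m M T β a₀ R lc kd Fv Vv h) {R' lc' kd' Fv' Vv' : ℕ → ℕ}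
    (hR : ∀ i < n, R i = R' i) (hlc : ∀ i < n, lc i = lc' i) (hkd : ∀ i < n, kd i = kd' i)
    (hF : ∀ a < M, Fv a = Fv' a) (hV : ∀ a < M, Vv a = Vv' a) :
    DistOk n m M T β a₀ R' lc' kd' Fv' Vv' h where
  place i hi a := by rw [← hlc i hi]; exact H.place i hi a
  kind i hi := by rw [← hlc i hi, ← hkd i hi]; exact H.kind i hi
  flag a ha := by
    rw [← hF a ha]
    rcases H.flag a ha with ⟨h1, h2⟩ | ⟨h1, i, h2, h3, h4⟩
    · exact .inl ⟨h1, fun i hi => by rw [← hlc i hi, ← hkd i hi]; exact h2 i hi⟩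
    · exact .inr ⟨h1, i, h2, by rw [← hlc i h2]; exact h3, by rw [← hkd i h2]; exact h4⟩
  inj i hi i' hi' := by
    rw [← hlc i hi, ← hkd i hi, ← hlc i' hi', ← hkd i' hi']; exact H.inj i hi i' hi'
  value i hi a h1 h2 := by
    rw [← hlc i hi] at h1
    rw [← hkd i hi] at h2
    rw [← hV a (H.place i hi a h1).1]
    exact H.value i hi a h1 h2
  idle i hi := by rw [← hlc i hi, ← hR i hi]; exact H.idle i hi
  pending i hi := by rw [← hlc i hi, ← hR i hi, ← hkd i hi]; exact H.pending i hi
  hit i hi := by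
    rw [← hlc i hi, ← hR i hi, ← hkd i hi]
    rintro h1 h2 ⟨i', h3, h4, h5⟩
    exact H.hit i hi h1 h2 ⟨i', h3, h4, by rw [hlc i' h3]; exact h5⟩

open Classical in
/-- The numbers of collisions after element `i` has drawn place `a`. -/
noncomputable def bump (n : ℕ) (lc : ℕ → ℕ) (i a : ℕ) (h : ℕ → ℕ) : ℕ → ℕ := fun e =>
  if e = i then h i + (if ∃ e' < n, e' ≠ i ∧ lc e' = a + 1 then 1 else 0)
  else h e + (if lc e = a + 1 then 1 else 0)

theorem bump_le (lc : ℕ → ℕ) (i a : ℕ) (h : ℕ → ℕ) (e : ℕ) : h e ≤ bump n lc i a h e := by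
  unfold bump
  split_ifs <;> simp_all

/-- Two elements can have drawn the same place before either has reserved it, and then the scheduler
chooses the loser. Charging both of them at once keeps `hit` true: whoever loses has already been
charged. Elements that have reserved the place are charged as well, which is harmless. -/
theorem DistOk.draw (H : DistOk n m M T β a₀ R lc kd Fv Vv h) {i a k : ℕ} (hi : i < n)
    (hlc : lc i = 0) (hR : R i = k + 1) (ha : a < M) (ham : a / m = β i) :
    DistOk n m M T β a₀ (Function.update R i k) (Function.update lc i (a + 1)) kd Fv Vv
      (bump n lc i a h) := by
  have hkd : kd i = 0 := by by_contra h0; exact H.kind i hi h0 hlc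
  constructor
  · intro e he b hb
    by_cases hei : e = i
    · subst hei
      rw [Function.update_self] at hb
      obtain rfl : a = b := by omega
      exact ⟨ha, ham⟩
    · rw [Function.update_of_ne hei] at hb; exact H.place e he b hb
  · intro e he hk
    have hei : e ≠ i := by rintro rfl; exact hk hkd
    rw [Function.update_of_ne hei]; exact H.kind e he hk
  · intro b hb
    rcases H.flag b hb with ⟨h1, h2⟩ | ⟨h1, e, h2, h3, h4⟩
    · refine .inl ⟨h1, fun e he hb => ?_⟩
      by_cases hei : e = i
      · rw [hei]; exact hkd
      · rw [Function.update_of_ne hei] at hb; exact h2 e he hb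
    · have hei : e ≠ i := by rintro rfl; exact h4 hkd
      exact .inr ⟨h1, e, h2, by rw [Function.update_of_ne hei]; exact h3, h4⟩
  · intro e he e' he' hl hk hk'
    have hei : e ≠ i := by rintro rfl; exact hk hkd
    have hei' : e' ≠ i := by rintro rfl; exact hk' hkd
    rw [Function.update_of_ne hei, Function.update_of_ne hei'] at hl
    exact H.inj e he e' he' hl hk hk'
  · intro e he b hb hk
    have hei : e ≠ i := by rintro rfl; omega
    rw [Function.update_of_ne hei] at hb
    exact H.value e he b hb hk
  · intro e he hl
    have hei : e ≠ i := by rintro rfl; simp at hl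
    rw [Function.update_of_ne hei] at hl ⊢
    exact (H.idle e he hl).trans (Nat.add_le_add_right (bump_le _ _ _ _ _) _)
  · intro e he hl hk
    have hb := bump_le (n := n) lc i a h e
    by_cases hei : e = i
    · subst hei
      rw [Function.update_self]
      have := H.idle e he hlc
      omega
    · rw [Function.update_of_ne hei] at hl ⊢
      have := H.pending e he hl hk
      omega
  · rintro e he hl hk ⟨e', he', hne, hl'⟩
    have hb := bump_le (n := n) lc i a h e
    by_cases hei : e = i
    · subst hei
      rw [Function.update_of_ne hne, Function.update_self] at hl'
      have h1 : bump n lc e a h e = h e + 1 := by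
        unfold bump
        rw [if_pos rfl, if_pos ⟨e', he', hne, hl'⟩]
      rw [Function.update_self, h1]
      have := H.idle e he hlc
      omega
    · rw [Function.update_of_ne hei] at hl hl' ⊢
      by_cases hei' : e' = i
      · subst hei'
        rw [Function.update_self] at hl'
        have h1 : bump n lc e' a h e = h e + 1 := by
          unfold bump
          rw [if_neg hei, if_pos hl'.symm]
        rw [h1]
        have := H.pending e he hl hk
        omega
      · rw [Function.update_of_ne hei'] at hl'
        have := H.hit e he hl hk ⟨e', he', hne, hl'⟩
        omega

theorem DistOk.reserve (H : DistOk n m M T β a₀ R lc kd Fv Vv h) {i a : ℕ} (hi : i < n)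
    (hlc : lc i = a + 1) (hF : Fv a = 0) :
    DistOk n m M T β a₀ R lc (Function.update kd i 1) (Function.update Fv a 1) Vv h := by
  have ha := (H.place i hi a hlc).1
  have hnone : ∀ e < n, lc e = a + 1 → kd e = 0 := by
    rcases H.flag a ha with ⟨_, h2⟩ | ⟨h1, _⟩
    · exact h2
    · omega
  refine ⟨H.place, fun e he hk => ?_, fun b hb => ?_, fun e he e' he' hl hk hk' => ?_,
    fun e he b hb hk => ?_, H.idle, fun e he hl hk => ?_, fun e he hl hk => ?_⟩
  · by_cases hei : e = i
    · subst hei; omega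
    · rw [Function.update_of_ne hei] at hk; exact H.kind e he hk
  · by_cases hba : b = a
    · subst hba
      exact .inr ⟨by simp, i, hi, hlc, by simp⟩
    · rw [Function.update_of_ne hba]
      have hne : ∀ e, lc e = b + 1 → e ≠ i := by rintro e he rfl; omega
      rcases H.flag b hb with ⟨h1, h2⟩ | ⟨h1, e, h2, h3, h4⟩
      · exact .inl ⟨h1, fun e he hl => by rw [Function.update_of_ne (hne e hl)]; exact h2 e he hl⟩
      · exact .inr ⟨h1, e, h2, h3, by rw [Function.update_of_ne (hne e h3)]; exact h4⟩
  · by_cases hei : e = i <;> by_cases hei' : e' = i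
    · rw [hei, hei']
    · subst hei
      rw [Function.update_of_ne hei'] at hk'
      exact absurd (hnone e' he' (hl ▸ hlc)) hk'
    · subst hei'
      rw [Function.update_of_ne hei] at hk
      exact absurd (hnone e he (hl ▸ hlc)) hk
    · rw [Function.update_of_ne hei] at hk
      rw [Function.update_of_ne hei'] at hk'
      exact H.inj e he e' he' hl hk hk'
  · have hei : e ≠ i := by rintro rfl; simp at hk
    rw [Function.update_of_ne hei] at hk
    exact H.value e he b hb hk
  · have hei : e ≠ i := by rintro rfl; simp at hk
    rw [Function.update_of_ne hei] at hk
    exact H.pending e he hl hk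
  · have hei : e ≠ i := by rintro rfl; simp at hk
    rw [Function.update_of_ne hei] at hk
    exact H.hit e he hl hk

/-- The flag was set by another element at the same place, since `i` itself has not reserved it. So
`hit` applies, and the attempt that is now lost has been counted as a collision. -/
theorem DistOk.retry (H : DistOk n m M T β a₀ R lc kd Fv Vv h) {i a : ℕ} (hi : i < n)
    (hlc : lc i = a + 1) (hkd : kd i = 0) (hF : Fv a ≠ 0) :
    DistOk n m M T β a₀ R (Function.update lc i 0) kd Fv Vv h := by
  have ha := (H.place i hi a hlc).1
  have hT : T ≤ h i + R i := by
    rcases H.flag a ha with ⟨h1, _⟩ | ⟨_, e, h2, h3, h4⟩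
    · omega
    · exact H.hit i hi (by omega) hkd ⟨e, h2, by rintro rfl; exact h4 hkd, by omega⟩
  refine ⟨fun e he b hb => ?_, fun e he hk => ?_, fun b hb => ?_, fun e he e' he' hl hk hk' => ?_,
    fun e he b hb hk => ?_, fun e he hl => ?_, fun e he hl hk => ?_, fun e he hl hk h' => ?_⟩
  · have hei : e ≠ i := by rintro rfl; simp at hb
    rw [Function.update_of_ne hei] at hb
    exact H.place e he b hb
  · have hei : e ≠ i := by rintro rfl; exact hk hkd
    rw [Function.update_of_ne hei]; exact H.kind e he hk
  · rcases H.flag b hb with ⟨h1, h2⟩ | ⟨h1, e, h2, h3, h4⟩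
    · refine .inl ⟨h1, fun e he hl => ?_⟩
      have hei : e ≠ i := by rintro rfl; simp at hl
      rw [Function.update_of_ne hei] at hl
      exact h2 e he hl
    · have hei : e ≠ i := by rintro rfl; exact h4 hkd
      exact .inr ⟨h1, e, h2, by rw [Function.update_of_ne hei]; exact h3, h4⟩
  · have hei : e ≠ i := by rintro rfl; exact hk hkd
    have hei' : e' ≠ i := by rintro rfl; exact hk' hkd
    rw [Function.update_of_ne hei, Function.update_of_ne hei'] at hl
    exact H.inj e he e' he' hl hk hk'
  · have hei : e ≠ i := by rintro rfl; simp at hb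
    rw [Function.update_of_ne hei] at hb
    exact H.value e he b hb hk
  · by_cases hei : e = i
    · rw [hei]; exact hT
    · rw [Function.update_of_ne hei] at hl; exact H.idle e he hl
  · have hei : e ≠ i := by rintro rfl; simp at hl
    rw [Function.update_of_ne hei] at hl
    exact H.pending e he hl hk
  · have hei : e ≠ i := by rintro rfl; simp at hl
    rw [Function.update_of_ne hei] at hl h'
    obtain ⟨e', h1, h2, h3⟩ := h'
    have hei' : e' ≠ i := by rintro rfl; simp at h3; omega
    rw [Function.update_of_ne hei'] at h3
    exact H.hit e he hl hk ⟨e', h1, h2, h3⟩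

theorem DistOk.write (H : DistOk n m M T β a₀ R lc kd Fv Vv h) {i a : ℕ} (hi : i < n)
    (hlc : lc i = a + 1) (hkd : kd i = 1) :
    DistOk n m M T β a₀ R lc (Function.update kd i 2) Fv (Function.update Vv a (a₀ i)) h := by
  have hk0 : ∀ e, Function.update kd i 2 e = 0 ↔ kd e = 0 := fun e => by
    by_cases hei : e = i
    · subst hei; simp [hkd]
    · rw [Function.update_of_ne hei]
  refine ⟨H.place, fun e he hk => H.kind e he (by rwa [Ne, hk0] at hk), fun b hb => ?_,
    fun e he e' he' hl hk hk' => H.inj e he e' he' hl (by rwa [Ne, hk0] at hk)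
      (by rwa [Ne, hk0] at hk'), fun e he b hb hk => ?_, H.idle,
    fun e he hl hk => H.pending e he hl ((hk0 e).1 hk),
    fun e he hl hk => H.hit e he hl ((hk0 e).1 hk)⟩
  · rcases H.flag b hb with ⟨h1, h2⟩ | ⟨h1, e, h2, h3, h4⟩
    · exact .inl ⟨h1, fun e he hl => (hk0 e).2 (h2 e he hl)⟩
    · exact .inr ⟨h1, e, h2, h3, by rwa [Ne, hk0]⟩
  · by_cases hei : e = i
    · subst hei
      obtain rfl : a = b := by omega
      simp
    · rw [Function.update_of_ne hei] at hk
      have hba : b ≠ a := by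
        rintro rfl
        exact hei (H.inj e he i hi (by omega) (by omega) (by omega))
      rw [Function.update_of_ne hba]
      exact H.value e he b hb hk

end

end BF

/-! ### The invariant of the distribution loop and its tasks -/

namespace BF
variable {E : Env} {t : ℕ} {W : World} {L : ℕ} {f : ℝ≥0∞} {d w : ℕ} {s : St} {p : Share}

/-- The data of the distribution loop: `n` elements `a₀`, buckets `β` of `m` places each, `M` places
in arrays `F` and `V`, `T` attempts, and the price of the numbers of collisions and of attempts
that are left. -/
structure DistData where
  n : ℕ
  m : ℕ
  M : ℕ
  T : ℕ
  F : ℕ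
  V : ℕ
  β : ℕ → ℕ
  a₀ : ℕ → ℕ
  Ψ : (ℕ → ℕ) → (ℕ → ℕ) → ℝ≥0∞
  cost : ℝ≥0∞
  hn : 0 < n
  hm : 0 < m
  hnM : n ≤ M
  hFV : ∀ a < M, ∀ b < M, F + a ≠ V + b
  hβ : ∀ i < n, (β i + 1) * m ≤ M
  congr : ∀ h h' R R', (∀ i < n, h i = h' i) → (∀ i < n, R i = R' i) → Ψ h R = Ψ h' R'
  draw : ∀ (h R lc : ℕ → ℕ) (i k : ℕ), i < n → R i = k + 1 → lc i = 0 →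
    (∀ e < n, ∀ a, lc e = a + 1 → a / m = β e) →
    ∑ v ∈ Finset.range m, Ψ (bump n lc i (β i * m + v) h) (Function.update R i k) ≤ m * Ψ h R
  fail : ∀ (h R : ℕ → ℕ) (i : ℕ), i < n → T ≤ h i → cost ≤ Ψ h R

namespace DistData
variable (D : DistData)

/-- The places, in both arrays. -/
def Places (x : ℕ × ℕ) : Prop :=
  x.1 = 0 ∧ (D.F ≤ x.2 ∧ x.2 < D.F + D.M ∨ D.V ≤ x.2 ∧ x.2 < D.V + D.M)

-- Any element may compete for any place of its bucket, so the invariant owns all places completely.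
-- Of the ghost cells it has half; the other half lets an element rely on its own entries between
-- two instructions.
open Classical in
noncomputable def invShare : Share := fun x =>
  if Gh D.F D.n x then 1 / 2 else if D.Places x then 1 else 0

def Ok (s : St) (h : ℕ → ℕ) : Prop :=
  DistOk D.n D.m D.M D.T D.β D.a₀ (fun i => s (1, D.F + i)) (fun i => s (2, D.F + i))
    (fun i => s (3, D.F + i)) (fun a => s (0, D.F + a)) (fun a => s (0, D.V + a)) h

/-- The invariant of the distribution loop. -/
def Inv : BF.Inv := fun s p e δ => δ = 0 ∧
  ((∀ i < D.n, 1 ≤ p (1, D.F + i)) ∨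
    p = D.invShare ∧ ∃ h, D.Ok s h ∧ D.Ψ h (fun i => s (1, D.F + i)) ≤ e)

variable {D}

theorem invShare_gh {i j : ℕ} (hj : j ≠ 0) (hi : i < D.n) : D.invShare (j, D.F + i) = 1 / 2 :=
  if_pos (gh_mk hj hi)

theorem invShare_F {a : ℕ} (ha : a < D.M) : D.invShare (0, D.F + a) = 1 := by
  rw [invShare, if_neg fun h => h.1 rfl, if_pos]
  exact ⟨rfl, .inl ⟨Nat.le_add_right _ _, by simp only; omega⟩⟩

theorem invShare_V {a : ℕ} (ha : a < D.M) : D.invShare (0, D.V + a) = 1 := by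
  rw [invShare, if_neg fun h => h.1 rfl, if_pos]
  exact ⟨rfl, .inr ⟨Nat.le_add_right _ _, by simp only; omega⟩⟩

theorem Ok.congr {s s' : St} {h : ℕ → ℕ} (H : D.Ok s h) (hs : Agree D.invShare s s') : D.Ok s' h := by
  refine DistOk.congr H (fun i hi => hs _ ?_) (fun i hi => hs _ ?_) (fun i hi => hs _ ?_)
    (fun a ha => hs _ ?_) (fun a ha => hs _ ?_)
  · rw [invShare_gh one_ne_zero hi]; norm_num
  · rw [invShare_gh (by norm_num) hi]; norm_num
  · rw [invShare_gh (by norm_num) hi]; norm_num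
  · rw [invShare_F ha]; norm_num
  · rw [invShare_V ha]; norm_num

/-- Opening the invariant with a part of the ghost cells. -/
theorem Inv.at_open {s' : St} {p₁ : Share} {e₁ : ℝ≥0∞} {δ₁ : ℕ} (hI : D.Inv.At s' p₁ e₁ δ₁)
    (hle : p + p₁ ≤ 1) {i : ℕ} (hi : i < D.n) (hp : 1 / 2 ≤ p (1, D.F + i)) :
    δ₁ = 0 ∧ p₁ = D.invShare ∧ ∃ h, D.Ok s' h ∧ D.Ψ h (fun i => s' (1, D.F + i)) ≤ e₁ := by
  obtain ⟨s₄, hs₄, hδ, hdead | ⟨hp₁, h, h1, h2⟩⟩ := hI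
  · exfalso
    have h4 := hle (1, D.F + i)
    simp only [Pi.add_apply, Pi.one_apply] at h4
    exact half_add_one ((add_le_add hp (hdead i hi)).trans h4)
  · rw [hp₁] at hs₄
    refine ⟨hδ, hp₁, h, h1.congr hs₄, ?_⟩
    rwa [D.congr h h _ (fun i => s₄ (1, D.F + i)) (fun _ _ => rfl) fun i hi => (hs₄ _ ?_).symm]
    rw [invShare_gh one_ne_zero hi]; norm_num

theorem Inv.at_close {s' : St} {e₁ : ℝ≥0∞} {h : ℕ → ℕ} (h1 : D.Ok s' h)
    (h2 : D.Ψ h (fun i => s' (1, D.F + i)) ≤ e₁) : D.Inv.At s' D.invShare e₁ 0 :=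
  ⟨s', .refl _ _, rfl, .inr ⟨rfl, h, h1, h2⟩⟩

/-- What task `i` knows about its ghost cells in the end. -/
def Post (D : DistData) (i v : ℕ) (s : St) : Prop :=
  v = 0 ∧ s (2, D.F + i) ≠ 0 ∧ s (3, D.F + i) = 2 ∨
  v = 1 ∧ s (2, D.F + i) = 0 ∧ s (1, D.F + i) = 0

theorem attempt_bind (κ : Params) (e F V base m k : ℕ) (kk : ℕ → Prog Proc Word) :
    (Proc.code κ (.attempt e F V base m k)).bind kk = .instr (.alu .eq k 0) fun none =>
      if none = 1 then kk 1 else .instr (.rand m) fun s => .instr (.alu .add base s) fun a =>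
      .instr (.alu .add F a) fun x => .instr (.tas x) fun taken =>
      if taken = 0 then .instr (.alu .add V a) fun x => .instr (.write x e) fun _ => kk 0
      else .instr (.alu .sub k 1) fun k' => .call (.attempt e F V base m k') kk := by
  simp only [Proc.code, Prog.bind_def, Prog.pure_def, BF.call, BF.alu, BF.rand, BF.tasAt, BF.tas,
    BF.writeAt, BF.write, Prog.bind, Prog.bind_ite]

/-- Three atomic instructions open the invariant, and each is one transition of `DistOk`: the random
draw is `draw`, the test-and-set is `reserve` or `retry`, and the write is `write`. Only the draw
changes the estimator. -/
theorem attempt {D : DistData} (hJ : Opens W D.Inv) {i e k : ℕ} {kk : ℕ → Prog Proc Word} {c : ℕ}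
    (hi : i < D.n) (he : e = D.a₀ i) (hc : c = 9 * (k + 1)) (hd : d + c ≤ L) (hw : c ≤ w)
    (hbd : 3 ≤ E.bd) (hM : D.M ≤ E.bd) (hk : k ≤ E.bd) (he' : e ≤ E.bd)
    (hF : D.F + D.M ≤ E.bd + W.nx) (hV : D.V + D.M ≤ E.bd + W.nx)
    (hp : ∀ j, j ≠ 0 → p (j, D.F + i) = 1 / 2)
    (hR : s (1, D.F + i) = k) (hlc : s (2, D.F + i) = 0) (hkd : s (3, D.F + i) = 0)
    (hkk : ∀ t' ≤ t, ∀ W', W ≤ W' → ∀ d' w' s' v, d' ≤ d + c → w ≤ w' + c → D.Post i v s' →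
      (∀ x, p x ≠ 0 → (∀ j, j ≠ 0 → x ≠ (j, D.F + i)) → s x = s' x) →
      FS E t' W' L f d' w' (kk v) s' p) :
    FS E t W L f d w (.call (.attempt e D.F D.V (D.β i * D.m) D.m k) kk) s p := by
  induction k generalizing c d w s t W with
  | zero =>
    refine FS.call (by omega) (by omega) ?_
    rw [attempt_bind]
    refine FS.eq (by omega) (by omega) (by omega) ?_
    rw [if_pos (by simp)]
    exact hkk t le_rfl W le_rfl _ _ s 1 (by omega) (by omega) (.inr ⟨rfl, hlc, hR⟩) fun _ _ _ => rfl
  | succ k ih =>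
    have hM' := D.hβ i hi
    rw [add_one_mul] at hM'
    have hm := D.hm
    have hpi : ∀ j, j ≠ 0 → p (j, D.F + i) ≠ 0 := fun j hj => by rw [hp j hj]; norm_num
    have half : ∀ j, j ≠ 0 → p (j, D.F + i) + D.invShare (j, D.F + i) = 1 := fun j hj => by
      rw [hp j hj, invShare_gh hj hi, add_halves]
    have hp0 : p + D.invShare ≤ 1 → ∀ x, D.invShare x = 1 → p x = 0 := fun hle x hx => by
      have := hle x
      simp only [Pi.add_apply, hx, Pi.one_apply] at this
      simpa using this
    refine FS.call (by omega) (by omega) ?_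
    rw [attempt_bind]
    refine FS.eq (by omega) (by omega) (by omega) ?_
    rw [if_neg (by simp)]
    refine FS.rand (by omega) (by omega) hm (by omega) hJ fun W₁ s₁ p₁ e₁ δ₁ hW₁ hs₁ hI hle => ?_
    obtain ⟨rfl, rfl, h, hOk, hΨ⟩ := Inv.at_open hI hle hi (hp 1 one_ne_zero).ge
    have hR1 : s₁ (1, D.F + i) = k + 1 := by rw [← hs₁ _ (hpi 1 one_ne_zero), hR]
    have hlc1 : s₁ (2, D.F + i) = 0 := by rw [← hs₁ _ (hpi 2 (by norm_num)), hlc]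
    have hkd1 : s₁ (3, D.F + i) = 0 := by rw [← hs₁ _ (hpi 3 (by norm_num)), hkd]
    refine ⟨fun v => D.Ψ (bump D.n (fun i => s₁ (2, D.F + i)) i (D.β i * D.m + v) h)
      (Function.update (fun i => s₁ (1, D.F + i)) i k),
      (D.draw h _ (fun i => s₁ (2, D.F + i)) i k hi hR1 hlc1
        fun e he a ha => (hOk.place e he a ha).2).trans (mul_le_mul' le_rfl hΨ), fun v hv => ?_⟩
    obtain ⟨a, ha⟩ : ∃ a, a = D.β i * D.m + v := ⟨_, rfl⟩
    beta_reduce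
    rw [← ha]
    have haM : a < D.M := by omega
    have hne : ∀ b < D.M, D.V + b ≠ D.F + a := fun b hb h => D.hFV a haM b hb h.symm
    have hne' : ∀ b < D.M, D.F + b ≠ D.V + a := fun b hb => D.hFV b hb a haM
    have ham : a / D.m = D.β i := by
      rw [ha, mul_comm, Nat.mul_add_div hm, Nat.div_eq_of_lt hv, add_zero]
    set s₂ : St := Function.update (Function.update s₁ (1, D.F + i) k) (2, D.F + i) (a + 1) with hs₂
    have hOk2 : D.Ok s₂ (bump D.n (fun i => s₁ (2, D.F + i)) i a h) := by
      refine DistOk.congr (hOk.draw hi hlc1 hR1 haM ham) (fun i' hi' => ?_) (fun i' hi' => ?_)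
        (fun i' hi' => ?_) (fun b hb => ?_) (fun b hb => ?_)
      all_goals simp only [hs₂, Function.update_apply, Prod.mk.injEq, add_right_inj]; simp
    have hs₂x : ∀ x, (∀ j, j ≠ 0 → x ≠ (j, D.F + i)) → s₂ x = s₁ x := fun x hx => by
      rw [hs₂, Function.update_of_ne (hx 2 (by norm_num)), Function.update_of_ne (hx 1 one_ne_zero)]
    refine ⟨s₂, p, D.invShare, fun b => hs₂x _ fun j hj => by simp [hj.symm], fun x hx => ?_,
      Inv.at_close hOk2 (D.congr _ _ _ _ (fun _ _ => rfl) fun i' _ => ?_).le, le_rfl, ?_⟩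
    · refine (hs₂x x fun j hj hxj => ?_).symm
      rw [hxj, half j hj] at hx
      exact lt_irrefl _ hx
    · simp only [hs₂, Function.update_apply, Prod.mk.injEq, add_right_inj]; simp
    have hnx1 := hW₁.2
    refine FS.add (by omega) (by omega) (by omega) ?_
    rw [← ha]
    refine FS.add (by omega) (by omega) (by omega) ?_
    have hag2 : ∀ x, p x ≠ 0 → (∀ j, j ≠ 0 → x ≠ (j, D.F + i)) → s x = s₂ x := fun x hpx hx => by
      rw [hs₂x x hx]; exact hs₁ x hpx
    have hR2 : s₂ (1, D.F + i) = k := by simp [hs₂]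
    have hlc2 : s₂ (2, D.F + i) = a + 1 := by simp [hs₂]
    have hkd2 : s₂ (3, D.F + i) = 0 := by simp [hs₂, hkd1]
    clear_value s₂
    clear hs₂x hOk2 hOk hΨ hR1 hlc1 hkd1 hs₁ hI
    refine FS.tas (by omega) (by omega) (by omega) (hJ.mono hW₁)
      fun W₃ s₃ p₃ e₃ δ₃ hW₃ hs₃ hI hle => ?_
    obtain ⟨rfl, rfl, h, hOk, hΨ⟩ := Inv.at_open hI hle hi (hp 1 one_ne_zero).ge
    have hnx3 := hW₃.2
    have hR3 : s₃ (1, D.F + i) = k := by rw [← hs₃ _ (hpi 1 one_ne_zero), hR2]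
    have hlc3 : s₃ (2, D.F + i) = a + 1 := by rw [← hs₃ _ (hpi 2 (by norm_num)), hlc2]
    have hkd3 : s₃ (3, D.F + i) = 0 := by rw [← hs₃ _ (hpi 3 (by norm_num)), hkd2]
    by_cases hfl : s₃ (0, D.F + a) = 0
    · set s₄ : St := Function.update (Function.update s₃ (0, D.F + a) 1) (3, D.F + i) 1 with hs₄
      have hOk4 : D.Ok s₄ h := by
        refine DistOk.congr (hOk.reserve hi hlc3 hfl) (fun i' hi' => ?_) (fun i' hi' => ?_)
          (fun i' hi' => ?_) (fun b hb => ?_) (fun b hb => ?_)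
        all_goals simp only [hs₄, Function.update_apply, Prod.mk.injEq, add_right_inj]
        all_goals first | (simp; done) | simp [hne b hb]
      have hs₄x : ∀ x, x ≠ (0, D.F + a) → (∀ j, j ≠ 0 → x ≠ (j, D.F + i)) → s₄ x = s₃ x :=
        fun x hx hx' => by
          rw [hs₄, Function.update_of_ne (hx' 3 (by norm_num)), Function.update_of_ne hx]
      refine ⟨s₄, p, D.invShare, fun b => ?_, fun x hx => ?_,
        Inv.at_close hOk4 ((D.congr _ _ _ _ (fun _ _ => rfl) fun i' _ => ?_).le.trans hΨ), le_rfl, ?_⟩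
      · simp [hs₄, Function.update_apply, hfl]
      · refine (hs₄x x ?_ fun j hj hxj => ?_).symm
        · rintro rfl
          rw [invShare_F haM] at hx
          exact absurd hx (not_lt.2 le_add_self)
        · rw [hxj, half j hj] at hx
          exact lt_irrefl _ hx
      · simp [hs₄]
      simp only [if_pos hfl, if_true]
      refine FS.add (by omega) (by omega) (by omega) ?_
      have hag4 : ∀ x, p x ≠ 0 → (∀ j, j ≠ 0 → x ≠ (j, D.F + i)) → s x = s₄ x := fun x hpx hx => by
        rw [hs₄x x (by rintro rfl; exact hpx (hp0 hle _ (invShare_F haM))) hx, ← hs₃ x hpx]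
        exact hag2 x hpx hx
      have hlc4 : s₄ (2, D.F + i) = a + 1 := by simp [hs₄, hlc3]
      have hkd4 : s₄ (3, D.F + i) = 1 := by simp [hs₄]
      clear_value s₄
      clear hs₄x hOk4 hOk hΨ hR3 hlc3 hkd3 hs₃ hI hfl
      refine FS.write_inv (by omega) (by omega) (by omega) ((hJ.mono hW₁).mono hW₃)
        fun W₅ s₅ p₅ e₅ δ₅ hW₅ hs₅ hI hle => ?_
      obtain ⟨rfl, rfl, h, hOk, hΨ⟩ := Inv.at_open hI hle hi (hp 1 one_ne_zero).ge
      have hlc5 : s₅ (2, D.F + i) = a + 1 := by rw [← hs₅ _ (hpi 2 (by norm_num)), hlc4]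
      have hkd5 : s₅ (3, D.F + i) = 1 := by rw [← hs₅ _ (hpi 3 (by norm_num)), hkd4]
      set s₆ : St := Function.update (Function.update s₅ (0, D.V + a) e) (3, D.F + i) 2 with hs₆
      have hOk6 : D.Ok s₆ h := by
        refine DistOk.congr (hOk.write hi hlc5 hkd5) (fun i' hi' => ?_) (fun i' hi' => ?_)
          (fun i' hi' => ?_) (fun b hb => ?_) (fun b hb => ?_)
        all_goals simp only [hs₆, Function.update_apply, Prod.mk.injEq, add_right_inj]
        all_goals first | (simp; done) | (simp [he]; done) | simp [hne' b hb]
      have hs₆x : ∀ x, x ≠ (0, D.V + a) → (∀ j, j ≠ 0 → x ≠ (j, D.F + i)) → s₆ x = s₅ x :=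
        fun x hx hx' => by
          rw [hs₆, Function.update_of_ne (hx' 3 (by norm_num)), Function.update_of_ne hx]
      refine ⟨s₆, p, D.invShare, fun b => ?_, fun x hx => ?_,
        Inv.at_close hOk6 ((D.congr _ _ _ _ (fun _ _ => rfl) fun i' _ => ?_).le.trans hΨ), le_rfl, ?_⟩
      · simp [hs₆, Function.update_apply]
      · refine (hs₆x x ?_ fun j hj hxj => ?_).symm
        · rintro rfl
          rw [invShare_V haM] at hx
          exact absurd hx (not_lt.2 le_add_self)
        · rw [hxj, half j hj] at hx
          exact lt_irrefl _ hx
      · simp [hs₆]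
      refine hkk t le_rfl W₅ ((hW₁.trans hW₃).trans hW₅) _ _ s₆ 0 (by omega) (by omega)
        (.inl ⟨rfl, ?_, ?_⟩) fun x hpx hx => ?_
      · simp [hs₆, hlc5]
      · simp [hs₆]
      · rw [hs₆x x (by rintro rfl; exact hpx (hp0 hle _ (invShare_V haM))) hx, ← hs₅ x hpx]
        exact hag4 x hpx hx
    · set s₄ : St := Function.update s₃ (2, D.F + i) 0 with hs₄
      have hOk4 : D.Ok s₄ h := by
        refine DistOk.congr (hOk.retry hi hlc3 hkd3 hfl) (fun i' hi' => ?_) (fun i' hi' => ?_)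
          (fun i' hi' => ?_) (fun b hb => ?_) (fun b hb => ?_)
        all_goals simp only [hs₄, Function.update_apply, Prod.mk.injEq, add_right_inj]; simp
      have hs₄x : ∀ x, (∀ j, j ≠ 0 → x ≠ (j, D.F + i)) → s₄ x = s₃ x :=
        fun x hx' => by rw [hs₄, Function.update_of_ne (hx' 2 (by norm_num))]
      refine ⟨s₄, p, D.invShare, fun b => ?_, fun x hx => ?_,
        Inv.at_close hOk4 ((D.congr _ _ _ _ (fun _ _ => rfl) fun i' _ => ?_).le.trans hΨ), le_rfl, ?_⟩
      · simp [hs₄, hfl]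
      · refine (hs₄x x fun j hj hxj => ?_).symm
        rw [hxj, half j hj] at hx
        exact lt_irrefl _ hx
      · simp [hs₄]
      simp only [if_neg hfl, one_ne_zero, if_false]
      have hag4 : ∀ x, p x ≠ 0 → (∀ j, j ≠ 0 → x ≠ (j, D.F + i)) → s x = s₄ x := fun x hpx hx => by
        rw [hs₄x x hx, ← hs₃ x hpx]
        exact hag2 x hpx hx
      refine FS.sub (by omega) (by omega) (by omega) ?_
      rw [Nat.add_sub_cancel]
      refine ih ((hJ.mono hW₁).mono hW₃) (c := 9 * (k + 1)) rfl (by omega) (by omega) (by omega)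
        (by omega) (by omega) ?_ ?_ ?_ fun t' ht' W' hW' d' w' s' v g1 g2 g3 g4 =>
        hkk t' ht' W' ((hW₁.trans hW₃).trans hW') d' w' s' v (by omega) (by omega) g3
          fun x hpx hx => (hag4 x hpx hx).trans (g4 x hpx hx)
      · simp [hs₄, hR3]
      · simp [hs₄]
      · simp [hs₄, hkd3]

/-- A task that reports failure has no attempts left and no place, so `idle` gives at least `T`
collisions, and the estimator releases the cost of a restart. If no task fails, every element has
written itself to a place that it alone has reserved. -/
theorem distribute {D : DistData} {N : ℕ} {rk : ℕ → ℕ} (hr : Ranked E N rk) {b Q q j jq : ℕ}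
    {P : ℕ → ℕ} {k : ℕ → Prog Proc Word} {c c' : ℕ}
    (hc : c = 17 * j + 10 * jq + 9 * D.T + 18) (hc' : c' = D.n * (10 * jq + 9 * D.T + 39) + 3)
    (hd : d + c ≤ L) (hw : c' ≤ w) (hj : D.n ≤ 2 ^ j) (hjq : q + 1 ≤ 2 ^ jq)
    (hbd : 3 ≤ E.bd) (hM : 2 * D.M ≤ E.bd) (hT : D.T ≤ E.bd) (hN : N ≤ E.bd) (hq : 2 * q ≤ E.bd)
    (hF : D.F + D.M ≤ E.bd + W.nx) (hV : D.V + D.M ≤ E.bd + W.nx) (hQ : Q + q ≤ E.bd + W.nx)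
    (hb : b + D.n ≤ E.bd + W.nx)
    (hpF : ∀ a < D.M, 1 ≤ p (0, D.F + a)) (hpV : ∀ a < D.M, 1 ≤ p (0, D.V + a))
    (hpg : ∀ x, Gh D.F D.n x → 1 ≤ p x)
    (hpb : ∀ i < D.n, p (0, b + i) ≠ 0) (hpQ : ∀ i < q, p (0, Q + i) ≠ 0)
    (hbFV : ∀ i < D.n, ¬ D.Places (0, b + i)) (hQFV : ∀ i < q, ¬ D.Places (0, Q + i))
    (hF0 : ∀ a < D.M, s (0, D.F + a) = 0) (hsb : ∀ i < D.n, s (0, b + i) = D.a₀ i)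
    (ha₀ : ∀ i < D.n, D.a₀ i < N)
    (hsQ : ∀ i < q, s (0, Q + i) = P i) (hPN : ∀ i < q, P i < N)
    (hmono : ∀ i i', i ≤ i' → i' < q → rk (P i) ≤ rk (P i'))
    (hβ : ∀ i < D.n, D.β i ≤ q ∧ (∀ i' < D.β i, rk (P i') < rk (D.a₀ i)) ∧
      ∀ i', D.β i ≤ i' → i' < q → rk (D.a₀ i) ≤ rk (P i'))
    (hok : ∀ t' ≤ t, ∀ W', W ≤ W' → ∀ d' w' s' (loc : ℕ → ℕ), d' ≤ d + c → w ≤ w' + c' →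
      (∀ i < D.n, loc i < D.M ∧ loc i / D.m = D.β i ∧ s' (0, D.F + loc i) = 1 ∧
        s' (0, D.V + loc i) = D.a₀ i) →
      (∀ i < D.n, ∀ i' < D.n, loc i = loc i' → i = i') →
      (∀ a < D.M, (∀ i < D.n, loc i ≠ a) → s' (0, D.F + a) = 0) →
      (∀ x, ¬ D.Places x → ¬ Gh D.F D.n x → p x ≠ 0 → s x = s' x) →
      FS E t' W' L f d' w' (k 0) s' (Share.gh D.F D.n 0 p))
    (hfail : ∀ t' ≤ t, ∀ W', W ≤ W' → ∀ d' w' s' v, d' ≤ d + c → w ≤ w' + c' → v ≠ 0 →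
      (∀ x, ¬ D.Places x → ¬ Gh D.F D.n x → p x ≠ 0 → s x = s' x) →
      FS E t' W' L (f + D.cost) d' w' (k v) s' (Share.gh D.F D.n 0 p)) :
    FS E t W L (f + D.Ψ (fun _ => 0) fun _ => D.T) d w
      (.call (.parFor (.distribute b Q q D.F D.V D.m D.T) 0 D.n) k) s p := by
  classical
  refine safe.of_le_one fun hp1 => ?_
  refine FS.init_ghost (fun x => if x.1 = 1 then D.T else 0) hpg fun W₁ s₁ hW₁ hs₁ hs₁g => ?_
  have hnx1 := hW₁.2
  have hng : ∀ a, ¬ Gh D.F D.n (0, a) := fun a h => h.1 rfl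
  have hg1 : ∀ i < D.n, s₁ (1, D.F + i) = D.T := fun i hi => by
    rw [hs₁g _ (gh_mk one_ne_zero hi)]; simp
  have hgj : ∀ j, j ≠ 0 → j ≠ 1 → ∀ i < D.n, s₁ (j, D.F + i) = 0 := fun j h0 h1 i hi => by
    rw [hs₁g _ (gh_mk h0 hi)]; simp [h1]
  have hF1 : ∀ a < D.M, s₁ (0, D.F + a) = 0 := fun a ha => by
    rw [← hs₁ _ (hng _) (fun h => by simpa [h] using hpF a ha)]; exact hF0 a ha
  have hPl : ∀ x, D.Places x → 1 ≤ p x := by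
    rintro ⟨i, x⟩ ⟨rfl, ⟨h1, h2⟩ | ⟨h1, h2⟩⟩
    · have := hpF (x - D.F) (by simp only at h1 h2; omega)
      rwa [Nat.add_sub_cancel' h1] at this
    · have := hpV (x - D.V) (by simp only at h1 h2; omega)
      rwa [Nat.add_sub_cancel' h1] at this
  have hPg : ∀ x, D.Places x → ¬ Gh D.F D.n x := fun x h h' => h'.1 h.1
  set pm : Share := fun x => if Gh D.F D.n x then 1 / 2 else if D.Places x then 0 else p x with hpm
  have pm_g : ∀ x, Gh D.F D.n x → pm x = 1 / 2 := fun x h => if_pos h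
  have pm_o : ∀ x, ¬ Gh D.F D.n x → ¬ D.Places x → pm x = p x := fun x h h' => by
    rw [hpm]; simp only [if_neg h, if_neg h']
  refine FS.new_inv D.Inv (p := pm) (q := D.invShare)
    ⟨rfl, .inr ⟨rfl, fun _ => 0, ?_, (D.congr _ _ _ _ (fun _ _ => rfl) fun i hi => ?_).le⟩⟩
    (fun x => ?_) ?_
  · refine ⟨fun i hi a h => ?_, fun i hi h => ?_, fun a ha => .inl ⟨hF1 a ha, fun i hi h => ?_⟩,
      fun i hi i' hi' h h' => ?_, fun i hi a h => ?_, fun i hi h => ?_, fun i hi h => ?_,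
      fun i hi h => ?_⟩
    · rw [hgj 2 (by norm_num) (by norm_num) i hi] at h; omega
    · rw [hgj 3 (by norm_num) (by norm_num) i hi] at h; omega
    · rw [hgj 2 (by norm_num) (by norm_num) i hi] at h; omega
    · rw [hgj 3 (by norm_num) (by norm_num) i hi] at h'; omega
    · rw [hgj 2 (by norm_num) (by norm_num) i hi] at h; omega
    · rw [hg1 i hi]; omega
    · rw [hgj 2 (by norm_num) (by norm_num) i hi] at h; omega
    · rw [hgj 2 (by norm_num) (by norm_num) i hi] at h; omega
  · rw [hg1 i hi]
  · simp only [Pi.add_apply, hpm, invShare]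
    by_cases hx : Gh D.F D.n x
    · rw [if_pos hx, if_pos hx, add_halves]; exact hpg x hx
    · rw [if_neg hx, if_neg hx]
      by_cases hx' : D.Places x
      · rw [if_pos hx', if_pos hx', zero_add]; exact hPl x hx'
      · rw [if_neg hx', if_neg hx', add_zero]
  set W₂ : World := ⟨D.Inv :: W₁.invs, W₁.nx⟩ with hW₂
  have hW12 : W₁ ≤ W₂ := World.le_new _ _
  have hnx2 : W₂.nx = W₁.nx := rfl
  have hJ : Opens W₂ D.Inv := Opens.of_mem (by simp [hW₂])
  have hnM := D.hnM
  have hbv : ∀ i < D.n, s₁ (0, b + i) = D.a₀ i := fun i hi => by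
    rw [← hs₁ _ (hng _) (hpb i hi), hsb i hi]
  have hQv : ∀ i < q, s₁ (0, Q + i) = P i := fun i hi => by
    rw [← hs₁ _ (hng _) (hpQ i hi), hsQ i hi]
  have hA : ∀ i x, (Gh D.F D.n x ∧ x.2 = D.F + i) → pm x ≠ 0 := fun i x h => by
    rw [pm_g x h.1]; norm_num
  refine FS.parFor_owned (A := fun i x => Gh D.F D.n x ∧ x.2 = D.F + i)
    (cd := 10 * jq + 9 * D.T + 14) (cw := 10 * jq + 9 * D.T + 14) (F := fun i v s' => D.Post i v s')
    (fun i _ i' _ a h1 h2 => by omega) (hc.trans (by ring)) hc' hd hw hj hbd (by omega)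
    (fun i hi v s s' h1 h2 => ?_) (fun i hi v s h => ?_) (fun i hi q' h1 h2 => ?_)
    (fun t' ht' W' hW' d' w' s' vs g1 g2 g3 g4 => ?_)
  · have h3 : ∀ j, j ≠ 0 → s (j, D.F + i) = s' (j, D.F + i) := fun j hj =>
      h1 _ ⟨gh_mk hj hi, rfl⟩ (hA i _ ⟨gh_mk hj hi, rfl⟩)
    rw [Post, ← h3 1 one_ne_zero, ← h3 2 (by norm_num), ← h3 3 (by norm_num)]
    exact h2
  · rcases h with ⟨h, -⟩ | ⟨h, -⟩ <;> omega
  · intro t' ht' W' hW' k s₀ px f d w hag hd hw hk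
    have hqg : ∀ j, j ≠ 0 → q' (j, D.F + i) = 1 / 2 := fun j hj => by
      rw [h1 _ ⟨gh_mk hj hi, rfl⟩, pm_g _ (gh_mk hj hi)]
    -- Nothing is changed here. The invariant is opened only to learn that the frame has no share of
    -- the ghost cells of task `i`, of which one half belongs to the task and one to the invariant.
    refine FS.view_shift (hJ.mono hW') fun W₃ s₃ p₁ e₁ δ₁ hW₃ hs₃ hI hle => ?_
    obtain ⟨rfl, rfl, -⟩ := Inv.at_open hI hle hi (le_trans (hqg 1 one_ne_zero).ge le_self_add)
    refine ⟨s₃, q' + px, D.invShare, 0, e₁, fun _ => rfl, fun _ _ => rfl, hI, le_rfl, by simp, ?_⟩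
    have hpx : ∀ j, j ≠ 0 → px (j, D.F + i) = 0 := fun j hj => by
      have h4 := hle (j, D.F + i)
      simp only [Pi.add_apply, Pi.one_apply, hqg j hj, invShare_gh hj hi] at h4
      have h5 : (1 : ℝ≥0) + px (j, D.F + i) ≤ 1 := by
        calc _ = 1 / 2 + px (j, D.F + i) + 1 / 2 := by rw [add_right_comm, add_halves]
          _ ≤ 1 := h4
      simpa using h5
    rw [add_zero]
    have hqb : ∀ i < D.n, q' (0, b + i) ≠ 0 := fun i' hi' =>
      h2 _ (fun _ _ h => hng _ h.1) (by rw [pm_o _ (hng _) (hbFV i' hi')]; exact hpb i' hi')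
    have hqQ : ∀ i < q, q' (0, Q + i) ≠ 0 := fun i' hi' =>
      h2 _ (fun _ _ h => hng _ h.1) (by rw [pm_o _ (hng _) (hQFV i' hi')]; exact hpQ i' hi')
    have hag3 : Agree q' s₁ s₃ := hag.trans (hs₃.mono le_self_add)
    have hnx3 := (hW'.trans hW₃).2
    simp only [Task.code, Prog.bind_def, Prog.bind_assoc, Prog.bind, BF.alu, BF.call]
    refine FS.readAt (by omega) (by omega) (by omega) (ne_zero_of_le le_self_add (hqb i hi)) ?_
    rw [← hag3 _ (hqb i hi), hbv i hi]
    have hai := ha₀ i hi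
    refine FS.search hr (P := P) (q := q) (j := jq) rfl (by omega) (by omega) (by omega) hai (by omega)
      (Nat.zero_le _) le_rfl hq (by omega) (fun i' hi' => ne_zero_of_le le_self_add (hqQ i' hi'))
      (fun i' hi' => by rw [← hag3 _ (hqQ i' hi')]; exact hQv i' hi') hPN hmono
      (fun i' hi' => by omega) (fun i' h3 h4 => by omega) fun d₁ w₁ r h3 h4 h5 h6 h7 => ?_
    obtain ⟨hb1, hb2, hb3⟩ := hβ i hi
    have hr : r = D.β i := by
      rcases lt_trichotomy r (D.β i) with h | h | h
      · exact absurd (hb2 r h) (not_lt.2 (h7 r le_rfl (by omega)))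
      · exact h
      · exact absurd (h6 _ h) (not_lt.2 (hb3 _ le_rfl (by omega)))
    have hβM := D.hβ i hi
    rw [add_one_mul] at hβM
    rw [hr]
    refine FS.mul (by omega) (by omega) (by omega) ?_
    have hag' : ∀ j, j ≠ 0 → s₃ (j, D.F + i) = s₁ (j, D.F + i) := fun j hj =>
      (hag3 _ (by rw [hqg j hj]; norm_num)).symm
    refine attempt ((hJ.mono hW').mono hW₃) hi rfl rfl (by omega) (by omega) hbd (by omega) hT
      (by omega) (by omega) (by omega)
      (fun j hj => by simp only [Pi.add_apply, hpx j hj, hqg j hj, add_zero])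
      (by rw [hag' 1 one_ne_zero, hg1 i hi])
      (by rw [hag' 2 (by norm_num), hgj 2 (by norm_num) (by norm_num) i hi])
      (by rw [hag' 3 (by norm_num), hgj 3 (by norm_num) (by norm_num) i hi])
      fun t'' ht'' W'' hW'' d' w' s' v g1 g2 g3 g4 => ?_
    refine hk t'' ht'' W'' (hW₃.trans hW'') v d' w' s' (by omega) (by omega)
      ⟨g3, fun a ha hA => (hag3 a ha).trans (g4 a (ne_zero_of_le le_self_add ha) ?_)⟩
      fun a ha => (hs₃ a (ne_zero_of_le le_add_self ha)).trans
        (g4 a (ne_zero_of_le le_add_self ha) ?_)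
    · rintro j hj rfl
      exact hA ⟨gh_mk hj hi, rfl⟩
    · rintro j hj rfl
      exact ha (hpx j hj)
  · have hn := D.hn
    have hpm1 : ∀ i < D.n, ∀ j, j ≠ 0 → pm (j, D.F + i) ≠ 0 := fun i hi j hj =>
      hA i _ ⟨gh_mk hj hi, rfl⟩
    refine FS.view_shift (hJ.mono hW') fun W₃ s₃ p₁ e₁ δ₁ hW₃ hs₃ hI hle => ?_
    obtain ⟨rfl, rfl, h, hOk, hΨ⟩ := Inv.at_open hI hle hn (pm_g _ (gh_mk one_ne_zero hn)).ge
    have hsh : Share.gh D.F D.n 0 p + Share.gh D.F D.n 1 0 ≤ pm + D.invShare := fun x => by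
      simp only [Pi.add_apply, invShare]
      by_cases hx : Gh D.F D.n x
      · rw [gh_of hx, gh_of hx, pm_g x hx, if_pos hx, add_halves, zero_add]
      · rw [gh_of_not hx, gh_of_not hx, if_neg hx]
        by_cases hx' : D.Places x
        · rw [if_pos hx']
          simp only [Pi.zero_apply, add_zero]
          exact le_trans (hp1 x) le_add_self
        · rw [if_neg hx', pm_o x hx hx']
          simp
    have hag : ∀ x, ¬ D.Places x → ¬ Gh D.F D.n x → p x ≠ 0 → s x = s₃ x := fun x hx hx' hpx => by
      have hpx' : pm x ≠ 0 := by rwa [pm_o x hx' hx]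
      rw [hs₁ x hx' hpx, g4 x (fun i hi h => hx' h.1) hpx', hs₃ x hpx']
    have hpost : ∀ i < D.n, D.Post i (vs i) s₃ := fun i hi => by
      have := g3 i hi
      rwa [Post, hs₃ _ (hpm1 i hi 1 one_ne_zero), hs₃ _ (hpm1 i hi 2 (by norm_num)),
        hs₃ _ (hpm1 i hi 3 (by norm_num))] at this
    have hW := ((hW₁.trans hW12).trans hW').trans hW₃
    by_cases hv : ∃ i < D.n, vs i ≠ 0
    · obtain ⟨i, hi, hvi⟩ := hv
      have hfl : s₃ (2, D.F + i) = 0 ∧ s₃ (1, D.F + i) = 0 := by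
        rcases hpost i hi with ⟨h1, _⟩ | ⟨_, h2⟩
        · exact absurd h1 hvi
        · exact h2
      have hTi : D.T ≤ h i := by
        have := hOk.idle i hi hfl.1
        rwa [hfl.2, add_zero] at this
      refine ⟨s₃, Share.gh D.F D.n 0 p, Share.gh D.F D.n 1 0, D.cost, 0, fun _ => rfl, fun _ _ => rfl,
        ⟨s₃, .refl _ _, rfl, .inl fun i hi => (gh_of (gh_mk one_ne_zero hi)).ge⟩, hsh, ?_, ?_⟩
      · rw [add_zero]
        exact (D.fail h _ i hi hTi).trans hΨ
      · refine hfail t' ht' W₃ hW d' w' s₃ _ g1 g2 (fun h0 => ?_) hag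
        rw [Finset.sum_eq_zero_iff] at h0
        exact hvi (h0 i (Finset.mem_range.2 hi))
    · push Not at hv
      have hall : ∀ i < D.n, s₃ (2, D.F + i) ≠ 0 ∧ s₃ (3, D.F + i) = 2 := fun i hi => by
        rcases hpost i hi with ⟨_, h2⟩ | ⟨h1, _⟩
        · exact h2
        · have := hv i hi; omega
      have hlc : ∀ i < D.n, s₃ (2, D.F + i) = (s₃ (2, D.F + i) - 1) + 1 := fun i hi => by
        have := (hall i hi).1; omega
      rw [Finset.sum_eq_zero fun i hi => hv i (Finset.mem_range.1 hi)]
      refine ⟨s₃, Share.gh D.F D.n 0 p, Share.gh D.F D.n 1 0, 0, 0, fun _ => rfl, fun _ _ => rfl,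
        ⟨s₃, .refl _ _, rfl, .inl fun i hi => (gh_of (gh_mk one_ne_zero hi)).ge⟩, hsh, by simp, ?_⟩
      rw [add_zero]
      refine hok t' ht' W₃ hW d' w' s₃ (fun i => s₃ (2, D.F + i) - 1) g1 g2 (fun i hi => ?_)
        (fun i hi i' hi' h0 => ?_) (fun a ha hne => ?_) hag
      · obtain ⟨h1, h2⟩ := hOk.place i hi _ (hlc i hi)
        refine ⟨h1, h2, ?_, hOk.value i hi _ (hlc i hi) (hall i hi).2⟩
        rcases hOk.flag _ h1 with ⟨_, h3⟩ | ⟨h3, _⟩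
        · have := h3 i hi (hlc i hi)
          rw [(hall i hi).2] at this
          omega
        · exact h3
      · refine hOk.inj i hi i' hi' (by rw [hlc i hi, hlc i' hi', h0]) ?_ ?_
        · rw [(hall i hi).2]; norm_num
        · rw [(hall i' hi').2]; norm_num
      · rcases hOk.flag a ha with ⟨h3, _⟩ | ⟨_, i, hi, h4, _⟩
        · exact h3
        · exact absurd (by simp only [h4]; omega) (hne i hi)

end DistData
end BF

namespace BF

/-! ## The potential of the sampling loop -/

/-- The contribution of a sample to the potential of block `w` of `h` consecutive ranks. -/
noncomputable def blockFactor (n h : ℕ) (ord : ℕ → ℕ) (w : ℕ) : ℕ → ℝ≥0∞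
  | 0 => ((2 * n - h : ℕ) : ℝ≥0∞) / ((2 * n : ℕ) : ℝ≥0∞)
  | v + 1 => if ord v / h = w then 1 / 2 else 1

/-- The potential of `m` samples, of which every block of ranks should receive `l`. -/
noncomputable def samplePot (n h m l : ℕ) (ord : ℕ → ℕ) (cost : ℝ≥0∞) (g : ℕ → ℕ) : ℝ≥0∞ :=
  cost * (2 ^ l * ∑ w ∈ Finset.range (n / h), ∏ i ∈ Finset.range m, blockFactor n h ord w (g i))

theorem samplePot_congr {n h m l : ℕ} {ord : ℕ → ℕ} {cost : ℝ≥0∞} (g g' : ℕ → ℕ)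
    (hg : ∀ i < m, g i = g' i) : samplePot n h m l ord cost g = samplePot n h m l ord cost g' := by
  unfold samplePot
  congr 2
  refine Finset.sum_congr rfl fun w _ => Finset.prod_congr rfl fun i hi => ?_
  rw [hg i (Finset.mem_range.1 hi)]

theorem card_block {n h w : ℕ} {ord : ℕ → ℕ} (hord : ∀ v < n, ord v < n)
    (hinj : ∀ v < n, ∀ v' < n, ord v = ord v' → v = v') (hw : w < n / h) :
    ((Finset.range n).filter fun v => ord v / h = w).card = h := by
  have hh : 0 < h := by
    rcases Nat.eq_zero_or_pos h with rfl | hh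
    · simp at hw
    · exact hh
  have hwn : (w + 1) * h ≤ n := by
    calc (w + 1) * h ≤ n / h * h := Nat.mul_le_mul_right _ hw
      _ ≤ n := Nat.div_mul_le_self n h
  have himg : (Finset.range n).image ord = Finset.range n := by
    refine Finset.eq_of_subset_of_card_le (fun x hx => ?_) ?_
    · obtain ⟨v, hv, rfl⟩ := Finset.mem_image.1 hx
      exact Finset.mem_range.2 (hord v (Finset.mem_range.1 hv))
    · rw [Finset.card_image_of_injOn]
      intro v hv v' hv' h
      exact hinj v (by simpa using hv) v' (by simpa using hv') h
  have : ((Finset.range n).filter fun v => ord v / h = w).image ord =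
      Finset.Ico (w * h) (w * h + h) := by
    ext x
    simp only [Finset.mem_image, Finset.mem_filter, Finset.mem_range, Finset.mem_Ico]
    constructor
    · rintro ⟨v, ⟨_, hv⟩, rfl⟩
      rw [Nat.div_eq_iff hh] at hv
      rw [mul_comm]
      rw [mul_comm] at hv
      omega
    · rintro ⟨h1, h2⟩
      have hx : x < n := by rw [add_one_mul] at hwn; omega
      obtain ⟨v, hv, rfl⟩ := Finset.mem_image.1 (himg.symm ▸ Finset.mem_range.2 hx)
      refine ⟨v, ⟨Finset.mem_range.1 hv, ?_⟩, rfl⟩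
      rw [Nat.div_eq_iff hh]
      rw [mul_comm] at h1 h2 ⊢
      omega
  rw [← Finset.card_image_of_injOn (f := ord), this, Nat.card_Ico, Nat.add_sub_cancel_left]
  intro v hv v' hv' h
  simp only [Finset.coe_filter, Finset.mem_range, Set.mem_ofPred_eq] at hv hv'
  exact hinj v hv.1 v' hv'.1 h

/-- A complete block contains exactly `h` of the `n` ranks, so the average of the factor, `1 / 2`
inside the block and `1` outside, is `1 - h / (2 * n)`. This is the factor of a sample not yet
drawn, and the estimator is a martingale. -/
theorem samplePot_draw {n h m l : ℕ} {ord : ℕ → ℕ} {cost : ℝ≥0∞} (hn : 0 < n)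
    (hord : ∀ v < n, ord v < n) (hinj : ∀ v < n, ∀ v' < n, ord v = ord v' → v = v')
    (g : ℕ → ℕ) (i : ℕ) (hi : i < m) (hg : g i = 0) :
    ∑ v ∈ Finset.range n, samplePot n h m l ord cost (Function.update g i (v + 1)) ≤
      n * samplePot n h m l ord cost g := by
  unfold samplePot
  have key : ∀ w < n / h, ∑ v ∈ Finset.range n,
      ∏ i' ∈ Finset.range m, blockFactor n h ord w (Function.update g i (v + 1) i') =
      n * ∏ i' ∈ Finset.range m, blockFactor n h ord w (g i') := by
    intro w hw
    have h1 : ∀ x, ∏ i' ∈ Finset.range m, blockFactor n h ord w (Function.update g i x i') =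
        blockFactor n h ord w x *
          ∏ i' ∈ (Finset.range m).erase i, blockFactor n h ord w (g i') := fun x => by
      rw [← Finset.mul_prod_erase _ _ (Finset.mem_range.2 hi), Function.update_self]
      congr 1
      refine Finset.prod_congr rfl fun i' hi' => ?_
      rw [Function.update_of_ne (Finset.ne_of_mem_erase hi')]
    simp only [h1]
    rw [← Finset.sum_mul]
    have h2 := h1 (g i)
    rw [Function.update_eq_self] at h2
    rw [h2, ← mul_assoc, hg]
    congr 1
    simp only [blockFactor]
    have e1 : ∀ v, (if ord v / h = w then (1 / 2 : ℝ≥0∞) else 1) =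
        ((if ord v / h = w then 1 else 2 : ℕ) : ℝ≥0∞) / 2 := fun v => by
      split_ifs
      · simp
      · rw [Nat.cast_ofNat, ENNReal.div_self (by norm_num) (by norm_num)]
    simp only [e1]
    simp only [div_eq_mul_inv]
    rw [← Finset.sum_mul, ← Nat.cast_sum]
    have e2 : ∑ v ∈ Finset.range n, (if ord v / h = w then 1 else 2) = 2 * n - h := by
      have e3 := card_block hord hinj hw
      have e4 : ∑ v ∈ Finset.range n, ((if ord v / h = w then 1 else 2) +
          (if ord v / h = w then 1 else 0)) = ∑ v ∈ Finset.range n, 2 :=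
        Finset.sum_congr rfl fun v _ => by split_ifs <;> rfl
      rw [Finset.sum_add_distrib, Finset.sum_boole, Finset.sum_const, Finset.card_range] at e4
      simp only [Nat.cast_id, smul_eq_mul] at e4
      omega
    have hn0 : (n : ℝ≥0∞) ≠ 0 := by exact_mod_cast hn.ne'
    rw [e2]
    push_cast
    rw [ENNReal.mul_inv (.inl (by norm_num)) (.inl (by norm_num))]
    calc _ = ((2 * n - h : ℕ) : ℝ≥0∞) * 2⁻¹ * (n * (n : ℝ≥0∞)⁻¹) := by
          rw [ENNReal.mul_inv_cancel hn0 (by simp), mul_one]; push_cast; rfl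
      _ = _ := by push_cast; ring
  rw [← Finset.mul_sum, ← Finset.mul_sum, Finset.sum_comm, Finset.sum_congr rfl fun w hw =>
    key w (Finset.mem_range.1 hw), ← Finset.mul_sum]
  apply le_of_eq
  ring

/-- The exponential Markov inequality: when fewer than `l` samples are in block `w`, its term is `2
^ l` times a power of `1 / 2` with exponent below `l`. -/
theorem samplePot_fail {n h m l w : ℕ} {ord y : ℕ → ℕ} {cost : ℝ≥0∞} (hw : w < n / h)
    (hl : ((Finset.range m).filter fun i => ord (y i) / h = w).card < l) :
    cost ≤ samplePot n h m l ord cost fun i => y i + 1 := by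
  have h1 : ∏ i ∈ Finset.range m, blockFactor n h ord w (y i + 1) =
      (1 / 2) ^ ((Finset.range m).filter fun i => ord (y i) / h = w).card := by
    simp only [blockFactor, Finset.prod_ite, Finset.prod_const, one_pow, mul_one]
  have h2 : (1 : ℝ≥0∞) ≤ 2 ^ l * ∏ i ∈ Finset.range m, blockFactor n h ord w (y i + 1) := by
    rw [h1]
    calc (1 : ℝ≥0∞) = (2 * (1 / 2)) ^ l := by
          rw [one_div, ENNReal.mul_inv_cancel (by norm_num) (by norm_num), one_pow]
      _ = 2 ^ l * (1 / 2) ^ l := mul_pow _ _ _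
      _ ≤ _ := mul_le_mul' le_rfl (pow_le_pow_of_le_one zero_le (by simp) hl.le)
  unfold samplePot
  calc cost = cost * 1 := (mul_one _).symm
    _ ≤ _ := mul_le_mul' le_rfl (h2.trans (mul_le_mul' le_rfl
      (Finset.single_le_sum (f := fun w => ∏ i ∈ Finset.range m, blockFactor n h ord w (y i + 1))
        (fun _ _ => zero_le) (Finset.mem_range.2 hw))))

theorem samplePot_zero {n h m l : ℕ} {ord : ℕ → ℕ} {cost : ℝ≥0∞} :
    samplePot n h m l ord cost (fun _ => 0) =
      cost * (2 ^ l * ((n / h : ℕ) * (((2 * n - h : ℕ) : ℝ≥0∞) / ((2 * n : ℕ) : ℝ≥0∞)) ^ m)) := by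
  simp [samplePot, blockFactor]

/-! ## The pivots -/

/-- Fewer than `l` samples lie strictly between two consecutive pivots. -/
theorem pivot_gap {rk Y Z : ℕ → ℕ} {q l r : ℕ} (hl : 0 < l)
    (hZ : ∀ i < q * l, Z (keyPos (tieKey rk Y (q * l)) (q * l) i) = Y i) (hr : r ≤ q) :
    ((Finset.range (q * l)).filter fun i => (0 < r → rk (Z (r * l - 1)) < rk (Y i)) ∧
      (r < q → rk (Y i) < rk (Z ((r + 1) * l - 1)))).card < l := by
  set m := q * l with hm
  set pos := keyPos (tieKey rk Y m) m with hpos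
  have pos_lt : ∀ i < m, pos i < m := fun i hi => keyPos_lt hi
  have pos_mono : ∀ i < m, ∀ i' < m, rk (Y i) < rk (Y i') → pos i < pos i' := fun i hi i' hi' h =>
    keyPos_mono hi ((tieKey_lt_iff hi hi').2 (.inl h))
  have pos_surj : ∀ a < m, ∃ i < m, pos i = a := fun a ha => tiePos_surj ha
  have hle : ((Finset.range m).filter fun i => (0 < r → rk (Z (r * l - 1)) < rk (Y i)) ∧
      (r < q → rk (Y i) < rk (Z ((r + 1) * l - 1)))).card ≤
      (Finset.Ico (r * l) ((r + 1) * l - 1)).card := by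
    refine Finset.card_le_card_of_injOn pos (fun i hi => ?_) (fun i hi i' hi' h => ?_)
    · simp only [Finset.coe_filter, Finset.mem_range, Set.mem_ofPred_eq] at hi
      obtain ⟨hi, h1, h2⟩ := hi
      have hrq : r * l ≤ m := Nat.mul_le_mul_right _ hr
      have hlo : r * l ≤ pos i := by
        rcases Nat.eq_zero_or_pos r with rfl | hr0
        · simp
        · have : 1 * l ≤ r * l := Nat.mul_le_mul_right _ hr0
          obtain ⟨i₀, hi₀, h3⟩ := pos_surj (r * l - 1) (by omega)
          have h4 := h1 hr0
          rw [← h3, hZ i₀ hi₀] at h4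
          have := pos_mono i₀ hi₀ i hi h4
          omega
      have hhi : pos i < (r + 1) * l - 1 := by
        rcases hr.eq_or_lt with rfl | hrq
        · have := pos_lt i hi
          omega
        · have h5 : (r + 1) * l ≤ m := Nat.mul_le_mul_right _ hrq
          have h6 : 1 * l ≤ (r + 1) * l := Nat.mul_le_mul_right _ (by omega)
          obtain ⟨i₀, hi₀, h3⟩ := pos_surj ((r + 1) * l - 1) (by omega)
          have h4 := h2 hrq
          rw [← h3, hZ i₀ hi₀] at h4
          have := pos_mono i hi i₀ hi₀ h4
          omega
      simp [hlo, hhi]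
    · simp only [Finset.coe_filter, Finset.mem_range, Set.mem_ofPred_eq] at hi hi'
      exact tiePos_inj hi.1 hi'.1 h
  refine hle.trans_lt ?_
  rw [Nat.card_Ico, add_one_mul]
  omega

theorem pivot_mono {rk Y Z : ℕ → ℕ} {m a b : ℕ}
    (hZ : ∀ i < m, Z (keyPos (tieKey rk Y m) m i) = Y i) (hab : a ≤ b) (hb : b < m) :
    rk (Z a) ≤ rk (Z b) ∧ ∃ i < m, Z b = Y i := by
  obtain ⟨i, hi, rfl⟩ := tiePos_surj (rk := rk) (Y := Y) (hab.trans_lt hb)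
  obtain ⟨i', hi', rfl⟩ := tiePos_surj (rk := rk) (Y := Y) hb
  rw [hZ i hi, hZ i' hi']
  refine ⟨?_, i', hi', rfl⟩
  by_contra h
  exact absurd (keyPos_mono hi' ((tieKey_lt_iff hi' hi).2 (.inl (not_le.1 h)))) (not_lt.2 hab)

/-- If every block of ranks contains `l` samples, then no bucket is large. -/
theorem bucket_card_le {n h q l : ℕ} {rk a₀ y Z β : ℕ → ℕ} (hh : 0 < h) (hl : 0 < l)
    (hinj : ∀ i < n, ∀ i' < n, rk (a₀ i) = rk (a₀ i') → i = i')
    (hy : ∀ i < q * l, y i < n)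
    (hZ : ∀ i < q * l, Z (keyPos (tieKey rk (fun i => a₀ (y i)) (q * l)) (q * l) i) = a₀ (y i))
    (hβ : ∀ i < n, β i ≤ q ∧ (∀ i' < β i, rk (Z ((i' + 1) * l - 1)) < rk (a₀ i)) ∧
      ∀ i', β i ≤ i' → i' < q → rk (a₀ i) ≤ rk (Z ((i' + 1) * l - 1)))
    (hgood : ∀ w < n / h, l ≤ ((Finset.range (q * l)).filter fun i =>
      keyPos (fun i => rk (a₀ i)) n (y i) / h = w).card) (r : ℕ) :
    ((Finset.range n).filter fun i => β i = r).card ≤ 2 * h := by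
  set ord := keyPos (fun i => rk (a₀ i)) n with hord
  by_contra hbig
  push Not at hbig
  set B := (Finset.range n).filter fun i => β i = r with hB
  have hBn : ∀ i ∈ B, i < n ∧ β i = r := fun i hi => by
    rw [hB, Finset.mem_filter, Finset.mem_range] at hi; exact hi
  have ord_inj : ∀ i < n, ∀ i' < n, ord i = ord i' → i = i' := fun i hi i' hi' h =>
    hinj i hi i' hi' (keyPos_inj (key := fun i => rk (a₀ i)) (m := n) hi hi' h)
  have ord_lt : ∀ i < n, ∀ i' < n, ord i < ord i' → rk (a₀ i) < rk (a₀ i') := fun i hi i' hi' h => by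
    by_contra h'
    rcases (not_lt.1 h').eq_or_lt with h'' | h''
    · obtain rfl := hinj i' hi' i hi h''
      exact lt_irrefl _ h
    · exact absurd (keyPos_mono (key := fun i => rk (a₀ i)) (m := n) hi' h'') (not_lt.2 h.le)
  have hne : B.Nonempty := Finset.card_pos.1 (by omega)
  obtain ⟨u, hu, humin⟩ := Finset.exists_min_image B ord hne
  obtain ⟨v, hv, hvmax⟩ := Finset.exists_max_image B ord hne
  have hspan : ord u + 2 * h ≤ ord v := by
    have h1 : B.card ≤ (Finset.Icc (ord u) (ord v)).card :=
      Finset.card_le_card_of_injOn ord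
        (fun i hi => by simpa using ⟨humin i hi, hvmax i hi⟩)
        (fun i hi i' hi' h => ord_inj i (hBn i hi).1 i' (hBn i' hi').1 h)
    rw [Nat.card_Icc] at h1
    omega
  have hvn : ord v < n := keyPos_lt (hBn v hv).1
  have hdm := Nat.div_add_mod (ord u) h
  have hmod := Nat.mod_lt (ord u) hh
  -- This is the first block that begins after the rank of `u`. The ranks of `u` and `v` differ by
  -- at least `2 * h`, so it also ends before the rank of `v`, and all its samples lie between the
  -- pivots around the bucket.
  set w := ord u / h + 1 with hw
  have hwh : w * h = h * (ord u / h) + h := by rw [hw]; ring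
  have hwn : w < n / h := by
    refine (Nat.lt_iff_add_one_le).2 ((Nat.le_div_iff_mul_le hh).2 ?_)
    rw [add_one_mul]
    omega
  have hlt := pivot_gap (rk := rk) (Y := fun i => a₀ (y i)) (Z := Z) (q := q) (l := l) hl hZ
    (r := r) ((hBn u hu).2 ▸ (hβ u (hBn u hu).1).1)
  refine absurd (hgood w hwn) (not_le.2 (lt_of_le_of_lt (Finset.card_le_card fun i hi => ?_) hlt))
  rw [Finset.mem_filter, Finset.mem_range] at hi ⊢
  obtain ⟨hi, hiw⟩ := hi
  rw [Nat.div_eq_iff hh] at hiw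
  refine ⟨hi, fun hr => ?_, fun hr => ?_⟩
  · obtain ⟨h1, h2, h3⟩ := hβ u (hBn u hu).1
    have h4 := h2 (r - 1) (by rw [(hBn u hu).2]; omega)
    rw [Nat.sub_add_cancel hr] at h4
    exact h4.trans (ord_lt u (hBn u hu).1 _ (hy i hi) (by omega))
  · obtain ⟨h1, h2, h3⟩ := hβ v (hBn v hv).1
    have h4 := h3 r (by rw [(hBn v hv).2]) hr
    exact (ord_lt _ (hy i hi) v (hBn v hv).1 (by omega)).trans_le h4

end BF

namespace BF

/-! ## The potential of the distribution loop -/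

/-- The attempts that are left to the other elements of the bucket of `e`. -/
def otherTries (n : ℕ) (β R : ℕ → ℕ) (e : ℕ) : ℕ :=
  ∑ e' ∈ (Finset.range n).filter fun e' => e' ≠ e ∧ β e' = β e, R e'

/-- The potential of the collision numbers `h` when the elements have `R` attempts left. -/
noncomputable def hitPot (n T : ℕ) (β : ℕ → ℕ) (u v cost : ℝ≥0∞) (h R : ℕ → ℕ) : ℝ≥0∞ :=
  cost * ∑ e ∈ Finset.range n, (16 ^ T)⁻¹ * 16 ^ h e * u ^ R e * v ^ otherTries n β R e

variable {n T K m : ℕ} {β : ℕ → ℕ} {u v cost : ℝ≥0∞}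

theorem hitPot_congr (h h' R R' : ℕ → ℕ) (hh : ∀ i < n, h i = h' i) (hR : ∀ i < n, R i = R' i) :
    hitPot n T β u v cost h R = hitPot n T β u v cost h' R' := by
  unfold hitPot otherTries
  congr 1
  refine Finset.sum_congr rfl fun e he => ?_
  rw [hh e (Finset.mem_range.1 he), hR e (Finset.mem_range.1 he)]
  congr 2
  exact Finset.sum_congr rfl fun e' he' =>
    hR e' (Finset.mem_range.1 (Finset.mem_filter.1 he').1)

theorem hitPot_fail (hu : 1 ≤ u) (hv : 1 ≤ v) (h R : ℕ → ℕ) (i : ℕ) (hi : i < n) (hT : T ≤ h i) :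
    cost ≤ hitPot n T β u v cost h R := by
  unfold hitPot
  have h1 : (1 : ℝ≥0∞) ≤ (16 ^ T)⁻¹ * 16 ^ h i * u ^ R i * v ^ otherTries n β R i := by
    have h2 : (1 : ℝ≥0∞) ≤ (16 ^ T)⁻¹ * 16 ^ h i := by
      calc (1 : ℝ≥0∞) = (16 ^ T)⁻¹ * 16 ^ T :=
            (ENNReal.inv_mul_cancel (by positivity) (by simp)).symm
        _ ≤ _ := mul_le_mul' le_rfl (pow_le_pow_right₀ (by norm_num) hT)
    calc (1 : ℝ≥0∞) = 1 * 1 * 1 := by norm_num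
      _ ≤ _ := mul_le_mul' (mul_le_mul' h2 (one_le_pow₀ hu)) (one_le_pow₀ hv)
  calc cost = cost * 1 := (mul_one _).symm
    _ ≤ _ := mul_le_mul' le_rfl (h1.trans (Finset.single_le_sum
      (f := fun e => (16 ^ T)⁻¹ * 16 ^ h e * u ^ R e * v ^ otherTries n β R e)
      (fun _ _ => zero_le) (Finset.mem_range.2 hi)))

/-- One more collision multiplies the power by `16`, which adds `15` times its value. -/
theorem sum_pow_indicator_le {P : ℕ → Prop} [DecidablePred P] {a k : ℕ}
    (hk : ((Finset.range m).filter P).card ≤ k) :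
    ∑ v ∈ Finset.range m, (16 : ℝ≥0∞) ^ (a + if P v then 1 else 0) ≤ 16 ^ a * (m + 15 * k) := by
  have h1 : ∀ v, (16 : ℝ≥0∞) ^ (a + if P v then 1 else 0) =
      16 ^ a * (1 + 15 * if P v then 1 else 0) := fun v => by
    split_ifs
    · rw [pow_add]; norm_num
    · simp
  simp only [h1]
  rw [← Finset.mul_sum, Finset.sum_add_distrib, ← Finset.mul_sum, Finset.sum_boole]
  simp only [Finset.sum_const, Finset.card_range, nsmul_eq_mul, mul_one]
  gcongr

theorem otherTries_update_self {R : ℕ → ℕ} {i k : ℕ} :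
    otherTries n β (Function.update R i k) i = otherTries n β R i := by
  unfold otherTries
  refine Finset.sum_congr rfl fun e' he' => ?_
  rw [Function.update_of_ne (Finset.mem_filter.1 he').2.1]

theorem otherTries_update_of_ne {R : ℕ → ℕ} {i k e : ℕ} (hne : β e ≠ β i) :
    otherTries n β (Function.update R i k) e = otherTries n β R e := by
  unfold otherTries
  refine Finset.sum_congr rfl fun e' he' => ?_
  rw [Function.update_of_ne]
  rintro rfl
  exact hne (Finset.mem_filter.1 he').2.2.symm

theorem otherTries_update_of_eq {R : ℕ → ℕ} {i k e : ℕ} (hi : i < n) (hR : R i = k + 1)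
    (hei : e ≠ i) (heq : β e = β i) :
    otherTries n β (Function.update R i k) e + 1 = otherTries n β R e := by
  unfold otherTries
  have hmem : i ∈ (Finset.range n).filter fun e' => e' ≠ e ∧ β e' = β e := by
    rw [Finset.mem_filter, Finset.mem_range]; exact ⟨hi, hei.symm, heq.symm⟩
  rw [← Finset.add_sum_erase _ _ hmem, ← Finset.add_sum_erase _ _ hmem, Function.update_self, hR,
    Finset.sum_congr rfl fun e' he' =>
      Function.update_of_ne (Finset.ne_of_mem_erase he') k R]
  ring

/-- The draw of `i` affects the term of `e` in three ways. For `e = i`, at most `K` places of the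
bucket have been drawn by others, and the factor `1 + 15 * K / m` is paid by a factor `u`. For
another `e` of the same bucket only its own place matters, and `1 + 15 / m` is paid by a factor `v`.
In a different bucket nothing happens. -/
theorem hitPot_draw (hu : m + 15 * K ≤ m * u) (hv : m + 15 ≤ m * v)
    (hK : ∀ r, ((Finset.range n).filter fun e => β e = r).card ≤ K)
    (h R lc : ℕ → ℕ) (i k : ℕ) (hi : i < n) (hR : R i = k + 1)
    (hlc : ∀ e < n, ∀ a, lc e = a + 1 → a / m = β e) :
    ∑ w ∈ Finset.range m, hitPot n T β u v cost (bump n lc i (β i * m + w) h)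
      (Function.update R i k) ≤ m * hitPot n T β u v cost h R := by
  classical
  unfold hitPot
  rw [← Finset.mul_sum, Finset.sum_comm, mul_left_comm]
  refine mul_le_mul' le_rfl ?_
  rw [Finset.mul_sum]
  refine Finset.sum_le_sum fun e he => ?_
  have hen := Finset.mem_range.1 he
  have pull : ∀ (c y : ℝ≥0∞) (R' : ℕ) (g : ℕ → ℝ≥0∞),
      ∑ w ∈ Finset.range m, c * g w * u ^ R' * y =
        (∑ w ∈ Finset.range m, g w) * (c * u ^ R' * y) := fun c y R' g => by
    rw [Finset.sum_mul]
    exact Finset.sum_congr rfl fun w _ => by ring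
  have hmod : ∀ w < m, (β i * m + w) / m = β i := fun w hw => by
    rw [mul_comm, Nat.mul_add_div (by omega), Nat.div_eq_of_lt hw, add_zero]
  rw [pull]
  by_cases hei : e = i
  · subst hei
    rw [Function.update_self, otherTries_update_self, hR, pow_succ]
    have h1 : ∑ w ∈ Finset.range m, (16 : ℝ≥0∞) ^ bump n lc e (β e * m + w) h e ≤
        16 ^ h e * (m * u) := by
      refine le_trans ?_ (mul_le_mul' le_rfl hu)
      have h2 : ((Finset.range m).filter fun w =>
          ∃ e' < n, e' ≠ e ∧ lc e' = β e * m + w + 1).card ≤ K := by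
        refine (Finset.card_le_card_of_forall_subsingleton
          (t := (Finset.range n).filter fun e' => β e' = β e)
          (fun w e' => lc e' = β e * m + w + 1) (fun w hw => ?_) (fun e' _ w hw w' hw' => ?_)).trans
          (hK (β e))
        · obtain ⟨hw, e', h3, h4, h5⟩ := Finset.mem_filter.1 hw
          refine ⟨e', ?_, h5⟩
          rw [Finset.mem_filter, Finset.mem_range]
          exact ⟨h3, (hlc e' h3 _ h5).symm.trans (hmod w (Finset.mem_range.1 hw))⟩
        · have h3 := hw.2
          have h4 := hw'.2
          omega
      have h3 := sum_pow_indicator_le (a := h e) h2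
      simp only [bump, ↓reduceIte]
      convert h3
    calc _ ≤ 16 ^ h e * (m * u) * ((16 ^ T)⁻¹ * u ^ k * v ^ otherTries n β R e) :=
          mul_le_mul' h1 le_rfl
      _ = _ := by ring
  · rw [Function.update_of_ne hei]
    have h0 : ∀ w, bump n lc i (β i * m + w) h e =
        h e + if lc e = β i * m + w + 1 then 1 else 0 := fun w => by
      unfold bump
      rw [if_neg hei]
    by_cases hβ : β e = β i
    · rw [← otherTries_update_of_eq hi hR hei hβ, pow_succ]
      have h1 : ∑ w ∈ Finset.range m, (16 : ℝ≥0∞) ^ bump n lc i (β i * m + w) h e ≤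
          16 ^ h e * (m * v) := by
        refine le_trans ?_ (mul_le_mul' le_rfl hv)
        have h2 : ((Finset.range m).filter fun w => lc e = β i * m + w + 1).card ≤ 1 := by
          refine Finset.card_le_one.2 fun w hw w' hw' => ?_
          rw [Finset.mem_filter] at hw hw'
          omega
        have h3 := sum_pow_indicator_le (a := h e) h2
        simp only [h0]
        rw [Nat.cast_one, mul_one] at h3
        convert h3
      calc _ ≤ _ := mul_le_mul' h1 le_rfl
        _ = _ := by ring
    · rw [otherTries_update_of_ne hβ]
      have h1 : ∑ w ∈ Finset.range m, (16 : ℝ≥0∞) ^ bump n lc i (β i * m + w) h e =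
          m * 16 ^ h e := by
        rw [Finset.sum_congr rfl fun w hw => ?_, Finset.sum_const, Finset.card_range, nsmul_eq_mul]
        rw [h0, if_neg, add_zero]
        intro h2
        exact hβ ((hlc e hen _ h2).symm.trans (hmod w (Finset.mem_range.1 hw)))
      rw [h1]
      exact le_of_eq (by ring)

/-- The own attempts contribute at most `(3 / 2) ^ T`. The others in the bucket have at most `K * T`
attempts, contributing at most `2 ^ T`. So each term is at most `16 ^ (-T) * 3 ^ T`. -/
theorem hitPot_init_le (hv1 : 1 ≤ v) (hu : u ≤ 3 / 2) (hv : v ^ K ≤ 2)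
    (hK : ∀ r, ((Finset.range n).filter fun e => β e = r).card ≤ K) :
    hitPot n T β u v cost (fun _ => 0) (fun _ => T) ≤ cost * (n * (3 / 16) ^ T) := by
  unfold hitPot
  refine mul_le_mul' le_rfl ?_
  calc _ ≤ ∑ e ∈ Finset.range n, (3 / 16 : ℝ≥0∞) ^ T := by
        refine Finset.sum_le_sum fun e he => ?_
        have h1 : otherTries n β (fun _ => T) e ≤ K * T := by
          unfold otherTries
          rw [Finset.sum_const, smul_eq_mul]
          refine Nat.mul_le_mul_right _ (le_trans (Finset.card_le_card fun e' he' => ?_) (hK (β e)))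
          rw [Finset.mem_filter] at he' ⊢
          exact ⟨he'.1, he'.2.2⟩
        have h2 : v ^ otherTries n β (fun _ => T) e ≤ 2 ^ T :=
          (pow_le_pow_right₀ hv1 h1).trans (by rw [pow_mul]; gcongr)
        calc _ ≤ ((16 : ℝ≥0∞) ^ T)⁻¹ * 16 ^ 0 * (3 / 2) ^ T * 2 ^ T := by gcongr
          _ = ((16 : ℝ≥0∞)⁻¹ * ((3 / 2) * 2)) ^ T := by
            rw [pow_zero, mul_one, mul_pow, mul_pow, ENNReal.inv_pow, mul_assoc]
          _ = _ := by
            rw [ENNReal.div_mul_cancel (by norm_num) (by norm_num), mul_comm, div_eq_mul_inv]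
    _ = _ := by rw [Finset.sum_const, Finset.card_range, nsmul_eq_mul]

theorem one_add_inv_two_mul_pow_le (hK : 0 < K) : (1 + (2 * K : ℝ≥0∞)⁻¹) ^ K ≤ 2 := by
  have hK' : (0 : ℝ) < K := by exact_mod_cast hK
  have h1 : (1 + (2 * K : ℝ≥0∞)⁻¹) = ENNReal.ofReal (1 + (2 * K : ℝ)⁻¹) := by
    rw [ENNReal.ofReal_add (by norm_num) (by positivity), ENNReal.ofReal_inv_of_pos (by positivity),
      ENNReal.ofReal_mul (by norm_num)]
    simp
  rw [h1, ← ENNReal.ofReal_pow (by positivity), show (2 : ℝ≥0∞) = ENNReal.ofReal 2 by simp]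
  refine ENNReal.ofReal_le_ofReal ?_
  have h2 : 1 + (2 * K : ℝ)⁻¹ ≤ Real.exp ((2 * K : ℝ)⁻¹) := by
    rw [add_comm]; exact Real.add_one_le_exp _
  calc (1 + (2 * K : ℝ)⁻¹) ^ K ≤ Real.exp ((2 * K : ℝ)⁻¹) ^ K := by gcongr
    _ = Real.exp (1 / 2) := by
      rw [← Real.exp_nat_mul]; congr 1; field_simp
    _ ≤ 2 := by
      have h3 := Real.exp_one_lt_d9
      have h4 : Real.exp (1 / 2) * Real.exp (1 / 2) = Real.exp 1 := by
        rw [← Real.exp_add]; norm_num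
      nlinarith [Real.exp_pos (1 / 2)]

end BF

namespace BF
variable {E : Env} {t : ℕ} {W : World} {L : ℕ} {f : ℝ≥0∞} {d w : ℕ} {s : St} {p : Share}

/-! ## Specification of sorting, and the parallel recursion -/

/-- The array `b` of length `n` contains distinct input elements. -/
structure Unsorted (E : Env) (N : ℕ) (nx b n : ℕ) (s : St) (p : Share) : Prop where
  own : ∀ i < n, 1 ≤ p (0, b + i)
  lt : ∀ i < n, s (0, b + i) < N
  inj : ∀ i < n, ∀ i' < n, s (0, b + i) = s (0, b + i') → i = i'
  bound : b + n ≤ E.bd + nx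

/-- The array `b` of length `n` has been sorted. -/
structure Sorted (rk : ℕ → ℕ) (b n : ℕ) (s s' : St) (p : Share) : Prop where
  mem : ∀ i < n, ∃ i' < n, s' (0, b + i) = s (0, b + i')
  lt : ∀ i i', i < i' → i' < n → rk (s' (0, b + i)) < rk (s' (0, b + i'))
  same : ∀ a, (a.1 = 0 → b ≤ a.2 → b + n ≤ a.2) → p a ≠ 0 → s a = s' a

/-- Sorting `n` elements with credit `κ * X n * th ^ d` leaves the credit `κ * th ^ d'` at its end
in depth `d'`. -/
def SortSpec (E : Env) (N : ℕ) (rk : ℕ → ℕ) (X : ℕ → ℝ≥0∞) (t : ℕ) : Prop :=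
  ∀ W d s p b n κ, 12 ≤ κ → κ ≠ ⊤ → Unsorted E N W.nx b n s p →
    Tri E t W d (.call (.sort b n) .ret) s p (κ * X n * E.th ^ d)
      fun v d' s' e' => (v = 0 ∧ Sorted rk b n s s' p) ∧ κ * E.th ^ d' ≤ e'

theorem exists_part {pc : ℕ → ℕ} {q n x : ℕ} (h0 : pc 0 = 0) (hq : pc q = n) (hx : x < n) :
    ∃ i < q, pc i ≤ x ∧ x < pc (i + 1) := by
  classical
  have h : ∃ i, x < pc i := ⟨q, hq ▸ hx⟩
  have h1 := Nat.find_spec h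
  have h2 : Nat.find h ≠ 0 := fun h2 => by rw [h2, h0] at h1; omega
  obtain ⟨i, hi⟩ := Nat.exists_eq_succ_of_ne_zero h2
  have h3 := Nat.find_min' h (hq ▸ hx)
  have h4 : ¬ x < pc i := Nat.find_min h (by omega)
  rw [hi] at h1
  exact ⟨i, by omega, by omega, h1⟩

variable {N : ℕ} {rk : ℕ → ℕ} {X : ℕ → ℝ≥0∞}

/-- The subproblems end in depths that are random and may differ much, and the instructions after a
join are charged at the larger one. So every bucket is sorted with parameter `κ * β ^ j`. At each of
the at most `j` joins, `hβ` turns the two remainders into twice a remainder with one factor `β` less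
at the maximal depth: one copy pays for the join, since `12 ≤ κ`, and the other goes on. For `th = β
= 1` no factor is lost, as a bound for the work requires. -/
theorem tri_recurse {β κ : ℝ≥0∞} (hβ : ∀ d₁ d₂, 2 * E.th ^ (max d₁ d₂ + 8) ≤
      β * (E.th ^ d₁ + E.th ^ d₂)) (hβ' : E.th ^ 8 ≤ β) (hβt : β ≠ ⊤)
    (hκ : 12 ≤ κ) (hκt : κ ≠ ⊤) (hsort : SortSpec E N rk X t)
    {b B n q j : ℕ} {pc : ℕ → ℕ} (hbd : 3 ≤ E.bd) (hq0 : 0 < q) (hqj : q ≤ 2 ^ j)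
    (hq : 2 * q ≤ E.bd) (hn : n ≤ E.bd)
    (hU : Unsorted E N W.nx b n s p) (hpc0 : pc 0 = 0) (hpcq : pc q = n)
    (hmono : ∀ i < q, pc i ≤ pc (i + 1))
    (hB : ∀ i ≤ q, p (0, B + i) ≠ 0 ∧ s (0, B + i) = pc i)
    (hBb : ∀ i ≤ q, ∀ x < n, B + i ≠ b + x) (hBbd : B + q ≤ E.bd + W.nx)
    (hord : ∀ i ≤ q, ∀ x < pc i, ∀ y < n, pc i ≤ y → rk (s (0, b + x)) < rk (s (0, b + y)))
    (hL : L = d + 9 * j + 4) :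
    Tri E t W d (.call (.parFor (.recurse b B) 0 q) .ret) s p
      (κ * β ^ j * (∑ i ∈ Finset.range q, X (pc (i + 1) - pc i)) * E.th ^ (L + 7) +
        ((20 * q : ℕ) : ℝ≥0∞) * E.th ^ (L + 7))
      fun v d' s' e' => (v = 0 ∧ Sorted rk b n s s' p) ∧ κ * E.th ^ d' ≤ e' := by
  have hβ1 : 1 ≤ β := (one_le_pow₀ E.one_le_th).trans hβ'
  have hpcm : ∀ i i', i ≤ i' → i' ≤ q → pc i ≤ pc i' := fun i i' h h' => by
    induction i' with
    | zero => obtain rfl : i = 0 := by omega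
              exact le_rfl
    | succ k ih =>
      rcases h.eq_or_lt with rfl | h
      · exact le_rfl
      · exact (ih (by omega) (by omega)).trans (hmono k (by omega))
  have hpcn : ∀ i ≤ q, pc i ≤ n := fun i hi => hpcq ▸ hpcm i q hi le_rfl
  set A : ℕ → ℕ × ℕ → Prop := fun i a => a.1 = 0 ∧ b + pc i ≤ a.2 ∧ a.2 < b + pc (i + 1) with hA
  have hAA : ∀ i < q, ∀ i' < q, ∀ a, A i a → A i' a → i = i' := by
    rintro i hi i' hi' a ⟨_, h1, h2⟩ ⟨_, h3, h4⟩
    by_contra hne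
    rcases Nat.lt_or_gt_of_ne hne with h | h
    · have := hpcm (i + 1) i' h hi'.le; omega
    · have := hpcm (i' + 1) i h hi.le; omega
  classical
  set own : ℕ × ℕ → Option ℕ := fun a =>
    if h : ∃ i < q, A i a then some h.choose else none with hown
  have ho1 : ∀ i < q, ∀ a, A i a → own a = some i := fun i hi a ha => by
    have h : ∃ i < q, A i a := ⟨i, hi, ha⟩
    rw [hown]
    simp only [dif_pos h]
    rw [hAA _ h.choose_spec.1 i hi a h.choose_spec.2 ha]
  have ho2 : ∀ a, (∀ i < q, ¬ A i a) → own a = none := fun a h => by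
    rw [hown]
    exact dif_neg (by simpa using h)
  have ho3 : ∀ a i, own a = some i → i < q := fun a i ha => by
    rw [hown] at ha
    by_cases h : ∃ i < q, A i a
    · simp only [dif_pos h, Option.some.injEq] at ha
      rw [← ha]; exact h.choose_spec.1
    · simp [dif_neg h] at ha
  have hBo : ∀ i ≤ q, own (0, B + i) = none := fun i hi => ho2 _ fun i' hi' h => by
    obtain ⟨-, h1, h2⟩ := h
    have h3 := hpcn (i' + 1) hi'
    exact hBb i hi (B + i - b) (by omega) (by omega)
  set F : ℕ → Word → St → Prop := fun i v s' => (v = 0 ∧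
    Sorted rk (b + pc i) (pc (i + 1) - pc i) s s' 0) ∧ ∀ a, own a = none → p a ≠ 0 → s a = s' a
    with hF
  have key := tri_parFor (E := E) (t := t) (W := W) (T := .recurse b B) (ρ := Share.split q own p)
    (ε := fun i => (κ * β ^ j) * X (pc (i + 1) - pc i) * E.th ^ (L + 7) +
      ((7 : ℕ) : ℝ≥0∞) * E.th ^ (L + 7)) (L := L) (d := d) (s := s) (F := F)
    (R := fun j' d e => κ * β ^ (j - j') * E.th ^ d ≤ e) (lo := 0) (hi := q)
    (j := j) hbd ?_ ?_ ?_ hq0 (by omega) hq ?_ ?_ ?_ hL.ge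
  · rw [sum_split hq0.ne' ho3] at key
    refine (key.weaken ?_).conseq ?_
    · rw [Finset.sum_add_distrib, Finset.sum_const, Nat.card_Ico, ← Finset.sum_mul, ← Finset.mul_sum,
        ← Finset.range_eq_Ico, add_assoc, Nat.sub_zero, nsmul_eq_mul]
      refine add_le_add le_rfl ?_
      calc _ ≤ (q : ℝ≥0∞) * (((7 : ℕ) : ℝ≥0∞) * E.th ^ (L + 7)) +
            ((13 * q : ℕ) : ℝ≥0∞) * E.th ^ (L + 7) := by
            refine add_le_add le_rfl (mul_le_mul' ?_ (th_pow_le E (by omega)))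
            exact_mod_cast Nat.sub_le _ _
        _ = _ := by push_cast; ring
    · rintro v d' s' e' ⟨vs, rfl, hvs, he⟩
      simp only [Nat.sub_self, pow_zero, mul_one] at he
      refine ⟨⟨Finset.sum_eq_zero fun i hi => ?_, ?_⟩, he⟩
      · rw [Finset.mem_Ico] at hi
        exact (hvs i hi.1 hi.2).1.1
      · have hmem : ∀ i < q, ∀ x, pc i ≤ x → x < pc (i + 1) → ∃ y, pc i ≤ y ∧ y < pc (i + 1) ∧
            s' (0, b + x) = s (0, b + y) := fun i hi x h1 h2 => by
          obtain ⟨y, h3, h4⟩ := (hvs i (Nat.zero_le _) hi).1.2.mem (x - pc i) (by omega)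
          exact ⟨pc i + y, by omega, by omega, by
            rw [← add_assoc, ← h4]; congr 2; omega⟩
        refine ⟨fun x hx => ?_, fun x y hxy hy => ?_, fun a ha hp => ?_⟩
        · obtain ⟨i, hi, h1, h2⟩ := exists_part hpc0 hpcq hx
          obtain ⟨y, h3, h4, h5⟩ := hmem i hi x h1 h2
          exact ⟨y, h4.trans_le (hpcn _ hi), h5⟩
        · obtain ⟨i, hi, h1, h2⟩ := exists_part hpc0 hpcq (hxy.trans hy)
          obtain ⟨i', hi', h1', h2'⟩ := exists_part hpc0 hpcq hy
          rcases Nat.lt_trichotomy i i' with h | rfl | h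
          · obtain ⟨x', h3, h4, h5⟩ := hmem i hi x h1 h2
            obtain ⟨y', h3', h4', h5'⟩ := hmem i' hi' y h1' h2'
            rw [h5, h5']
            have h6 := hpcm (i + 1) i' h hi'.le
            exact hord (i + 1) hi x' h4 y' (h4'.trans_le (hpcn _ hi')) (by omega)
          · have := (hvs i (Nat.zero_le _) hi).1.2.lt (x - pc i) (y - pc i) (by omega) (by omega)
            rw [show b + pc i + (x - pc i) = b + x by omega,
              show b + pc i + (y - pc i) = b + y by omega] at this
            exact this
          · have := hpcm (i' + 1) i h hi.le
            omega
        · refine (hvs 0 le_rfl hq0).2 a (ho2 a ?_) hp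
          rintro i hi ⟨h1, h2, h3⟩
          have := ha h1 (by omega)
          have := hpcn (i + 1) hi
          omega
  · intro j' hj' d' e he
    refine le_trans ?_ he
    calc 12 * E.th ^ (d' + 8) = 12 * E.th ^ 8 * E.th ^ d' := by rw [pow_add]; ring
      _ ≤ κ * β ^ (j - j') * E.th ^ d' := by
        refine mul_le_mul' (mul_le_mul' hκ (hβ'.trans ?_)) le_rfl
        exact le_self_pow₀ hβ1 (by omega)
  · intro j' d' e he
    refine le_trans ?_ he
    refine mul_le_mul' (mul_le_mul' le_rfl (pow_le_pow_right₀ hβ1 (by omega))) le_rfl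
  · intro j' hj' d₁ d₂ e₁ e₂ d' e h1 h2 h3 h4
    have hX : (12 * E.th ^ (max d₁ d₂ + 8) : ℝ≥0∞) ≠ ⊤ :=
      ENNReal.mul_ne_top (by norm_num) (ENNReal.pow_ne_top E.th_ne_top)
    refine (ENNReal.add_le_add_iff_right hX).1 (le_trans ?_ h4)
    refine le_trans ?_ (add_le_add h1 h2)
    obtain ⟨i, hi⟩ : ∃ i, j - j' = i + 1 := ⟨j - j' - 1, by omega⟩
    rw [show j - (j' + 1) = i by omega, hi, pow_succ β]
    calc _ ≤ κ * β ^ i * E.th ^ (max d₁ d₂ + 8) + κ * β ^ i * E.th ^ (max d₁ d₂ + 8) := by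
          refine add_le_add (mul_le_mul' le_rfl (th_pow_le E (Nat.add_le_add_right h3 8)))
            (mul_le_mul' (hκ.trans ?_) le_rfl)
          exact le_mul_of_one_le_right zero_le (one_le_pow₀ hβ1)
      _ = κ * β ^ i * (2 * E.th ^ (max d₁ d₂ + 8)) := by ring
      _ ≤ κ * β ^ i * (β * (E.th ^ d₁ + E.th ^ d₂)) := mul_le_mul' le_rfl (hβ _ _)
      _ = _ := by ring
  · rintro i - hi v s₁ s₂ hag ⟨⟨h1, h2⟩, h3⟩
    have hAi : ∀ x < pc (i + 1) - pc i, s₁ (0, b + pc i + x) = s₂ (0, b + pc i + x) :=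
      fun x hx => by
        refine hag _ ?_
        rw [split_own (ho1 i hi _ ⟨rfl, by dsimp only; omega, by dsimp only; omega⟩), add_assoc]
        have := hU.own (pc i + x) (by have := hpcn (i + 1) hi; omega)
        intro h0
        rw [h0] at this
        exact absurd this (by norm_num)
    refine ⟨⟨h1, ?_, ?_, fun a _ h0 => absurd rfl h0⟩, fun a ha hp =>
      (h3 a ha hp).trans (hag a (split_shared ha hi hp))⟩
    · intro x hx
      rw [← hAi x hx]
      exact h2.mem x hx
    · intro x y hxy hy
      rw [← hAi x (hxy.trans hy), ← hAi y hy]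
      exact h2.lt x y hxy hy
  · rintro i - hi v s₁ ⟨⟨h1, -⟩, -⟩
    exact h1.le.trans (Nat.zero_le _)
  · rintro i - hi d' hd' t' ht' W' hW' k s₀ px ex hag hk
    have hnx := hW'.2
    have h1 := hpcn (i + 1) hi
    have h2 := hmono i hi
    have hB1 := hB i hi.le
    have hB2 := hB (i + 1) hi
    have hs1 := split_shared (n := q) (i := i) (hBo i hi.le) hi hB1.1
    have hs2 := split_shared (n := q) (i := i) (hBo (i + 1) hi) hi hB2.1
    have hg1 := (hag _ hs1).symm.trans hB1.2
    have hg2 := (hag _ hs2).symm.trans hB2.2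
    have hsx : ∀ {a}, Share.split q own p i a ≠ 0 → (Share.split q own p i + px) a ≠ 0 :=
      fun h h0 => h (by simpa using (add_eq_zero.1 h0).1)
    have hbound := hU.bound
    have main : FS E t' W' (L + 7) ((κ * β ^ j) * X (pc (i + 1) - pc i) * E.th ^ (L + 7) + ex) d' 7
        (((Task.recurse b B).code i).bind k) s₀ (Share.split q own p i + px) := by
      simp only [Task.code, Prog.bind_def, Prog.bind_assoc, Prog.bind, BF.alu, BF.call]
      refine FS.readAt (by omega) (by omega) (by omega) (hsx hs1) ?_
      rw [hg1]
      refine FS.add (by omega) (by omega) (by omega) ?_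
      refine FS.readAt (by omega) (by omega) (by omega) (hsx hs2) ?_
      rw [hg2]
      refine FS.add (by omega) (by omega) (by omega) ?_
      refine FS.sub (by omega) (by omega) (by omega) ?_
      have hcell : ∀ x, pc i ≤ x → x < pc (i + 1) →
          Share.split q own p i (0, b + x) = p (0, b + x) ∧ s (0, b + x) = s₀ (0, b + x) :=
        fun x h3 h4 => by
          have h5 : Share.split q own p i (0, b + x) = p (0, b + x) :=
            split_own (ho1 i hi _ ⟨rfl, by dsimp only; omega, by dsimp only; omega⟩)
          refine ⟨h5, hag _ fun h0 => ?_⟩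
          have := hU.own x (by omega)
          rw [← h5, h0] at this
          exact absurd this (by norm_num)
      have hsub : Unsorted E N W'.nx (b + pc i) (pc (i + 1) - pc i) s₀ (Share.split q own p i) := by
        refine ⟨fun x hx => ?_, fun x hx => ?_, fun x hx y hy hxy => ?_, by omega⟩
        · rw [add_assoc, (hcell _ (by omega) (by omega)).1]
          exact hU.own _ (by omega)
        · rw [add_assoc, ← (hcell _ (by omega) (by omega)).2]
          exact hU.lt _ (by omega)
        · rw [add_assoc, add_assoc, ← (hcell _ (by omega) (by omega)).2,
            ← (hcell _ (by omega) (by omega)).2] at hxy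
          have := hU.inj _ (by omega) _ (by omega) hxy
          omega
      have h12 : 12 ≤ κ * β ^ j := hκ.trans (le_mul_of_one_le_right zero_le (one_le_pow₀ hβ1))
      have hrec := hsort W' (d' + 7) s₀ _ _ _ (κ * β ^ j) h12
        (ENNReal.mul_ne_top hκt (ENNReal.pow_ne_top hβt)) hsub t' ht' W' le_rfl k s₀ px ex
        (.refl _ _) ?_
      · refine hrec.weaken le_rfl ?_
        rw [Nat.cast_zero, zero_mul, zero_add]
        exact add_le_add (mul_le_mul' le_rfl (th_pow_le E (by omega))) le_rfl
      · rintro t'' ht'' W'' hW'' v d'' s' e' ⟨⟨rfl, hS⟩, he'⟩ hpx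
        refine hk t'' ht'' W'' hW'' 0 d'' s' e' ⟨⟨⟨rfl, fun x hx => ?_, hS.lt,
          fun a _ h0 => absurd rfl h0⟩, fun a ha hp => ?_⟩, ?_⟩ hpx
        · obtain ⟨y, hy, hxy⟩ := hS.mem x hx
          refine ⟨y, hy, hxy.trans ?_⟩
          rw [add_assoc, (hcell _ (by omega) (by omega)).2]
        · have h3 := split_shared (n := q) (i := i) ha hi hp
          refine (hag a h3).trans (hS.same a (fun h4 h5 => ?_) h3)
          by_contra h6
          rw [ho1 i hi a ⟨h4, h5, by omega⟩] at ha
          cases ha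
        · rw [Nat.sub_zero]; exact he'
    refine safe.weaken (p := _) main le_rfl (le_of_eq ?_)
    rw [← add_assoc]
    congr 1
    exact add_comm _ _

end BF

namespace BF
variable {E : Env} {t : ℕ} {W : World} {L : ℕ} {f : ℝ≥0∞} {d w : ℕ} {s : St} {p : Share}

/-! ## Packing the buckets and sorting them recursively -/

theorem FS.fn {cd cw : ℕ} {c : Prog Proc Word} {F : ℕ → St → Prop} {k : ℕ → Prog Proc Word}
    (h : Fn E t W L cd cw c s p F) (hd : d + cd ≤ L) (hw : cw ≤ w)
    (hk : ∀ t' ≤ t, ∀ W', W ≤ W' → ∀ (v : ℕ) d' w' s', d' ≤ d + cd → w ≤ w' + cw → F v s' →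
      FS E t' W' L f d' w' (k v) s' p) : FS E t W L f d w (c.bind k) s p := by
  have := h t le_rfl W le_rfl k s 0 f d w (.refl _ _) hd hw
    fun t' ht' W' hW' v d' w' s' h1 h2 h3 _ => by
      rw [add_zero]; exact hk t' ht' W' hW' v d' w' s' h1 h2 h3
  rwa [add_zero] at this

theorem one_le_blk {a k j i : ℕ} (hi : i < k) : 1 ≤ blk a k (j, a + i) := by
  unfold blk
  rw [if_pos ⟨by dsimp only; omega, by dsimp only; omega⟩]

theorem FS.weaken {c : Prog Proc Word} {q : Share} {g : ℝ≥0∞} (h : FS E t W L f d w c s p)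
    (hp : p ≤ q) (hf : f ≤ g) : FS E t W L g d w c s q :=
  safe.weaken h hp (add_le_add le_rfl hf)

/-- The number of flagged places below `i`. -/
def flagged (φ : ℕ → ℕ) (i : ℕ) : ℕ := ∑ a ∈ Finset.range i, φ a

theorem flagged_succ (φ : ℕ → ℕ) (i : ℕ) : flagged φ (i + 1) = flagged φ i + φ i :=
  Finset.sum_range_succ φ i

theorem flagged_mono (φ : ℕ → ℕ) : Monotone (flagged φ) :=
  monotone_nat_of_le_succ fun i => by rw [flagged_succ]; omega

theorem flagged_add_le {φ : ℕ → ℕ} (h : ∀ a, φ a ≤ 1) (i k : ℕ) :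
    flagged φ (i + k) ≤ flagged φ i + k := by
  induction k with
  | zero => rfl
  | succ k ih =>
    have h1 := flagged_succ φ (i + k)
    have := h (i + k)
    rw [← add_assoc]
    omega

section
variable {φ loc : ℕ → ℕ} {n M : ℕ} (hloc : ∀ i < n, loc i < M ∧ φ (loc i) = 1)
  (hinj : ∀ i < n, ∀ i' < n, loc i = loc i' → i = i')
  (h0 : ∀ a < M, (∀ i < n, loc i ≠ a) → φ a = 0)

include hloc in
theorem flagged_lt {i i' : ℕ} (hi : i < n) (h : loc i < i') : flagged φ (loc i) < flagged φ i' := by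
  have h1 := flagged_succ φ (loc i)
  have h2 := flagged_mono φ (show loc i + 1 ≤ i' from h)
  have := (hloc i hi).2
  omega

include hloc hinj h0 in
theorem flagged_total : flagged φ M = n := by
  have h1 : (Finset.range n).image loc ⊆ Finset.range M := fun x hx => by
    obtain ⟨i, hi, rfl⟩ := Finset.mem_image.1 hx
    exact Finset.mem_range.2 (hloc i (Finset.mem_range.1 hi)).1
  unfold flagged
  rw [← Finset.sum_subset h1, Finset.sum_image, Finset.sum_congr rfl fun i hi =>
    (hloc i (Finset.mem_range.1 hi)).2]
  · simp
  · intro i hi i' hi' h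
    exact hinj i (by simpa using hi) i' (by simpa using hi') h
  · intro a ha hn
    refine h0 a (Finset.mem_range.1 ha) fun i hi h => hn ?_
    exact Finset.mem_image.2 ⟨i, Finset.mem_range.2 hi, h⟩

include hloc hinj h0 in
theorem exists_flagged_eq {x : ℕ} (hx : x < n) : ∃ i < n, flagged φ (loc i) = x := by
  obtain ⟨a, ha, h1, h2⟩ := exists_part (pc := flagged φ) rfl
    (flagged_total hloc hinj h0) hx
  by_cases h : ∃ i < n, loc i = a
  · obtain ⟨i, hi, rfl⟩ := h
    refine ⟨i, hi, ?_⟩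
    rw [flagged_succ, (hloc i hi).2] at h2
    omega
  · push Not at h
    rw [flagged_succ, h0 a ha h] at h2
    omega

end

variable {N : ℕ} {rk : ℕ → ℕ} {X : ℕ → ℝ≥0∞}

/-- The continuation is safe after the array has been sorted. -/
def Done (E : Env) (rk : ℕ → ℕ) (t : ℕ) (W : World) (κ ex : ℝ≥0∞) (b n : ℕ)
    (k : ℕ → Prog Proc Word) (s : St) (p : Share) : Prop :=
  ∀ t' ≤ t, ∀ W', W ≤ W' → ∀ d' s' e', κ * E.th ^ d' ≤ e' → Sorted rk b n s s' p →
    safe E t' W' ⟨d', k 0⟩ s' p (e' + ex)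

theorem Done.mono {κ ex : ℝ≥0∞} {b n : ℕ} {k : ℕ → Prog Proc Word}
    (h : Done E rk t W κ ex b n k s p) {t' : ℕ} (ht : t' ≤ t) {W' : World} (hW : W ≤ W') :
    Done E rk t' W' κ ex b n k s p :=
  fun t'' ht' W'' hW' => h t'' (ht'.trans ht) W'' (hW.trans hW')

/-- Packing keeps the order of the places and therefore of the buckets, and by `hord` elements of an
earlier bucket have smaller rank. So the array is sorted as soon as each bucket is. Bucket `i`
begins at `pc (i * m)`, and it has at most `m` elements because it has only `m` places. -/
theorem FS.packSort {β κ Y ex : ℝ≥0∞} (hβ : ∀ d₁ d₂, 2 * E.th ^ (max d₁ d₂ + 8) ≤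
      β * (E.th ^ d₁ + E.th ^ d₂)) (hβ' : E.th ^ 8 ≤ β) (hβt : β ≠ ⊤)
    (hκ : 12 ≤ κ) (hκt : κ ≠ ⊤) (hsort : SortSpec E N rk X t)
    {F V m M b q n j : ℕ} {P : Share} {s₁ : St} {loc : ℕ → ℕ} {k : ℕ → Prog Proc Word}
    (hm : 0 < m) (hM : M = (q + 1) * m)
    (hY : ∀ g : ℕ → ℕ, ∑ i ∈ Finset.range (q + 1), g i = n → (∀ i, g i ≤ m) →
      ∑ i ∈ Finset.range (q + 1), X (g i) ≤ Y)
    (hd : d + 45 * j + 40 ≤ L) (hw : 85 * M + 20 * (q + 1) + 5 ≤ w) (hj : M ≤ 2 ^ j)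
    (hbd : 3 ≤ E.bd) (hMb : 2 * M + 2 ≤ E.bd) (hNb : N ≤ E.bd) (hF : F + M ≤ W.nx) (hV : V + M ≤ W.nx)
    (hbF : b + n ≤ F) (hbV : b + n ≤ V) (hU : Unsorted E N W.nx b n s p) (hP : p ≤ P)
    (hpF : ∀ a < M, P (0, F + a) ≠ 0) (hpV : ∀ a < M, P (0, V + a) ≠ 0) (hs : Agree p s s₁)
    (hloc : ∀ i < n, loc i < M ∧ s₁ (0, F + loc i) = 1 ∧ s₁ (0, V + loc i) = s (0, b + i))
    (hinj : ∀ i < n, ∀ i' < n, loc i = loc i' → i = i')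
    (h0 : ∀ a < M, (∀ i < n, loc i ≠ a) → s₁ (0, F + a) = 0)
    (hord : ∀ i < n, ∀ i' < n, loc i / m < loc i' / m →
      rk (s (0, b + i)) < rk (s (0, b + i')))
    (hdone : Done E rk t W κ ex b n k s p) :
    FS E t W L (κ * β ^ j * Y * E.th ^ L + ex) d w
      (.instr (.alloc M) fun T => .instr (.alu .add (q + 1) 1) fun k' => .instr (.alloc k') fun B =>
        .call (.sumFlags F T 0 M) fun _ => .call (.pack F V T m B b 0 M 0) fun _ =>
        .instr (.alu .add B (q + 1)) fun a => .instr (.write a n) fun _ =>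
        .call (.parFor (.recurse b B) 0 (q + 1)) k) s₁ P := by
  have hmM : m ≤ M := by rw [hM]; exact Nat.le_mul_of_pos_left _ (by omega)
  have hqM : q + 1 ≤ M := by rw [hM]; exact Nat.le_mul_of_pos_right _ hm
  have hbound := hU.bound
  -- the flags
  set φ : ℕ → ℕ := fun a => if a < M then s₁ (0, F + a) else 0 with hφ
  have hφ_lt : ∀ a < M, φ a = s₁ (0, F + a) := fun a ha => if_pos ha
  have hφloc : ∀ i < n, loc i < M ∧ φ (loc i) = 1 := fun i hi =>
    ⟨(hloc i hi).1, (hφ_lt _ (hloc i hi).1).trans (hloc i hi).2.1⟩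
  have hφ0 : ∀ a < M, (∀ i < n, loc i ≠ a) → φ a = 0 := fun a ha h =>
    (hφ_lt a ha).trans (h0 a ha h)
  have hφ1 : ∀ a, φ a ≤ 1 := fun a => by
    by_cases ha : a < M
    · by_cases h : ∃ i < n, loc i = a
      · obtain ⟨i, hi, rfl⟩ := h
        exact (hφloc i hi).2.le
      · push Not at h
        rw [hφ0 a ha h]; omega
    · rw [hφ]; simp [ha]
  have hφof : ∀ a < M, φ a = 1 → ∃ i < n, loc i = a := fun a ha h1 => by
    by_contra h
    push Not at h
    rw [hφ0 a ha h] at h1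
    cases h1
  set pc := flagged φ with hpc
  have hpcM : pc M = n := flagged_total hφloc hinj hφ0
  have hpcm : Monotone pc := flagged_mono φ
  have hpcn : ∀ a ≤ M, pc a ≤ n := fun a ha => hpcM ▸ hpcm ha
  have hpcl : ∀ i < n, pc (loc i) < n := fun i hi => hpcM ▸ flagged_lt hφloc hi (hloc i hi).1
  have hnM : n ≤ M := by
    have := Finset.card_le_card_of_injOn (s := Finset.range n) (t := Finset.range M) loc
      (fun i hi => by simpa using (hloc i (by simpa using hi)).1)
      (fun i hi i' hi' h => hinj i (by simpa using hi) i' (by simpa using hi') h)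
    simpa using this
  -- allocation
  refine FS.alloc (by omega) (by omega) (by omega) fun W₁ T s₂ hW₁ hT hTM hs₂ hT0 => ?_
  have hnx₁ := hW₁.2
  refine FS.add (by omega) (by omega) (by omega) ?_
  refine FS.alloc (by omega) (by omega) (by omega) fun W₂ B s₃ hW₂ hB hBM hs₃ hB0 => ?_
  have hnx₂ := hW₂.2
  set P' := P + blk T M + blk B (q + 1 + 1) with hP'
  have hPP' : P ≤ P' := by rw [hP', add_assoc]; exact le_self_add
  have hP'0 : ∀ {a}, P a ≠ 0 → P' a ≠ 0 := fun h => ne_zero_of_le hPP' h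
  have hTP : ∀ i < M, 1 ≤ P' (0, T + i) := fun i hi =>
    one_le_of_le (le_self_add.trans' le_add_self) (one_le_blk hi)
  have hBP : ∀ i ≤ q + 1, 1 ≤ P' (0, B + i) := fun i hi =>
    one_le_of_le le_add_self (one_le_blk (by omega))
  have hsP : Agree P s₁ s₃ := hs₂.trans (hs₃.mono le_self_add)
  have hsF : ∀ a < M, s₃ (0, F + a) = s₁ (0, F + a) := fun a ha => (hsP _ (hpF a ha)).symm
  refine FS.fn (c := .call (.sumFlags F T 0 M) .ret) (Fn.sumFlags (φ := φ) (by omega) (by omega)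
    hbd (by omega) (by omega) (by omega) (fun a _ ha => (hsF a ha).trans (hφ_lt a ha).symm) hφ1
    (fun a _ ha => hP'0 (hpF a ha)) (fun a _ ha => hTP a ha) (fun a _ ha a' _ ha' => by omega))
    (by omega) (by omega) fun t' ht' W₃ hW₃ v d' w' s₄ hd' hw' ⟨⟨_, hT4⟩, hs₄⟩ => ?_
  have hnx₃ := hW₃.2
  have hown : ∀ a, PackOwn B b m φ pc 0 M a → (∃ i ≤ q, a = (0, B + i)) ∨ ∃ x < n, a = (0, b + x) := by
    rintro a ⟨i, -, hi, ⟨-, rfl⟩ | ⟨h1, rfl⟩⟩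
    · have := Nat.div_lt_of_lt_mul (by rw [mul_comm, ← hM]; exact hi : i < m * (q + 1))
      exact .inl ⟨i / m, by omega, rfl⟩
    · obtain ⟨i', hi', rfl⟩ := hφof i hi h1
      exact .inr ⟨_, hpcl i' hi', rfl⟩
  have hsT : ∀ a, P' a ≠ 0 → (∀ i < M, a ≠ (0, T + i)) → s₃ a = s₄ a := fun a ha h =>
    hs₄ a ha fun i _ hi => h i hi
  have hsF4 : ∀ a < M, φ a = s₄ (0, F + a) := fun a ha => by
    rw [hφ_lt a ha, ← hsF a ha]
    exact hsT _ (hP'0 (hpF a ha)) fun i hi h => by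
      simp only [Prod.mk.injEq, true_and] at h
      omega
  have hsV4 : ∀ a < M, s₁ (0, V + a) = s₄ (0, V + a) := fun a ha => by
    rw [hsP _ (hpV a ha)]
    exact hsT _ (hP'0 (hpV a ha)) fun i hi h => by
      simp only [Prod.mk.injEq, true_and] at h
      omega
  refine FS.fn (c := .call (.pack F V T m B b 0 M 0) .ret) (Fn.pack (φ := φ) (pc := pc)
    (Vv := fun a => s₁ (0, V + a)) (j := j) (by omega) (by omega)
    hbd (by omega) (by omega) (by omega) (by omega) (by omega) (by omega) (by omega)
    (flagged_succ φ) rfl (fun a _ ha => (hsF4 a ha).symm) hφ1 (fun a _ ha h1 => ?_) hT4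
    (fun a _ ha => hP'0 (hpF a ha)) (fun a _ ha => hP'0 (hpV a ha))
    (fun a _ ha h => by simpa [h] using hTP a ha) (fun a ha => ?_) (fun i _ hi a ha => ?_)
    (fun i i' _ hi _ hi' h1 h2 => ?_))
    (by omega) (by omega) fun t₅ ht₅ W₅ hW₅ v₅ d₅ w₅ s₅ hd₅ hw₅ ⟨⟨_, hpk⟩, hs₅⟩ => ?_
  · obtain ⟨i, hi, rfl⟩ := hφof a ha h1
    refine ⟨(hsV4 _ ha).symm, ?_⟩
    rw [(hloc i hi).2.2]
    have := hU.lt i hi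
    omega
  · rcases hown a ha with ⟨i, hi, rfl⟩ | ⟨x, hx, rfl⟩
    · exact hBP i (by omega)
    · exact one_le_of_le (hP.trans hPP') (hU.own x hx)
  · rcases hown a ha with ⟨i', hi', rfl⟩ | ⟨x, hx, rfl⟩ <;>
    simp only [ne_eq, Prod.mk.injEq, true_and] <;> omega
  · obtain ⟨u, hu, rfl⟩ := hφof i' hi' h2
    have := hpcl u hu
    generalize i / m = z
    omega
  have hnx₅ := hW₅.2
  refine FS.add (by omega) (by omega) (by omega) ?_
  refine FS.write (by omega) (by omega) (hBP _ le_rfl) (by omega) ?_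
  set s₆ := Function.update s₅ (0, B + (q + 1)) n with hs₆
  have hB6 : ∀ i ≤ q, s₆ (0, B + i) = pc (i * m) := fun i hi => by
    rw [hs₆, Function.update_of_ne (by simp only [ne_eq, Prod.mk.injEq, true_and]; omega)]
    have h1 : (i + 1) * m ≤ M := by rw [hM]; exact Nat.mul_le_mul_right _ (by omega)
    rw [add_one_mul] at h1
    have := (hpk (i * m) (Nat.zero_le _) (by omega)).1 (Nat.mul_mod_left i m)
    rwa [Nat.mul_div_cancel _ hm] at this
  have hb6 : ∀ i < n, s₆ (0, b + pc (loc i)) = s (0, b + i) := fun i hi => by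
    have := hpcl i hi
    rw [hs₆, Function.update_of_ne (by simp only [ne_eq, Prod.mk.injEq, true_and]; omega)]
    rw [← (hloc i hi).2.2]
    exact (hpk (loc i) (Nat.zero_le _) (hloc i hi).1).2 (hφloc i hi).2
  have hperm : ∀ x < n, ∃ i < n, pc (loc i) = x ∧ s₆ (0, b + x) = s (0, b + i) := fun x hx => by
    obtain ⟨i, hi, rfl⟩ := exists_flagged_eq hφloc hinj hφ0 hx
    exact ⟨i, hi, rfl, hb6 i hi⟩
  have hsame : ∀ a, p a ≠ 0 → (a.1 = 0 → b ≤ a.2 → b + n ≤ a.2) → s a = s₆ a := fun a ha hout => by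
    have hPa : P a ≠ 0 := ne_zero_of_le hP ha
    have h1 : a.2 < T := by
      by_contra h
      exact hPa (hT0 a.1 a.2 (by omega))
    have h2 : ∀ i, a ≠ (0, B + i) := fun i h => by rw [h] at h1; dsimp only at h1; omega
    rw [hs a ha, hsP a hPa, hsT a (hP'0 hPa) (fun i _ h => by rw [h] at h1; dsimp only at h1; omega),
      hs₅ a (hP'0 hPa) fun h => ?_, hs₆, Function.update_of_ne (h2 _)]
    rcases hown a h with ⟨i, -, h⟩ | ⟨x, hx, h⟩
    · exact h2 i h
    · have := hout (by rw [h]) (by rw [h]; dsimp only; omega)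
      rw [h] at this
      dsimp only at this
      omega
  have hpcs : ∀ i ≤ q + 1, pc (i * m) ≤ n := fun i hi =>
    hpcn _ (by rw [hM]; exact Nat.mul_le_mul_right _ hi)
  have hmul : ∀ i, i * m ≤ (i + 1) * m := fun i => Nat.mul_le_mul_right _ (by omega)
  have h6 := tri_recurse (E := E) (t := t₅) (W := W₅) (L := d₅ + 1 + 1 + 9 * j + 4) (d := d₅ + 1 + 1)
    (s := s₆) (p := P') hβ hβ' hβt hκ hκt (X := X) (N := N) (rk := rk)
    (fun W d s p b n κ h1 h2 h3 => (hsort W d s p b n κ h1 h2 h3).mono (ht₅.trans ht') le_rfl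
      (.refl _ _))
    (b := b) (B := B) (n := n) (q := q + 1) (j := j) (pc := fun i => pc (i * m)) hbd (by omega) (by omega)
    (by omega) (by omega) ⟨fun i hi => one_le_of_le (hP.trans hPP') (hU.own i hi), fun i hi => ?_,
      fun i hi i' hi' h => ?_, by omega⟩ (by simp [hpc, flagged]) (by rw [← hM]; exact hpcM)
    (fun i _ => hpcm (hmul i)) (fun i hi => ⟨fun h => by simpa [h] using hBP i hi, ?_⟩)
    (fun i hi x hx => by omega) (by omega) (fun i hi x hx y hy hxy => ?_) rfl
  rotate_left
  · obtain ⟨u, hu, -, h⟩ := hperm i hi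
    rw [h]; exact hU.lt u hu
  · obtain ⟨u, hu, hu', h1⟩ := hperm i hi
    obtain ⟨v, hv, hv', h2⟩ := hperm i' hi'
    rw [h1, h2] at h
    obtain rfl := hU.inj u hu v hv h
    rw [← hu', hv']
  · rcases hi.eq_or_lt with rfl | hi
    · rw [hs₆, Function.update_self, ← hM, hpcM]
    · exact hB6 i (by omega)
  · have hxn := hpcs i hi
    obtain ⟨u, hu, rfl, h1⟩ := hperm x (by omega)
    obtain ⟨v, hv, rfl, h2⟩ := hperm y hy
    rw [h1, h2]
    refine hord u hu v hv ?_
    have h3 : loc u < i * m := by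
      by_contra h
      exact absurd (hpcm (not_lt.1 h)) (not_le.2 hx)
    have h4 : i * m ≤ loc v := by
      by_contra h
      exact absurd (flagged_lt hφloc hv (not_le.1 h)) (not_lt.2 hxy)
    rw [mul_comm] at h3
    have h5 := Nat.div_lt_of_lt_mul h3
    have h6 := (Nat.le_div_iff_mul_le hm).2 h4
    omega
  have h7 := h6 t₅ le_rfl W₅ le_rfl k s₆ 0 ex (.refl _ _) ?_
  · refine h7.weaken (by rw [add_zero]) ?_
    have h8 : 20 * (q + 1) ≤ w₅ - 1 - 1 := by omega
    have hsum : ∑ i ∈ Finset.range (q + 1), X (pc ((i + 1) * m) - pc (i * m)) ≤ Y := by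
      refine hY (fun i => pc ((i + 1) * m) - pc (i * m)) ?_ fun i => ?_
      · rw [Finset.sum_range_tsub (f := fun i => pc (i * m)) fun i i' h =>
          hpcm (Nat.mul_le_mul_right _ h), ← hM, hpcM]
        simp [hpc, flagged]
      · have : pc (i * m + m) ≤ pc (i * m) + m := flagged_add_le hφ1 (i * m) m
        rw [add_one_mul]
        omega
    rw [add_comm (κ * β ^ j * _ * _), add_assoc]
    have hth := th_pow_le E (by omega : d₅ + 1 + 1 + 9 * j + 4 + 7 ≤ L)
    exact add_le_add (mul_le_mul' (by exact_mod_cast h8) hth)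
      (add_le_add (mul_le_mul' (mul_le_mul' le_rfl hsum) hth) le_rfl)
  · rintro t₇ ht₇ W₇ hW₇ v d' s₇ e' ⟨⟨rfl, hS⟩, he⟩ -
    rw [add_zero]
    refine (hdone t₇ (by omega) W₇ ?_ d' s₇ e' he ⟨fun i hi => ?_, hS.lt, fun a ha hp => ?_⟩).weaken
      (hP.trans hPP') le_rfl
    · exact hW₁.trans (hW₂.trans (hW₃.trans (hW₅.trans hW₇)))
    · obtain ⟨x, hx, h⟩ := hS.mem i hi
      obtain ⟨u, hu, -, h'⟩ := hperm x hx
      exact ⟨u, hu, h.trans h'⟩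
    · exact (hsame a hp ha).trans (hS.same a ha (ne_zero_of_le (hP.trans hPP') hp))

end BF

namespace BF
variable {E : Env} {t : ℕ} {W : World} {L : ℕ} {f : ℝ≥0∞} {d w : ℕ} {s : St} {p : Share}

/-! ## Choosing the pivots by sampling -/

variable {N : ℕ} {rk : ℕ → ℕ}

theorem le_gh {S m : ℕ} {q : Share} (hpq : p ≤ q) (hp : ∀ j x, S ≤ x → p (j, x) = 0) :
    p ≤ Share.gh S m 0 q := fun x => by
  by_cases hx : Gh S m x
  · rw [gh_of hx, hp x.1 x.2 hx.2.1]
  · rw [gh_of_not hx]; exact hpq x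

theorem ne_zero_of_one_le {a : ℕ × ℕ} (h : 1 ≤ p a) : p a ≠ 0 := fun h0 => by
  rw [h0] at h
  exact absurd h (by norm_num)

/-- The bucket of element `i` is `β i`, when the buckets are separated by the pivots `Z`. -/
def IsBucket (rk : ℕ → ℕ) (n q : ℕ) (Z a₀ β : ℕ → ℕ) : Prop :=
  ∀ i < n, β i ≤ q ∧ (∀ i' < β i, rk (Z i') < rk (a₀ i)) ∧
    ∀ i', β i ≤ i' → i' < q → rk (a₀ i) ≤ rk (Z i')

/-- The program does not notice unlucky samples. In the proof, either the cost of a restart is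
already released here (`g = cost`), or every bucket is small. The second alternative is stated for
every assignment of buckets that the pivots allow, since the assignment is fixed only later. -/
theorem FS.choosePivots (hr : Ranked E N rk) {b n q l h j : ℕ} {a₀ : ℕ → ℕ}
    {k : ℕ → Prog Proc Word} {c c' : ℕ} {cost : ℝ≥0∞} (hc : c = 68 * j + 42)
    (hc' : c' = q * l * 62 + q * l * (32 * (q * l)) + 32 * q + 12) (hd : d + c ≤ L) (hw : c' ≤ w)
    (hj : q * l ≤ 2 ^ j) (hbd : 3 ≤ E.bd) (hql : 2 * (q * l) ≤ E.bd) (hN : N ≤ E.bd) (hn : n ≤ E.bd)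
    (hbn : b + n ≤ E.bd + W.nx) (hpb : ∀ i < n, p (0, b + i) ≠ 0)
    (hsb : ∀ i < n, s (0, b + i) = a₀ i) (ha₀ : ∀ i < n, a₀ i < N)
    (hinj : ∀ i < n, ∀ i' < n, a₀ i = a₀ i' → i = i') (hn0 : 0 < n) (hq0 : 0 < q) (hl0 : 0 < l)
    (hh0 : 0 < h)
    (hk : ∀ t' ≤ t, ∀ W', W ≤ W' → ∀ d' w' s' Q g (Z : ℕ → ℕ), d' ≤ d + c → w ≤ w' + c' →
      Q + q ≤ W'.nx → (∀ j x, Q ≤ x → p (j, x) = 0) → Agree p s s' →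
      (∀ i < q, s' (0, Q + i) = Z i ∧ Z i < N) →
      (∀ i i', i ≤ i' → i' < q → rk (Z i) ≤ rk (Z i')) →
      (g = cost ∨ ∀ β, IsBucket rk n q Z a₀ β →
        ∀ r, ((Finset.range n).filter fun i => β i = r).card ≤ 2 * h) →
      FS E t' W' L (f + g) d' w' (k Q) s' (p + blk Q q)) :
    FS E t W L (f + samplePot n h (q * l) l (keyPos (fun i => rk (a₀ i)) n) cost fun _ => 0) d w
      (.instr (.alloc (q * l)) fun S => .call (.parFor (.sample b n S) 0 (q * l)) fun _ =>
        .instr (.alloc (q * l)) fun R => .call (.parFor (.place S (q * l) R) 0 (q * l)) fun _ =>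
        .instr (.alloc q) fun Q => .call (.parFor (.pivot R l Q) 0 q) fun _ => k Q) s p := by
  have hqm : q ≤ q * l := Nat.le_mul_of_pos_right _ hl0
  set m := q * l with hm
  have hrinj : ∀ i < n, ∀ i' < n, rk (a₀ i) = rk (a₀ i') → i = i' := fun i hi i' hi' h =>
    hinj i hi i' hi' (hr.inj _ (ha₀ i hi) _ (ha₀ i' hi') h)
  set ord := keyPos (fun i => rk (a₀ i)) n with hord
  have hq1 : m * 30 + 3 + (m * (m * 32 + 32) + 3) + (q * 32 + 3) + 3 = c' := by rw [hc']; ring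
  refine FS.alloc (by omega) (by omega) (by omega) fun W₁ S s₁ hW₁ hS hSm hs₁ hS0 => ?_
  have hnx₁ := hW₁.2
  have hbS : ∀ i < n, b + i < S := fun i hi => by
    by_contra h
    exact hpb i hi (hS0 0 _ (not_lt.1 h))
  refine FS.sample (j := j) rfl rfl (by omega) (by omega) hj (by omega) hn0 hbd (by omega) (by omega)
    (by omega) (by omega) (fun i _ i' hi' => by have := hbS i' hi'; omega)
    (fun i hi => one_le_of_le le_add_self (one_le_blk hi))
    (fun x hx => one_le_of_le le_add_self (by
      have := one_le_blk (a := S) (k := m) (j := x.1) (i := x.2 - S) (by have := hx.2; omega)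
      rwa [Nat.add_sub_cancel' hx.2.1] at this))
    (fun i hi => ne_zero_of_le le_self_add (hpb i hi))
    (fun i hi => by
      rw [← hs₁ _ (hpb i hi), hsb i hi]
      exact (ha₀ i hi).le.trans hN)
    (samplePot_draw hn0 (fun v hv => keyPos_lt hv)
      (fun v hv v' hv' h => hrinj v hv v' hv' (keyPos_inj (key := fun i => rk (a₀ i)) (m := n) hv hv' h)))
    samplePot_congr
    fun t₂ ht₂ W₂ hW₂ d₂ w₂ s₂ v₂ y hd₂ hw₂ hy hs₂ => ?_
  have hnx₂ := hW₂.2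
  set P₂ := Share.gh S m 0 (p + blk S m) with hP₂
  have hpP₂ : p ≤ P₂ := le_gh le_self_add hS0
  have hS2 : ∀ i < m, 1 ≤ P₂ (0, S + i) := fun i hi => by
    rw [hP₂, gh_of_not (fun h => h.1 rfl)]
    exact one_le_of_le le_add_self (one_le_blk hi)
  have hlo : ∀ a, p a ≠ 0 → a.2 < S := fun a ha => by
    by_contra h
    exact ha (hS0 a.1 a.2 (not_lt.1 h))
  have hag₂ : Agree p s s₂ := fun a ha =>
    (hs₁ a ha).trans (hs₂ a (.inl (hlo a ha)) (ne_zero_of_le le_self_add ha))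
  have hy2 : ∀ i < m, s₂ (0, S + i) = a₀ (y i) := fun i hi => by
    obtain ⟨h1, h2⟩ := hy i hi
    rw [h2, ← hs₁ _ (hpb _ h1), hsb _ h1]
  refine FS.alloc (by omega) (by omega) (by omega) fun W₃ R s₃ hW₃ hR hRm hs₃ hR0 => ?_
  have hnx₃ := hW₃.2
  have hnR : ∀ a, P₂ a ≠ 0 → a.2 < R := fun a ha => by
    by_contra h
    exact ha (hR0 a.1 a.2 (not_lt.1 h))
  have hSR : S + m ≤ R := by
    by_contra h
    have := hnR _ (ne_zero_of_one_le (hS2 (m - 1) (by omega)))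
    dsimp only at this
    omega
  have hR3 : ∀ i < m, 1 ≤ (P₂ + blk R m) (0, R + i) := fun i hi =>
    one_le_of_le le_add_self (one_le_blk hi)
  refine FS.place hr (j := j) (Y := fun i => a₀ (y i)) rfl rfl (by omega) (by omega) hj hbd hN (by omega)
    (by omega) (by omega) (fun i _ i' _ => by omega)
    (fun i hi => ne_zero_of_le le_self_add (ne_zero_of_one_le (hS2 i hi))) hR3
    (fun i hi => (hs₃ _ (ne_zero_of_one_le (hS2 i hi))).symm.trans (hy2 i hi))
    (fun i hi => ha₀ _ (hy i hi).1)
    fun t₄ ht₄ W₄ hW₄ d₄ w₄ s₄ v₄ hd₄ hw₄ hs₄R hs₄ => ?_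
  have hnx₄ := hW₄.2
  refine FS.alloc (by omega) (by omega) (by omega) fun W₅ Q s₅ hW₅ hQ hQm hs₅ hQ0 => ?_
  have hnx₅ := hW₅.2
  have hpP₃ : p ≤ P₂ + blk R m := hpP₂.trans le_self_add
  have hR5 : ∀ i < m, s₅ (0, R + keyPos (tieKey rk (fun i => a₀ (y i)) m) m i) = a₀ (y i) :=
    fun i hi => by
      rw [← hs₅ _ (ne_zero_of_one_le (hR3 _ (keyPos_lt hi)))]
      exact hs₄R i hi
  have hZ : ∀ a < m, ∃ i < m, s₅ (0, R + a) = a₀ (y i) := fun a ha => by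
    obtain ⟨i, hi, rfl⟩ := tiePos_surj (rk := rk) (Y := fun i => a₀ (y i)) ha
    exact ⟨i, hi, hR5 i hi⟩
  have hpos : ∀ i < q, (i + 1) * l - 1 < m := fun i hi => by
    have h1 : (i + 1) * l ≤ m := Nat.mul_le_mul_right _ hi
    have h2 : 1 * l ≤ (i + 1) * l := Nat.mul_le_mul_right _ (by omega)
    omega
  have hRQ : R + m ≤ Q := by
    by_contra h
    exact ne_zero_of_one_le (hR3 (m - 1) (by omega)) (hQ0 0 (R + (m - 1)) (by omega))
  refine FS.pivot (j := j) rfl rfl (by omega) (by omega) (by omega) hbd (by omega) hl0 (by omega)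
    (by omega) (by omega) (fun i _ i' _ => by omega)
    (fun i hi => ne_zero_of_le le_self_add (ne_zero_of_one_le (hR3 i hi)))
    (fun i hi => one_le_of_le le_add_self (one_le_blk hi)) (fun i hi => ?_)
    fun t₆ ht₆ W₆ hW₆ d₆ w₆ s₆ v₆ hd₆ hw₆ hs₆Q hs₆ => ?_
  · obtain ⟨i', hi', h⟩ := hZ i hi
    rw [h]
    exact (ha₀ _ (hy i' hi').1).le.trans hN
  have hnx₆ := hW₆.2
  have hag₆ : Agree p s s₆ := fun a ha => by
    have h2 := hlo a ha
    rw [hag₂ a ha, hs₃ a (ne_zero_of_le hpP₂ ha), hs₄ a _ (ne_zero_of_le hpP₃ ha),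
      hs₅ a (ne_zero_of_le hpP₃ ha), hs₆ a _ (ne_zero_of_le (hpP₃.trans le_self_add) ha)]
    · rintro i - rfl
      dsimp only at h2
      omega
    · rintro i - rfl
      dsimp only at h2
      omega
  have hZ6 : ∀ i < q, s₆ (0, Q + i) = s₅ (0, R + ((i + 1) * l - 1)) ∧
      s₅ (0, R + ((i + 1) * l - 1)) < N := fun i hi => by
    obtain ⟨i', hi', h⟩ := hZ _ (hpos i hi)
    exact ⟨hs₆Q i hi, h ▸ ha₀ _ (hy i' hi').1⟩
  have hmono : ∀ i i', i ≤ i' → i' < q → rk (s₅ (0, R + ((i + 1) * l - 1))) ≤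
      rk (s₅ (0, R + ((i' + 1) * l - 1))) := fun i i' h hi' =>
    (pivot_mono (Z := fun a => s₅ (0, R + a)) hR5
      (Nat.sub_le_sub_right (Nat.mul_le_mul_right l (by omega)) 1) (hpos i' hi')).1
  have fin : ∀ g, g ≤ samplePot n h m l ord cost (fun i => y i + 1) → (g = cost ∨ ∀ β,
      IsBucket rk n q (fun i => s₅ (0, R + ((i + 1) * l - 1))) a₀ β →
        ∀ r, ((Finset.range n).filter fun i => β i = r).card ≤ 2 * h) →
      FS E t₆ W₆ L (f + samplePot n h m l ord cost fun i => y i + 1) d₆ w₆ (k Q) s₆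
        (P₂ + blk R m + blk Q q) := fun g hg hg' =>
    (hk t₆ (by omega) W₆ (hW₁.trans (hW₂.trans (hW₃.trans (hW₄.trans (hW₅.trans hW₆))))) d₆ w₆ s₆ Q g
      _ (by omega) (by omega) (by omega) (fun j x hx => by
        have := hpP₃ (j, x)
        rw [hQ0 j x hx] at this
        exact le_antisymm this zero_le) hag₆ hZ6 hmono hg').weaken
      (add_le_add hpP₃ le_rfl) (add_le_add le_rfl hg)
  by_cases hgood : ∀ w < n / h, l ≤ ((Finset.range m).filter fun i => ord (y i) / h = w).card
  · refine fin 0 zero_le (.inr fun β hβ r => ?_)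
    exact bucket_card_le hh0 hl0 hrinj (fun i hi => (hy i hi).1) (Z := fun a => s₅ (0, R + a)) hR5 hβ
      hgood r
  · push Not at hgood
    obtain ⟨w, hw1, hw2⟩ := hgood
    exact fin cost (samplePot_fail hw1 hw2) (.inl rfl)

end BF

namespace BF
variable {E : Env} {t : ℕ} {W : World} {L : ℕ} {f : ℝ≥0∞} {d w : ℕ} {s : St} {p : Share}

/-! ## One round of the sample sort -/

variable {N : ℕ} {rk : ℕ → ℕ} {X : ℕ → ℝ≥0∞}

theorem exists_isBucket {n q : ℕ} {Z a₀ : ℕ → ℕ}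
    (hmono : ∀ i i', i ≤ i' → i' < q → rk (Z i) ≤ rk (Z i')) : ∃ β, IsBucket rk n q Z a₀ β := by
  classical
  have h : ∀ i, ∃ j, j = q ∨ j < q ∧ rk (a₀ i) ≤ rk (Z j) := fun i => ⟨q, .inl rfl⟩
  refine ⟨fun i => Nat.find (h i), fun i hi => ⟨Nat.find_min' (h i) (.inl rfl), fun j hj => ?_,
    fun j hj hjq => ?_⟩⟩
  · have h1 := Nat.find_min (h i) hj
    have h2 : Nat.find (h i) ≤ q := Nat.find_min' (h i) (.inl rfl)
    have h3 : j < Nat.find (h i) := hj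
    push Not at h1
    exact h1.2 (by omega)
  · rcases Nat.find_spec (h i) with h1 | ⟨h1, h2⟩
    · dsimp only at hj; omega
    · exact h2.trans (hmono _ _ hj hjq)

theorem IsBucket.lt {n q : ℕ} {Z a₀ β : ℕ → ℕ} (hβ : IsBucket rk n q Z a₀ β) {i i' : ℕ} (hi : i < n)
    (hi' : i' < n) (h : β i < β i') : rk (a₀ i) < rk (a₀ i') :=
  ((hβ i hi).2.2 (β i) le_rfl (h.trans_le (hβ i' hi').1)).trans_lt ((hβ i' hi').2.1 _ h)

open Classical in
/-- The state of the distribution: failures are paid for by `g` if that is the cost, and by the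
potential of the collisions if all buckets are small. -/
theorem exists_distData {n q m M T F V K : ℕ} {β a₀ : ℕ → ℕ} {u v cost g : ℝ≥0∞}
    (hn : 0 < n) (hm : 0 < m) (hM : M = (q + 1) * m) (hnM : n ≤ M)
    (hFV : ∀ a < M, ∀ b < M, F + a ≠ V + b) (hβ : ∀ i < n, β i ≤ q)
    (hu : m + 15 * K ≤ m * u) (hv : m + 15 ≤ m * v) (hu1 : 1 ≤ u) (hv1 : 1 ≤ v)
    (hg : g = cost ∨ ∀ r, ((Finset.range n).filter fun i => β i = r).card ≤ K) :
    ∃ D : DistData, D.n = n ∧ D.m = m ∧ D.M = M ∧ D.T = T ∧ D.F = F ∧ D.V = V ∧ D.β = β ∧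
      D.a₀ = a₀ ∧ D.cost = cost ∧ (D.Ψ (fun _ => 0) (fun _ => T) ≤
        g + if ∀ r, ((Finset.range n).filter fun i => β i = r).card ≤ K then
          hitPot n T β u v cost (fun _ => 0) (fun _ => T) else 0) := by
  have hβM : ∀ i < n, (β i + 1) * m ≤ M := fun i hi => by
    rw [hM]; exact Nat.mul_le_mul_right _ (by have := hβ i hi; omega)
  by_cases hK : ∀ r, ((Finset.range n).filter fun i => β i = r).card ≤ K
  · refine ⟨⟨n, m, M, T, F, V, β, a₀, hitPot n T β u v cost, cost, hn, hm, hnM, hFV, hβM,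
      hitPot_congr, fun h R lc i k hi hR _ hlc => hitPot_draw hu hv hK h R lc i k hi hR hlc,
      fun h R i hi => hitPot_fail hu1 hv1 h R i hi⟩, rfl, rfl, rfl, rfl, rfl, rfl, rfl, rfl, rfl, ?_⟩
    rw [if_pos hK]
    exact le_add_self
  · refine ⟨⟨n, m, M, T, F, V, β, a₀, fun _ _ => cost, cost, hn, hm, hnM, hFV, hβM,
      fun _ _ _ _ _ _ => rfl, fun h R lc i k hi hR _ hlc => ?_, fun h R i hi _ => le_rfl⟩,
      rfl, rfl, rfl, rfl, rfl, rfl, rfl, rfl, rfl, ?_⟩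
    · simp
    · rw [if_neg hK, add_zero]
      exact (hg.resolve_right hK).ge

/-- If a bucket is too large, the distribution is run with the constant estimator `cost`, paid for
by `g`; then failures are free. Otherwise the estimator counts collisions with buckets of at most `2
* h` elements. -/
theorem FS.distributeAll (hr : Ranked E N rk) {b n q Q m M T h j jq : ℕ} {a₀ Z : ℕ → ℕ}
    {c₂ l : ℕ} {k : ℕ → ℕ → ℕ → Prog Proc Word} {c c' : ℕ} {cost g : ℝ≥0∞} {P : Share}
    (hc : c = 34 * j + 10 * jq + 9 * T + 27)
    (hc' : c' = 27 * M + n * (10 * jq + 9 * T + 39) + 9) (hd : d + c ≤ L)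
    (hw : c' ≤ w) (hj : M ≤ 2 ^ j) (hjq : q + 1 ≤ 2 ^ jq) (hT : T = c₂ * l) (hM : M = (q + 1) * m)
    (hnM : n ≤ M) (hn0 : 0 < n) (hh0 : 0 < h) (hmh : 60 * h ≤ m)
    (hbd : 3 ≤ E.bd) (hMb : 2 * M ≤ E.bd) (hTb : T ≤ E.bd) (hN : N ≤ E.bd)
    (hbn : b + n ≤ E.bd + W.nx) (hP : p + blk Q q ≤ P) (hp0 : ∀ j x, Q ≤ x → p (j, x) = 0)
    (hPQ : Q + q ≤ W.nx)
    (hpb : ∀ i < n, p (0, b + i) ≠ 0) (hsb : ∀ i < n, s (0, b + i) = a₀ i) (ha₀ : ∀ i < n, a₀ i < N)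
    (hZ : ∀ i < q, s (0, Q + i) = Z i ∧ Z i < N)
    (hmono : ∀ i i', i ≤ i' → i' < q → rk (Z i) ≤ rk (Z i'))
    (hg : g = cost ∨ ∀ β, IsBucket rk n q Z a₀ β →
        ∀ r, ((Finset.range n).filter fun i => β i = r).card ≤ 2 * h)
    (hok : ∀ t' ≤ t, ∀ W', W ≤ W' → ∀ d' w' s' F V (loc : ℕ → ℕ) P', d' ≤ d + c → w ≤ w' + c' →
      F + M ≤ W'.nx → V + M ≤ W'.nx → b + n ≤ F → b + n ≤ V → p ≤ P' → Agree p s s' →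
      (∀ a < M, P' (0, F + a) ≠ 0) → (∀ a < M, P' (0, V + a) ≠ 0) →
      (∀ i < n, loc i < M ∧ s' (0, F + loc i) = 1 ∧ s' (0, V + loc i) = a₀ i) →
      (∀ i < n, ∀ i' < n, loc i = loc i' → i = i') →
      (∀ a < M, (∀ i < n, loc i ≠ a) → s' (0, F + a) = 0) →
      (∀ i < n, ∀ i' < n, loc i / m < loc i' / m → rk (a₀ i) < rk (a₀ i')) →
      FS E t' W' L f d' w' (k F V 0) s' P')
    (hfail : ∀ t' ≤ t, ∀ W', W ≤ W' → ∀ d' w' s' F V v, d' ≤ d + c → w ≤ w' + c' → v ≠ 0 →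
      Agree p s s' → FS E t' W' L (f + cost) d' w' (k F V v) s' p) :
    FS E t W L (f + (g + cost * (n * (3 / 16) ^ T))) d w
      (.instr (.alloc M) fun F => .instr (.alloc M) fun V =>
        .call (.parFor (.clear F) 0 M) fun _ => .instr (.alu .mul c₂ l) fun tries =>
        .call (.parFor (.distribute b Q q F V m tries) 0 n) fun v => k F V v) s P := by
  have hm0 : 0 < m := by omega
  have hmM : m ≤ M := by rw [hM]; exact Nat.le_mul_of_pos_left _ (by omega)
  have hqM : q + 1 ≤ M := by rw [hM]; exact Nat.le_mul_of_pos_right _ hm0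
  obtain ⟨β, hβ⟩ := exists_isBucket (n := n) (a₀ := a₀) hmono
  refine FS.alloc (by omega) (by omega) (by omega) fun W₁ F s₁ hW₁ hF hFM hs₁ hF0 => ?_
  have hnx₁ := hW₁.2
  refine FS.alloc (by omega) (by omega) (by omega) fun W₂ V s₂ hW₂ hV hVM hs₂ hV0 => ?_
  have hnx₂ := hW₂.2
  set P₂ := P + blk F M + blk V M with hP₂
  have hpP : p ≤ P := le_self_add.trans hP
  have hPP₂ : P ≤ P₂ := by rw [hP₂, add_assoc]; exact le_self_add
  have hFP : ∀ j, ∀ i < M, 1 ≤ P₂ (j, F + i) := fun j i hi =>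
    one_le_of_le (le_self_add.trans' le_add_self) (one_le_blk hi)
  have hVP : ∀ i < M, 1 ≤ P₂ (0, V + i) := fun i hi => one_le_of_le le_add_self (one_le_blk hi)
  have hag₂ : Agree P s s₂ := hs₁.trans (hs₂.mono le_self_add)
  have hlo : ∀ a, p a ≠ 0 → a.2 < Q := fun a ha => by
    by_contra h
    exact ha (hp0 a.1 a.2 (not_lt.1 h))
  have hQP : ∀ i < q, P (0, Q + i) ≠ 0 := fun i hi =>
    ne_zero_of_le hP (ne_zero_of_le le_add_self (ne_zero_of_one_le (one_le_blk hi)))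
  have hbQ : b + n ≤ Q := by
    have := hlo _ (hpb (n - 1) (by omega))
    dsimp only at this
    omega
  refine FS.clear (j := j) rfl rfl (by omega) (by omega) hj hbd hMb (by omega) (hFP 0)
    fun t₃ ht₃ W₃ hW₃ d₃ w₃ s₃ v₃ hd₃ hw₃ hs₃0 hs₃ => ?_
  have hnx₃ := hW₃.2
  refine FS.mul (by omega) (by omega) (by omega) ?_
  rw [← hT]
  have hag₃ : ∀ a, P a ≠ 0 → a.2 < F → s a = s₃ a := fun a ha haF =>
    (hag₂ a ha).trans (hs₃ a (fun i hi h => by rw [h] at haF; dsimp only at haF; omega)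
      (ne_zero_of_le hPP₂ ha))
  have hle : ∀ {x y : ℕ}, x * y ≤ m → (x : ℝ≥0∞) ≤ m * (y : ℝ≥0∞)⁻¹ := fun {x y} hxy => by
    rw [← div_eq_mul_inv]
    exact ENNReal.le_div_iff_mul_le (.inr (by simpa using hm0.ne')) (.inl (by simp)) |>.2
      (by exact_mod_cast hxy)
  -- With `K = 2 * h` the choices are `u = 1 + 1 / 2` and `v = 1 + 1 / (2 * K)`. Both conditions of
  -- the estimator, `15 * K ≤ m / 2` and `15 ≤ m / (2 * K)`, amount to `60 * h ≤ m`; this condition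
  -- determines the constant `r`.
  have hu : 1 + ((2 : ℕ) : ℝ≥0∞)⁻¹ ≤ 3 / 2 := by
    rw [show (3 : ℝ≥0∞) = 2 + 1 by norm_num, ENNReal.add_div,
      ENNReal.div_self (by norm_num) (by norm_num)]
    simp
  have hu2 : (m : ℝ≥0∞) + 15 * (2 * h : ℕ) ≤ m * (1 + ((2 : ℕ) : ℝ≥0∞)⁻¹) := by
    rw [mul_add, mul_one]
    refine add_le_add le_rfl ?_
    exact_mod_cast hle (x := 15 * (2 * h)) (y := 2) (by omega)
  have hv2 : (m : ℝ≥0∞) + 15 ≤ m * (1 + ((2 * (2 * h) : ℕ) : ℝ≥0∞)⁻¹) := by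
    rw [mul_add, mul_one]
    refine add_le_add le_rfl ?_
    exact_mod_cast hle (x := 15) (y := 2 * (2 * h)) (by omega)
  obtain ⟨D, rfl, rfl, rfl, rfl, rfl, rfl, rfl, rfl, rfl, hΨ⟩ := exists_distData (T := T) (F := F)
    (V := V) (a₀ := a₀) (cost := cost) (K := 2 * h) (u := 1 + ((2 : ℕ) : ℝ≥0∞)⁻¹)
    (v := 1 + ((2 * (2 * h) : ℕ) : ℝ≥0∞)⁻¹) hn0 hm0 hM hnM
    (fun a _ b _ => by omega) (fun i hi => (hβ i hi).1) hu2 hv2 le_self_add le_self_add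
    (hg.imp_right fun h => h β hβ)
  have hΨ' : D.Ψ (fun _ => 0) (fun _ => D.T) ≤ g + D.cost * (D.n * (3 / 16) ^ D.T) := by
    refine hΨ.trans (add_le_add le_rfl ?_)
    split_ifs with hK
    · refine hitPot_init_le le_self_add hu ?_ hK
      have := one_add_inv_two_mul_pow_le (K := 2 * h) (by omega)
      exact_mod_cast this
    · exact zero_le
  have hD : ∀ x, D.Places x → D.F ≤ x.2 := fun x hx => by
    rcases hx.2 with hx | hx <;> omega
  have hGh : ∀ x, Gh D.F D.n x → D.F ≤ x.2 := fun x hx => hx.2.1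
  have hP2g : p ≤ Share.gh D.F D.n 0 P₂ := le_gh (hpP.trans hPP₂) fun j x hx => by
    by_contra h
    have := hlo _ h
    dsimp only at this
    omega
  have hpF : ∀ a, p a ≠ 0 → a.2 < D.F := fun a ha => by
    have := hlo a ha
    omega
  have hag₄ : ∀ s₄, (∀ x, ¬ D.Places x → ¬ Gh D.F D.n x → P₂ x ≠ 0 → s₃ x = s₄ x) → Agree p s s₄ :=
    fun s₄ h a ha => by
      have h1 := hpF a ha
      rw [hag₃ a (ne_zero_of_le hpP ha) h1]
      exact h a (fun h2 => by have := hD a h2; omega) (fun h2 => by have := hGh a h2; omega)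
        (ne_zero_of_le (hpP.trans hPP₂) ha)
  refine FS.weaken (DistData.distribute (D := D) hr (P := Z) (j := j) (jq := jq) rfl rfl (by omega) (by omega)
    (by omega) hjq hbd hMb hTb hN (by omega) (by omega) (by omega) (by omega) (by omega) (hFP 0)
    hVP (fun x hx => ?_) (fun i hi => ne_zero_of_le (hpP.trans hPP₂) (hpb i hi))
    (fun i hi => ne_zero_of_le hPP₂ (hQP i hi)) (fun i hi h => ?_) (fun i hi h => ?_) hs₃0
    (fun i hi => ?_) ha₀ (fun i hi => ?_) (fun i hi => (hZ i hi).2) hmono hβ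
    (fun t' ht' W' hW' d' w' s' loc hd' hw' hloc hinj h0 hs' => ?_)
    (fun t' ht' W' hW' d' w' s' v hd' hw' hv hs' => ?_)) le_rfl (add_le_add le_rfl hΨ')
  · have := hFP x.1 (x.2 - D.F) (by have := hx.2; omega)
    rwa [Nat.add_sub_cancel' hx.2.1] at this
  · have := hD _ h
    dsimp only at this
    omega
  · have := hD _ h
    dsimp only at this
    omega
  · rw [← hag₃ _ (ne_zero_of_le hpP (hpb i hi)) (by dsimp only; omega)]
    exact hsb i hi
  · rw [← hag₃ _ (hQP i hi) (by dsimp only; omega)]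
    exact (hZ i hi).1
  · have hnx' := hW'.2
    refine hok t' (by omega) W' (hW₁.trans (hW₂.trans (hW₃.trans hW'))) d' w' s' D.F D.V loc _
      (by omega) (by omega) (by omega) (by omega) (by omega) (by omega) hP2g (hag₄ s' hs')
      (fun a ha => ?_) (fun a ha => ?_) (fun i hi => ?_) hinj h0 (fun i hi i' hi' h => ?_)
    · rw [gh_of_not (fun h => h.1 rfl)]
      exact ne_zero_of_one_le (hFP 0 a ha)
    · rw [gh_of_not (fun h => h.1 rfl)]
      exact ne_zero_of_one_le (hVP a ha)
    · obtain ⟨h1, -, h2, h3⟩ := hloc i hi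
      exact ⟨h1, h2, h3⟩
    · rw [(hloc i hi).2.1, (hloc i' hi').2.1] at h
      exact hβ.lt hi hi' h
  · exact (hfail t' (by omega) W' (hW₁.trans (hW₂.trans (hW₃.trans hW'))) d' w' s' D.F D.V v
      (by omega) (by omega) hv (hag₄ s' hs')).weaken hP2g le_rfl

end BF

namespace BF
variable {E : Env} {t : ℕ} {W : World} {L : ℕ} {f : ℝ≥0∞} {d w : ℕ} {s : St} {p : Share}

/-! ## The sample sort -/

variable {N : ℕ} {rk : ℕ → ℕ} {X X' : ℕ → ℝ≥0∞} {β : ℝ≥0∞}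

def SampleSortSpec (E : Env) (N : ℕ) (rk : ℕ → ℕ) (X' : ℕ → ℝ≥0∞) (t : ℕ) : Prop :=
  ∀ W d s p b n κ, 12 ≤ κ → κ ≠ ⊤ → E.par.n₀ < n → Unsorted E N W.nx b n s p →
    Tri E t W d (.call (.sampleSort b n) .ret) s p (κ * X' n * E.th ^ d)
      fun v d' s' e' => (v = 0 ∧ Sorted rk b n s s' p) ∧ κ * E.th ^ d' ≤ e'

/-- The numerical conditions for a round with `n` elements and `q` pivots, of depth `D` and with
work `w` and failure probability `P`, if all loops have length at most `2 ^ j`. -/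
structure RoundOk (E : Env) (X : ℕ → ℝ≥0∞) (x' β : ℝ≥0∞) (n q j D w : ℕ) (Y P : ℝ≥0∞) : Prop where
  q_pos : 0 < q
  l_pos : 0 < Nat.log 2 n
  samples_le : q * Nat.log 2 n ≤ 2 ^ j
  places_le : (q + 1) * (2 * E.par.c₁ * E.par.r * ((q + 1) * (q + 1))) ≤ 2 ^ j
  bound_samples : 2 * (q * Nat.log 2 n) ≤ E.bd
  bound_places : 2 * ((q + 1) * (2 * E.par.c₁ * E.par.r * ((q + 1) * (q + 1)))) + 2 ≤ E.bd
  bound_size : 4 * n + 1 ≤ E.bd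
  bound_tries : E.par.c₂ * Nat.log 2 n ≤ E.bd
  le_places : n ≤ (q + 1) * (2 * E.par.c₁ * E.par.r * ((q + 1) * (q + 1)))
  place : 60 * (16 * ((q + 1) * (q + 1))) ≤ 2 * E.par.c₁ * E.par.r * ((q + 1) * (q + 1))
  depth : 147 * j + 24 * Nat.log 2 n + 9 * (E.par.c₂ * Nat.log 2 n) + 150 ≤ D
  work : 14 * Nat.log 2 n + 62 * (q * Nat.log 2 n) + q * Nat.log 2 n * (32 * (q * Nat.log 2 n)) +
    52 * q + 112 * ((q + 1) * (2 * E.par.c₁ * E.par.r * ((q + 1) * (q + 1)))) +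
    n * (10 * Nat.log 2 n + 9 * (E.par.c₂ * Nat.log 2 n) + 49) + 69 ≤ w
  fail : 2 ^ Nat.log 2 n * ((n / (16 * ((q + 1) * (q + 1))) : ℕ) *
      (((2 * n - 16 * ((q + 1) * (q + 1)) : ℕ) : ℝ≥0∞) / ((2 * n : ℕ) : ℝ≥0∞)) ^ (q * Nat.log 2 n)) +
    n * (3 / 16) ^ (E.par.c₂ * Nat.log 2 n) ≤ P
  parts : ∀ g : ℕ → ℕ, ∑ i ∈ Finset.range (q + 1), g i = n →
    (∀ i, g i ≤ 2 * E.par.c₁ * E.par.r * ((q + 1) * (q + 1))) →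
      ∑ i ∈ Finset.range (q + 1), X (g i) ≤ Y
  -- The recurrence: the work of the round, a restart with probability at most `P` and the recursive
  -- calls are paid in depth up to `D` below the start. The factor `β ^ j` covers the joins of the
  -- last loop.
  total : E.th ^ D * (w + P * x' + β ^ j * Y) ≤ x'

theorem Unsorted.size_le {nx b n : ℕ} (h : Unsorted E N nx b n s p) : n ≤ N := by
  have := Finset.card_le_card_of_injOn (s := Finset.range n) (t := Finset.range N)
    (fun i => s (0, b + i)) (fun i hi => by simpa using h.lt i (by simpa using hi))
    (fun i hi i' hi' => h.inj i (by simpa using hi) i' (by simpa using hi'))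
  simpa using this

theorem Unsorted.of_agree {nx b n : ℕ} (h : Unsorted E N nx b n s p) {s' : St} {q : Share} {nx' : ℕ}
    (hs : Agree p s s') (hq : p ≤ q) (hnx : nx ≤ nx') : Unsorted E N nx' b n s' q where
  own i hi := one_le_of_le hq (h.own i hi)
  lt i hi := hs _ (ne_zero_of_one_le (h.own i hi)) ▸ h.lt i hi
  inj i hi i' hi' := by
    rw [← hs _ (ne_zero_of_one_le (h.own i hi)), ← hs _ (ne_zero_of_one_le (h.own i' hi'))]
    exact h.inj i hi i' hi'
  bound := h.bound.trans (by omega)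

theorem Sorted.of_agree {b n : ℕ} {s₁ s₂ : St} {q : Share} (h : Sorted rk b n s₁ s₂ q)
    (hp : ∀ i < n, p (0, b + i) ≠ 0) (hs : Agree p s s₁) (hq : p ≤ q) : Sorted rk b n s s₂ p where
  mem i hi := by
    obtain ⟨i', hi', h'⟩ := h.mem i hi
    exact ⟨i', hi', h'.trans (hs _ (hp i' hi')).symm⟩
  lt := h.lt
  same a ha hpa := (hs a hpa).trans (h.same a ha (ne_zero_of_le hq hpa))

theorem exists_cbrt (n : ℕ) : ∃ q, q ^ 3 ≤ n ∧ n < (q + 1) ^ 3 := by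
  obtain ⟨i, -, h⟩ := exists_part (pc := fun i => i ^ 3) (q := n + 1) (n := (n + 1) ^ 3) (x := n) rfl
    rfl (lt_of_lt_of_le (Nat.lt_succ_self n) (Nat.le_self_pow (by norm_num) _))
  exact ⟨i, h⟩

/-- The failure probability times the price of a restart is set aside at the beginning of the round
and put into the two estimators. A restart has the same size as the round itself, so the
specification is used for fewer steps, not for a smaller size. -/
theorem sampleSort_step (hβ : ∀ d₁ d₂, 2 * E.th ^ (max d₁ d₂ + 8) ≤
      β * (E.th ^ d₁ + E.th ^ d₂)) (hβ' : E.th ^ 8 ≤ β) (hβt : β ≠ ⊤) (hr : Ranked E N rk)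
    (hbd : 3 ≤ E.bd) (hN : N ≤ E.bd)
    (hround : ∀ n, E.par.n₀ < n → n ≤ N → ∀ q, q ^ 3 ≤ n → n < (q + 1) ^ 3 →
      ∃ j D w Y P, RoundOk E X (X' n) β n q j D w Y P)
    (hs : SortSpec E N rk X t) (hss : SampleSortSpec E N rk X' t) :
    SampleSortSpec E N rk X' (t + 1) := by
  intro W d s p b n κ hκ hκt hn hU t' ht' W' hW' k s₀ px ex hag hk
  cases t' with
  | zero => trivial
  | succ t' =>
  refine safe.of_le_one fun hle1 => ?_
  obtain ⟨q, hq1, hq2⟩ := exists_cbrt n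
  obtain ⟨j, D, w, Y, P, R⟩ := hround n hn hU.size_le q hq1 hq2
  set l := Nat.log 2 n with hl
  set m := 2 * E.par.c₁ * E.par.r * ((q + 1) * (q + 1)) with hm
  set M := (q + 1) * m with hM
  set h := 16 * ((q + 1) * (q + 1)) with hh
  set T := E.par.c₂ * l with hT
  set L := d + D with hL
  set cost := κ * X' n * E.th ^ L with hcost
  set P0 := p + px with hP0
  have hnN := hU.size_le
  have hn0 : 0 < n := by omega
  have h1 := R.q_pos
  have h2 := R.l_pos
  have h3 := R.samples_le
  have h4 := R.places_le
  have h5 := R.bound_samples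
  have h6 := R.bound_places
  have h7 := R.bound_size
  have h8 := R.bound_tries
  have h9 := R.le_places
  have h10 := R.place
  have h11 := R.depth
  have h12 := R.work
  rw [← hl] at h2 h3 h5 h8 h11 h12
  rw [← hT] at h8 h11 h12
  rw [← hm, ← hM] at h4 h6 h9 h12
  rw [← hm, ← hh] at h10
  have hqq : 1 ≤ (q + 1) * (q + 1) := Nat.one_le_iff_ne_zero.2 (by positivity)
  have hmM : m ≤ M := Nat.le_mul_of_pos_left _ (by omega)
  have hlog2 : Nat.log 2 (2 * n) = l + 1 := by
    rw [mul_comm, Nat.log_mul_base (by norm_num) hn0.ne']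
  have hln : l ≤ n := (Nat.log_le_self 2 n)
  have hqn : q ≤ n := (Nat.le_self_pow (by norm_num) q).trans hq1
  have hjq : q + 1 ≤ 2 ^ (l + 1) := by
    have : n < 2 ^ (l + 1) := Nat.lt_pow_succ_log_self (by norm_num) n
    omega
  have hwork : n * (10 * (l + 1) + 9 * T + 39) = n * (10 * l + 9 * T + 49) := by ring
  have hU₀ : Unsorted E N W'.nx b n s₀ P0 := hU.of_agree hag le_self_add hW'.2
  have hbound := hU₀.bound
  set f := κ * β ^ j * Y * E.th ^ L + ex with hf
  -- the credits
  have hcred : (w : ℝ≥0∞) * E.th ^ L + (f + cost * P) ≤ κ * X' n * E.th ^ d + ex := by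
    have e1 : (1 : ℝ≥0∞) ≤ κ := le_trans (by norm_num) hκ
    calc _ ≤ κ * (w * E.th ^ L) + (f + cost * P) :=
          add_le_add (le_mul_of_one_le_left zero_le e1) le_rfl
      _ = κ * (E.th ^ D * (w + P * X' n + β ^ j * Y)) * E.th ^ d + ex := by
          rw [hf, hcost, hL, pow_add]; ring
      _ ≤ _ := add_le_add (mul_le_mul' (mul_le_mul' le_rfl R.total) le_rfl) le_rfl
  have hfail : samplePot n h (q * l) l (keyPos (fun i => rk (s₀ (0, b + i))) n) cost (fun _ => 0) +
      cost * (n * (3 / 16) ^ T) ≤ cost * P := by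
    rw [samplePot_zero, ← mul_add]
    exact mul_le_mul' le_rfl R.fail
  refine safe.weaken (p := P0) (e := (w : ℝ≥0∞) * E.th ^ L + (f + cost * P)) ?_ le_rfl hcred
  refine safe.call (price_le (by omega) (by omega)) ?_
  change FS E t' W' L (f + cost * P) (d + 1) (w - 1) _ s₀ P0
  -- the continuations
  have hdone : Done E rk t' W' κ ex b n k s₀ P0 := fun t₁ ht₁ W₁ hW₁ d₁ s₁ e₁ he₁ hS => by
    refine hk t₁ (by omega) W₁ hW₁ 0 d₁ s₁ e₁ ⟨⟨rfl, hS.of_agree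
      (fun i hi => ne_zero_of_one_le (hU.own i hi)) hag le_self_add⟩, he₁⟩ fun a ha => ?_
    refine hS.same a (fun h1 h2 => ?_) (ne_zero_of_le le_add_self ha)
    by_contra h3
    have h4 := hU.own (a.2 - b) (by omega)
    rw [show ((0 : ℕ), b + (a.2 - b)) = a by rw [← h1, Nat.add_sub_cancel' h2]] at h4
    have h5 : p a + px a ≤ 1 := hle1 a
    exact ha (le_antisymm (by
      have := h5.trans h4
      simpa using this) zero_le)
  -- The released `cost` is the full credit of a restart at depth `L`, and all restarts happen in
  -- depth at most `L`.
  have hretry : ∀ t₁ ≤ t', ∀ W₁, W' ≤ W₁ → ∀ d₁ w₁ s₁, d₁ ≤ L → Agree P0 s₀ s₁ →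
      FS E t₁ W₁ L (f + cost) d₁ w₁ (.call (.sampleSort b n) k) s₁ P0 :=
    fun t₁ ht₁ W₁ hW₁ d₁ w₁ s₁ hd₁ hag₁ => by
    have := hss W₁ d₁ s₁ P0 b n κ hκ hκt hn (hU₀.of_agree hag₁ le_rfl hW₁.2) t₁ (by omega) W₁ le_rfl
      k s₁ 0 ex (.refl _ _) fun t₂ ht₂ W₂ hW₂ v d₂ s₂ e₂ ⟨⟨hv, hS⟩, he⟩ _ => by
        rw [add_zero, hv]
        exact hdone t₂ (by omega) W₂ (hW₁.trans hW₂) d₂ s₂ e₂ he (hS.of_agree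
          (fun i hi => ne_zero_of_one_le (hU₀.own i hi)) hag₁ le_rfl)
    refine this.weaken (by rw [add_zero]) ?_
    refine le_trans ?_ le_add_self
    rw [hf, hcost]
    calc _ ≤ κ * X' n * E.th ^ L + ex :=
          add_le_add (mul_le_mul' le_rfl (th_pow_le E hd₁)) le_rfl
      _ ≤ _ := by rw [add_comm _ ex]; exact add_le_add le_add_self le_rfl
  simp only [Proc.code, Prog.bind_def, BF.call, BF.alu, BF.alloc, Prog.bind, Prog.bind_ite,
    Prog.bind_assoc]
  refine FS.log rfl (by omega) (by omega) (by omega) (by omega) (by omega) fun d₁ w₁ hd₁ hw₁ => ?_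
  rw [add_zero, ← hl]
  refine FS.cbrt rfl (by omega) (by omega) (by omega) fun d₂ w₂ q' hd₂ hw₂ hq1' hq2' => ?_
  obtain rfl : q' = q := by
    have e1 := lt_of_pow_lt_pow_left₀ 3 (by omega) (hq1'.trans_lt hq2)
    have e2 := lt_of_pow_lt_pow_left₀ 3 (by omega) (hq1.trans_lt hq2')
    omega
  refine FS.mul (by omega) (by omega) (by omega) ?_
  refine FS.weaken (FS.choosePivots (f := f + cost * (n * (3 / 16) ^ T)) (cost := cost) (j := j)
    (h := h) (a₀ := fun i => s₀ (0, b + i)) hr rfl rfl (by omega)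
    (by omega) h3 hbd h5 hN (by omega) (by omega)
    (fun i hi => ne_zero_of_one_le (hU₀.own i hi)) (fun i hi => rfl) hU₀.lt hU₀.inj hn0 h1 h2
    (by omega) ?_) le_rfl (by rw [add_assoc]; exact add_le_add le_rfl ((add_comm _ _).trans_le hfail))
  intro t₃ ht₃ W₃ hW₃ d₃ w₃ s₃ Q g Z hd₃ hw₃ hQ hQ0 hag₃ hZ hmono hg
  have hnx₃ := hW₃.2
  refine FS.add (by omega) (by omega) (by omega) ?_
  refine FS.mul (by omega) (by omega) (by omega) ?_
  refine FS.mul (by omega) (by omega) (by omega) ?_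
  refine FS.mul (by omega) (by omega) (show M ≤ E.bd by omega) ?_
  refine FS.weaken (f := f + (g + cost * (n * (3 / 16) ^ T))) ?_ le_rfl
    (le_of_eq (by ring))
  refine FS.distributeAll (p := P0) (j := j) (jq := l + 1) (T := T) (h := h) (m := m) (M := M)
    (a₀ := fun i => s₀ (0, b + i)) hr rfl rfl (by omega) (by omega) h4 hjq hT hM
    h9 hn0 (by omega) h10 hbd (by omega) h8 hN (by omega) le_rfl hQ0 hQ
    (fun i hi => ne_zero_of_one_le (hU₀.own i hi))
    (fun i hi => (hag₃ _ (ne_zero_of_one_le (hU₀.own i hi))).symm) hU₀.lt hZ hmono hg ?_ ?_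
  · intro t₄ ht₄ W₄ hW₄ d₄ w₄ s₄ F V loc P' hd₄ hw₄ hF hV hbF hbV hP' hag₄ hpF hpV hloc hinj h0 hord
    refine FS.eq (by omega) (by omega) (by omega) ?_
    rw [if_pos rfl, if_neg (by norm_num)]
    have hW34 := hW₃.trans hW₄
    refine FS.packSort (m := m) (M := M) hβ hβ' hβt hκ hκt (j := j)
      (fun W d s p b n κ h1 h2 h3 => (hs W d s p b n κ h1 h2 h3).mono (by omega) le_rfl
      (.refl _ _)) (by omega) hM R.parts (by omega) (by omega) h4 hbd (by omega) hN hF hV hbF hbV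
      (hU₀.of_agree (.refl _ _) le_rfl hW34.2) hP' hpF hpV (hag₃.trans hag₄) hloc hinj h0 hord
      (hdone.mono (by omega) hW34)
  · intro t₄ ht₄ W₄ hW₄ d₄ w₄ s₄ F V v hd₄ hw₄ hv hag₄
    refine FS.eq (by omega) (by omega) (by omega) ?_
    rw [if_neg hv, if_pos rfl]
    exact hretry t₄ (by omega) W₄ (hW₃.trans hW₄) _ _ s₄ (by omega) (hag₃.trans hag₄)

end BF

/-! ### The base case and the closing of the recursion -/

namespace BF
variable {E : Env} {N : ℕ} {rk : ℕ → ℕ} {X X' : ℕ → ℝ≥0∞} {β : ℝ≥0∞} {s : St} {p : Share}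

/-- The number of instructions that insertion sort of `n` elements executes at most. -/
def insertionCost (n : ℕ) : ℕ := (n + 1) * (14 * n + 20)

theorem sort_step (hr : Ranked E N rk) (hbd : 3 ≤ E.bd) (hN : N ≤ E.bd)
    (hbase : ∀ n ≤ E.par.n₀,
      ((insertionCost n + 3 : ℕ) : ℝ≥0∞) * E.th ^ (insertionCost n + 2) ≤ X n)
    (hstep : ∀ n, E.par.n₀ < n → n ≤ N → E.th ^ 2 * (2 + X' n) ≤ X n)
    (hss : SampleSortSpec E N rk X' t) : SortSpec E N rk X (t + 1) := by
  intro W d s p b n κ hκ hκt hU t' ht' W' hW' k s₀ px ex hag hk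
  cases t' with
  | zero => trivial
  | succ t' =>
  refine safe.of_le_one fun hle1 => ?_
  have hnN := hU.size_le
  set P0 := p + px with hP0
  have hU₀ : Unsorted E N W'.nx b n s₀ P0 := hU.of_agree hag le_self_add hW'.2
  have hκ1 : (1 : ℝ≥0∞) ≤ κ := le_trans (by norm_num) hκ
  have hdone : Done E rk t' W' κ ex b n k s₀ P0 := fun t₁ ht₁ W₁ hW₁ d₁ s₁ e₁ he₁ hS => by
    refine hk t₁ (by omega) W₁ hW₁ 0 d₁ s₁ e₁ ⟨⟨rfl, hS.of_agree
      (fun i hi => ne_zero_of_one_le (hU.own i hi)) hag le_self_add⟩, he₁⟩ fun a ha => ?_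
    refine hS.same a (fun h1 h2 => ?_) (ne_zero_of_le le_add_self ha)
    by_contra h3
    have h4 := hU.own (a.2 - b) (by omega)
    rw [show ((0 : ℕ), b + (a.2 - b)) = a by rw [← h1, Nat.add_sub_cancel' h2]] at h4
    have h5 : p a + px a ≤ 1 := hle1 a
    exact ha (le_antisymm (by
      have := h5.trans h4
      simpa using this) zero_le)
  by_cases hn : n ≤ E.par.n₀
  · set c := insertionCost n with hc
    set L := d + (c + 2) with hL
    refine safe.weaken (p := P0) (e := ((c + 2 : ℕ) : ℝ≥0∞) * E.th ^ L + (κ * E.th ^ L + ex)) ?_ le_rfl ?_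
    · refine safe.call (price_le (by omega) (by omega)) ?_
      change FS E t' W' L (κ * E.th ^ L + ex) (d + 1) (c + 2 - 1) _ s₀ P0
      simp only [Proc.code, Prog.bind_def, BF.call, BF.alu, Prog.bind, Prog.bind_ite]
      refine FS.le (by omega) (by omega) (by omega) ?_
      rw [if_pos (if_pos hn)]
      refine FS.insertionSort hr rfl (by simp only [Nat.sub_zero]; change _ + c ≤ L; omega)
        (by simp only [Nat.sub_zero]; change c ≤ _; omega) (by omega) hN (by omega)
        (by omega) hU₀.bound hU₀.own hU₀.lt (by omega) (fun i i' h1 h2 h3 => ?_)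
        fun d' w' s' hd' hw' hs' hmem hlt => ?_
      · have := hU₀.inj i (by omega) i' h2 h3
        omega
      · simp only [Nat.sub_zero] at hd'
        change d' ≤ d + 1 + 1 + c at hd'
        refine (hdone t' le_rfl W' le_rfl d' s' (κ * E.th ^ L)
          (mul_le_mul' le_rfl (th_pow_le E (by omega))) ⟨hmem, hlt, fun a ha _ => ?_⟩).weaken le_rfl
            le_add_self
        refine (hs' a fun i hi h => ?_).symm
        have := ha (by rw [h]) (by rw [h]; dsimp only; omega)
        rw [h] at this
        dsimp only at this
        omega
    · rw [← add_assoc]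
      refine add_le_add ?_ le_rfl
      calc _ ≤ κ * (((c + 2 : ℕ) : ℝ≥0∞) * E.th ^ L) + κ * E.th ^ L :=
            add_le_add (le_mul_of_one_le_left zero_le hκ1) le_rfl
        _ = κ * (((c + 3 : ℕ) : ℝ≥0∞) * E.th ^ (c + 2)) * E.th ^ d := by
            rw [hL, pow_add]; push_cast; ring
        _ ≤ _ := mul_le_mul' (mul_le_mul' le_rfl (hbase n hn)) le_rfl
  · have hn' : E.par.n₀ < n := by omega
    refine safe.weaken (p := P0) (e := ((2 : ℕ) : ℝ≥0∞) * E.th ^ (d + 2) +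
      (κ * X' n * E.th ^ (d + 2) + ex)) ?_ le_rfl ?_
    · refine safe.call (price_le (by omega) (by omega)) ?_
      change FS E t' W' (d + 2) (κ * X' n * E.th ^ (d + 2) + ex) (d + 1) (2 - 1) _ s₀ P0
      simp only [Proc.code, Prog.bind_def, BF.call, BF.alu, Prog.bind, Prog.bind_ite]
      refine FS.le (by omega) (by omega) (by omega) ?_
      rw [if_neg (by rw [if_neg hn]; norm_num)]
      have := hss W' (d + 2) s₀ P0 b n κ hκ hκt hn' hU₀ t' (by omega) W' le_rfl k s₀ 0 ex
        (.refl _ _) fun t₂ ht₂ W₂ hW₂ v d₂ s₂ e₂ ⟨⟨hv, hS⟩, he⟩ _ => by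
          rw [add_zero, hv]
          exact hdone t₂ ht₂ W₂ hW₂ d₂ s₂ e₂ he hS
      exact this.weaken (by rw [add_zero]) le_add_self
    · rw [← add_assoc]
      refine add_le_add ?_ le_rfl
      calc _ ≤ κ * (((2 : ℕ) : ℝ≥0∞) * E.th ^ (d + 2)) + κ * X' n * E.th ^ (d + 2) :=
            add_le_add (le_mul_of_one_le_left zero_le hκ1) le_rfl
        _ = κ * (E.th ^ 2 * (2 + X' n)) * E.th ^ d := by
            rw [pow_add]; push_cast; ring
        _ ≤ _ := mul_le_mul' (mul_le_mul' le_rfl (hstep n hn' hnN)) le_rfl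

/-- The numerical conditions for sorting at most `N` elements. -/
structure SortOk (E : Env) (N : ℕ) (X X' : ℕ → ℝ≥0∞) (β : ℝ≥0∞) : Prop where
  fork : ∀ d₁ d₂, 2 * E.th ^ (max d₁ d₂ + 8) ≤ β * (E.th ^ d₁ + E.th ^ d₂)
  pow_le : E.th ^ 8 ≤ β
  ne_top : β ≠ ⊤
  three_le : 3 ≤ E.bd
  size_le : N ≤ E.bd
  base : ∀ n ≤ E.par.n₀, ((insertionCost n + 3 : ℕ) : ℝ≥0∞) * E.th ^ (insertionCost n + 2) ≤ X n
  step : ∀ n, E.par.n₀ < n → n ≤ N → E.th ^ 2 * (2 + X' n) ≤ X n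
  round : ∀ n, E.par.n₀ < n → n ≤ N → ∀ q, q ^ 3 ≤ n → n < (q + 1) ^ 3 →
    ∃ j D w Y P, RoundOk E X (X' n) β n q j D w Y P

/-- The two specifications are proved together by induction on the number of steps. Every call
executes an instruction first, so recursive calls and restarts are needed only for fewer steps; no
measure of termination is involved. -/
theorem sort_spec (hr : Ranked E N rk) (h : SortOk E N X X' β) (t : ℕ) : SortSpec E N rk X t := by
  suffices SortSpec E N rk X t ∧ SampleSortSpec E N rk X' t from this.1
  induction t with
  | zero =>
    refine ⟨fun W d s p b n κ _ _ _ t' ht' => ?_, fun W d s p b n κ _ _ _ _ t' ht' => ?_⟩ <;>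
    · obtain rfl : t' = 0 := by omega
      intros
      trivial
  | succ t ih =>
    exact ⟨sort_step hr h.three_le h.size_le h.base h.step ih.2,
      sampleSort_step h.fork h.pow_le h.ne_top hr h.three_le h.size_le h.round ih.1 ih.2⟩

end BF

namespace BF
variable {E : Env} {N : ℕ} {rk : ℕ → ℕ} {X X' : ℕ → ℝ≥0∞} {β : ℝ≥0∞}

/-! ## The complete computation -/

section Order

variable {n : ℕ} {α : Type*} [LinearOrder α] (x : Fin n → α)

/-- The number of input elements that precede element `i`. -/
def keyRank (i : ℕ) : ℕ :=
  if h : i < n then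
    (Finset.univ.filter fun j : Fin n => toLex (x j, j) < toLex (x ⟨i, h⟩, ⟨i, h⟩)).card
  else 0

theorem keyRank_lt_iff (i j : Fin n) :
    keyRank x i < keyRank x j ↔ toLex (x i, i) < toLex (x j, j) := by
  simp only [keyRank, Fin.is_lt, dif_pos, Fin.eta]
  constructor
  · intro h
    by_contra! h'
    refine absurd h (not_lt.2 (Finset.card_le_card fun k hk => ?_))
    simp only [Finset.mem_filter, Finset.mem_univ, true_and] at hk ⊢
    exact hk.trans_le h'
  · intro h
    refine Finset.card_lt_card ⟨fun k hk => ?_, fun hk => ?_⟩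
    · simp only [Finset.mem_filter, Finset.mem_univ, true_and] at hk ⊢
      exact hk.trans h
    · have : i ∈ Finset.univ.filter fun k : Fin n => toLex (x k, k) < toLex (x i, i) :=
        hk (by simpa using h)
      simp at this

theorem ranked_keyRank (hE : E.lt = keyLt x) : Ranked E n (keyRank x) where
  inj i hi j hj h := by
    have h1 := keyRank_lt_iff x ⟨i, hi⟩ ⟨j, hj⟩
    have h2 := keyRank_lt_iff x ⟨j, hj⟩ ⟨i, hi⟩
    simp only [h, lt_irrefl, false_iff, not_lt] at h1 h2
    have := le_antisymm h1 h2
    simp only [EmbeddingLike.apply_eq_iff_eq, Prod.mk.injEq, Fin.mk.injEq] at this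
    exact this.2.symm
  less i hi j hj := by
    rw [keyRank_lt_iff x ⟨i, hi⟩ ⟨j, hj⟩, Prod.Lex.toLex_lt_toLex, hE]
    simp only [keyLt, hi, hj, and_self, dif_pos, decide_eq_true_eq, decide_eq_false_iff_not,
      not_lt, Fin.mk_lt_mk]
    constructor
    · rintro (h | ⟨h, h'⟩)
      · exact .inl h
      · exact h.lt_or_eq.imp_right fun h => ⟨h, h'⟩
    · exact Or.imp_right fun h => ⟨h.1.le, h.2⟩

/-- Strictly increasing ranks make the entries distinct, and `n` distinct numbers below `n` form a
permutation. -/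
theorem isSortedOutput_of_keyRank {mem : Word → Word} (hlt : ∀ i < n, mem i < n)
    (hrk : ∀ i i', i < i' → i' < n → keyRank x (mem i) < keyRank x (mem i')) :
    IsSortedOutput x mem := by
  have hinj : Function.Injective fun i : Fin n => (⟨mem i, hlt i i.2⟩ : Fin n) := fun i j h => by
    have h : mem i = mem j := congrArg Fin.val h
    rcases lt_trichotomy i j with h' | h' | h'
    · exact absurd (hrk i j h' j.2) (by simp [h])
    · exact h'
    · exact absurd (hrk j i h' i.2) (by simp [h])
  refine ⟨Equiv.ofBijective _ (Finite.injective_iff_bijective.1 hinj), fun i => rfl, ?_⟩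
  refine monotone_iff_forall_lt.2 fun i j hij => ?_
  have h := (keyRank_lt_iff x ⟨mem i, hlt i i.2⟩ ⟨mem j, hlt j j.2⟩).1 (hrk i j hij j.2)
  rw [Prod.Lex.toLex_lt_toLex] at h
  exact h.elim le_of_lt fun h => h.1.le

end Order

/-- With `κ = 12` the remainder `12 * th ^ d'` pays for the final instruction, whose price is `th ^
(d' + 1)`. -/
theorem good_startConfig (hr : Ranked E N rk) (h : SortOk E N X X' β) (hth : E.th ≤ 12)
    (hfin : ∀ mem : Word → Word, (∀ i < N, mem i < N) →
      (∀ i i', i < i' → i' < N → rk (mem i) < rk (mem i')) → E.fin mem) (t : ℕ) :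
    Good E N t (startConfig N) (12 * X N) where
  word := Nat.le_add_left _ _
  next := Nat.le_add_right _ _
  fin := by simp [startConfig]
  cost := by
    refine ⟨0, by simp [startConfig], by simp [startConfig], zero_le, fun _ => ?_⟩
    set s : St := fun x => if x.2 < N then x.2 else 0 with hs
    have hs0 : ∀ i < N, s (0, 0 + i) = i := fun i hi => by simp [hs, hi]
    refine ⟨⟨[], N⟩, s, 0, 0, 0, [(⟨0, mainCode N⟩, blk 0 N, 12 * X N)], rfl, fun a => rfl,
      ⟨rfl, fun a => ?_, fun j a ha => ?_, fun a => ?_⟩, rfl, ?_, by simp, rfl⟩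
    · simp only [List.map_cons, List.map_nil, List.sum_cons, List.sum_nil, add_zero, blk]
      split_ifs <;> simp
    · simp [blk, show ¬ a < N by simpa using ha]
    · simp only [hs]
      split_ifs <;> omega
    · simp only [List.mem_singleton, forall_eq]
      have hU : Unsorted E N N 0 N s (blk 0 N) :=
        ⟨fun i hi => by simp [blk, hi], fun i hi => by rw [hs0 i hi]; exact hi,
          fun i hi i' hi' he => by rwa [hs0 i hi, hs0 i' hi'] at he, by omega⟩
      have := sort_spec hr h t ⟨[], N⟩ 0 s (blk 0 N) 0 N 12 le_rfl (by simp) hU t le_rfl _ le_rfl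
        (fun _ => .finish) s 0 0 (.refl _ _) fun t' ht' W' hW' v d' s' e' hq _ => by
          obtain ⟨⟨-, hsort⟩, he⟩ := hq
          refine safe.finish ?_ fun s₁ hs₁ => ?_
          · rw [pow_succ', add_zero]
            exact (mul_le_mul' hth le_rfl).trans he
          · have hown : ∀ i < N, s' (0, 0 + i) = s₁ (0, i) := fun i hi => by
              rw [zero_add]
              exact hs₁ _ (by simp [blk, hi])
            refine hfin _ (fun i hi => ?_) fun i i' hii hi' => ?_
            · obtain ⟨i', hi', h1⟩ := hsort.mem i hi
              show s₁ (0, i) < N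
              rw [← hown i hi, h1, hs0 i' hi']
              exact hi'
            · have := hsort.lt i i' hii hi'
              rwa [hown i (hii.trans hi'), hown i' hi'] at this
      simpa [mainCode, call, Prog.bind_def, Prog.bind] using this

/-- This is Markov's inequality for the potential. -/
theorem Good.prob_mul_le {B t : ℕ} {c : Config Proc} {Φ : ℝ≥0∞} (h : Good E B t c Φ)
    (σ : Scheduler Proc) (past : List (Config Proc)) (S : Set (Config Proc)) (A : ℝ≥0∞)
    (hA : ∀ c Φ, Good E B 0 c Φ → c ∈ S → A ≤ Φ) :
    (BF.run (Proc.code E.par) E.lt σ t past c).toOuterMeasure S * A ≤ Φ := by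
  classical
  have := (h.run σ (S.indicator fun _ => A) (fun c Φ hc => by
    by_cases hS : c ∈ S
    · simpa [hS] using hA c Φ hc hS
    · simp [hS]) t past).1
  rw [PMF.toOuterMeasure_apply, ← ENNReal.tsum_mul_right]
  refine le_trans (ENNReal.tsum_le_tsum fun c' => ?_) this
  by_cases hS : c' ∈ S <;> simp [hS]

theorem one_le_toOuterMeasure_add {α : Type*} (q : PMF α) {S T : Set α}
    (h : ∀ a ∈ q.support, a ∈ S ∨ a ∈ T) : 1 ≤ q.toOuterMeasure S + q.toOuterMeasure T :=
  ((q.toOuterMeasure_apply_eq_one_iff (s := S ∪ T)).2 h).symm.le.trans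
    (MeasureTheory.measure_union_le S T)

theorem toOuterMeasure_le_one {α : Type*} (q : PMF α) (S : Set α) : q.toOuterMeasure S ≤ 1 := by
  rw [← (q.toOuterMeasure_apply_eq_one_iff (s := Set.univ)).2 (Set.subset_univ _)]
  exact MeasureTheory.measure_mono (Set.subset_univ S)

/-- A computation that has not finished after `t` steps has work at least `t`, which has probability
at most `Φ / t`. -/
theorem probFinish_eq_one {B : ℕ} {c : Config Proc} {Φ : ℝ≥0∞} (hΦ : Φ ≠ ⊤)
    (h : ∀ t, Good E B t c Φ) (σ : Scheduler Proc) :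
    probFinish (Proc.code E.par) E.lt σ c = 1 := by
  refine le_antisymm (iSup_le fun t => toOuterMeasure_le_one _ _) ?_
  have hlim : Filter.Tendsto (fun t : ℕ => probFinish (Proc.code E.par) E.lt σ c + Φ * (t : ℝ≥0∞)⁻¹)
      Filter.atTop (nhds (probFinish (Proc.code E.par) E.lt σ c + Φ * 0)) :=
    (ENNReal.Tendsto.const_mul ENNReal.tendsto_inv_nat_nhds_zero (.inr hΦ)).const_add _
  rw [mul_zero, add_zero] at hlim
  refine ge_of_tendsto hlim ((Filter.eventually_gt_atTop 0).mono fun t ht => ?_)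
  have h1 := (h t).prob_mul_le σ [] {c' | t ≤ c'.work} t fun c' Φ' hc hS => by
    obtain ⟨z, h1, -, h2, -⟩ := hc.cost
    exact (Nat.cast_le.2 hS).trans (h1.trans h2)
  have h2 := one_le_toOuterMeasure_add (run (Proc.code E.par) E.lt σ t [] c)
    (S := {c' | c'.finished = true}) (T := {c' | t ≤ c'.work}) fun c' hc' =>
      (((h t).run σ 0 (fun _ _ _ => zero_le) t []).2 c' hc').2.imp_right fun h => by
        simp only [Set.mem_ofPred_eq]
        omega
  refine h2.trans (add_le_add (le_iSup (fun t => (run (Proc.code E.par) E.lt σ t [] c).toOuterMeasure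
    {c' | c'.finished = true}) t) ?_)
  rw [← div_eq_mul_inv, ENNReal.le_div_iff_mul_le (.inl (by simpa using ht.ne')) (.inl (by simp))]
  exact h1

theorem expectedWork_le {B : ℕ} {c : Config Proc} {Φ : ℝ≥0∞} (h : ∀ t, Good E B t c Φ)
    (σ : Scheduler Proc) : expectedWork (Proc.code E.par) E.lt σ c ≤ Φ :=
  iSup_le fun t => ((h t).run σ (fun c => c.work) (fun c Φ hc => by
    obtain ⟨z, h1, -, h2, -⟩ := hc.cost
    exact h1.trans h2) t []).1

/-- If the span exceeds `u`, then `A + 1 ≤ th ^ span ≤ z + 1`, so the potential is at least `A`. The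
summand `1` in `hA` compensates the one in the bound of the span. -/
theorem le_probSpanLE {B : ℕ} {c : Config Proc} {Φ : ℝ≥0∞} (h : ∀ t, Good E B t c Φ)
    (σ : Scheduler Proc) {u : ℝ} {A δ : ℝ≥0∞} (hA : ∀ k : ℕ, u < k → A + 1 ≤ E.th ^ k)
    (hδ : Φ ≤ δ * A) (hA0 : A ≠ 0) (hA1 : A ≠ ⊤) :
    1 - δ ≤ probSpanLE (Proc.code E.par) E.lt σ c u := by
  refine le_iInf fun t => tsub_le_iff_right.2 ?_
  have h1 := (h t).prob_mul_le σ [] {c' | u < c'.span} A fun c' Φ' hc hS => by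
    obtain ⟨z, -, h1, h2, -⟩ := hc.cost
    exact (ENNReal.add_le_add_iff_right ENNReal.one_ne_top).1
      ((hA _ hS).trans (h1.trans (add_le_add h2 le_rfl)))
  refine (one_le_toOuterMeasure_add _ (S := {c' : Config Proc | (c'.span : ℝ) ≤ u})
    (T := {c' : Config Proc | u < c'.span})
    fun c' _ => le_or_gt (c'.span : ℝ) u).trans (add_le_add le_rfl ?_)
  exact (ENNReal.mul_le_mul_iff_left hA0 hA1).1 (h1.trans hδ)

end BF

namespace BF

/-! ## The choice of the constants -/

theorem cube_le_two_pow {n : ℕ} (hn : 10 ≤ n) : n ^ 3 ≤ 2 ^ n := by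
  induction n, hn using Nat.le_induction with
  | base => norm_num
  | succ n hn ih =>
    rw [pow_succ 2]
    nlinarith [mul_le_mul hn hn (by norm_num) (by omega), Nat.mul_le_mul_left (n * n) hn]

/-- For the integer cube root `q` of a large number `n`, relations between `n`, `q` and `log n`. -/
structure LargeSize (c₁ n q l : ℕ) : Prop where
  q_ge : 1000 ≤ q
  l_ge : 10 ≤ l
  pow_le : 2 ^ l ≤ n
  lt_pow : n < 2 * 2 ^ l
  lt_cube : n < (q + 1) ^ 3
  succ_cube : (q + 1) ^ 3 ≤ 8 * n
  l_le : l ≤ q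
  q_lt : q + 1 ≤ 2 ^ l
  sq_mul_le : q * q * l ≤ n
  places_le : 3840 * c₁ * n ≤ 2 ^ (2 * l)
  bucket_le : (2 * c₁ * 240 * ((q + 1) * (q + 1))) ^ 4 ≤ 2 ^ (3 * l)

/-- The critical relation is `bucket_le`: a bucket has about `n ^ (2 / 3)` places up to a constant,
and this has to stay below `n ^ (3 / 4)` even when the logarithm is rounded down. From `q + 1 ≤ 2 *
q` the number of places is at most `1920 * c₁ * q ^ 2`. Its fourth power is of order `q ^ 8`, and
the missing factor `q` absorbs the constant. -/
theorem largeSize {c₁ n q : ℕ} (hc : 1 ≤ c₁) (hq1 : q ^ 3 ≤ n) (hq2 : n < (q + 1) ^ 3)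
    (hq : 8 * (1920 * c₁) ^ 4 ≤ q) : LargeSize c₁ n q (Nat.log 2 n) := by
  have hA : 1920 * c₁ ≤ (1920 * c₁) ^ 4 := Nat.le_self_pow (by norm_num) _
  have hq0 : 15360 ≤ q := by omega
  have hn0 : n ≠ 0 := by
    have : 0 < q ^ 3 := by positivity
    omega
  have hn1 : q * (q * q) ≤ n := by rwa [show q * (q * q) = q ^ 3 by ring]
  set l := Nat.log 2 n with hl
  have h1 : 2 ^ l ≤ n := Nat.pow_log_le_self 2 hn0
  have h2 : n < 2 * 2 ^ l := by
    have := Nat.lt_pow_succ_log_self (b := 2) (by norm_num) n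
    rwa [pow_succ, mul_comm] at this
  have hqq : q * 4 ≤ q * (q * q) := Nat.mul_le_mul_left q (by nlinarith)
  have hlq : l ≤ q := by
    by_contra! h
    have := (cube_le_two_pow (show 10 ≤ q + 1 by omega)).trans
      (Nat.pow_le_pow_right (n := 2) (by norm_num) h)
    omega
  have hql : q + 1 ≤ 2 ^ l := by omega
  have hsucc : (q + 1) ^ 3 ≤ 8 * n := by
    calc (q + 1) ^ 3 ≤ (2 * q) ^ 3 := Nat.pow_le_pow_left (by omega) 3
      _ = 8 * q ^ 3 := by ring
      _ ≤ 8 * n := by omega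
  refine ⟨by omega, ?_, h1, h2, hq2, hsucc, hlq, hql, ?_, ?_, ?_⟩
  · by_contra! h
    have := Nat.pow_le_pow_right (n := 2) (by norm_num) (show l ≤ 9 by omega)
    omega
  · calc q * q * l ≤ q * q * q := Nat.mul_le_mul_left _ hlq
      _ = q ^ 3 := by ring
      _ ≤ n := hq1
  · calc 3840 * c₁ * n ≤ 3840 * c₁ * (2 * 2 ^ l) := by gcongr
      _ = 7680 * c₁ * 2 ^ l := by ring
      _ ≤ 2 ^ l * 2 ^ l := by gcongr; omega
      _ = 2 ^ (2 * l) := by rw [two_mul, pow_add]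
  · have h3 : 2 * c₁ * 240 * ((q + 1) * (q + 1)) ≤ 1920 * c₁ * (q * q) := by
      have : (q + 1) * (q + 1) ≤ (2 * q) * (2 * q) := Nat.mul_le_mul (by omega) (by omega)
      calc 2 * c₁ * 240 * ((q + 1) * (q + 1)) ≤ 2 * c₁ * 240 * ((2 * q) * (2 * q)) := by gcongr
        _ = _ := by ring
    have h4 : 8 * (1920 * c₁ * (q * q)) ^ 4 ≤ 8 * 2 ^ (3 * l) := by
      calc 8 * (1920 * c₁ * (q * q)) ^ 4 = 8 * (1920 * c₁) ^ 4 * q ^ 8 := by ring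
        _ ≤ q * q ^ 8 := by gcongr
        _ = (q ^ 3) ^ 3 := by ring
        _ ≤ (2 * 2 ^ l) ^ 3 := by gcongr; omega
        _ = 8 * 2 ^ (3 * l) := by ring
    exact (Nat.pow_le_pow_left h3 4).trans (by omega)

theorem LargeSize.log_bucket_le {c₁ n q l : ℕ} (h : LargeSize c₁ n q l) {g : ℕ}
    (hg : g ≤ 2 * c₁ * 240 * ((q + 1) * (q + 1))) : 4 * Nat.log 2 g ≤ 3 * l := by
  rcases Nat.eq_zero_or_pos g with rfl | hg0
  · simp
  rw [← Nat.pow_le_pow_iff_right (a := 2) (by norm_num)]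
  calc 2 ^ (4 * Nat.log 2 g) = (2 ^ Nat.log 2 g) ^ 4 := by rw [← pow_mul, mul_comm]
    _ ≤ g ^ 4 := Nat.pow_le_pow_left (Nat.pow_log_le_self 2 hg0.ne') 4
    _ ≤ _ := (Nat.pow_le_pow_left hg 4).trans h.bucket_le

/-- The left side is at most `exp (-(h * q) / (2 * n)) ≤ exp (-4)`, and `exp 1 ≥ 2`. -/
theorem sub_div_pow_le {h n q : ℕ} (hn : 0 < n) (hq : 8 * n ≤ h * q) :
    (((2 * n - h : ℕ) : ℝ≥0∞) / ((2 * n : ℕ) : ℝ≥0∞)) ^ q ≤ 16⁻¹ := by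
  have hn' : (0 : ℝ) < (2 * n : ℕ) := by positivity
  rw [← ENNReal.ofReal_natCast, ← ENNReal.ofReal_natCast, ← ENNReal.ofReal_div_of_pos hn',
    ← ENNReal.ofReal_pow (by positivity)]
  rw [show (16 : ℝ≥0∞)⁻¹ = ENNReal.ofReal (16⁻¹) by
    rw [ENNReal.ofReal_inv_of_pos (by norm_num)]; simp]
  refine ENNReal.ofReal_le_ofReal ?_
  have h1 : ((2 * n - h : ℕ) : ℝ) / (2 * n : ℕ) ≤ Real.exp (-(h / (2 * n : ℕ))) := by
    rcases le_total h (2 * n) with h1 | h1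
    · refine le_trans (le_of_eq ?_) (Real.add_one_le_exp _)
      rw [Nat.cast_sub h1]
      field_simp
      ring
    · rw [Nat.sub_eq_zero_of_le h1]
      simpa using (Real.exp_pos _).le
  refine (pow_le_pow_left₀ (by positivity) h1 q).trans ?_
  rw [← Real.exp_nat_mul, show (16 : ℝ)⁻¹ = (2 ^ 4)⁻¹ by norm_num]
  have h2 : (q : ℝ) * -(h / (2 * n : ℕ)) ≤ -(4 : ℕ) * 1 := by
    have : (8 * n : ℝ) ≤ h * q := by exact_mod_cast hq
    have : (4 : ℝ) ≤ h * q / (2 * n : ℕ) := by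
      rw [le_div_iff₀ hn']
      push_cast
      linarith
    push_cast at this ⊢
    have h3 : (q : ℝ) * -(h / (2 * n)) = -(h * q / (2 * n)) := by ring
    rw [h3]
    linarith
  refine (Real.exp_le_exp.2 h2).trans ?_
  rw [neg_mul, Real.exp_neg, Real.exp_nat_mul]
  refine inv_anti₀ (by norm_num) (pow_le_pow_left₀ (by norm_num) ?_ 4)
  linarith [Real.add_one_le_exp (1 : ℝ)]

/-- Both events have a factor `16 ^ (-l)`, the second one because `(3 / 16) ^ 2 ≤ 1 / 16` and `2 ≤
c₂`. With the number of blocks or elements at most `2 * 2 ^ l` and another `2 ^ l`, each contributes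
at most `2 * 4 ^ (-l)`. -/
theorem LargeSize.fail_le {c₁ c₂ n q l : ℕ} (hc₂ : 2 ≤ c₂) (h : LargeSize c₁ n q l) :
    (2 : ℝ≥0∞) ^ l * ((n / (16 * ((q + 1) * (q + 1))) : ℕ) *
      (((2 * n - 16 * ((q + 1) * (q + 1)) : ℕ) : ℝ≥0∞) / ((2 * n : ℕ) : ℝ≥0∞)) ^ (q * l)) +
      n * (3 / 16) ^ (c₂ * l) ≤ 4 * (4 ^ l)⁻¹ := by
  have hn : 0 < n := lt_of_lt_of_le (by positivity) h.pow_le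
  have hq : 8 * n ≤ 16 * ((q + 1) * (q + 1)) * q := by
    have h1 := h.lt_cube
    have h2 := h.q_ge
    have h3 : (q + 1) ^ 3 ≤ (q + 1) * (q + 1) * (2 * q) := by
      rw [show (q + 1) ^ 3 = (q + 1) * (q + 1) * (q + 1) by ring]
      gcongr
      omega
    nlinarith
  have h1 : (((2 * n - 16 * ((q + 1) * (q + 1)) : ℕ) : ℝ≥0∞) / ((2 * n : ℕ) : ℝ≥0∞)) ^ (q * l) ≤
      (16⁻¹) ^ l := by
    rw [pow_mul]
    gcongr
    exact sub_div_pow_le hn hq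
  have h2 : (3 / 16 : ℝ≥0∞) ^ (c₂ * l) ≤ (16⁻¹) ^ l := by
    rw [pow_mul]
    gcongr
    refine (pow_le_pow_right_of_le_one' (ENNReal.div_le_of_le_mul (by norm_num)) hc₂).trans ?_
    rw [← ENNReal.toReal_le_toReal (ENNReal.pow_ne_top (ENNReal.div_ne_top (by simp) (by simp)))
      (by simp)]
    norm_num [ENNReal.toReal_pow, ENNReal.toReal_div, ENNReal.toReal_inv]
  have h3 : (n : ℝ≥0∞) ≤ 2 * 2 ^ l := by exact_mod_cast h.lt_pow.le
  calc _ ≤ (2 : ℝ≥0∞) ^ l * (2 * 2 ^ l * (16⁻¹) ^ l) + 2 ^ l * (2 * 2 ^ l * (16⁻¹) ^ l) := by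
        refine add_le_add (mul_le_mul' le_rfl (mul_le_mul' ?_ h1)) ((mul_le_mul' h3 h2).trans
          (le_mul_of_one_le_left zero_le (one_le_pow₀ (by norm_num))))
        exact le_trans (by exact_mod_cast Nat.div_le_self _ _) h3
    _ = 4 * ((2 * 2 * 16⁻¹) ^ l) := by rw [mul_pow, mul_pow]; ring
    _ = 4 * (4 ^ l)⁻¹ := by
      rw [ENNReal.inv_pow]
      congr 2
      rw [← ENNReal.toReal_eq_toReal_iff' (ENNReal.mul_ne_top (by norm_num) (by simp)) (by simp)]
      norm_num [ENNReal.toReal_inv]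

end BF

/-! ### The numerical conditions of a round -/

namespace BF
variable {E : Env} {X : ℕ → ℝ≥0∞} {β : ℝ≥0∞}

/-- The depth of a round is at most this constant times `log n`. -/
def depthRate (c₂ : ℕ) : ℕ := 468 + 9 * c₂

/-- The work of a round is at most this constant times `n log n`. -/
def workRate (c₁ c₂ : ℕ) : ℕ := 288 + 9 * c₂ + 430080 * c₁

/-- The largest word in the computation is at most this constant times `n + 1`, apart from
addresses. -/
def boundRate (c₁ c₂ : ℕ) : ℕ := 7680 * c₁ + c₂ + 4

/-- The number of places is `480 * c₁ * (q + 1) ^ 3 ≤ 3840 * c₁ * n`, linear in `n`, so a round has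
linear work up to the logarithm. It is also at most `2 ^ (2 * log n)`, so `2 * log n` levels suffice
for all loops. Sorting the samples by all comparisons costs `q ^ 2 * l ^ 2 ≤ n * l` up to a
constant. -/
theorem roundOk {c₁ c₂ n₀ n q : ℕ} {x' Y : ℝ≥0∞} (hE : E.par = ⟨c₁, c₂, 240, n₀⟩) (hc₁ : 2 ≤ c₁)
    (hc₂ : 2 ≤ c₂) (hbd : boundRate c₁ c₂ * (n + 1) ≤ E.bd) (h : LargeSize c₁ n q (Nat.log 2 n))
    (parts : ∀ g : ℕ → ℕ, ∑ i ∈ Finset.range (q + 1), g i = n →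
      (∀ i, g i ≤ 2 * c₁ * 240 * ((q + 1) * (q + 1))) → ∑ i ∈ Finset.range (q + 1), X (g i) ≤ Y)
    (total : E.th ^ (depthRate c₂ * Nat.log 2 n) * ((workRate c₁ c₂ * (n * Nat.log 2 n) : ℕ) +
      4 * (4 ^ Nat.log 2 n)⁻¹ * x' + β ^ (2 * Nat.log 2 n) * Y) ≤ x') :
    RoundOk E X x' β n q (2 * Nat.log 2 n) (depthRate c₂ * Nat.log 2 n)
      (workRate c₁ c₂ * (n * Nat.log 2 n)) Y (4 * (4 ^ Nat.log 2 n)⁻¹) := by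
  set l := Nat.log 2 n with hl
  have hq := h.q_ge
  have hl1 := h.l_ge
  have hlq := h.l_le
  have hM : (q + 1) * (2 * c₁ * 240 * ((q + 1) * (q + 1))) ≤ 3840 * c₁ * n := by
    calc (q + 1) * (2 * c₁ * 240 * ((q + 1) * (q + 1))) = 480 * c₁ * (q + 1) ^ 3 := by ring
      _ ≤ 480 * c₁ * (8 * n) := Nat.mul_le_mul_left _ h.succ_cube
      _ = _ := by ring
  have hqql := h.sq_mul_le
  have hql : q * l ≤ n := le_trans (by nlinarith [Nat.mul_le_mul_right l hq]) hqql
  have hqn : q ≤ n := le_trans (by nlinarith) hql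
  have hbd' : 7680 * c₁ * n + c₂ * n + 4 * n + 7680 * c₁ + c₂ + 4 ≤ E.bd := by
    refine le_trans (le_of_eq ?_) hbd
    unfold boundRate
    ring
  have hnl : n ≤ n * l := Nat.le_mul_of_pos_right n (by omega)
  have hc₂l : c₂ * l ≤ c₂ * n := Nat.mul_le_mul_left _ (hlq.trans hqn)
  refine ⟨by omega, by omega, ?_, ?_, by rw [← hl]; omega, ?_, by omega, ?_, ?_, ?_, ?_, ?_, ?_, ?_, total⟩
  · calc q * l ≤ 2 ^ l * 2 ^ l :=
          Nat.mul_le_mul (by have := h.q_lt; omega) (Nat.lt_two_pow_self).le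
      _ = _ := by rw [two_mul, pow_add]
  all_goals simp only [hE]
  · exact hM.trans h.places_le
  · generalize (q + 1) * (2 * c₁ * 240 * ((q + 1) * (q + 1))) = M at hM ⊢
    have : 7680 * c₁ * n = 2 * (3840 * c₁ * n) := by ring
    omega
  · rw [← hl]
    omega
  · refine h.lt_cube.le.trans ?_
    rw [show (q + 1) ^ 3 = (q + 1) * ((q + 1) * (q + 1)) by ring]
    exact Nat.mul_le_mul_left _ (Nat.le_mul_of_pos_left _ (by positivity))
  · rw [← mul_assoc]
    exact Nat.mul_le_mul_right _ (by omega)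
  · rw [depthRate, add_mul]
    nlinarith
  · have h1 : q * l * (32 * (q * l)) ≤ 32 * (n * l) := by
      calc q * l * (32 * (q * l)) = 32 * (q * q * l * l) := by ring
        _ ≤ _ := by gcongr
    have h2 : 112 * ((q + 1) * (2 * c₁ * 240 * ((q + 1) * (q + 1)))) ≤ 430080 * c₁ * (n * l) := by
      calc 112 * ((q + 1) * (2 * c₁ * 240 * ((q + 1) * (q + 1)))) ≤ 112 * (3840 * c₁ * n) :=
            Nat.mul_le_mul_left _ hM
        _ = 430080 * c₁ * n := by ring
        _ ≤ _ := by gcongr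
    have h3 : n * (10 * l + 9 * (c₂ * l) + 49) ≤ (59 + 9 * c₂) * (n * l) := by
      calc n * (10 * l + 9 * (c₂ * l) + 49) = (10 + 9 * c₂) * (n * l) + 49 * n := by ring
        _ ≤ (10 + 9 * c₂) * (n * l) + 49 * (n * l) := by gcongr
        _ = _ := by ring
    have h4 : l ≤ n * l := Nat.le_mul_of_pos_left l (by omega)
    calc _ ≤ 14 * (n * l) + 62 * (n * l) + 32 * (n * l) + 52 * (n * l) + 430080 * c₁ * (n * l) +
          (59 + 9 * c₂) * (n * l) + 69 * (n * l) := by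
          gcongr
          · omega
          · omega
      _ = _ := by rw [workRate]; ring
  · exact h.fail_le hc₂
  · exact parts

end BF

/-! ### The recurrence for the expected work -/

namespace BF
variable {E : Env} {N : ℕ}

/-- Subproblems of at most this size are sorted sequentially. -/
def baseSize (c₁ : ℕ) : ℕ := (8 * (1920 * c₁) ^ 4) ^ 3

theorem largeSize_of_baseSize_lt {c₁ n q : ℕ} (hc₁ : 2 ≤ c₁) (hn : baseSize c₁ < n)
    (hq1 : q ^ 3 ≤ n) (hq2 : n < (q + 1) ^ 3) : LargeSize c₁ n q (Nat.log 2 n) := by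
  refine largeSize (by omega) hq1 hq2 ?_
  have := lt_of_pow_lt_pow_left₀ 3 (by omega) (hn.trans hq2)
  omega

theorem inv_four_pow_mul_le {l a b : ℕ} (h : a ≤ 4 ^ l * b) :
    4 * ((4 : ℝ≥0∞) ^ l)⁻¹ * (a : ℕ) ≤ ((4 * b : ℕ) : ℝ≥0∞) := by
  have : ((4 : ℝ≥0∞) ^ l)⁻¹ * (a : ℕ) ≤ b := by
    rw [mul_comm, ← div_eq_mul_inv]
    refine ENNReal.div_le_of_le_mul' ?_
    exact_mod_cast h
  rw [mul_assoc, Nat.cast_mul]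
  exact mul_le_mul' (by norm_num) this

/-- The factor in the bound of the expected work. -/
def workFactor (c₁ c₂ : ℕ) : ℕ := 4 * workRate c₁ c₂ + 14 * baseSize c₁ + 23

/-- A bound of the expected work. -/
def workBound (c₁ c₂ n : ℕ) : ℕ := workFactor c₁ c₂ * ((n + 1) * (4 * Nat.log 2 n + 4))

/-- All prices are one and `β = 1`. In the buckets the factor `4 * log n` drops to at most `3 * log
n`, so a round gains about `workFactor * n * log n`. A quarter of this pays for its instructions,
and the rest covers the restart and the additional `q` in the sum over the buckets. The two
instructions by which `sort` comes before `sampleSort` are the `2` that is subtracted. -/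
theorem sortOk_work {c₁ c₂ : ℕ} (hE : E.par = ⟨c₁, c₂, 240, baseSize c₁⟩) (hc₁ : 2 ≤ c₁)
    (hc₂ : 2 ≤ c₂) (hbd : boundRate c₁ c₂ * (N + 1) ≤ E.bd) (hth : E.th = 1) :
    SortOk E N (fun n => (workBound c₁ c₂ n : ℕ)) (fun n => (workBound c₁ c₂ n - 2 : ℕ)) 1 := by
  have hbN : 4 * (N + 1) ≤ E.bd := (Nat.mul_le_mul_right _ (by unfold boundRate; omega)).trans hbd
  have hA : 23 ≤ workFactor c₁ c₂ := Nat.le_add_left _ _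
  have h2 : ∀ n, 2 ≤ workBound c₁ c₂ n := fun n => by
    unfold workBound
    nlinarith [Nat.zero_le (n * (4 * Nat.log 2 n + 4))]
  refine ⟨fun d₁ d₂ => ?_, by simp [hth], by simp, by omega, by omega, fun n hn => ?_,
    fun n _ _ => ?_, fun n hn hnN q hq1 hq2 => ?_⟩
  · norm_num [hth]
  · rw [hth, one_pow, mul_one, Nat.cast_le]
    rw [hE] at hn
    have hn : n ≤ baseSize c₁ := hn
    have : 14 * n + 23 ≤ workFactor c₁ c₂ := by unfold workFactor; omega
    calc insertionCost n + 3 ≤ (14 * n + 23) * ((n + 1) * (4 * 0 + 4)) := by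
          unfold insertionCost
          nlinarith
      _ ≤ _ := by unfold workBound; gcongr; omega
  · rw [hth, one_pow, one_mul]
    have := h2 n
    exact_mod_cast (by omega : 2 + (workBound c₁ c₂ n - 2) ≤ workBound c₁ c₂ n)
  · rw [hE] at hn
    have h := largeSize_of_baseSize_lt hc₁ hn hq1 hq2
    refine ⟨_, _, _, (workFactor c₁ c₂ * ((n + (q + 1)) * (3 * Nat.log 2 n + 4)) : ℕ), _,
      roundOk hE hc₁ hc₂ ((Nat.mul_le_mul_left _ (by omega)).trans hbd) h (fun g hg hgm => ?_) ?_⟩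
    · norm_cast
      calc ∑ i ∈ Finset.range (q + 1), workBound c₁ c₂ (g i)
          ≤ ∑ i ∈ Finset.range (q + 1), workFactor c₁ c₂ * ((g i + 1) * (3 * Nat.log 2 n + 4)) :=
            Finset.sum_le_sum fun i _ => by
              unfold workBound
              exact Nat.mul_le_mul_left _ (Nat.mul_le_mul_left _
                (Nat.add_le_add_right (h.log_bucket_le (hgm i)) 4))
        _ = _ := by
          rw [← Finset.mul_sum, ← Finset.sum_mul, Finset.sum_add_distrib, hg]
          simp
    · have hl := h.l_ge
      have hq := h.q_ge
      have hlt := h.lt_pow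
      have hqql := h.sq_mul_le
      set l := Nat.log 2 n
      -- A restart costs at most `4 ^ l` times a constant, so with failure probability `4 * 4 ^
      -- (-l)` its expected cost is bounded.
      have h3 : workBound c₁ c₂ n - 2 ≤ 4 ^ l * (8 * workFactor c₁ c₂) := by
        have h4 : (n + 1) * (l + 1) ≤ (2 * 2 ^ l) * 2 ^ l :=
          Nat.mul_le_mul (by omega) (Nat.lt_two_pow_self (n := l))
        calc workBound c₁ c₂ n - 2 ≤ workBound c₁ c₂ n := Nat.sub_le _ _
          _ = 4 * workFactor c₁ c₂ * ((n + 1) * (l + 1)) := by unfold workBound; ring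
          _ ≤ 4 * workFactor c₁ c₂ * ((2 * 2 ^ l) * 2 ^ l) := Nat.mul_le_mul_left _ h4
          _ = (2 ^ 2) ^ l * (8 * workFactor c₁ c₂) := by rw [← pow_mul, two_mul l, pow_add]; ring
      rw [hth, one_pow, one_mul, one_pow, one_mul]
      refine (add_le_add (add_le_add le_rfl (inv_four_pow_mul_le h3)) le_rfl).trans ?_
      norm_cast
      refine Nat.le_sub_of_add_le ?_
      have h5 : 4 * workRate c₁ c₂ ≤ workFactor c₁ c₂ := by unfold workFactor; omega
      unfold workBound
      set A := workFactor c₁ c₂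
      set R := workRate c₁ c₂
      have h6 : 8 * (q * l) ≤ n := by nlinarith [Nat.mul_le_mul_right l hq]
      have h7 : n ≤ n * l := Nat.le_mul_of_pos_right n (by omega)
      have h8 : 1000 ≤ q * l := by nlinarith
      have h9 : 4 * (R * (n * l)) ≤ A * (n * l) := by rw [← mul_assoc]; gcongr
      have h10 : 33 * 8 * A ≤ A * (n * l) := by
        rw [mul_comm]
        exact Nat.mul_le_mul_left _ (by omega)
      have h11 : 8 * (A * (q * (3 * l + 4))) ≤ 4 * (A * (n * l)) := by
        calc 8 * (A * (q * (3 * l + 4))) ≤ 8 * (A * (q * (4 * l))) := by gcongr; omega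
          _ = 4 * (A * (8 * (q * l))) := by ring
          _ ≤ 4 * (A * (n * l)) :=
            Nat.mul_le_mul_left _ (Nat.mul_le_mul_left _ (h6.trans h7))
      have h12 : A * ((n + 1) * (4 * l + 4)) + A * (q * (3 * l + 4)) =
          A * ((n + (q + 1)) * (3 * l + 4)) + A * (n * l) + A * l := by ring
      nlinarith

end BF

/-! ### The recurrence for the exponential of the span, and the final constants -/

namespace BF
variable {E : Env} {N : ℕ}

/-- The factor in the bound of the expected exponential of the span. -/
def spanFactor (c₁ c₂ : ℕ) : ℕ :=
  (insertionCost (baseSize c₁) + 3) * 2 ^ (insertionCost (baseSize c₁) + 2) + workRate c₁ c₂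

/-- The base is chosen so that the depth of a round costs a factor `2 ^ l`. The buckets cost `2 ^
(21 * l)` each, their number is at most `2 ^ l`, and the `2 * l` levels of joins with `β = 4` give
`2 ^ (4 * l)`: in all `2 ^ (27 * l)` up to a constant. A restart costs `2 ^ (28 * l)`, times `2 ^ l`
for the depth and `4 ^ (-l)` for its probability, again `2 ^ (27 * l)`. So any constant is absorbed
by the last factor `2 ^ l`. -/
theorem sortOk_span {c₁ c₂ : ℕ} (hE : E.par = ⟨c₁, c₂, 240, baseSize c₁⟩) (hc₁ : 2 ≤ c₁)
    (hc₂ : 2 ≤ c₂) (hbd : boundRate c₁ c₂ * (N + 1) ≤ E.bd) (hth : E.th ^ depthRate c₂ = 2) :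
    SortOk E N (fun n => (4 * (spanFactor c₁ c₂ * 2 ^ (28 * Nat.log 2 n)) : ℕ))
      (fun n => (spanFactor c₁ c₂ * 2 ^ (28 * Nat.log 2 n) : ℕ)) 4 := by
  have hbN : 4 * (N + 1) ≤ E.bd := (Nat.mul_le_mul_right _ (by unfold boundRate; omega)).trans hbd
  have hth' : ∀ k ≤ 8, E.th ^ k ≤ 2 := fun k hk =>
    (th_pow_le E (hk.trans (by unfold depthRate; omega))).trans hth.le
  have hF : 2 ≤ spanFactor c₁ c₂ := by unfold spanFactor workRate; omega
  refine ⟨fun d₁ d₂ => ?_, (hth' 8 le_rfl).trans (by norm_num), by simp, by omega, by omega,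
    fun n hn => ?_, fun n _ _ => ?_, fun n hn hnN q hq1 hq2 => ?_⟩
  · have h1 : E.th ^ max d₁ d₂ ≤ E.th ^ d₁ + E.th ^ d₂ := by
      rcases le_total d₁ d₂ with h | h <;> simp [h]
    calc 2 * E.th ^ (max d₁ d₂ + 8) = 2 * E.th ^ 8 * E.th ^ max d₁ d₂ := by rw [pow_add]; ring
      _ ≤ 2 * 2 * (E.th ^ d₁ + E.th ^ d₂) := by gcongr; exact hth' 8 le_rfl
      _ = _ := by norm_num
  · rw [hE] at hn
    have hn : n ≤ baseSize c₁ := hn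
    have h1 : insertionCost n ≤ insertionCost (baseSize c₁) := by unfold insertionCost; gcongr
    calc ((insertionCost n + 3 : ℕ) : ℝ≥0∞) * E.th ^ (insertionCost n + 2)
        ≤ ((insertionCost (baseSize c₁) + 3 : ℕ) : ℝ≥0∞) *
            E.th ^ (insertionCost (baseSize c₁) + 2) := by
          refine mul_le_mul' (Nat.cast_le.2 (by omega)) (th_pow_le E (by omega))
      _ ≤ ((insertionCost (baseSize c₁) + 3 : ℕ) : ℝ≥0∞) *
            2 ^ (insertionCost (baseSize c₁) + 2) := by
          gcongr
          simpa using hth' 1 (by norm_num)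
      _ ≤ (spanFactor c₁ c₂ : ℕ) := by
          unfold spanFactor
          push_cast
          exact le_self_add
      _ ≤ _ := by
          refine Nat.cast_le.2 ?_
          have := Nat.le_mul_of_pos_right (spanFactor c₁ c₂)
            (show 0 < 2 ^ (28 * Nat.log 2 n) by positivity)
          omega
  · refine (mul_le_mul' (hth' 2 (by norm_num)) le_rfl).trans ?_
    have := Nat.le_mul_of_pos_right (spanFactor c₁ c₂)
      (show 0 < 2 ^ (28 * Nat.log 2 n) by positivity)
    exact_mod_cast (by omega : 2 * (2 + spanFactor c₁ c₂ * 2 ^ (28 * Nat.log 2 n)) ≤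
      4 * (spanFactor c₁ c₂ * 2 ^ (28 * Nat.log 2 n)))
  · rw [hE] at hn
    have h := largeSize_of_baseSize_lt hc₁ hn hq1 hq2
    refine ⟨_, _, _, (2 ^ Nat.log 2 n * (4 * (spanFactor c₁ c₂ * 2 ^ (21 * Nat.log 2 n))) : ℕ), _,
      roundOk hE hc₁ hc₂ ((Nat.mul_le_mul_left _ (by omega)).trans hbd) h (fun g hg hgm => ?_) ?_⟩
    · norm_cast
      refine (Finset.sum_le_card_nsmul _ _ (4 * (spanFactor c₁ c₂ * 2 ^ (21 * Nat.log 2 n)))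
        fun i _ => ?_).trans ?_
      · have := h.log_bucket_le (hgm i)
        refine Nat.mul_le_mul_left _ (Nat.mul_le_mul_left _ (Nat.pow_le_pow_right ?_ ?_))
        · norm_num
        · omega
      · rw [Finset.card_range, smul_eq_mul]
        exact Nat.mul_le_mul_right _ h.q_lt
    · have hl := h.l_ge
      have hlt := h.lt_pow
      have hR : workRate c₁ c₂ ≤ spanFactor c₁ c₂ := Nat.le_add_left _ _
      set l := Nat.log 2 n
      set F := spanFactor c₁ c₂
      have h3 : F * 2 ^ (28 * l) ≤ 4 ^ l * (F * 2 ^ (26 * l)) := by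
        refine le_of_eq ?_
        rw [show 28 * l = 2 * l + 26 * l by ring, pow_add, pow_mul 2 2 l]
        norm_num
        ring
      rw [pow_mul, hth]
      refine (mul_le_mul' le_rfl (add_le_add (add_le_add le_rfl (inv_four_pow_mul_le h3))
        le_rfl)).trans ?_
      norm_cast
      have hu : 2 ^ 10 ≤ 2 ^ l := Nat.pow_le_pow_right (by norm_num) hl
      have hll : l ≤ 2 ^ l := (Nat.lt_two_pow_self (n := l)).le
      have h4 : ∀ a, 2 ^ (a * l) = (2 ^ l) ^ a := fun a => by rw [mul_comm, pow_mul]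
      rw [show 4 ^ (2 * l) = (2 ^ l) ^ 4 by
        rw [show 4 = 2 ^ 2 by norm_num, ← pow_mul, ← pow_mul]; congr 1; ring, h4, h4, h4]
      set u := 2 ^ l
      have hu1 : 1 ≤ u := by omega
      -- The three summands are the work of the round, the restart and the buckets. They add up to
      -- at most `10 * F * u ^ 27`, and `u = 2 ^ l ≥ 2 ^ 10`.
      calc u * (workRate c₁ c₂ * (n * l) + 4 * (F * u ^ 26) + u ^ 4 * (u * (4 * (F * u ^ 21))))
          ≤ u * (F * ((2 * u) * u) + 4 * (F * u ^ 26) + u ^ 4 * (u * (4 * (F * u ^ 21)))) := by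
            gcongr
        _ = F * (2 * u ^ 3 + 8 * u ^ 27) := by ring
        _ ≤ F * (2 * u ^ 27 + 8 * u ^ 27) := by
            gcongr
            norm_num
        _ = F * (10 * u ^ 27) := by ring
        _ ≤ F * (u * u ^ 27) := by gcongr; omega
        _ = _ := by ring

theorem log_le_two_mul_log {n : ℕ} (hn : 1 ≤ n) : (Nat.log 2 n : ℝ) ≤ 2 * Real.log n := by
  have h1 : ((2 ^ Nat.log 2 n : ℕ) : ℝ) ≤ n := Nat.cast_le.2 (Nat.pow_log_le_self 2 (by omega))
  have h2 := Real.log_le_log (by positivity) h1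
  rw [Nat.cast_pow, Real.log_pow] at h2
  have h3 := Real.log_two_gt_d9
  have h4 : (0 : ℝ) ≤ Nat.log 2 n := Nat.cast_nonneg _
  push_cast at h2
  nlinarith

/-- A bound of the expected work divided by `n log n`, and of the span divided by `k log n`. -/
def costFactor (c₁ c₂ : ℕ) : ℕ :=
  384 * workFactor c₁ c₂ + 2 * depthRate c₂ * (29 + 49 * spanFactor c₁ c₂)

theorem workBound_le {c₁ c₂ n : ℕ} (hn : 2 ≤ n) :
    12 * ((workBound c₁ c₂ n : ℕ) : ℝ≥0∞) ≤
      ENNReal.ofReal (costFactor c₁ c₂ * (n * Real.log n)) := by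
  have hl : 1 ≤ Nat.log 2 n := Nat.le_log_of_pow_le (by norm_num) (by omega)
  have h1 : 12 * workBound c₁ c₂ n ≤ 192 * workFactor c₁ c₂ * (n * Nat.log 2 n) := by
    unfold workBound
    calc 12 * (workFactor c₁ c₂ * ((n + 1) * (4 * Nat.log 2 n + 4)))
        ≤ 12 * (workFactor c₁ c₂ * ((2 * n) * (8 * Nat.log 2 n))) := by
          gcongr <;> omega
      _ = _ := by ring
  refine le_trans (b := ((192 * workFactor c₁ c₂ * (n * Nat.log 2 n) : ℕ) : ℝ≥0∞))
    (by exact_mod_cast h1) ?_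
  rw [← ENNReal.ofReal_natCast]
  refine ENNReal.ofReal_le_ofReal ?_
  have h2 := log_le_two_mul_log (show 1 ≤ n by omega)
  have h3 : (384 * workFactor c₁ c₂ : ℝ) ≤ costFactor c₁ c₂ := by
    exact_mod_cast Nat.le_add_right _ _
  have h4 : 0 ≤ Real.log n := Real.log_natCast_nonneg n
  push_cast
  calc (192 * workFactor c₁ c₂ * (n * Nat.log 2 n) : ℝ)
      ≤ 192 * workFactor c₁ c₂ * (n * (2 * Real.log n)) := by gcongr
    _ = 384 * workFactor c₁ c₂ * (n * Real.log n) := by ring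
    _ ≤ _ := by gcongr

/-- The base of the price of instructions that is used for the span. -/
noncomputable def spanBase (c₂ : ℕ) : ℝ := Real.exp (Real.log 2 / depthRate c₂)

theorem spanBase_pow (c₂ : ℕ) : ENNReal.ofReal (spanBase c₂) ^ depthRate c₂ = 2 := by
  have : (depthRate c₂ : ℝ) ≠ 0 := by
    unfold depthRate
    positivity
  rw [spanBase, ← ENNReal.ofReal_pow (Real.exp_pos _).le, ← Real.exp_nat_mul,
    mul_div_cancel₀ _ this, Real.exp_log (by norm_num)]
  simp

/-- Since `n ≥ 2`, the constant `49 * F + 1` is itself at most a power of `n`, so the left side is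
at most a power of `n` with exponent linear in `k`. The right side is `2 ^ (j / depthRate c₂)`,
which is larger once `j` exceeds a multiple of `k * log n`. -/
theorem add_one_le_spanBase_pow {c₁ c₂ n : ℕ} (hn : 2 ≤ n) {k : ℝ} (hk : 1 ≤ k) {j : ℕ}
    (hj : costFactor c₁ c₂ * (k * Real.log n) < j) :
    48 * spanFactor c₁ c₂ * (n : ℝ) ^ 28 * (n : ℝ) ^ k + 1 ≤ spanBase c₂ ^ j := by
  have hD : (0 : ℝ) < depthRate c₂ := by
    unfold depthRate
    positivity
  have hn' : (2 : ℝ) ≤ n := by exact_mod_cast hn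
  have hlog : 0 ≤ Real.log n := Real.log_natCast_nonneg n
  set F := spanFactor c₁ c₂
  have h1 : 1 ≤ (n : ℝ) ^ 28 * (n : ℝ) ^ k :=
    one_le_mul_of_one_le_of_one_le (one_le_pow₀ (by linarith))
      (Real.one_le_rpow (by linarith) (by linarith))
  have h2 : (49 * F + 1 : ℝ) ≤ (n : ℝ) ^ (49 * F) := by
    have h3 : (49 * F + 1 : ℝ) ≤ 2 ^ (49 * F) := by
      exact_mod_cast Nat.lt_two_pow_self (n := 49 * F)
    exact h3.trans (by gcongr)
  calc 48 * F * (n : ℝ) ^ 28 * (n : ℝ) ^ k + 1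
      ≤ ((n : ℝ) ^ 28 * (n : ℝ) ^ k) * (49 * F + 1) := by
        nlinarith [mul_nonneg (Nat.cast_nonneg (α := ℝ) F) (zero_le_one.trans h1)]
    _ ≤ ((n : ℝ) ^ 28 * (n : ℝ) ^ k) * (n : ℝ) ^ (49 * F) := by gcongr
    _ = Real.exp (Real.log n * (28 + k + 49 * F)) := by
        have h0 : (0 : ℝ) < n := by linarith
        rw [← Real.rpow_def_of_pos h0, Real.rpow_add h0, Real.rpow_add h0]
        norm_cast
    _ ≤ spanBase c₂ ^ j := by
        rw [spanBase, ← Real.exp_nat_mul]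
        refine Real.exp_le_exp.2 ?_
        rw [mul_div_assoc', le_div_iff₀ hD]
        have h4 : (2 * depthRate c₂ * (29 + 49 * F) : ℝ) ≤ costFactor c₁ c₂ := by
          exact_mod_cast Nat.le_add_left _ _
        have h5 : (28 + k + 49 * F : ℝ) ≤ k * (29 + 49 * F) := by
          nlinarith [Nat.cast_nonneg (α := ℝ) F]
        have h6 : (1 / 2 : ℝ) ≤ Real.log 2 := by
          have := Real.log_two_gt_d9
          linarith
        calc Real.log n * (28 + k + 49 * F) * depthRate c₂
            ≤ Real.log n * (k * (29 + 49 * F)) * depthRate c₂ := by gcongr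
          _ = 2 * depthRate c₂ * (29 + 49 * F) * (k * Real.log n) * (1 / 2) := by ring
          _ ≤ costFactor c₁ c₂ * (k * Real.log n) * Real.log 2 := by gcongr
          _ ≤ j * Real.log 2 := by gcongr

end BF

theorem mainTheorem2 (c₁ c₂ : ℕ) (hc₁ : 2 ≤ c₁) (hc₂ : 2 ≤ c₂) :
    ∃ (r n₀ d : ℕ) (C : ℝ), 0 < C ∧
      ∀ {α : Type*} [LinearOrder α] (n : ℕ) (x : Fin n → α) (σ : BF.Scheduler BF.Proc),
        -- whenever the computation finishes, the elements are sorted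
        (∀ (t : ℕ), ∀ c ∈ (BF.run (BF.Proc.code ⟨c₁, c₂, r, n₀⟩) (BF.keyLt x) σ t []
            (BF.startConfig n)).support,
          (c.finished = true → BF.IsSortedOutput x c.mem) ∧
          -- words have `O(log n + log work)` bits
          c.maxWord ≤ (n + 2) ^ d * (c.work + 1)) ∧
        -- it finishes almost surely
        BF.probFinish (BF.Proc.code ⟨c₁, c₂, r, n₀⟩) (BF.keyLt x) σ (BF.startConfig n) = 1 ∧
        (2 ≤ n →
          -- expected work `O(n log n)`
          BF.expectedWork (BF.Proc.code ⟨c₁, c₂, r, n₀⟩) (BF.keyLt x) σ (BF.startConfig n)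
            ≤ ENNReal.ofReal (C * (n * Real.log n)) ∧
          -- span `O(log n)` with high probability
          ∀ k : ℝ, 1 ≤ k →
            ENNReal.ofReal (1 - 1 / (n : ℝ) ^ k) ≤
              BF.probSpanLE (BF.Proc.code ⟨c₁, c₂, r, n₀⟩) (BF.keyLt x) σ (BF.startConfig n)
                (C * (k * Real.log n))) := by
  refine ⟨240, BF.baseSize c₁, BF.boundRate c₁ c₂ + 2, BF.costFactor c₁ c₂, ?_, ?_⟩
  · exact_mod_cast (by unfold BF.costFactor BF.workFactor; omega : 0 < BF.costFactor c₁ c₂)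
  intro α _ n x σ
  set K := BF.boundRate c₁ c₂
  set P : BF.Params := ⟨c₁, c₂, 240, BF.baseSize c₁⟩
  -- Base `1`: this instance of the logic yields correctness, the bound for words, termination and
  -- the expected work.
  let E₁ : BF.Env := ⟨P, BF.keyLt x, 1, K * (n + 1), BF.IsSortedOutput x, le_rfl, by simp⟩
  have good₁ : ∀ t, BF.Good E₁ n t (BF.startConfig n) (12 * (BF.workBound c₁ c₂ n : ℕ)) :=
    BF.good_startConfig (BF.ranked_keyRank x rfl) (BF.sortOk_work rfl hc₁ hc₂ le_rfl rfl)
      (by norm_num [E₁]) fun _ => BF.isSortedOutput_of_keyRank x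
  have hbase : 1 ≤ BF.spanBase c₂ := by
    rw [BF.spanBase, Real.one_le_exp_iff]
    positivity
  -- A base above `1`: this instance is used for the span only.
  let E₂ : BF.Env := ⟨P, BF.keyLt x, ENNReal.ofReal (BF.spanBase c₂), K * (n + 1),
    BF.IsSortedOutput x, by simpa using hbase, by simp⟩
  have hth : E₂.th ^ BF.depthRate c₂ = 2 := BF.spanBase_pow c₂
  have good₂ : ∀ t, BF.Good E₂ n t (BF.startConfig n) (12 * (4 * (BF.spanFactor c₁ c₂ *
      2 ^ (28 * Nat.log 2 n)) : ℕ)) :=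
    BF.good_startConfig (BF.ranked_keyRank x rfl) (BF.sortOk_span rfl hc₁ hc₂ le_rfl hth)
      (by
        have : E₂.th ^ 1 ≤ E₂.th ^ BF.depthRate c₂ :=
          BF.th_pow_le E₂ (by unfold BF.depthRate; omega)
        rw [pow_one, hth] at this
        exact this.trans (by norm_num)) fun _ => BF.isSortedOutput_of_keyRank x
  refine ⟨fun t c hc => ?_, ?_, fun hn => ⟨?_, fun k hk => ?_⟩⟩
  · obtain ⟨Φ, h⟩ := (((good₁ t).run σ 0 (fun _ _ _ => zero_le) t []).2 c hc).1
    refine ⟨h.fin, ?_⟩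
    -- Words exceed the largest address by at most `E.bd`, and every instruction allocates at most
    -- `E.bd` cells, so addresses grow linearly with the work.
    have h1 : c.maxWord ≤ K * (n + 1) + (n + K * (n + 1) * c.work) :=
      h.word.trans (Nat.add_le_add_left h.next _)
    refine h1.trans ?_
    have h2 : K + 1 ≤ (n + 2) ^ (K + 1) :=
      (Nat.lt_two_pow_self (n := K + 1)).le.trans (Nat.pow_le_pow_left (by omega) _)
    calc K * (n + 1) + (n + K * (n + 1) * c.work) ≤ (K + 1) * (n + 2) * (c.work + 1) := by
          nlinarith [Nat.zero_le ((n + 2 + K) * c.work)]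
      _ ≤ (n + 2) ^ (K + 1) * (n + 2) * (c.work + 1) := by gcongr
      _ = _ := by rw [← pow_succ]
  · exact BF.probFinish_eq_one (ENNReal.mul_ne_top (by simp) (by simp)) good₁ σ
  · exact (BF.expectedWork_le good₁ σ).trans (BF.workBound_le hn)
  · have hn' : (1 : ℝ) ≤ n := by exact_mod_cast (by omega : 1 ≤ n)
    have hk0 : 0 < (n : ℝ) ^ k := Real.rpow_pos_of_pos (by linarith) k
    have hF : 0 < BF.spanFactor c₁ c₂ := by unfold BF.spanFactor BF.workRate; omega
    rw [ENNReal.ofReal_sub _ (by positivity), ENNReal.ofReal_one]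
    have hpos : 0 < 48 * BF.spanFactor c₁ c₂ * (n : ℝ) ^ 28 * (n : ℝ) ^ k := by positivity
    -- The threshold is `n ^ k` times an upper bound of the initial potential `48 * F * 2 ^ (28 *
    -- log n)`, so Markov's inequality gives failure probability at most `1 / n ^ k`.
    refine BF.le_probSpanLE (A := ENNReal.ofReal
      (48 * BF.spanFactor c₁ c₂ * (n : ℝ) ^ 28 * (n : ℝ) ^ k)) good₂ σ (fun j hj => ?_) ?_ ?_ ?_
    · rw [← ENNReal.ofReal_one, ← ENNReal.ofReal_add hpos.le zero_le_one]
      refine (ENNReal.ofReal_le_ofReal (BF.add_one_le_spanBase_pow hn hk hj)).trans ?_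
      rw [ENNReal.ofReal_pow (by linarith)]
    · rw [← ENNReal.ofReal_mul (by positivity)]
      rw [show 1 / (n : ℝ) ^ k * (48 * BF.spanFactor c₁ c₂ * (n : ℝ) ^ 28 * (n : ℝ) ^ k) =
        ((48 * BF.spanFactor c₁ c₂ * n ^ 28 : ℕ) : ℝ) by push_cast; field_simp,
        ENNReal.ofReal_natCast]
      have h1 : 2 ^ (28 * Nat.log 2 n) ≤ n ^ 28 := by
        rw [mul_comm, pow_mul]
        exact Nat.pow_le_pow_left (Nat.pow_log_le_self 2 (by omega)) 28
      exact_mod_cast (show 12 * (4 * (BF.spanFactor c₁ c₂ * 2 ^ (28 * Nat.log 2 n))) ≤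
        48 * BF.spanFactor c₁ c₂ * n ^ 28 by
          calc _ = 48 * BF.spanFactor c₁ c₂ * 2 ^ (28 * Nat.log 2 n) := by ring
            _ ≤ _ := Nat.mul_le_mul_left _ h1)
    · simpa using hpos
    · simp
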